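/- **Setting.** Let $n\ge 1$, $R_0>0$, $B(0,R_0)=\{x\in\mathbb R^n:|x|<R_0\}$, and let $\mathcal H=\mathcal H_{R_0}\oplus L^2(\mathbb R^n\setminus B(0,R_0))$ be an orthogonal sum, where $\mathcal H_{R_0}$ is a complex separable Hilbert space. The orthogonal projections are denoted $u\mapsto 1_{B(0,R_0)}u$ and $u\mapsto u|_{\mathbb R^n\setminus B(0,R_0)}$. Put $$\mathcal H_0=\mathcal H_{R_0}\oplus e^{-|x|^2}L^2(\mathbb R^n\setminus B(0,R_0)),\qquad \mathcal H_1=\mathcal H_{R_0}\oplus e^{|x|^2}L^2(\mathbb R^n\setminus B(0,R_0)),$$ with their natural Hilbert norms, so that $\mathcal H_0\subset\mathcal H\subset\mathcal H_1$. A self-adjoint operator $P:\mathcal H\to\mathcal H$ with domain $\mathcal D(P)$ is a *black box Hamiltonian* if 1. $u|_{\mathbb R^n\setminus B(0,R_0)}\in H^2(\mathbb R^n\setminus B(0,R_0))$ for all $u\in\mathcal D(P)$; 2. conversely, every $u\in H^2(\mathbb R^n\setminus B(0,R_0))$ that vanishes near $B(0,R_0)$ (that is, on $\{R_0\le|x|<R_0+\varepsilon\}$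 for some $\varepsilon>0$), extended by $0$ to $\mathcal H_{R_0}$, belongs to $\mathcal D(P)$; 3. $(Pu)|_{\mathbb R^n\setminus B(0,R_0)}=-\Delta(u|_{\mathbb R^n\setminus B(0,R_0)})$ for all $u\in\mathcal D(P)$; 4. $1_{B(0,R_0)}(P+i)^{-1}$ is compact. The domain $\mathcal D(P)$ carries the graph norm. For $\chi\in C_c^\infty(\mathbb R^n)$ with $\chi=1$ on $B(0,R_0)$ and $u\in\mathcal H_1$, the product $\chi u$ is $u$ on the $\mathcal H_{R_0}$ component and the pointwise product outside the ball. Let $\mathcal D_1(P)$ be the space of all $u\in\mathcal H_1$ such that $\chi u\in\mathcal D(P)$ and $\Delta((1-\chi)u)\in\mathcal H_1$ for every $\chi\in C_c^\infty(\mathbb R^n)$ with $\chi=1$ on $B(0,R_0)$. It is normed by $\|u\|_{\mathcal H_1}+\|\chi u\|_{\mathcal D(P)}+\|\Delta((1-\chi)u)\|_{\mathcal H_1}$ for any such $\chi$ (all these norms are equivalent). A family $A(z)$ of bounded operators $X\to Y$ between normed spaces is *meromorphic* on an open set $\Omega\subset\mathbb C$ if near each $z_0\in\Omega$, for $z\ne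 z_0$, one has $A(z)=A_0(z)+\sum_{j=1}^{J}(z-z_0)^{-j}B_j$ with $A_0$ holomorphic near $z_0$ with values in the bounded operators and $B_1,\dots,B_J$ bounded operators of finite rank. Let $\Lambda=\exp^{-1}(\mathbb C\setminus\{0\})$ be the logarithmic plane, on which $w\in\mathbb C$ is a global coordinate and represents $\lambda=e^w$ with $\arg\lambda=\operatorname{Im}w$; its part $0<\operatorname{Im}w<\pi$ is identified with $\{\operatorname{Im}\lambda>0\}$. **Proposition.** Let $P$ be a black box Hamiltonian. Then for every $\lambda_0$ with $\operatorname{Im}\lambda_0>0$ the number $\lambda^2$ lies in the resolvent set of $P$ for all $\lambda\neq\lambda_0$ near $\lambda_0$, and $$R(\lambda):=(P-\lambda^2)^{-1}:\mathcal H\to\mathcal D(P)$$ is a meromorphic family on $\{\operatorname{Im}\lambda>0\}$. Moreover, when $n$ is odd, $R(\lambda)$, restricted to $\mathcal H_0$, extends from $\{\operatorname{Im}\lambda>0\}$ to a meromorphic family $$R(\lambda):\mathcal H_0\to\mathcal D_1(P),\qquad \lambda\in\mathbb C .$$ When $n$ is even, the same holds with $\mathbb C$ replaced by $\Lambda$.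 -/

import Mathlib

open MeasureTheory Filter Topology
open scoped ENNReal ContDiff

noncomputable section

namespace BlackBox

/-! ### Weak derivatives on open subsets of Euclidean space -/

/-- `φ` is a smooth, compactly supported test function on the open set `U`. -/
def IsTestOn {n : ℕ} (U : Set (EuclideanSpace ℝ (Fin n))) (φ : EuclideanSpace ℝ (Fin n) → ℝ) :
    Prop :=
  ContDiff ℝ ∞ φ ∧ HasCompactSupport φ ∧ tsupport φ ⊆ U

/-- `g` is the weak partial derivative `∂ᵢ u` on `U`. -/
def HasWeakPartialOn {n : ℕ} (U : Set (EuclideanSpace ℝ (Fin n))) (i : Fin n)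
    (u g : EuclideanSpace ℝ (Fin n) → ℂ) : Prop :=
  LocallyIntegrableOn u U ∧ LocallyIntegrableOn g U ∧
    ∀ φ, IsTestOn U φ →
      ∫ x in U, fderiv ℝ φ x (EuclideanSpace.single i 1) • u x = -∫ x in U, φ x • g x

/-- `w` is the distributional Laplacian `Δ u` on `U`. -/
def HasWeakLaplacianOn {n : ℕ} (U : Set (EuclideanSpace ℝ (Fin n)))
    (u w : EuclideanSpace ℝ (Fin n) → ℂ) : Prop :=
  LocallyIntegrableOn u U ∧ LocallyIntegrableOn w U ∧
    ∀ φ, IsTestOn U φ →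
      ∫ x in U, Laplacian.laplacian φ x • u x = ∫ x in U, φ x • w x

/-- `u` belongs to the Sobolev space `H²(U)`. -/
def MemSobolevTwo {n : ℕ} (U : Set (EuclideanSpace ℝ (Fin n)))
    (u : EuclideanSpace ℝ (Fin n) → ℂ) : Prop :=
  MemLp u 2 (volume.restrict U) ∧
    ∃ (g : Fin n → EuclideanSpace ℝ (Fin n) → ℂ)
      (h : Fin n → Fin n → EuclideanSpace ℝ (Fin n) → ℂ),
      (∀ i, MemLp (g i) 2 (volume.restrict U) ∧ HasWeakPartialOn U i u (g i)) ∧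
      ∀ i j, MemLp (h i j) 2 (volume.restrict U) ∧ HasWeakPartialOn U j (g i) (h i j)

/-! ### The Hilbert space and its weighted versions -/

/-- The complement `ℝⁿ ∖ B(0, R₀)` of the open ball. -/
def exterior (n : ℕ) (R₀ : ℝ) : Set (EuclideanSpace ℝ (Fin n)) := (Metric.ball 0 R₀)ᶜ

/-- The interior `{|x| > R₀}` of `ℝⁿ ∖ B(0, R₀)`; the two differ by a null set. -/
def openExterior (n : ℕ) (R₀ : ℝ) : Set (EuclideanSpace ℝ (Fin n)) := (Metric.closedBall 0 R₀)ᶜ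

/-- Lebesgue measure on `ℝⁿ ∖ B(0, R₀)`. -/
abbrev extMeasure (n : ℕ) (R₀ : ℝ) : Measure (EuclideanSpace ℝ (Fin n)) :=
  volume.restrict (exterior n R₀)

/-- The measure `e^{2 c |x|²} dx` on `ℝⁿ ∖ B(0, R₀)`; its `L²` space is `e^{-c|x|²} L²`, with the
norm `‖e^{c|x|²} u‖_{L²}`. -/
abbrev weightMeasure (n : ℕ) (R₀ c : ℝ) : Measure (EuclideanSpace ℝ (Fin n)) :=
  (extMeasure n R₀).withDensity fun x => ENNReal.ofReal (Real.exp (2 * c * ‖x‖ ^ 2))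

/-- The Hilbert space `ℋ = E ⊕ L²(ℝⁿ ∖ B(0, R₀))`, where `E = ℋ_{R₀}`. The components of `u` are
`u.fst = u|_{B(0, R₀)}` and `u.snd = u|_{ℝⁿ ∖ B(0, R₀)}`. -/
abbrev Space (n : ℕ) (R₀ : ℝ) (E : Type*) [NormedAddCommGroup E] [InnerProductSpace ℂ E] :=
  WithLp 2 (E × Lp ℂ 2 (extMeasure n R₀))

/-- The space `ℋ₀ = E ⊕ e^{-|x|²} L²(ℝⁿ ∖ B(0, R₀))`. -/
abbrev SpaceZero (n : ℕ) (R₀ : ℝ) (E : Type*) [NormedAddCommGroup E] [InnerProductSpace ℂ E] :=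
  WithLp 2 (E × Lp ℂ 2 (weightMeasure n R₀ 1))

/-- The space `ℋ₁ = E ⊕ e^{|x|²} L²(ℝⁿ ∖ B(0, R₀))`. -/
abbrev SpaceOne (n : ℕ) (R₀ : ℝ) (E : Type*) [NormedAddCommGroup E] [InnerProductSpace ℂ E] :=
  WithLp 2 (E × Lp ℂ 2 (weightMeasure n R₀ (-1)))

lemma extMeasure_le_weight (n : ℕ) (R₀ : ℝ) : extMeasure n R₀ ≤ weightMeasure n R₀ 1 := by
  conv_lhs => rw [← withDensity_one (μ := extMeasure n R₀)]
  refine withDensity_mono (ae_of_all _ fun x => ?_)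
  rw [Pi.one_apply, ENNReal.one_le_ofReal]
  exact Real.one_le_exp (by positivity)

lemma weight_le_extMeasure (n : ℕ) (R₀ : ℝ) : weightMeasure n R₀ (-1) ≤ extMeasure n R₀ := by
  conv_rhs => rw [← withDensity_one (μ := extMeasure n R₀)]
  refine withDensity_mono (ae_of_all _ fun x => ?_)
  rw [Pi.one_apply, ENNReal.ofReal_le_one]
  exact Real.exp_le_one_iff.2 (by nlinarith [sq_nonneg ‖x‖])

/-- The inclusion `E ⊕ L²(ν) ⊆ E ⊕ L²(μ)` for `μ ≤ ν`: the same function, seen in the larger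
space. -/
def incl {α E : Type*} [MeasurableSpace α] [NormedAddCommGroup E] {μ ν : Measure α} (h : μ ≤ ν)
    (u : WithLp 2 (E × Lp ℂ 2 ν)) : WithLp 2 (E × Lp ℂ 2 μ) :=
  WithLp.toLp 2 (u.fst, ((Lp.memLp u.snd).mono_measure h).toLp u.snd)

/-- The inclusion `ℋ₀ ⊆ ℋ`. -/
def zeroToSpace {n : ℕ} {R₀ : ℝ} {E : Type*} [NormedAddCommGroup E] [InnerProductSpace ℂ E]
    (f : SpaceZero n R₀ E) : Space n R₀ E :=
  incl (extMeasure_le_weight n R₀) f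

/-- The inclusion `ℋ ⊆ ℋ₁`. -/
def spaceToOne {n : ℕ} {R₀ : ℝ} {E : Type*} [NormedAddCommGroup E] [InnerProductSpace ℂ E]
    (f : Space n R₀ E) : SpaceOne n R₀ E :=
  incl (weight_le_extMeasure n R₀) f

/-! ### Resolvents of unbounded operators

The domain of `P` with its graph norm is the graph `P.graph ⊆ H × H` with the norm of `H × H`:
the element `u` of the domain is `⟨(u, P u), _⟩`. -/

/-- `T : H → 𝒟(P)` is a bounded two-sided inverse of `P - z : 𝒟(P) → H`. -/
def IsResolventAt {H : Type*} [NormedAddCommGroup H] [InnerProductSpace ℂ H]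
    (P : H →ₗ.[ℂ] H) (z : ℂ) (T : H →L[ℂ] P.graph) : Prop :=
  (∀ f : H, (T f).1.2 - z • (T f).1.1 = f) ∧
    ∀ u : P.domain, (T (P u - z • (u : H))).1.1 = (u : H)

/-- The resolvent set of `P`. -/
def resolventSet {H : Type*} [NormedAddCommGroup H] [InnerProductSpace ℂ H]
    (P : H →ₗ.[ℂ] H) : Set ℂ :=
  {z | ∃ T, IsResolventAt P z T}

open Classical in
/-- The resolvent `(P - z)⁻¹ : H → 𝒟(P)` for `z` in the resolvent set (and `0` elsewhere). -/
def resolvent {H : Type*} [NormedAddCommGroup H] [InnerProductSpace ℂ H]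
    (P : H →ₗ.[ℂ] H) (z : ℂ) : H →L[ℂ] P.graph :=
  if h : ∃ T, IsResolventAt P z T then h.choose else 0

/-! ### Meromorphic families of operators -/

/-- `A` is a meromorphic family of bounded operators on `Ω`: near every point of `Ω` it is the sum
of a holomorphic family and of a principal part with finitely many terms, all of finite rank. As
usual, the value of `A` at a pole is irrelevant. -/
def IsMeromorphicFamilyOn {X Y : Type*} [NormedAddCommGroup X] [NormedSpace ℂ X]
    [NormedAddCommGroup Y] [NormedSpace ℂ Y] (A : ℂ → X →L[ℂ] Y) (Ω : Set ℂ) : Prop :=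
  ∀ z₀ ∈ Ω, ∃ (m : ℕ) (B : Fin m → X →L[ℂ] Y) (A₀ : ℂ → X →L[ℂ] Y),
    AnalyticAt ℂ A₀ z₀ ∧
    (∀ j, FiniteDimensional ℂ (LinearMap.range (B j).toLinearMap)) ∧
    ∀ᶠ z in 𝓝[≠] z₀, A z = A₀ z + ∑ j : Fin m, ((z - z₀) ^ ((j : ℕ) + 1))⁻¹ • B j

/-- The logarithmic plane `Λ = exp⁻¹(ℂ ∖ {0})`, the Riemann surface of the logarithm. A point
`w ∈ Λ` stands for the frequency `λ = exp w` with `arg λ = Im w`. -/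
def logPlane : Set ℂ := Complex.exp ⁻¹' {0}ᶜ

/-! ### Black box Hamiltonians -/

/-- `P` is a black box Hamiltonian on `ℋ = E ⊕ L²(ℝⁿ ∖ B(0, R₀))`. -/
structure IsBlackBoxHamiltonian {n : ℕ} {R₀ : ℝ} {E : Type*} [NormedAddCommGroup E]
    [InnerProductSpace ℂ E] [CompleteSpace E]
    (P : Space n R₀ E →ₗ.[ℂ] Space n R₀ E) : Prop where
  /-- `P` is densely defined. -/
  dense : Dense (P.domain : Set (Space n R₀ E))
  /-- `P` is self-adjoint. -/
  selfAdjoint : IsSelfAdjoint P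
  /-- Elements of the domain are `H²` outside the ball. -/
  sobolev : ∀ u ∈ P.domain, MemSobolevTwo (openExterior n R₀) u.snd
  /-- Elements of `H²(ℝⁿ ∖ B(0, R₀))` that vanish near `B(0, R₀)` belong to the domain. -/
  mem_domain : ∀ u : Space n R₀ E, u.fst = 0 → MemSobolevTwo (openExterior n R₀) u.snd →
    (∃ ε > 0, ∀ᵐ x ∂extMeasure n R₀, ‖x‖ < R₀ + ε → u.snd x = 0) → u ∈ P.domain
  /-- Outside the ball, `P` is `-Δ`. -/
  laplacian : ∀ u : P.domain,
    HasWeakLaplacianOn (openExterior n R₀) (u : Space n R₀ E).snd fun x => -(P u).snd x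
  /-- `1_{B(0, R₀)} (P + i)⁻¹` is compact. -/
  compact : IsCompactOperator fun f : Space n R₀ E => (resolvent P (-Complex.I) f).1.1.fst

/-! ### The space `𝒟₁(P)` -/

/-- `χ ∈ C_c^∞(ℝⁿ)` is equal to `1` on `B(0, R₀)`. -/
def IsCutoff {n : ℕ} (R₀ : ℝ) (χ : EuclideanSpace ℝ (Fin n) → ℂ) : Prop :=
  ContDiff ℝ ∞ χ ∧ HasCompactSupport χ ∧ ∀ x ∈ Metric.ball 0 R₀, χ x = 1

/-- For `u ∈ ℋ₁`, `v ∈ ℋ` and `χ` equal to `1` on `B(0, R₀)`: `v = χ u`. -/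
def IsCutoffMul {n : ℕ} {R₀ : ℝ} {E : Type*} [NormedAddCommGroup E] [InnerProductSpace ℂ E]
    (χ : EuclideanSpace ℝ (Fin n) → ℂ) (u : SpaceOne n R₀ E) (v : Space n R₀ E) : Prop :=
  v.fst = u.fst ∧ ∀ᵐ x ∂extMeasure n R₀, v.snd x = χ x * u.snd x

/-- For `u ∈ ℋ₁` and `χ` equal to `1` on `B(0, R₀)`: `Δ((1 - χ) u) = w`, where
`w ∈ e^{|x|²} L²(ℝⁿ ∖ B(0, R₀)) ⊆ ℋ₁`. -/
def IsCutoffLaplacian {n : ℕ} {R₀ : ℝ} {E : Type*} [NormedAddCommGroup E] [InnerProductSpace ℂ E]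
    (χ : EuclideanSpace ℝ (Fin n) → ℂ) (u : SpaceOne n R₀ E)
    (w : Lp ℂ 2 (weightMeasure n R₀ (-1))) : Prop :=
  HasWeakLaplacianOn (openExterior n R₀) (fun x => (1 - χ x) * u.snd x) w

section lemmas

variable {n : ℕ} {R₀ : ℝ} {E : Type*} [NormedAddCommGroup E] [InnerProductSpace ℂ E]

lemma extMeasure_ac (c : ℝ) : extMeasure n R₀ ≪ weightMeasure n R₀ c := by
  refine withDensity_absolutelyContinuous' (by fun_prop) (ae_of_all _ fun x => ?_)
  simpa using Real.exp_pos _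

lemma openExterior_subset : openExterior n R₀ ⊆ exterior n R₀ :=
  Set.compl_subset_compl.2 Metric.ball_subset_closedBall

lemma restrict_openExterior_le : volume.restrict (openExterior n R₀) ≤ extMeasure n R₀ :=
  Measure.restrict_mono openExterior_subset le_rfl

lemma isOpen_openExterior : IsOpen (openExterior n R₀) :=
  Metric.isClosed_closedBall.isOpen_compl

lemma ae_open_of_ae_weight {c : ℝ} {p : EuclideanSpace ℝ (Fin n) → Prop}
    (h : ∀ᵐ x ∂weightMeasure n R₀ c, p x) : ∀ᵐ x ∂volume.restrict (openExterior n R₀), p x :=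
  ae_mono restrict_openExterior_le ((extMeasure_ac c).ae_le h)

lemma integrableOn_test {U : Set (EuclideanSpace ℝ (Fin n))}
    {u : EuclideanSpace ℝ (Fin n) → ℂ}
    (hu : LocallyIntegrableOn u U) {ψ : EuclideanSpace ℝ (Fin n) → ℝ} (hψ : Continuous ψ)
    (hc : HasCompactSupport ψ) (hs : tsupport ψ ⊆ U) :
    IntegrableOn (fun x => ψ x • u x) U := by
  have h1 : IntegrableOn (fun x => ψ x • u x) (tsupport ψ) :=
    (hu.integrableOn_compact_subset hs hc).continuousOn_smul hψ.continuousOn hc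
  have h2 : Integrable (fun x => ψ x • u x) := by
    refine (integrableOn_iff_integrable_of_support_subset ?_).1 h1
    intro x hx
    refine subset_tsupport ψ fun h0 => hx ?_
    simp [h0]
  exact h2.integrableOn

lemma continuous_laplacian {φ : EuclideanSpace ℝ (Fin n) → ℝ} (hφ : ContDiff ℝ ∞ φ) :
    Continuous (Laplacian.laplacian φ) := by
  rw [InnerProductSpace.laplacian_eq_iteratedFDeriv_stdOrthonormalBasis]
  have := hφ.continuous_iteratedFDeriv (m := 2) (by norm_cast)
  fun_prop

lemma tsupport_laplacian {φ : EuclideanSpace ℝ (Fin n) → ℝ} :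
    tsupport (Laplacian.laplacian φ) ⊆ tsupport φ := by
  refine closure_minimal (fun x hx => ?_) (isClosed_tsupport φ)
  by_contra h
  refine hx ?_
  have h0 : iteratedFDeriv ℝ 2 φ x = 0 := by
    by_contra h1
    exact h (support_iteratedFDeriv_subset 2 h1)
  rw [InnerProductSpace.laplacian_eq_iteratedFDeriv_stdOrthonormalBasis]
  simp [h0]

lemma HasWeakLaplacianOn.congr {U : Set (EuclideanSpace ℝ (Fin n))} (hU : IsOpen U)
    {u u' w w' : EuclideanSpace ℝ (Fin n) → ℂ} (h : HasWeakLaplacianOn U u w)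
    (hu : u =ᵐ[volume.restrict U] u') (hw : w =ᵐ[volume.restrict U] w') :
    HasWeakLaplacianOn U u' w' := by
  have key : ∀ {a b : EuclideanSpace ℝ (Fin n) → ℂ}, LocallyIntegrableOn a U →
      a =ᵐ[volume.restrict U] b → LocallyIntegrableOn b U := by
    intro a b ha hab
    rw [locallyIntegrableOn_iff hU.isLocallyClosed] at ha ⊢
    intro K hK hKc
    exact (ha K hK hKc).congr (hab.filter_mono (ae_mono (Measure.restrict_mono hK le_rfl)))
  refine ⟨key h.1 hu, key h.2.1 hw, fun φ hφ => ?_⟩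
  have h1 : ∫ x in U, Laplacian.laplacian φ x • u' x = ∫ x in U, Laplacian.laplacian φ x • u x :=
    integral_congr_ae (hu.mono fun x hx => by simp only [hx])
  have h2 : ∫ x in U, φ x • w' x = ∫ x in U, φ x • w x :=
    integral_congr_ae (hw.mono fun x hx => by simp only [hx])
  rw [h1, h2, h.2.2 φ hφ]

lemma HasWeakLaplacianOn.add {U : Set (EuclideanSpace ℝ (Fin n))}
    {u u' w w' : EuclideanSpace ℝ (Fin n) → ℂ} (h : HasWeakLaplacianOn U u w)
    (h' : HasWeakLaplacianOn U u' w') : HasWeakLaplacianOn U (u + u') (w + w') := by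
  refine ⟨h.1.add h'.1, h.2.1.add h'.2.1, fun φ hφ => ?_⟩
  have hc := continuous_laplacian hφ.1
  have hs : HasCompactSupport (Laplacian.laplacian φ) :=
    hφ.2.1.of_isClosed_subset (isClosed_tsupport _) tsupport_laplacian
  have ht := (tsupport_laplacian (φ := φ)).trans hφ.2.2
  simp only [Pi.add_apply, smul_add]
  rw [integral_add (integrableOn_test h.1 hc hs ht) (integrableOn_test h'.1 hc hs ht),
    integral_add (integrableOn_test h.2.1 hφ.1.continuous hφ.2.1 hφ.2.2)
      (integrableOn_test h'.2.1 hφ.1.continuous hφ.2.1 hφ.2.2), h.2.2 φ hφ, h'.2.2 φ hφ]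

lemma HasWeakLaplacianOn.smul {U : Set (EuclideanSpace ℝ (Fin n))}
    {u w : EuclideanSpace ℝ (Fin n) → ℂ} (c : ℂ) (h : HasWeakLaplacianOn U u w) :
    HasWeakLaplacianOn U (c • u) (c • w) := by
  refine ⟨h.1.smul c, h.2.1.smul c, fun φ hφ => ?_⟩
  simp only [Pi.smul_apply, smul_comm _ c]
  rw [integral_smul, integral_smul, h.2.2 φ hφ]

lemma HasWeakLaplacianOn.zero {U : Set (EuclideanSpace ℝ (Fin n))} :
    HasWeakLaplacianOn U (0 : EuclideanSpace ℝ (Fin n) → ℂ) 0 :=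
  ⟨locallyIntegrableOn_zero, locallyIntegrableOn_zero, fun φ _ => by simp⟩

variable {χ : EuclideanSpace ℝ (Fin n) → ℂ}

lemma IsCutoffMul.add {u u' : SpaceOne n R₀ E} {v v' : Space n R₀ E}
    (h : IsCutoffMul χ u v) (h' : IsCutoffMul χ u' v') : IsCutoffMul χ (u + u') (v + v') := by
  refine ⟨by simp [h.1, h'.1], ?_⟩
  filter_upwards [h.2, h'.2, Lp.coeFn_add v.snd v'.snd,
    (extMeasure_ac (-1)).ae_le (Lp.coeFn_add u.snd u'.snd)] with x h1 h2 h3 h4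
  rw [WithLp.add_snd, WithLp.add_snd, h3, h4, Pi.add_apply, Pi.add_apply, h1, h2, mul_add]

lemma IsCutoffMul.smul {u : SpaceOne n R₀ E} {v : Space n R₀ E} (c : ℂ)
    (h : IsCutoffMul χ u v) : IsCutoffMul χ (c • u) (c • v) := by
  refine ⟨by simp [h.1], ?_⟩
  filter_upwards [h.2, Lp.coeFn_smul c v.snd,
    (extMeasure_ac (-1)).ae_le (Lp.coeFn_smul c u.snd)] with x h1 h3 h4
  rw [WithLp.smul_snd, WithLp.smul_snd, h3, h4, Pi.smul_apply, Pi.smul_apply, h1, mul_smul_comm]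

lemma IsCutoffMul.zero : IsCutoffMul χ (0 : SpaceOne n R₀ E) (0 : Space n R₀ E) := by
  refine ⟨by simp, ?_⟩
  filter_upwards [Lp.coeFn_zero ℂ 2 (extMeasure n R₀),
    (extMeasure_ac (-1)).ae_le (Lp.coeFn_zero ℂ 2 (weightMeasure n R₀ (-1)))] with x h3 h4
  rw [WithLp.zero_snd, WithLp.zero_snd, h3, h4]
  simp

lemma IsCutoffLaplacian.add {u u' : SpaceOne n R₀ E} {w w' : Lp ℂ 2 (weightMeasure n R₀ (-1))}
    (h : IsCutoffLaplacian χ u w) (h' : IsCutoffLaplacian χ u' w') :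
    IsCutoffLaplacian χ (u + u') (w + w') := by
  refine (HasWeakLaplacianOn.add h h').congr isOpen_openExterior ?_
    (EventuallyEq.symm (ae_open_of_ae_weight (Lp.coeFn_add w w')))
  filter_upwards [ae_open_of_ae_weight (Lp.coeFn_add u.snd u'.snd)] with x hx
  rw [WithLp.add_snd, hx]
  simp [mul_add]

lemma IsCutoffLaplacian.smul {u : SpaceOne n R₀ E} {w : Lp ℂ 2 (weightMeasure n R₀ (-1))} (c : ℂ)
    (h : IsCutoffLaplacian χ u w) : IsCutoffLaplacian χ (c • u) (c • w) := by
  refine (HasWeakLaplacianOn.smul c h).congr isOpen_openExterior ?_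
    (EventuallyEq.symm (ae_open_of_ae_weight (Lp.coeFn_smul c w)))
  filter_upwards [ae_open_of_ae_weight (Lp.coeFn_smul c u.snd)] with x hx
  rw [WithLp.smul_snd, hx]
  simp [mul_left_comm]

lemma IsCutoffLaplacian.zero :
    IsCutoffLaplacian χ (0 : SpaceOne n R₀ E) (0 : Lp ℂ 2 (weightMeasure n R₀ (-1))) := by
  refine HasWeakLaplacianOn.zero.congr isOpen_openExterior ?_
    (EventuallyEq.symm (ae_open_of_ae_weight (Lp.coeFn_zero ℂ 2 (weightMeasure n R₀ (-1)))))
  filter_upwards [ae_open_of_ae_weight (Lp.coeFn_zero ℂ 2 (weightMeasure n R₀ (-1)))] with x hx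
  rw [WithLp.zero_snd, hx]
  simp

end lemmas

/-- The space `𝒟₁(P)` of all `u ∈ ℋ₁` such that `χ u ∈ 𝒟(P)` and `Δ((1 - χ) u) ∈ ℋ₁` for every
`χ ∈ C_c^∞(ℝⁿ)` equal to `1` on `B(0, R₀)`. -/
def domainOne {n : ℕ} {R₀ : ℝ} {E : Type*} [NormedAddCommGroup E] [InnerProductSpace ℂ E]
    (P : Space n R₀ E →ₗ.[ℂ] Space n R₀ E) : Submodule ℂ (SpaceOne n R₀ E) where
  carrier := {u | ∀ χ : EuclideanSpace ℝ (Fin n) → ℂ, IsCutoff R₀ χ →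
    (∃ v ∈ P.domain, IsCutoffMul χ u v) ∧ ∃ w, IsCutoffLaplacian χ u w}
  add_mem' := by
    intro u u' hu hu' χ hχ
    obtain ⟨⟨v, hv, h1⟩, w, h2⟩ := hu χ hχ
    obtain ⟨⟨v', hv', h1'⟩, w', h2'⟩ := hu' χ hχ
    exact ⟨⟨v + v', P.domain.add_mem hv hv', h1.add h1'⟩, w + w', h2.add h2'⟩
  zero_mem' := fun χ _ => ⟨⟨0, P.domain.zero_mem, IsCutoffMul.zero⟩, 0, IsCutoffLaplacian.zero⟩
  smul_mem' := by
    intro c u hu χ hχ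
    obtain ⟨⟨v, hv, h1⟩, w, h2⟩ := hu χ hχ
    exact ⟨⟨c • v, P.domain.smul_mem c hv, h1.smul c⟩, c • w, h2.smul c⟩

/-- `𝒟₁(P)` as a normed space: the norm of `u` is the norm of the triple
`(u, χ u, Δ((1 - χ) u))` in `ℋ₁ × 𝒟(P) × ℋ₁`, where `𝒟(P)` carries the graph norm. For a cutoff `χ`,
every `u ∈ 𝒟₁(P)` is the first entry of exactly one such triple. -/
def domainOneGraph {n : ℕ} {R₀ : ℝ} {E : Type*} [NormedAddCommGroup E] [InnerProductSpace ℂ E]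
    (P : Space n R₀ E →ₗ.[ℂ] Space n R₀ E) (χ : EuclideanSpace ℝ (Fin n) → ℂ) :
    Submodule ℂ (SpaceOne n R₀ E × P.graph × Lp ℂ 2 (weightMeasure n R₀ (-1))) where
  carrier := {t | t.1 ∈ domainOne P ∧ IsCutoffMul χ t.1 t.2.1.1.1 ∧ IsCutoffLaplacian χ t.1 t.2.2}
  add_mem' := fun h h' => ⟨(domainOne P).add_mem h.1 h'.1, h.2.1.add h'.2.1, h.2.2.add h'.2.2⟩
  zero_mem' := ⟨(domainOne P).zero_mem, IsCutoffMul.zero, IsCutoffLaplacian.zero⟩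
  smul_mem' := fun c _ h => ⟨(domainOne P).smul_mem c h.1, h.2.1.smul c, h.2.2.smul c⟩

/-- `R` is a meromorphic family of bounded operators `ℋ₀ → 𝒟₁(P)` on `Ω`, with respect to each of
the (equivalent) norms of `𝒟₁(P)`. -/
def IsMeromorphicToDomainOne {n : ℕ} {R₀ : ℝ} {E : Type*} [NormedAddCommGroup E]
    [InnerProductSpace ℂ E] (P : Space n R₀ E →ₗ.[ℂ] Space n R₀ E)
    (R : ℂ → SpaceZero n R₀ E →ₗ[ℂ] domainOne P) (Ω : Set ℂ) : Prop :=
  ∀ χ : EuclideanSpace ℝ (Fin n) → ℂ, IsCutoff R₀ χ →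
    ∃ A : ℂ → SpaceZero n R₀ E →L[ℂ] domainOneGraph P χ,
      (∀ z ∈ Ω, ∀ f, (A z f).1.1 = (R z f : SpaceOne n R₀ E)) ∧
      IsMeromorphicFamilyOn (X := SpaceZero n R₀ E) (Y := domainOneGraph P χ) A Ω

end BlackBox

end

/-!
Meromorphic continuation of the resolvent of a black box Hamiltonian `P`, by perturbation of the
free resolvent. Write `k` for the frequency, so that the spectral parameter is `k²`.

*The free resolvent.* By the heat semigroup, `(-Δ - k²)⁻¹ = ∫₀^∞ e^{tk²} e^{tΔ} dt` if `k² < 0`.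
The part over `0 < t < 1` is a Fourier multiplier of order `-2` that is entire in `k²`
(`heatPart`). The part over `t > 1` has the kernel `∑ⱼ aⱼ(k) (-|x - y|²/4)ʲ / j!`, where `aⱼ(k)`
is a multiple of `∫₁^∞ t^{-n/2-j} e^{k²t} dt`. Between Gaussian weights the series converges in
operator norm (`norm_gaussJet_le`), to operators with values in a weighted Sobolev space, so only
the scalars have to be continued. Integration by parts gives a recurrence in `j` (`gammaSeq`), and
the initial value is an entire function of `k` for odd `n` and of `log k` for even `n`, up to a
pole at `k = 0` that occurs for `n = 1` and multiplies the term `j = 0`, an operator of rank one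
(`exists_freeContinuation_odd`, `exists_freeContinuation_even`).

*The parametrix.* Fix `k₀² = -i`, which is in the resolvent set as `P` is self-adjoint, and a
smooth `ψ` that vanishes near the ball and is `1` far away. With `R = (P - k₀²)⁻¹`, `R₀(k)` the
free resolvent and `G = (-Δ - k₀²) ψ R`, the operator `F(k) = R + ψ (R₀(k) - R₀(k₀)) G` satisfies
`(P - k²) F(k) = 1 + K(k)` with `K(k) = (k₀² - k²) (1 - ψ²) R - [Δ, ψ] (R₀(k) - R₀(k₀)) G`
(`parametrix_identity`). This `K(k)` is compact: the inner part of `R` is compact by assumption,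
its outer part by Rellich's theorem on the exterior (`isCompactOperator_cutoff`), and the
commutator is of order one with compactly supported coefficients. Moreover `K(k₀) = 0`, so
analytic Fredholm theory (`fredholm_meromorphic`, for families that may have poles of finite rank)
inverts `1 + K(k)` meromorphically, and `F(k) (1 + K(k))⁻¹` is the resolvent in the upper
half-plane. Since `G` changes a function of `ℋ₀` only on a bounded set, `K(k)` also acts on `ℋ₀`,
where the continued free resolvent may be inserted, and the same formula gives the continuation.

*Near the sphere.* Rellich's theorem up to the boundary of the ball is proved without extending
functions across it: the flux of a radial vector field shows that elements of the domain have
little mass in thin shells (`shell_estimate`). The cutoffs in the definition of `𝒟₁(P)` are `1` on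
the open ball only; multiplication by them preserves the domain of `P`, since their dilations are
`1` near the closed ball (`cutPair_mem`).
-/

noncomputable section

namespace BlackBox

open ContinuousLinearMap (comp_apply pi comp_add proj opNorm_le_bound comp_smul
  le_of_opNorm_le comp_sub toLinearMap_zero smul_comp mul_def inr_apply inl_apply add_comp compL)
open Complex (I norm_real ofRealCLM I_sq real_smul ofReal_mul)

/-! ### Meromorphic operator families and analytic Fredholm theory -/

section Fredholm

variable {X Y Z : Type*} [NormedAddCommGroup X] [NormedSpace ℂ X] [NormedAddCommGroup Y]
  [NormedSpace ℂ Y] [NormedAddCommGroup Z] [NormedSpace ℂ Z]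

lemma analyticAt_clm_comp {V : Type*} [NormedAddCommGroup V] [NormedSpace ℂ V]
    {L : ℂ → V →L[ℂ] Y} {Q : ℂ → X →L[ℂ] V} {z₀ : ℂ} (hL : AnalyticAt ℂ L z₀)
    (hQ : AnalyticAt ℂ Q z₀) : AnalyticAt ℂ (fun z => L z ∘L Q z) z₀ :=
  ((compL ℂ X V Y).analyticAt_bilinear (L z₀, Q z₀)).comp₂ hL hQ

/-- `A` is, near `z₀`, the sum of a holomorphic family and of a family `(z - z₀)⁻ᵐ L(z) Q(z)` that
factors holomorphically through a finite-dimensional space. This is the same as having a principal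
part of finite rank, but it is visibly stable under sums and products. -/
def FiniteRankMeromorphicAt (A : ℂ → X →L[ℂ] Y) (z₀ : ℂ) : Prop :=
  ∃ (V : Type) (_ : NormedAddCommGroup V) (_ : NormedSpace ℂ V) (_ : FiniteDimensional ℂ V)
    (m : ℕ) (A₀ : ℂ → X →L[ℂ] Y) (L : ℂ → V →L[ℂ] Y) (Q : ℂ → X →L[ℂ] V),
    AnalyticAt ℂ A₀ z₀ ∧ AnalyticAt ℂ L z₀ ∧ AnalyticAt ℂ Q z₀ ∧
    ∀ᶠ z in 𝓝[≠] z₀, A z = A₀ z + ((z - z₀) ^ m)⁻¹ • (L z ∘L Q z)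

lemma AnalyticAt.finiteRankMeromorphicAt {A : ℂ → X →L[ℂ] Y} {z₀ : ℂ} (hA : AnalyticAt ℂ A z₀) :
    FiniteRankMeromorphicAt A z₀ :=
  ⟨ℂ, inferInstance, inferInstance, inferInstance, 0, A, 0, 0, hA, analyticAt_const,
    analyticAt_const, Eventually.of_forall fun z => by simp⟩

lemma FiniteRankMeromorphicAt.congr {A A' : ℂ → X →L[ℂ] Y} {z₀ : ℂ}
    (hA : FiniteRankMeromorphicAt A z₀) (h : A =ᶠ[𝓝[≠] z₀] A') :
    FiniteRankMeromorphicAt A' z₀ := by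
  obtain ⟨V, i1, i2, i3, m, A₀, L, Q, h1, h2, h3, h4⟩ := hA
  exact ⟨V, i1, i2, i3, m, A₀, L, Q, h1, h2, h3, by
    filter_upwards [h, h4] with z h5 h6; rw [← h5, h6]⟩

lemma FiniteRankMeromorphicAt.clm_comp {A : ℂ → X →L[ℂ] Y} {S : ℂ → Y →L[ℂ] Z} {z₀ : ℂ}
    (hS : AnalyticAt ℂ S z₀) (hA : FiniteRankMeromorphicAt A z₀) :
    FiniteRankMeromorphicAt (fun z => S z ∘L A z) z₀ := by
  obtain ⟨V, i1, i2, i3, m, A₀, L, Q, h1, h2, h3, h4⟩ := hA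
  refine ⟨V, i1, i2, i3, m, _, _, Q, analyticAt_clm_comp hS h1, analyticAt_clm_comp hS h2, h3, ?_⟩
  filter_upwards [h4] with z h6
  rw [h6]
  ext x
  simp

lemma FiniteRankMeromorphicAt.comp_clm {A : ℂ → Y →L[ℂ] Z} {S : ℂ → X →L[ℂ] Y} {z₀ : ℂ}
    (hA : FiniteRankMeromorphicAt A z₀) (hS : AnalyticAt ℂ S z₀) :
    FiniteRankMeromorphicAt (fun z => A z ∘L S z) z₀ := by
  obtain ⟨V, i1, i2, i3, m, A₀, L, Q, h1, h2, h3, h4⟩ := hA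
  refine ⟨V, i1, i2, i3, m, _, L, _, analyticAt_clm_comp h1 hS, h2, analyticAt_clm_comp h3 hS, ?_⟩
  filter_upwards [h4] with z h6
  rw [h6]
  ext x
  simp

lemma eventually_ne_zero_sub (z₀ : ℂ) : ∀ᶠ z in 𝓝[≠] z₀, z - z₀ ≠ 0 := by
  filter_upwards [self_mem_nhdsWithin] with z hz
  exact sub_ne_zero.2 hz

lemma FiniteRankMeromorphicAt.add {A A' : ℂ → X →L[ℂ] Y} {z₀ : ℂ}
    (hA : FiniteRankMeromorphicAt A z₀) (hA' : FiniteRankMeromorphicAt A' z₀) :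
    FiniteRankMeromorphicAt (fun z => A z + A' z) z₀ := by
  obtain ⟨V, i1, i2, i3, m, A₀, L, Q, h1, h2, h3, h4⟩ := hA
  obtain ⟨V', i1', i2', i3', m', A₀', L', Q', h1', h2', h3', h4'⟩ := hA'
  refine ⟨V × V', inferInstance, inferInstance, inferInstance, m + m', fun z => A₀ z + A₀' z,
    fun z => ((z - z₀) ^ m') • (L z ∘L ContinuousLinearMap.fst ℂ V V') +
      ((z - z₀) ^ m) • (L' z ∘L ContinuousLinearMap.snd ℂ V V'),
    fun z => ContinuousLinearMap.inl ℂ V V' ∘L Q z + ContinuousLinearMap.inr ℂ V V' ∘L Q' z,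
    h1.add h1', ?_, ?_, ?_⟩
  · have hp : ∀ k : ℕ, AnalyticAt ℂ (fun z : ℂ => (z - z₀) ^ k) z₀ := fun k => by fun_prop
    exact AnalyticAt.add ((hp m').smul (analyticAt_clm_comp h2 analyticAt_const))
      ((hp m).smul (analyticAt_clm_comp h2' analyticAt_const))
  · exact (analyticAt_clm_comp analyticAt_const h3).add (analyticAt_clm_comp analyticAt_const h3')
  · filter_upwards [h4, h4', eventually_ne_zero_sub z₀] with z e e' hz
    rw [e, e']
    ext x
    simp only [add_apply, smul_apply,
      comp_apply, inl_apply, inr_apply,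
      ContinuousLinearMap.coe_fst', ContinuousLinearMap.coe_snd', Prod.fst_add, Prod.snd_add,
      add_zero, zero_add, smul_add, smul_smul]
    rw [pow_add, mul_inv, mul_assoc, inv_mul_cancel₀ (pow_ne_zero _ hz), mul_one,
      mul_comm ((z - z₀) ^ m)⁻¹, mul_assoc, inv_mul_cancel₀ (pow_ne_zero _ hz), mul_one]
    abel

lemma FiniteRankMeromorphicAt.factor {V : Type} [NormedAddCommGroup V] [NormedSpace ℂ V]
    [FiniteDimensional ℂ V] {z₀ : ℂ} (m : ℕ) {L : ℂ → V →L[ℂ] Y} {Q : ℂ → X →L[ℂ] V}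
    (hL : AnalyticAt ℂ L z₀) (hQ : AnalyticAt ℂ Q z₀) :
    FiniteRankMeromorphicAt (fun z => ((z - z₀) ^ m)⁻¹ • (L z ∘L Q z)) z₀ :=
  ⟨V, inferInstance, inferInstance, inferInstance, m, 0, L, Q, analyticAt_const, hL, hQ,
    Eventually.of_forall fun z => by simp⟩

lemma FiniteRankMeromorphicAt.comp {A : ℂ → Y →L[ℂ] Z} {A' : ℂ → X →L[ℂ] Y} {z₀ : ℂ}
    (hA : FiniteRankMeromorphicAt A z₀) (hA' : FiniteRankMeromorphicAt A' z₀) :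
    FiniteRankMeromorphicAt (fun z => A z ∘L A' z) z₀ := by
  obtain ⟨V, i1, i2, i3, m, A₀, L, Q, h1, h2, h3, h4⟩ := hA
  have hA'2 := hA'
  obtain ⟨V', i1', i2', i3', m', A₀', L', Q', h1', h2', h3', h4'⟩ := hA'
  have e1 := FiniteRankMeromorphicAt.clm_comp h1 hA'2
  have e2 := FiniteRankMeromorphicAt.factor m h2 (analyticAt_clm_comp h3 h1')
  have e3 := FiniteRankMeromorphicAt.factor (m + m') (analyticAt_clm_comp h2
    (analyticAt_clm_comp h3 h2')) h3'
  refine (e1.add (e2.add e3)).congr ?_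
  filter_upwards [h4, h4'] with z e e'
  rw [e, e']
  ext x
  simp only [add_apply, smul_apply,
      comp_apply, smul_add, map_add, map_smul, smul_smul, pow_add, mul_inv]
  rw [mul_comm ((z - z₀) ^ m')⁻¹]
  abel

lemma analyticAt_eq_add_smul_dslope {f : ℂ → Y} {z₀ : ℂ} (hf : AnalyticAt ℂ f z₀) :
    AnalyticAt ℂ (dslope f z₀) z₀ ∧ ∀ z, f z = f z₀ + (z - z₀) • dslope f z₀ z := by
  refine ⟨?_, fun z => by simp [sub_smul_dslope]⟩
  obtain ⟨p, hp⟩ := hf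
  exact ⟨_, hp.has_fpower_series_dslope_fslope⟩

/-- Families factoring through a finite-dimensional space have principal parts of finite rank. -/
lemma FiniteRankMeromorphicAt.exists_principal_part {A : ℂ → X →L[ℂ] Y} {z₀ : ℂ}
    (hA : FiniteRankMeromorphicAt A z₀) :
    ∃ (m : ℕ) (B : Fin m → X →L[ℂ] Y) (A₀ : ℂ → X →L[ℂ] Y), AnalyticAt ℂ A₀ z₀ ∧
      (∀ j, FiniteDimensional ℂ (LinearMap.range (B j).toLinearMap)) ∧
      ∀ᶠ z in 𝓝[≠] z₀, A z = A₀ z + ∑ j : Fin m, ((z - z₀) ^ ((j : ℕ) + 1))⁻¹ • B j := by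
  obtain ⟨V, i1, i2, i3, m, A₀, L, Q, h1, h2, h3, h4⟩ := hA
  induction m generalizing V A with
  | zero =>
    exact ⟨0, Fin.elim0, fun z => A₀ z + L z ∘L Q z, h1.add (analyticAt_clm_comp h2 h3),
      fun j => j.elim0, by filter_upwards [h4] with z hz; simp [hz]⟩
  | succ m ih =>
    obtain ⟨hL, eL⟩ := analyticAt_eq_add_smul_dslope h2
    obtain ⟨hQ, eQ⟩ := analyticAt_eq_add_smul_dslope h3
    set L' := dslope L z₀
    set Q' := dslope Q z₀
    -- Splitting off `L(z₀) Q(z₀)` lowers the order of the pole by one.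
    have key := ih (A := fun z => A z - ((z - z₀) ^ (m + 1))⁻¹ • (L z₀ ∘L Q z₀)) (V := V × V)
      inferInstance inferInstance inferInstance
      (fun z => L' z ∘L ContinuousLinearMap.fst ℂ V V + L z ∘L ContinuousLinearMap.snd ℂ V V)
      (fun z => ContinuousLinearMap.inl ℂ V V ∘L Q z₀ + ContinuousLinearMap.inr ℂ V V ∘L Q' z)
      ((analyticAt_clm_comp hL analyticAt_const).add (analyticAt_clm_comp h2 analyticAt_const))
      ((analyticAt_clm_comp analyticAt_const analyticAt_const).add
        (analyticAt_clm_comp analyticAt_const hQ)) ?_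
    · obtain ⟨M, B, A₁, k1, k2, k3⟩ := key
      -- The new coefficient is stored in a list that is long enough to hold its exponent.
      refine ⟨max M (m + 1), fun j => (if h : (j : ℕ) < M then B ⟨j, h⟩ else 0) +
        (if (j : ℕ) = m then L z₀ ∘L Q z₀ else 0), A₁, k1, fun j => ?_, ?_⟩
      · have f0 : FiniteDimensional ℂ (LinearMap.range (0 : X →L[ℂ] Y).toLinearMap) := by
          rw [toLinearMap_zero, LinearMap.range_zero]; infer_instance
        have f1 : ∀ T : X →L[ℂ] Y, T = (if h : (j : ℕ) < M then B ⟨j, h⟩ else 0) →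
            FiniteDimensional ℂ (LinearMap.range T.toLinearMap) := by
          rintro T hT
          split_ifs at hT with h
          · rw [hT]; exact k2 _
          · rw [hT]; exact f0
        have f2 : ∀ T : X →L[ℂ] Y, T = (if (j : ℕ) = m then L z₀ ∘L Q z₀ else 0) →
            FiniteDimensional ℂ (LinearMap.range T.toLinearMap) := by
          rintro T hT
          split_ifs at hT with h
          · have : LinearMap.range T.toLinearMap ≤ LinearMap.range (L z₀).toLinearMap := by
              rw [hT]; rintro _ ⟨x, rfl⟩; exact ⟨Q z₀ x, rfl⟩
            exact Submodule.finiteDimensional_of_le this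
          · rw [hT]; exact f0
        have f1 := f1 _ rfl
        have f2 := f2 _ rfl
        refine Submodule.finiteDimensional_of_le (S₂ := LinearMap.range
            (if h : (j : ℕ) < M then B ⟨j, h⟩ else 0).toLinearMap ⊔ LinearMap.range
            (if (j : ℕ) = m then L z₀ ∘L Q z₀ else 0).toLinearMap) ?_
        rintro _ ⟨x, rfl⟩
        exact Submodule.add_mem_sup ⟨x, rfl⟩ ⟨x, rfl⟩
      · filter_upwards [k3] with z hz
        rw [sub_eq_iff_eq_add] at hz
        rw [hz, add_assoc]
        congr 1
        simp only [smul_add, Finset.sum_add_distrib]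
        congr 1
        · rw [Fin.sum_univ_eq_sum_range (n := max M (m + 1))
            (fun j => ((z - z₀) ^ (j + 1))⁻¹ • if h : j < M then B ⟨j, h⟩ else 0),
            ← Finset.sum_subset (Finset.range_mono (le_max_left M (m + 1)))]
          · rw [← Fin.sum_univ_eq_sum_range
              (fun j => ((z - z₀) ^ (j + 1))⁻¹ • if h : j < M then B ⟨j, h⟩ else 0)]
            simp
          · intro j _ hj
            rw [dif_neg (by simpa using hj), smul_zero]
        · rw [Fin.sum_univ_eq_sum_range (n := max M (m + 1))
            (fun j => ((z - z₀) ^ (j + 1))⁻¹ • if j = m then L z₀ ∘L Q z₀ else 0),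
            Finset.sum_eq_single m]
          · simp
          · intro j _ hj; simp [hj]
          · intro hm; exact absurd (Finset.mem_range.2 (by omega)) hm
    · filter_upwards [h4, eventually_ne_zero_sub z₀] with z hz hz0
      rw [hz, eL z, eQ z]
      ext x
      simp only [add_apply, smul_apply, sub_apply, comp_apply,
        inl_apply, inr_apply, Prod.mk_add_mk, add_zero,
        zero_add, ContinuousLinearMap.coe_fst', ContinuousLinearMap.coe_snd']
      simp only [smul_add, map_add, map_smul, smul_smul, pow_succ, mul_inv]
      have h1 : ((z - z₀) ^ m)⁻¹ * (z - z₀)⁻¹ * (z - z₀) = ((z - z₀) ^ m)⁻¹ := by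
        rw [mul_assoc, inv_mul_cancel₀ hz0, mul_one]
      rw [show ((z - z₀) ^ m)⁻¹ * (z - z₀)⁻¹ * ((z - z₀) * (z - z₀)) =
        ((z - z₀) ^ m)⁻¹ * (z - z₀) by rw [← mul_assoc, h1], h1]
      abel

lemma isMeromorphicFamilyOn_of_finiteRank {A : ℂ → X →L[ℂ] Y} {Ω : Set ℂ}
    (h : ∀ z₀ ∈ Ω, FiniteRankMeromorphicAt A z₀) : IsMeromorphicFamilyOn A Ω :=
  fun z₀ hz₀ => (h z₀ hz₀).exists_principal_part

end Fredholm

section FredholmHilbert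

variable {X : Type*} [NormedAddCommGroup X] [InnerProductSpace ℂ X] [CompleteSpace X]

lemma opNorm_le_of_unit_ball {Y Z : Type*} [NormedAddCommGroup Y] [NormedSpace ℂ Y]
    [NormedAddCommGroup Z] [NormedSpace ℂ Z] (T : Y →L[ℂ] Z) {C : ℝ} (hC : 0 ≤ C)
    (h : ∀ x, ‖x‖ ≤ 1 → ‖T x‖ ≤ C) : ‖T‖ ≤ C := by
  refine T.opNorm_le_bound hC fun x => ?_
  rcases eq_or_ne x 0 with rfl | hx
  · simp
  have h1 := h (((‖x‖⁻¹ : ℝ) : ℂ) • x) (by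
    rw [norm_smul, norm_real, norm_inv, norm_norm, inv_mul_cancel₀ (norm_ne_zero_iff.2 hx)])
  rw [map_smul, norm_smul, norm_real, norm_inv, norm_norm,
    inv_mul_le_iff₀ (norm_pos_iff.2 hx), mul_comm] at h1
  exact h1

/-- Compact operators on a Hilbert space are limits of operators of finite rank. -/
lemma exists_finiteDimensional_approx (K : X →L[ℂ] X) (hK : IsCompactOperator K) :
    ∃ (V : Submodule ℂ X) (_ : FiniteDimensional ℂ V), ‖K - V.starProjection ∘L K‖ < 1 := by
  have hc : TotallyBounded (K '' Metric.closedBall 0 1) :=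
    (IsCompactOperator.isCompact_closure_image_closedBall (f := K.toLinearMap) hK 1).totallyBounded.subset
      subset_closure
  obtain ⟨t, ht, hcov⟩ := Metric.totallyBounded_iff.1 hc (1 / 2) (by norm_num)
  have : FiniteDimensional ℂ (Submodule.span ℂ t) := FiniteDimensional.span_of_finite ℂ ht
  refine ⟨Submodule.span ℂ t, this, ?_⟩
  refine lt_of_le_of_lt (opNorm_le_of_unit_ball _ (C := 1 / 2) (by norm_num) fun x hx => ?_)
    (by norm_num)
  have hm : K x ∈ K '' Metric.closedBall 0 1 := ⟨x, by simpa using hx, rfl⟩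
  obtain ⟨y, hy, hxy⟩ := Set.mem_iUnion₂.1 (hcov hm)
  rw [sub_apply, comp_apply, Submodule.starProjection_minimal]
  refine (ciInf_le ⟨0, ?_⟩ (⟨y, Submodule.subset_span hy⟩ : Submodule.span ℂ t)).trans ?_
  · rintro _ ⟨z, rfl⟩; positivity
  · rw [← dist_eq_norm]; exact (Metric.mem_ball.1 hxy).le

/-- The continuous linear map with a given matrix depends analytically on the matrix entries. -/
lemma analyticAt_matrix_toCLM {d : ℕ} {A : ℂ → Matrix (Fin d) (Fin d) ℂ} {z₀ : ℂ}
    (hA : ∀ i j, AnalyticAt ℂ (fun z => A z i j) z₀) :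
    AnalyticAt ℂ (fun z => LinearMap.toContinuousLinearMap (Matrix.toLin' (A z))) z₀ := by
  let T : (Fin d → Fin d → ℂ) →ₗ[ℂ] ((Fin d → ℂ) →L[ℂ] (Fin d → ℂ)) :=
    (LinearMap.toContinuousLinearMap (𝕜 := ℂ) (E := Fin d → ℂ) (F' := Fin d → ℂ)).toLinearMap ∘ₗ
      (Matrix.toLin' (R := ℂ) (m := Fin d) (n := Fin d)).toLinearMap ∘ₗ
        (Matrix.ofLinearEquiv ℂ).toLinearMap
  have h1 : AnalyticAt ℂ (fun z => (fun i j => A z i j : Fin d → Fin d → ℂ)) z₀ :=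
    AnalyticAt.pi fun i => AnalyticAt.pi fun j => hA i j
  exact (T.toContinuousLinearMap.analyticAt _).comp h1

lemma analyticAt_det {d : ℕ} {A : ℂ → Matrix (Fin d) (Fin d) ℂ} {z₀ : ℂ}
    (hA : ∀ i j, AnalyticAt ℂ (fun z => A z i j) z₀) :
    AnalyticAt ℂ (fun z => (A z).det) z₀ := by
  simp only [Matrix.det_apply]
  refine Finset.analyticAt_fun_sum _ fun σ _ => ?_
  have : AnalyticAt ℂ (fun z => ∏ i, A z (σ i) i) z₀ :=
    Finset.analyticAt_fun_prod _ fun i _ => hA _ _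
  simp only [Units.smul_def, zsmul_eq_mul]
  exact analyticAt_const.mul this

/-- The Schur complement identity behind the Fredholm theorem: if `U` has inverse `S` and
`N = w + Q S L` has inverse `M`, then `U + w⁻¹ L Q` has inverse `S - S L M Q S`. -/
lemma schur_inverse {V : Type*} [NormedAddCommGroup V] [NormedSpace ℂ V] {U S : X →L[ℂ] X}
    {L : V →L[ℂ] X} {Q : X →L[ℂ] V} {N M : V →L[ℂ] V} {w : ℂ} (hw : w ≠ 0)
    (h1 : ∀ x, U (S x) = x) (h2 : ∀ x, S (U x) = x) (hN : ∀ v, N v = w • v + Q (S (L v)))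
    (h3 : ∀ v, N (M v) = v) (h4 : ∀ v, M (N v) = v) :
    (U + w⁻¹ • L ∘L Q) * (S - S ∘L L ∘L M ∘L Q ∘L S) = 1 ∧
      (S - S ∘L L ∘L M ∘L Q ∘L S) * (U + w⁻¹ • L ∘L Q) = 1 := by
  have h5 : ∀ v, Q (S (L v)) = N v - w • v := fun v => by rw [hN]; abel
  constructor
  · ext x
    simp only [mul_def, comp_apply, add_apply, sub_apply,
      smul_apply, map_sub, h1, h5, h3, one_apply_eq_self, map_smul, smul_sub,
      smul_smul, inv_mul_cancel₀ hw, one_smul]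
    abel
  · ext x
    simp only [mul_def, comp_apply, add_apply, sub_apply,
      smul_apply, map_add, h2, h5, h4, one_apply_eq_self, map_smul, map_sub,
      smul_sub, smul_smul, inv_mul_cancel₀ hw, one_smul]
    abel

lemma isUnit_iff_det_ne_zero {d : ℕ} {U S : X →L[ℂ] X} {L : (Fin d → ℂ) →L[ℂ] X}
    {Q : X →L[ℂ] (Fin d → ℂ)} {N : (Fin d → ℂ) →L[ℂ] (Fin d → ℂ)} {w : ℂ} (hw : w ≠ 0)
    (h1 : ∀ x, U (S x) = x) (h2 : ∀ x, S (U x) = x) (hN : ∀ v, N v = w • v + Q (S (L v))) :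
    ((LinearMap.toMatrix' N.toLinearMap).det = 0 → ¬ IsUnit (U + w⁻¹ • L ∘L Q)) ∧
    ((LinearMap.toMatrix' N.toLinearMap).det ≠ 0 → IsUnit (U + w⁻¹ • L ∘L Q) ∧
      Ring.inverse (U + w⁻¹ • L ∘L Q) = S - (LinearMap.toMatrix' N.toLinearMap).det⁻¹ •
        (S ∘L L ∘L LinearMap.toContinuousLinearMap
          (Matrix.toLin' (LinearMap.toMatrix' N.toLinearMap).adjugate) ∘L Q ∘L S)) := by
  set A := LinearMap.toMatrix' N.toLinearMap
  have hA : ∀ v, N v = A.mulVec v := fun v => (LinearMap.toMatrix'_mulVec N.toLinearMap v).symm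
  constructor
  · intro h hu
    obtain ⟨v, hv, hv0⟩ := Matrix.exists_mulVec_eq_zero_iff.2 h
    rw [← hA, hN] at hv0
    have hx : (U + w⁻¹ • L ∘L Q) (S (L v)) = 0 := by
      have : Q (S (L v)) = -(w • v) := by rw [eq_neg_iff_add_eq_zero, add_comm, hv0]
      simp [h1, this, hw]
    obtain ⟨T, -, hT⟩ := isUnit_iff_exists.1 hu
    have hx0 : S (L v) = 0 := by
      have := congrArg T hx
      rw [← mul_apply_eq_comp, hT] at this
      simpa using this
    rw [hx0, map_zero, add_zero] at hv0
    exact hv ((smul_eq_zero.1 hv0).resolve_left hw)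
  · intro h
    obtain ⟨k1, k2⟩ := schur_inverse (M := A.det⁻¹ • LinearMap.toContinuousLinearMap
      (Matrix.toLin' A.adjugate)) hw h1 h2 hN
      (fun v => by
        simp [hA, Matrix.mulVec_smul, Matrix.mulVec_mulVec, Matrix.mul_adjugate, h,
          Matrix.smul_mulVec, smul_smul])
      (fun v => by
        simp [hA, Matrix.mulVec_mulVec, Matrix.adjugate_mul, h, Matrix.smul_mulVec, smul_smul])
    refine ⟨isUnit_iff_exists.2 ⟨_, k1, k2⟩, ?_⟩
    rw [show Ring.inverse (U + w⁻¹ • L ∘L Q) = _ from Ring.inverse_unit ⟨_, _, k1, k2⟩]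
    change S - _ = _
    ext x
    simp

/-- Near each point, `1 + K` is either nowhere invertible, or it is invertible off the point with an
inverse whose principal part has finite rank. -/
theorem fredholm_local {K Kr : ℂ → X →L[ℂ] X} {B : X →L[ℂ] X} {z₀ : ℂ}
    (hKr : AnalyticAt ℂ Kr z₀) (hc : IsCompactOperator (Kr z₀))
    (hB : FiniteDimensional ℂ (LinearMap.range B.toLinearMap))
    (hK : ∀ᶠ z in 𝓝[≠] z₀, K z = Kr z + (z - z₀)⁻¹ • B) :
    (∀ᶠ z in 𝓝[≠] z₀, ¬ IsUnit (1 + K z)) ∨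
    ((∀ᶠ z in 𝓝[≠] z₀, IsUnit (1 + K z)) ∧
      FiniteRankMeromorphicAt (fun z => Ring.inverse (1 + K z)) z₀) := by
  obtain ⟨V, hV, hlt⟩ := exists_finiteDimensional_approx (Kr z₀) hc
  set W : Submodule ℂ X := V ⊔ LinearMap.range B.toLinearMap
  let e : W ≃L[ℂ] (Fin (Module.finrank ℂ W) → ℂ) := (Module.finBasis ℂ W).equivFunL
  set d := Module.finrank ℂ W
  let L : (Fin d → ℂ) →L[ℂ] X := W.subtypeL ∘L e.symm.toContinuousLinearMap
  let q₁ : X →L[ℂ] (Fin d → ℂ) := e.toContinuousLinearMap ∘L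
    (V.starProjection ∘L Kr z₀).codRestrict W fun x =>
      Submodule.mem_sup_left (V.starProjection_apply_mem _)
  let q₂ : X →L[ℂ] (Fin d → ℂ) := e.toContinuousLinearMap ∘L
    B.codRestrict W fun x => Submodule.mem_sup_right ⟨x, rfl⟩
  have hq₁ : L ∘L q₁ = V.starProjection ∘L Kr z₀ := by ext x; simp [L, q₁]
  have hq₂ : L ∘L q₂ = B := by ext x; simp [L, q₂]
  -- `1 + K = U + (z - z₀)⁻¹ L Q` with `U` invertible and `Q` of finite rank.
  let U : ℂ → X →L[ℂ] X := fun z => 1 + Kr z - L ∘L q₁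
  let S : ℂ → X →L[ℂ] X := fun z => Ring.inverse (U z)
  let Q : ℂ → X →L[ℂ] (Fin d → ℂ) := fun z => (z - z₀) • q₁ + q₂
  let N : ℂ → (Fin d → ℂ) →L[ℂ] (Fin d → ℂ) := fun z => (z - z₀) • 1 + Q z ∘L S z ∘L L
  have hU0 : IsUnit (U z₀) := by
    have : U z₀ = 1 - (-(Kr z₀ - V.starProjection ∘L Kr z₀)) := by
      simp only [U, hq₁]; abel
    rw [this]
    exact isUnit_one_sub_of_norm_lt_one (by rwa [norm_neg])
  have hUa : AnalyticAt ℂ U z₀ := (analyticAt_const.add hKr).sub analyticAt_const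
  have hUev : ∀ᶠ z in 𝓝[≠] z₀, IsUnit (U z) :=
    (hUa.continuousAt.eventually (Units.isOpen.mem_nhds hU0)).filter_mono nhdsWithin_le_nhds
  have hSa : AnalyticAt ℂ S z₀ := by
    have h1 : AnalyticAt ℂ Ring.inverse (U z₀) := by
      have := analyticAt_inverse (𝕜 := ℂ) hU0.unit
      rwa [IsUnit.unit_spec] at this
    exact h1.comp hUa
  have hz : AnalyticAt ℂ (fun z : ℂ => z - z₀) z₀ := by fun_prop
  have hQa : AnalyticAt ℂ Q z₀ := (hz.smul analyticAt_const).add analyticAt_const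
  have hNa : AnalyticAt ℂ N z₀ := (hz.smul analyticAt_const).add
    (analyticAt_clm_comp hQa (analyticAt_clm_comp hSa analyticAt_const))
  let A : ℂ → Matrix (Fin d) (Fin d) ℂ := fun z => LinearMap.toMatrix' (N z).toLinearMap
  have hAa : ∀ i j, AnalyticAt ℂ (fun z => A z i j) z₀ := by
    intro i j
    have : (fun z => A z i j) = fun z => (proj (R := ℂ) (φ := fun _ : Fin d => ℂ) i ∘L
        ContinuousLinearMap.apply ℂ (Fin d → ℂ) (Pi.single j (1 : ℂ))) (N z) := by
      funext z
      simp [A, LinearMap.toMatrix'_apply]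
    rw [this]
    exact (ContinuousLinearMap.analyticAt _ _).comp hNa
  have hδ := analyticAt_det hAa
  have hadj : ∀ i j, AnalyticAt ℂ (fun z => (A z).adjugate i j) z₀ := by
    intro i j
    simp only [Matrix.adjugate_apply]
    refine analyticAt_det fun k l => ?_
    simp only [Matrix.updateRow_apply]
    split_ifs
    · exact analyticAt_const
    · exact hAa k l
  have hform : ∀ᶠ z in 𝓝[≠] z₀, z - z₀ ≠ 0 ∧ 1 + K z = U z + (z - z₀)⁻¹ • L ∘L Q z ∧
      (∀ x, U z (S z x) = x) ∧ (∀ x, S z (U z x) = x) := by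
    filter_upwards [hK, hUev, eventually_ne_zero_sub z₀] with z h1 h2 h3
    refine ⟨h3, ?_, fun x => ?_, fun x => ?_⟩
    · have : L ∘L Q z = (z - z₀) • (L ∘L q₁) + L ∘L q₂ := by ext x; simp [Q]
      rw [h1, this, hq₂, smul_add, smul_smul, inv_mul_cancel₀ h3, one_smul]
      simp only [U]
      abel
    · rw [← mul_apply_eq_comp, Ring.mul_inverse_cancel _ h2,
        one_apply_eq_self]
    · rw [← mul_apply_eq_comp, Ring.inverse_mul_cancel _ h2,
        one_apply_eq_self]
  rcases hδ.eventually_eq_zero_or_eventually_ne_zero with h0 | h0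
  · left
    filter_upwards [h0.filter_mono nhdsWithin_le_nhds, hform] with z hz0 ⟨hw, hf, h1, h2⟩
    rw [hf]
    exact (isUnit_iff_det_ne_zero hw h1 h2 (N := N z) fun v => by simp [N]).1 hz0
  · right
    have hn : ¬ ∀ᶠ z in 𝓝 z₀, (A z).det = 0 := fun h =>
      ((h.filter_mono nhdsWithin_le_nhds).and h0).exists.elim fun _ h => h.2 h.1
    obtain ⟨m, g, hg, hg0, hgm⟩ := hδ.exists_eventuallyEq_pow_smul_nonzero_iff.2 hn
    refine ⟨?_, ?_⟩
    · filter_upwards [h0, hform] with z hz0 ⟨hw, hf, h1, h2⟩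
      rw [hf]
      exact ((isUnit_iff_det_ne_zero hw h1 h2 (N := N z) fun v => by simp [N]).2 hz0).1
    · have hadjC := analyticAt_matrix_toCLM hadj
      refine ((AnalyticAt.finiteRankMeromorphicAt hSa).add (FiniteRankMeromorphicAt.factor m
        (L := fun z => (-(g z)⁻¹) • (S z ∘L L ∘L
          LinearMap.toContinuousLinearMap (Matrix.toLin' (A z).adjugate)))
        (Q := fun z => Q z ∘L S z) ?_ (analyticAt_clm_comp hQa hSa))).congr ?_
      · exact (hg.inv hg0).neg.smul (analyticAt_clm_comp hSa
          (analyticAt_clm_comp analyticAt_const hadjC))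
      · filter_upwards [h0, hform, hgm.filter_mono nhdsWithin_le_nhds] with z hz0 ⟨hw, hf, h1, h2⟩ hgz
        rw [hf, ((isUnit_iff_det_ne_zero hw h1 h2 (N := N z) fun v => by simp [N]).2 hz0).2]
        change _ = S z - (A z).det⁻¹ • _
        rw [hgz]
        ext x
        simp only [add_apply, sub_apply, smul_apply, comp_apply, smul_eq_mul,
          mul_inv, mul_neg, neg_smul]
        rw [smul_neg, smul_smul, ← sub_eq_add_neg]

/-- Analytic Fredholm theory. -/
theorem fredholm_meromorphic {Ω : Set ℂ} (hΩ : IsOpen Ω) (hΩc : IsPreconnected Ω)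
    {K : ℂ → X →L[ℂ] X}
    (hK : ∀ z₀ ∈ Ω, ∃ (Kr : ℂ → X →L[ℂ] X) (B : X →L[ℂ] X), AnalyticAt ℂ Kr z₀ ∧
      IsCompactOperator (Kr z₀) ∧ FiniteDimensional ℂ (LinearMap.range B.toLinearMap) ∧
      ∀ᶠ z in 𝓝[≠] z₀, K z = Kr z + (z - z₀)⁻¹ • B)
    {z₁ : ℂ} (hz₁ : z₁ ∈ Ω) (hu : ∀ᶠ z in 𝓝[≠] z₁, IsUnit (1 + K z)) :
    ∀ z₀ ∈ Ω, (∀ᶠ z in 𝓝[≠] z₀, IsUnit (1 + K z)) ∧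
      FiniteRankMeromorphicAt (fun z => Ring.inverse (1 + K z)) z₀ := by
  have hloc : ∀ z₀ ∈ Ω, (∀ᶠ z in 𝓝[≠] z₀, ¬ IsUnit (1 + K z)) ∨
      ((∀ᶠ z in 𝓝[≠] z₀, IsUnit (1 + K z)) ∧
        FiniteRankMeromorphicAt (fun z => Ring.inverse (1 + K z)) z₀) := by
    intro z₀ hz₀
    obtain ⟨Kr, B, h1, h2, h3, h4⟩ := hK z₀ hz₀
    exact fredholm_local h1 h2 h3 h4
  let G : Set ℂ := {z₀ | ∀ᶠ z in 𝓝[≠] z₀, IsUnit (1 + K z)}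
  have hG : IsOpen G := by
    rw [isOpen_iff_eventually]
    intro z₀ hz₀
    have h1 : ∀ᶠ z in 𝓝[≠] z₀, ∀ᶠ y in 𝓝 z, IsUnit (1 + K y) :=
      eventually_nhdsWithin_iff.2 ((eventually_eventually_nhds.2
        (eventually_nhdsWithin_iff.1 hz₀)).mono fun z h hz => by
          filter_upwards [h, isOpen_ne.mem_nhds hz] with y hy hy' using hy hy')
    have h2 : ∀ᶠ z in 𝓝[≠] z₀, z ∈ G := h1.mono fun z h => h.filter_mono nhdsWithin_le_nhds
    filter_upwards [eventually_nhdsWithin_iff.1 h2] with z hz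
    by_cases h : z = z₀
    · rw [h]; exact hz₀
    · exact hz h
  have hsub : Ω ⊆ G := by
    refine hΩc.subset_of_closure_inter_subset hG ⟨z₁, hz₁, hu⟩ ?_
    rintro z₀ ⟨hcl, hz₀⟩
    refine (hloc z₀ hz₀).resolve_left (fun hbad => ?_) |>.1
    obtain ⟨O, hO, hO1, hO2⟩ := mem_nhds_iff.1 (eventually_nhdsWithin_iff.1 hbad)
    obtain ⟨z, hz, hzG⟩ := mem_closure_iff.1 hcl O hO1 hO2
    have h1 : ∀ᶠ y in 𝓝[≠] z, y ∈ O := (hO1.mem_nhds hz : O ∈ 𝓝 z) |> fun h =>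
      (nhdsWithin_le_nhds h : O ∈ 𝓝[≠] z)
    have h2 : ∀ᶠ y in 𝓝[≠] z, y ≠ z₀ := by
      by_cases h : z = z₀
      · rw [h]; exact self_mem_nhdsWithin
      · exact nhdsWithin_le_nhds (isOpen_ne.mem_nhds h)
    obtain ⟨y, hy1, hy2, hy3⟩ := (h1.and (h2.and hzG)).exists
    exact hO hy1 hy2 hy3
  intro z₀ hz₀
  refine ⟨hsub hz₀, ((hloc z₀ hz₀).resolve_left fun hbad => ?_).2⟩
  obtain ⟨y, h1, h2⟩ := (hbad.and (hsub hz₀)).exists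
  exact h1 h2

end FredholmHilbert

/-! ### Multiplication operators between weighted `L²` spaces -/

section MulOp

variable {α : Type*} [MeasurableSpace α] {μ ν ξ : Measure α} {m m' : α → ℂ} {C C' : ℝ}

/-- Multiplication by `m` maps `L²(μ)` to `L²(ν)` with norm at most `C`. -/
def MulBound (m : α → ℂ) (μ ν : Measure α) (C : ℝ) : Prop :=
  Measurable m ∧ 0 ≤ C ∧ ν.withDensity (fun x => ‖m x‖ₑ ^ 2) ≤ ENNReal.ofReal (C ^ 2) • μ

lemma MulBound.ae_imp (h : MulBound m μ ν C) {p : α → Prop} (hp : ∀ᵐ x ∂μ, p x) :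
    ∀ᵐ x ∂ν, m x ≠ 0 → p x := by
  have h1 : ν.withDensity (fun x => ‖m x‖ₑ ^ 2) ≪ μ :=
    (Measure.absolutelyContinuous_of_le h.2.2).trans Measure.smul_absolutelyContinuous
  have h2 : ∀ᵐ x ∂ν.withDensity fun x => ‖m x‖ₑ ^ 2, p x := h1.ae_le hp
  rw [ae_withDensity_iff (by have := h.1; fun_prop)] at h2
  filter_upwards [h2] with x hx hm
  exact hx (by simpa using hm)

lemma MulBound.ae_mul_eq (h : MulBound m μ ν C) {f g : α → ℂ} (hp : f =ᵐ[μ] g) :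
    ∀ᵐ x ∂ν, m x * f x = m x * g x := by
  filter_upwards [h.ae_imp hp] with x hx
  by_cases hm : m x = 0
  · simp [hm]
  · rw [hx hm]

lemma eLpNorm_two_sq (f : α → ℂ) (μ : Measure α) :
    eLpNorm f 2 μ ^ 2 = ∫⁻ x, ‖f x‖ₑ ^ 2 ∂μ := by
  have := eLpNorm_nnreal_pow_eq_lintegral (f := f) (μ := μ) (p := 2) (by norm_num)
  simpa using this

lemma MulBound.eLpNorm_le (h : MulBound m μ ν C) {f : α → ℂ} (hf : StronglyMeasurable f) :
    eLpNorm (fun x => m x * f x) 2 ν ≤ ENNReal.ofReal C * eLpNorm f 2 μ := by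
  rw [← ENNReal.pow_le_pow_left_iff two_ne_zero, mul_pow, eLpNorm_two_sq, eLpNorm_two_sq,
    ← ENNReal.ofReal_pow h.2.1]
  have hm := h.1
  calc ∫⁻ x, ‖m x * f x‖ₑ ^ 2 ∂ν = ∫⁻ x, ‖f x‖ₑ ^ 2 ∂(ν.withDensity fun x => ‖m x‖ₑ ^ 2) := by
        rw [lintegral_withDensity_eq_lintegral_mul _ (by fun_prop)
          (by have := hf.measurable; fun_prop)]
        simp [enorm_mul, mul_pow]
    _ ≤ ∫⁻ x, ‖f x‖ₑ ^ 2 ∂(ENNReal.ofReal (C ^ 2) • μ) := lintegral_mono' h.2.2 le_rfl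
    _ = _ := by rw [lintegral_smul_measure, smul_eq_mul]

lemma MulBound.memLp (h : MulBound m μ ν C) (f : Lp ℂ 2 μ) : MemLp (fun x => m x * f x) 2 ν :=
  ⟨(h.1.stronglyMeasurable.mul (Lp.stronglyMeasurable f)).aestronglyMeasurable,
    (h.eLpNorm_le (Lp.stronglyMeasurable f)).trans_lt
      (ENNReal.mul_lt_top ENNReal.ofReal_lt_top (Lp.eLpNorm_lt_top f))⟩

open Classical in
/-- Multiplication by `m`, as an operator from `L²(μ)` to `L²(ν)` (and `0` if it is not bounded).
All restrictions, extensions by zero, cutoffs and changes of weight are operators of this form. -/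
def mulOp (m : α → ℂ) (μ ν : Measure α) : Lp ℂ 2 μ →L[ℂ] Lp ℂ 2 ν :=
  if h : ∃ C, MulBound m μ ν C then
    LinearMap.mkContinuous
      { toFun := fun f => (h.choose_spec.memLp f).toLp _
        map_add' := fun f g => by
          refine (MemLp.toLp_eq_toLp_iff _ ((h.choose_spec.memLp f).add (h.choose_spec.memLp g))).2 ?_
          filter_upwards [h.choose_spec.ae_mul_eq (Lp.coeFn_add f g)] with x hx
          rw [hx]
          simp [mul_add]
        map_smul' := fun c f => by
          refine (MemLp.toLp_eq_toLp_iff _ ((h.choose_spec.memLp f).const_smul c)).2 ?_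
          filter_upwards [h.choose_spec.ae_mul_eq (Lp.coeFn_smul c f)] with x hx
          rw [hx]
          simp [mul_left_comm] } h.choose
      (fun f => by
        have h1 := h.choose_spec.eLpNorm_le (Lp.stronglyMeasurable f)
        have h2 := ENNReal.toReal_mono (ENNReal.mul_ne_top ENNReal.ofReal_ne_top
          (Lp.eLpNorm_ne_top f)) h1
        rw [ENNReal.toReal_mul, ENNReal.toReal_ofReal h.choose_spec.2.1] at h2
        rw [Lp.norm_def, Lp.norm_def]
        exact (congrArg ENNReal.toReal (eLpNorm_congr_ae
          (MemLp.coeFn_toLp (h.choose_spec.memLp f)))).trans_le h2)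
  else 0

lemma coeFn_mulOp (h : MulBound m μ ν C) (f : Lp ℂ 2 μ) :
    ∀ᵐ x ∂ν, mulOp m μ ν f x = m x * f x := by
  have h' : ∃ C, MulBound m μ ν C := ⟨C, h⟩
  rw [mulOp, dif_pos h']
  exact MemLp.coeFn_toLp (h'.choose_spec.memLp f)

lemma norm_mulOp_le (h : MulBound m μ ν C) : ‖mulOp m μ ν‖ ≤ C := by
  refine opNorm_le_bound _ h.2.1 fun f => ?_
  have h1 := h.eLpNorm_le (Lp.stronglyMeasurable f)
  have h2 := ENNReal.toReal_mono (ENNReal.mul_ne_top ENNReal.ofReal_ne_top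
    (Lp.eLpNorm_ne_top f)) h1
  rw [ENNReal.toReal_mul, ENNReal.toReal_ofReal h.2.1] at h2
  rw [Lp.norm_def, Lp.norm_def, eLpNorm_congr_ae (coeFn_mulOp h f)]
  exact h2

/-- The measure `μ` on Euclidean space has the density `r` with respect to Lebesgue measure. -/
def HasDens {n : ℕ} (μ : Measure (EuclideanSpace ℝ (Fin n))) (r : EuclideanSpace ℝ (Fin n) → ℝ) :
    Prop :=
  Measurable r ∧ μ = volume.withDensity fun x => ENNReal.ofReal (r x)

lemma hasDens_volume : HasDens (volume : Measure (EuclideanSpace ℝ (Fin n))) fun _ => 1 :=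
  ⟨measurable_const, by simp⟩

lemma measurableSet_exterior : MeasurableSet (exterior n R₀) := measurableSet_ball.compl

lemma hasDens_extMeasure : HasDens (extMeasure n R₀) ((exterior n R₀).indicator fun _ => 1) := by
  refine ⟨measurable_const.indicator measurableSet_exterior, ?_⟩
  rw [extMeasure, ← withDensity_indicator_one measurableSet_exterior]
  congr 1
  funext x
  by_cases hx : x ∈ exterior n R₀ <;> simp [hx]

lemma hasDens_weightMeasure (c : ℝ) : HasDens (weightMeasure n R₀ c)
    ((exterior n R₀).indicator fun x => Real.exp (2 * c * ‖x‖ ^ 2)) := by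
  refine ⟨Measurable.indicator (by fun_prop) measurableSet_exterior, ?_⟩
  rw [weightMeasure, extMeasure, ← withDensity_indicator measurableSet_exterior]
  congr 1
  funext x
  by_cases hx : x ∈ exterior n R₀ <;> simp [hx]

lemma HasDens.mulBound {μ ν : Measure (EuclideanSpace ℝ (Fin n))}
    {r s : EuclideanSpace ℝ (Fin n) → ℝ} {m : EuclideanSpace ℝ (Fin n) → ℂ} {C : ℝ}
    (hμ : HasDens μ r) (hν : HasDens ν s) (hm : Measurable m) (hC : 0 ≤ C)
    (h : ∀ x, ‖m x‖ ^ 2 * s x ≤ C ^ 2 * r x) : MulBound m μ ν C := by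
  refine ⟨hm, hC, ?_⟩
  rw [hμ.2, hν.2, ← withDensity_mul _ hν.1.ennreal_ofReal (by fun_prop),
    ← withDensity_smul _ hμ.1.ennreal_ofReal]
  refine withDensity_mono (ae_of_all _ fun x => ?_)
  simp only [Pi.mul_apply, Pi.smul_apply, smul_eq_mul]
  rw [← ENNReal.ofReal_mul (sq_nonneg _), ← ofReal_norm,
    ← ENNReal.ofReal_pow (norm_nonneg _), mul_comm, ← ENNReal.ofReal_mul (sq_nonneg _)]
  exact ENNReal.ofReal_le_ofReal (h x)

lemma mulBound_volume {m : EuclideanSpace ℝ (Fin n) → ℂ} {C : ℝ} (hm : Measurable m)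
    (h : ∀ x, ‖m x‖ ≤ C) : MulBound m volume volume C := by
  have hC : 0 ≤ C := (norm_nonneg _).trans (h 0)
  refine hasDens_volume.mulBound hasDens_volume hm hC fun x => ?_
  have := h x
  gcongr

end MulOp

variable {n : ℕ} {R₀ : ℝ}

local notation "𝔼" => EuclideanSpace ℝ (Fin n)

/-! ### Calculus of weak derivatives -/

section Weak

/-- The classical partial derivative `∂ᵢ ψ`. -/
def pd (i : Fin n) (ψ : 𝔼 → ℂ) (x : 𝔼) : ℂ :=
  fderiv ℝ ψ x (EuclideanSpace.single i 1)

/-- The classical Laplacian `∑ ∂ᵢ ∂ᵢ ψ`. -/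
def lap (ψ : 𝔼 → ℂ) (x : 𝔼) : ℂ :=
  ∑ i, pd i (pd i ψ) x

lemma contDiff_pd {ψ : 𝔼 → ℂ} (h : ContDiff ℝ ∞ ψ) (i : Fin n) : ContDiff ℝ ∞ (pd i ψ) :=
  (h.fderiv_right (m := ∞) (by simp)).clm_apply contDiff_const

lemma contDiff_lap {ψ : 𝔼 → ℂ} (h : ContDiff ℝ ∞ ψ) : ContDiff ℝ ∞ (lap ψ) :=
  ContDiff.sum fun i _ => contDiff_pd (contDiff_pd h i) i

lemma tsupport_pd_subset (ψ : 𝔼 → ℂ) (i : Fin n) : tsupport (pd i ψ) ⊆ tsupport ψ := by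
  refine closure_minimal (fun x hx => ?_) (isClosed_tsupport ψ)
  refine support_fderiv_subset ℝ (f := ψ) fun h => hx ?_
  simp [pd, h]

lemma pd_mul {φ ψ : 𝔼 → ℂ} (hφ : ContDiff ℝ ∞ φ) (hψ : ContDiff ℝ ∞ ψ) (i : Fin n) (x : 𝔼) :
    pd i (fun y => φ y * ψ y) x = pd i φ x * ψ x + φ x * pd i ψ x := by
  have h1 := (hφ.differentiable (by simp)).differentiableAt (x := x)
  have h2 := (hψ.differentiable (by simp)).differentiableAt (x := x)
  simp only [pd]
  rw [fderiv_fun_mul h1 h2]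
  simp
  ring

/-- Complex valued test functions on `U`. -/
def IsComplexTest (U : Set 𝔼) (φ : 𝔼 → ℂ) : Prop :=
  ContDiff ℝ ∞ φ ∧ HasCompactSupport φ ∧ tsupport φ ⊆ U

lemma IsTestOn.complex {U : Set 𝔼} {φ : 𝔼 → ℝ} (h : IsTestOn U φ) :
    IsComplexTest U fun x => (φ x : ℂ) := by
  have hs : tsupport (fun x => (φ x : ℂ)) ⊆ tsupport φ :=
    closure_mono fun x hx h0 => hx (by simp [h0])
  exact ⟨Complex.ofRealCLM.contDiff.comp h.1, h.2.1.of_isClosed_subset (isClosed_tsupport _) hs,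
    hs.trans h.2.2⟩

lemma pd_ofReal {φ : 𝔼 → ℝ} (h : ContDiff ℝ ∞ φ) (i : Fin n) (x : 𝔼) :
    pd i (fun y => (φ y : ℂ)) x = (fderiv ℝ φ x (EuclideanSpace.single i 1) : ℝ) := by
  have h1 := (h.differentiable (by simp)).differentiableAt (x := x)
  have := (Complex.ofRealCLM.hasFDerivAt.comp x h1.hasFDerivAt).fderiv
  have h2 : (⇑ofRealCLM ∘ φ) = fun y => (φ y : ℂ) := rfl
  rw [h2] at this
  rw [pd, this]
  rfl

lemma integrableOn_ctest {U : Set 𝔼} {u ψ : 𝔼 → ℂ} (hu : LocallyIntegrableOn u U)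
    (hψ : Continuous ψ) (hc : HasCompactSupport ψ) (hs : tsupport ψ ⊆ U) :
    IntegrableOn (fun x => ψ x * u x) U := by
  have h1 : IntegrableOn (fun x => ψ x * u x) (tsupport ψ) := by
    simpa only [smul_eq_mul] using
      (hu.integrableOn_compact_subset hs hc).continuousOn_smul hψ.continuousOn hc
  refine ((integrableOn_iff_integrable_of_support_subset ?_).1 h1).integrableOn
  intro x hx
  exact subset_tsupport ψ fun h0 => hx (by simp [h0])

lemma HasWeakPartialOn.ctest {U : Set 𝔼} {i : Fin n} {u g : 𝔼 → ℂ} (h : HasWeakPartialOn U i u g)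
    {φ : 𝔼 → ℂ} (hφ : IsComplexTest U φ) :
    ∫ x in U, pd i φ x * u x = -∫ x in U, φ x * g x := by
  have part : ∀ ℓ : ℂ →L[ℝ] ℝ, IsTestOn U (fun x => ℓ (φ x)) ∧
      ∀ x, fderiv ℝ (fun y => ℓ (φ y)) x (EuclideanSpace.single i 1) = ℓ (pd i φ x) := by
    intro ℓ
    have hs : tsupport (fun x => ℓ (φ x)) ⊆ tsupport φ :=
      closure_mono fun x hx h0 => hx (by simp [h0])
    refine ⟨⟨ℓ.contDiff.comp hφ.1, hφ.2.1.of_isClosed_subset (isClosed_tsupport _) hs,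
      hs.trans hφ.2.2⟩, fun x => ?_⟩
    have h1 := (hφ.1.differentiable (by simp)).differentiableAt (x := x)
    have := (ℓ.hasFDerivAt.comp x h1.hasFDerivAt).fderiv
    have h2 : (⇑ℓ ∘ φ) = fun y => ℓ (φ y) := rfl
    rw [h2] at this
    rw [this]
    rfl
  have split : ∀ (ψ f : 𝔼 → ℂ), LocallyIntegrableOn f U → Continuous ψ → HasCompactSupport ψ →
      tsupport ψ ⊆ U → ∫ x in U, ψ x * f x =
        (∫ x in U, (Complex.reCLM (ψ x)) • f x) + I * ∫ x in U, (Complex.imCLM (ψ x)) • f x := by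
    intro ψ f hf hψ hc hs
    have hs' : ∀ ℓ : ℂ →L[ℝ] ℝ, tsupport (fun x => ℓ (ψ x)) ⊆ tsupport ψ := fun ℓ =>
      closure_mono fun x hx h0 => hx (by simp [h0])
    have hi : ∀ ℓ : ℂ →L[ℝ] ℝ, IntegrableOn (fun x => ℓ (ψ x) • f x) U := fun ℓ =>
      integrableOn_test hf (ℓ.continuous.comp hψ)
        (hc.of_isClosed_subset (isClosed_tsupport _) (hs' ℓ)) ((hs' ℓ).trans hs)
    rw [← integral_const_mul, ← integral_add (hi _) ((hi _).const_mul _)]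
    refine integral_congr_ae (ae_of_all _ fun x => ?_)
    simp only [Complex.reCLM_apply, Complex.imCLM_apply, real_smul]
    conv_lhs => rw [← Complex.re_add_im (ψ x)]
    ring
  have hts := tsupport_pd_subset φ i
  rw [split _ _ h.1 (contDiff_pd hφ.1 i).continuous
    (hφ.2.1.of_isClosed_subset (isClosed_tsupport _) hts) (hts.trans hφ.2.2),
    split _ _ h.2.1 hφ.1.continuous hφ.2.1 hφ.2.2]
  have e1 := h.2.2 _ (part Complex.reCLM).1
  have e2 := h.2.2 _ (part Complex.imCLM).1
  simp only [(part _).2] at e1 e2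
  rw [e1, e2]
  ring

lemma locallyIntegrableOn_mul_cutoff {U V : Set 𝔼} (hV : IsOpen V) {u ψ : 𝔼 → ℂ}
    (hu : LocallyIntegrableOn u U) (hψ : Continuous ψ) (hs : V ∩ tsupport ψ ⊆ U) :
    LocallyIntegrableOn (fun x => ψ x * u x) V := by
  rw [locallyIntegrableOn_iff hV.isLocallyClosed]
  intro K hK hKc
  have hc : IsCompact (K ∩ tsupport ψ) := hKc.inter_right (isClosed_tsupport ψ)
  have h1 : IntegrableOn (fun x => ψ x * u x) (K ∩ tsupport ψ) := by
    simpa only [smul_eq_mul] using (hu.integrableOn_compact_subset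
      ((Set.inter_subset_inter_left _ hK).trans hs) hc).continuousOn_smul hψ.continuousOn hc
  refine h1.of_forall_sdiff_eq_zero hKc.measurableSet fun x hx => ?_
  have : x ∉ tsupport ψ := fun h => hx.2 ⟨hx.1, h⟩
  simp [image_eq_zero_of_notMem_tsupport this]

/-- The Leibniz rule. If the support of `ψ` meets `V` only inside `U`, the product is a weakly
differentiable function on `V` even though `u` is so only on `U`. -/
lemma HasWeakPartialOn.mul {U V : Set 𝔼} (hV : IsOpen V) {i : Fin n} {u g ψ : 𝔼 → ℂ}
    (h : HasWeakPartialOn U i u g) (hψ : ContDiff ℝ ∞ ψ) (hs : V ∩ tsupport ψ ⊆ U) :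
    HasWeakPartialOn V i (fun x => ψ x * u x) (fun x => pd i ψ x * u x + ψ x * g x) := by
  have hs' : V ∩ tsupport (pd i ψ) ⊆ U :=
    (Set.inter_subset_inter_right _ (tsupport_pd_subset ψ i)).trans hs
  have l0 := locallyIntegrableOn_mul_cutoff hV h.1 hψ.continuous hs
  have l1 := locallyIntegrableOn_mul_cutoff hV h.1 (contDiff_pd hψ i).continuous hs'
  have l2 := locallyIntegrableOn_mul_cutoff hV h.2.1 hψ.continuous hs
  refine ⟨l0, l1.add l2, fun φ hφ => ?_⟩
  have hφc := hφ.complex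
  set φc : 𝔼 → ℂ := fun x => (φ x : ℂ)
  have hsub : tsupport (fun x => φc x * ψ x) ⊆ tsupport φc ∩ tsupport ψ :=
    Set.subset_inter (tsupport_mul_subset_left (f := φc) (g := ψ))
      (tsupport_mul_subset_right (f := φc) (g := ψ))
  have hT : IsComplexTest U (fun x => φc x * ψ x) :=
    ⟨hφc.1.mul hψ, hφc.2.1.of_isClosed_subset (isClosed_tsupport _)
      (hsub.trans Set.inter_subset_left),
      hsub.trans ((Set.inter_subset_inter_left _ hφc.2.2).trans hs)⟩
  have key := h.ctest hT
  simp only [pd_mul hφc.1 hψ] at key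
  have off : ∀ x, x ∉ U ∩ V → (φc x * ψ x = 0 ∧ pd i φc x * ψ x = 0 ∧ φc x * pd i ψ x = 0) := by
    intro x hx
    by_cases hxV : x ∈ V
    · have hxψ : x ∉ tsupport ψ := fun h' => hx ⟨hs ⟨hxV, h'⟩, hxV⟩
      have hxψ' : x ∉ tsupport (pd i ψ) := fun h' => hxψ (tsupport_pd_subset ψ i h')
      simp [image_eq_zero_of_notMem_tsupport hxψ, image_eq_zero_of_notMem_tsupport hxψ']
    · have hxφ : x ∉ tsupport φc := fun h' => hxV (hφc.2.2 h')
      have hxφ' : x ∉ tsupport (pd i φc) := fun h' => hxφ (tsupport_pd_subset φc i h')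
      simp [image_eq_zero_of_notMem_tsupport hxφ, image_eq_zero_of_notMem_tsupport hxφ']
  have e1 : ∀ f : 𝔼 → ℂ, (∀ x, x ∉ U ∩ V → f x = 0) → ∫ x in U, f x = ∫ x in V, f x := by
    intro f hf
    rw [setIntegral_eq_integral_of_forall_compl_eq_zero fun x hx => hf x fun h' => hx h'.1,
      setIntegral_eq_integral_of_forall_compl_eq_zero fun x hx => hf x fun h' => hx h'.2]
  rw [e1 _ fun x hx => by rw [(off x hx).2.1, (off x hx).2.2]; simp,
    e1 _ fun x hx => by rw [(off x hx).1]; simp] at key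
  have hpφ : HasCompactSupport (pd i φc) :=
    hφc.2.1.of_isClosed_subset (isClosed_tsupport _) (tsupport_pd_subset φc i)
  have i1 := integrableOn_ctest l0 (contDiff_pd hφc.1 i).continuous hpφ
    ((tsupport_pd_subset φc i).trans hφc.2.2)
  have i2 := integrableOn_ctest l1 hφc.1.continuous hφc.2.1 hφc.2.2
  have i3 := integrableOn_ctest l2 hφc.1.continuous hφc.2.1 hφc.2.2
  have k1 : ∫ x in V, (pd i φc x * ψ x + φc x * pd i ψ x) * u x =
      (∫ x in V, pd i φc x * (ψ x * u x)) + ∫ x in V, φc x * (pd i ψ x * u x) := by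
    rw [← integral_add i1 i2]
    exact integral_congr_ae (ae_of_all _ fun x => by ring)
  have k2 : ∫ x in V, φ x • (pd i ψ x * u x + ψ x * g x) =
      (∫ x in V, φc x * (pd i ψ x * u x)) + ∫ x in V, φc x * (ψ x * g x) := by
    rw [← integral_add i2 i3]
    exact integral_congr_ae (ae_of_all _ fun x => by simp only [φc, real_smul]; ring)
  have k3 : ∫ x in V, fderiv ℝ φ x (EuclideanSpace.single i 1) • (ψ x * u x) =
      ∫ x in V, pd i φc x * (ψ x * u x) :=
    integral_congr_ae (ae_of_all _ fun x => by simp only [φc, pd_ofReal hφ.1, real_smul])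
  rw [k1] at key
  simp only [mul_assoc] at key
  rw [k2, k3, neg_add, ← key]
  ring

lemma locallyIntegrableOn_congr {U : Set 𝔼} (hU : IsOpen U) {a b : 𝔼 → ℂ}
    (ha : LocallyIntegrableOn a U) (hab : a =ᵐ[volume.restrict U] b) : LocallyIntegrableOn b U := by
  rw [locallyIntegrableOn_iff hU.isLocallyClosed] at ha ⊢
  intro K hK hKc
  exact (ha K hK hKc).congr (hab.filter_mono (ae_mono (Measure.restrict_mono hK le_rfl)))

lemma HasWeakPartialOn.congr {U : Set 𝔼} (hU : IsOpen U) {i : Fin n} {u g u' g' : 𝔼 → ℂ}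
    (h : HasWeakPartialOn U i u g) (hu : u =ᵐ[volume.restrict U] u')
    (hg : g =ᵐ[volume.restrict U] g') : HasWeakPartialOn U i u' g' := by
  refine ⟨locallyIntegrableOn_congr hU h.1 hu, locallyIntegrableOn_congr hU h.2.1 hg,
    fun φ hφ => ?_⟩
  rw [← integral_congr_ae (hu.mono fun x hx => by
      simp only [hx] : (fun x => fderiv ℝ φ x (EuclideanSpace.single i 1) • u x) =ᵐ[volume.restrict U]
        fun x => fderiv ℝ φ x (EuclideanSpace.single i 1) • u' x),
    ← integral_congr_ae (hg.mono fun x hx => by simp only [hx] :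
      (fun x => φ x • g x) =ᵐ[volume.restrict U] fun x => φ x • g' x), h.2.2 φ hφ]

lemma isTestOn_fderiv {U : Set 𝔼} {φ : 𝔼 → ℝ} (h : IsTestOn U φ) (i : Fin n) :
    IsTestOn U fun x => fderiv ℝ φ x (EuclideanSpace.single i 1) := by
  have hs : tsupport (fun x => fderiv ℝ φ x (EuclideanSpace.single i 1)) ⊆ tsupport φ := by
    refine closure_minimal (fun x hx => ?_) (isClosed_tsupport φ)
    exact support_fderiv_subset ℝ (f := φ) fun h => hx (by simp [h])
  exact ⟨(h.1.fderiv_right (m := ∞) (by simp)).clm_apply contDiff_const,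
    h.2.1.of_isClosed_subset (isClosed_tsupport _) hs, hs.trans h.2.2⟩

lemma HasWeakPartialOn.add {U : Set 𝔼} {i : Fin n} {u g u' g' : 𝔼 → ℂ}
    (h : HasWeakPartialOn U i u g) (h' : HasWeakPartialOn U i u' g') :
    HasWeakPartialOn U i (fun x => u x + u' x) (fun x => g x + g' x) := by
  refine ⟨h.1.add h'.1, h.2.1.add h'.2.1, fun φ hφ => ?_⟩
  have hφ' := isTestOn_fderiv hφ i
  simp only [smul_add]
  rw [integral_add (integrableOn_test h.1 hφ'.1.continuous hφ'.2.1 hφ'.2.2)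
      (integrableOn_test h'.1 hφ'.1.continuous hφ'.2.1 hφ'.2.2),
    integral_add (integrableOn_test h.2.1 hφ.1.continuous hφ.2.1 hφ.2.2)
      (integrableOn_test h'.2.1 hφ.1.continuous hφ.2.1 hφ.2.2), h.2.2 φ hφ, h'.2.2 φ hφ]
  ring

lemma HasWeakPartialOn.smul {U : Set 𝔼} {i : Fin n} {u g : 𝔼 → ℂ} (c : ℂ)
    (h : HasWeakPartialOn U i u g) : HasWeakPartialOn U i (fun x => c * u x) (fun x => c * g x) := by
  refine ⟨h.1.smul c, h.2.1.smul c, fun φ hφ => ?_⟩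
  have := h.2.2 φ hφ
  simp only [real_smul, mul_left_comm _ c] at this ⊢
  rw [integral_const_mul, integral_const_mul, this]
  ring

lemma HasWeakPartialOn.unique {U : Set 𝔼} (hU : IsOpen U) {i : Fin n} {u g g' : 𝔼 → ℂ}
    (h : HasWeakPartialOn U i u g) (h' : HasWeakPartialOn U i u g') :
    g =ᵐ[volume.restrict U] g' := by
  have h1 : ∀ᵐ x, x ∈ U → g x - g' x = 0 := by
    refine hU.ae_eq_zero_of_integral_contDiff_smul_eq_zero (h.2.1.sub h'.2.1) fun φ h1 h2 h3 => ?_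
    have hφ : IsTestOn U φ := ⟨h1, h2, h3⟩
    have e := (h.2.2 φ hφ).symm.trans (h'.2.2 φ hφ)
    rw [← setIntegral_eq_integral_of_forall_compl_eq_zero (s := U) fun x hx => by
      simp [image_eq_zero_of_notMem_tsupport fun h' => hx (h3 h')]]
    simp only [smul_sub, Pi.sub_apply]
    rw [integral_sub (integrableOn_test h.2.1 h1.continuous h2 h3)
      (integrableOn_test h'.2.1 h1.continuous h2 h3), sub_eq_zero]
    exact neg_injective e
  rw [EventuallyEq, ae_restrict_iff' hU.measurableSet]
  filter_upwards [h1] with x hx hxU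
  exact sub_eq_zero.1 (hx hxU)

lemma HasWeakLaplacianOn.unique {U : Set 𝔼} (hU : IsOpen U) {u g g' : 𝔼 → ℂ}
    (h : HasWeakLaplacianOn U u g) (h' : HasWeakLaplacianOn U u g') :
    g =ᵐ[volume.restrict U] g' := by
  have h1 : ∀ᵐ x, x ∈ U → g x - g' x = 0 := by
    refine hU.ae_eq_zero_of_integral_contDiff_smul_eq_zero (h.2.1.sub h'.2.1) fun φ h1 h2 h3 => ?_
    have hφ : IsTestOn U φ := ⟨h1, h2, h3⟩
    have e := (h.2.2 φ hφ).symm.trans (h'.2.2 φ hφ)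
    rw [← setIntegral_eq_integral_of_forall_compl_eq_zero (s := U) fun x hx => by
      simp [image_eq_zero_of_notMem_tsupport fun h' => hx (h3 h')]]
    simp only [smul_sub, Pi.sub_apply]
    rw [integral_sub (integrableOn_test h.2.1 h1.continuous h2 h3)
      (integrableOn_test h'.2.1 h1.continuous h2 h3), sub_eq_zero]
    exact e
  rw [EventuallyEq, ae_restrict_iff' hU.measurableSet]
  filter_upwards [h1] with x hx hxU
  exact sub_eq_zero.1 (hx hxU)

/-- `g` and `h` are the first and second weak derivatives of `u` on `U`. -/
structure WeakTwo (U : Set 𝔼) (u : 𝔼 → ℂ)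
    (g : Fin n → 𝔼 → ℂ)
    (h : Fin n → Fin n → 𝔼 → ℂ) : Prop where
  first : ∀ i, HasWeakPartialOn U i u (g i)
  second : ∀ i j, HasWeakPartialOn U j (g i) (h i j)

lemma WeakTwo.mul {U V : Set 𝔼} (hV : IsOpen V) {u ψ : 𝔼 → ℂ} {g : Fin n → 𝔼 → ℂ}
    {h : Fin n → Fin n → 𝔼 → ℂ} (H : WeakTwo U u g h) (hψ : ContDiff ℝ ∞ ψ)
    (hs : V ∩ tsupport ψ ⊆ U) :
    WeakTwo V (fun x => ψ x * u x) (fun i x => pd i ψ x * u x + ψ x * g i x)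
      (fun i j x => (pd j (pd i ψ) x * u x + pd i ψ x * g j x) +
        (pd j ψ x * g i x + ψ x * h i j x)) :=
  ⟨fun i => (H.first i).mul hV hψ hs, fun i j =>
    ((H.first j).mul hV (contDiff_pd hψ i)
      ((Set.inter_subset_inter_right _ (tsupport_pd_subset ψ i)).trans hs)).add
      ((H.second i j).mul hV hψ hs)⟩

lemma pd_one (i : Fin n) (x : 𝔼) : pd i (fun _ => (1 : ℂ)) x = 0 := by simp [pd]

lemma WeakTwo.mono {U V : Set 𝔼} (hV : IsOpen V) {u : 𝔼 → ℂ} {g : Fin n → 𝔼 → ℂ}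
    {h : Fin n → Fin n → 𝔼 → ℂ} (H : WeakTwo U u g h) (hs : V ⊆ U) : WeakTwo V u g h := by
  have key : ∀ {i : Fin n} {a b : 𝔼 → ℂ}, HasWeakPartialOn U i a b → HasWeakPartialOn V i a b := by
    intro i a b hab
    have := hab.mul hV (ψ := fun _ => 1) contDiff_const (Set.inter_subset_left.trans hs)
    simpa [pd_one] using this
  exact ⟨fun i => key (H.first i), fun i j => key (H.second i j)⟩

lemma laplacian_eq_sum_fderiv {φ : 𝔼 → ℝ} (hφ : ContDiff ℝ ∞ φ) (x : 𝔼) :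
    Laplacian.laplacian φ x = ∑ i, fderiv ℝ (fun y => fderiv ℝ φ y (EuclideanSpace.single i 1)) x
      (EuclideanSpace.single i 1) := by
  rw [InnerProductSpace.laplacian_eq_iteratedFDeriv_orthonormalBasis φ
    (EuclideanSpace.basisFun (Fin n) ℝ)]
  refine Finset.sum_congr rfl fun i _ => ?_
  rw [iteratedFDeriv_two_apply]
  have hd : DifferentiableAt ℝ (fderiv ℝ φ) x :=
    ((hφ.fderiv_right (m := ∞) (by simp)).differentiable (by simp)).differentiableAt
  rw [fderiv_clm_apply hd (differentiableAt_const _)]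
  simp

lemma WeakTwo.hasWeakLaplacianOn {U : Set 𝔼} {u : 𝔼 → ℂ} {g : Fin n → 𝔼 → ℂ}
    {h : Fin n → Fin n → 𝔼 → ℂ} (hu : LocallyIntegrableOn u U) (H : WeakTwo U u g h) :
    HasWeakLaplacianOn U u (fun x => ∑ i, h i i x) := by
  have hsum : LocallyIntegrableOn (fun x => ∑ i, h i i x) U := by
    have : ∀ s : Finset (Fin n), LocallyIntegrableOn (fun x => ∑ i ∈ s, h i i x) U := by
      intro s
      classical
      induction s using Finset.induction_on with
      | empty => simpa using locallyIntegrableOn_zero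
      | insert a s ha ih =>
        simp only [Finset.sum_insert ha]
        exact (H.second a a).2.1.add ih
    exact this _
  refine ⟨hu, hsum, fun φ hφ => ?_⟩
  simp only [laplacian_eq_sum_fderiv hφ.1, Finset.sum_smul, Finset.smul_sum]
  rw [integral_finsetSum, integral_finsetSum]
  · refine Finset.sum_congr rfl fun i _ => ?_
    have hi := isTestOn_fderiv hφ i
    rw [(H.first i).2.2 _ hi, (H.second i i).2.2 φ hφ, neg_neg]
  · intro i _
    exact integrableOn_test (H.second i i).2.1 hφ.1.continuous hφ.2.1 hφ.2.2
  · intro i _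
    have hi := isTestOn_fderiv (isTestOn_fderiv hφ i) i
    exact integrableOn_test hu hi.1.continuous hi.2.1 hi.2.2

end Weak

/-! ### The Fourier transform on `L²` and weak derivatives -/

section FourierLemmas

open FourierTransform SchwartzMap LineDeriv

/-- `L²(ℝⁿ)`. -/
abbrev L2 (n : ℕ) := Lp ℂ 2 (volume : Measure (EuclideanSpace ℝ (Fin n)))

lemma continuous_integral_mul {α : Type*} [MeasurableSpace α] {μ : Measure α} {F : α → ℂ}
    (hF : MemLp F 2 μ) : Continuous fun u : Lp ℂ 2 μ => ∫ x, F x * u x ∂μ := by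
  have hF' : MemLp (fun x => (starRingEnd ℂ) (F x)) 2 μ := hF.star
  have : (fun u : Lp ℂ 2 μ => ∫ x, F x * u x ∂μ) = fun u => inner ℂ (hF'.toLp _) u := by
    funext u
    rw [L2.inner_def]
    refine integral_congr_ae ?_
    filter_upwards [hF'.coeFn_toLp] with x hx
    rw [hx]
    simp [mul_comm]
  rw [this]
  fun_prop

lemma memLp_of_continuous_compact {F : 𝔼 → ℂ} (hF : Continuous F) (hc : HasCompactSupport F)
    (μ : Measure 𝔼) [IsLocallyFiniteMeasure μ] : MemLp F 2 μ :=
  hF.memLp_of_hasCompactSupport hc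

lemma locallyIntegrableOn_L2 {μ : Measure 𝔼} (u : 𝔼 → ℂ) (hu : MemLp u 2 μ) {U : Set 𝔼}
    [IsLocallyFiniteMeasure μ] : LocallyIntegrableOn u U μ :=
  (hu.locallyIntegrable (by norm_num)).locallyIntegrableOn _

/-- Parseval's formula. -/
lemma integral_mul_fourierInv (φ : 𝓢(𝔼, ℂ)) (v : L2 n) :
    ∫ x, φ x * (𝓕⁻ v : L2 n) x = ∫ x, (𝓕⁻ φ) x * v x := by
  have h := Lp.fourierInv_toTemperedDistribution_eq v
  have h2 := congrArg (fun T => T φ) h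
  simp only [TemperedDistribution.fourierInv_apply, Lp.toTemperedDistribution_apply,
    smul_eq_mul] at h2
  exact h2.symm

lemma integral_mul_fourier (φ : 𝓢(𝔼, ℂ)) (v : L2 n) :
    ∫ x, φ x * (𝓕 v : L2 n) x = ∫ x, (𝓕 φ) x * v x := by
  have h := Lp.fourier_toTemperedDistribution_eq v
  have h2 := congrArg (fun T => T φ) h
  simp only [TemperedDistribution.fourier_apply, Lp.toTemperedDistribution_apply,
    smul_eq_mul] at h2
  exact h2.symm

/-- The symbol `2πi ξᵢ` of `∂ᵢ`. -/
def dsym (i : Fin n) (ξ : 𝔼) : ℂ := 2 * Real.pi * I * (ξ i : ℂ)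

/-- The symbol `4π²|ξ|²` of `-Δ`. -/
def ssq (ξ : 𝔼) : ℝ := (2 * Real.pi) ^ 2 * ‖ξ‖ ^ 2

lemma ssq_nonneg (ξ : 𝔼) : 0 ≤ ssq ξ := by unfold ssq; positivity

@[fun_prop]
lemma continuous_dsym (i : Fin n) : Continuous (dsym i) := by unfold dsym; fun_prop

@[fun_prop]
lemma continuous_ssq : Continuous (ssq : 𝔼 → ℝ) := by unfold ssq; fun_prop

lemma sum_dsym_sq (ξ : 𝔼) : ∑ i, dsym i ξ * dsym i ξ = -(ssq ξ : ℂ) := by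
  have h : (‖ξ‖ ^ 2 : ℝ) = ∑ i, ξ i ^ 2 := by
    rw [EuclideanSpace.norm_sq_eq]; simp
  rw [ssq, h]
  push_cast
  rw [Finset.mul_sum, ← Finset.sum_neg_distrib]
  refine Finset.sum_congr rfl fun i _ => ?_
  simp only [dsym]
  linear_combination (4 * (Real.pi : ℂ) ^ 2 * (ξ i : ℂ) ^ 2) * I_sq

lemma norm_dsym_le (i : Fin n) (ξ : 𝔼) : ‖dsym i ξ‖ ≤ Real.sqrt (ssq ξ) := by
  rw [ssq, Real.sqrt_mul' _ (sq_nonneg _), Real.sqrt_sq (by positivity),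
    Real.sqrt_sq (norm_nonneg _)]
  simp only [dsym, norm_mul, Complex.norm_ofNat, norm_real, Complex.norm_I, mul_one,
    Real.norm_of_nonneg Real.pi_pos.le]
  gcongr
  exact PiLp.norm_apply_le ξ i

lemma pd_schwartz (φ : 𝓢(𝔼, ℂ)) (i : Fin n) (x : 𝔼) :
    pd i φ x = (∂_{(EuclideanSpace.single i 1 : 𝔼)} φ) x := by
  rw [lineDerivOp_apply_eq_fderiv]; rfl

lemma hasTemperateGrowth_inner (m : 𝔼) : (inner ℝ · m : 𝔼 → ℝ).HasTemperateGrowth :=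
  ((innerSL ℝ).flip m).hasTemperateGrowth

lemma pd_fourier (φ : 𝓢(𝔼, ℂ)) (i : Fin n) :
    (∂_{(EuclideanSpace.single i 1 : 𝔼)} (𝓕 φ)) = 𝓕 (-(2 * Real.pi * I) •
      smulLeftCLM ℂ (inner ℝ · (EuclideanSpace.single i (1:ℝ) : 𝔼)) φ) :=
  lineDerivOp_fourier_eq φ _

lemma fourierInv_pd (φ : 𝓢(𝔼, ℂ)) (i : Fin n) (ξ : 𝔼) :
    (𝓕⁻ (∂_{(EuclideanSpace.single i 1 : 𝔼)} φ)) ξ = -dsym i ξ * (𝓕⁻ φ) ξ := by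
  rw [fourierInv_lineDerivOp_eq]
  simp only [smul_apply, smulLeftCLM_apply_apply (hasTemperateGrowth_inner _), dsym]
  simp [EuclideanSpace.inner_single_right]
  ring

lemma integrable_schwartz_mul (φ : 𝓢(𝔼, ℂ)) {u : 𝔼 → ℂ} (hu : MemLp u 2) :
    Integrable fun x => φ x * u x :=
  (φ.memLp 2).integrable_mul hu

/-- The weak derivative can be tested with Schwartz functions. -/
lemma HasWeakPartialOn.schwartz {i : Fin n} {u g : 𝔼 → ℂ} (h : HasWeakPartialOn Set.univ i u g)
    (hu : MemLp u 2) (hg : MemLp g 2) (φ : 𝓢(𝔼, ℂ)) :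
    ∫ x, pd i φ x * u x = -∫ x, φ x * g x := by
  let f : ContDiffBump (0 : 𝔼) := ⟨1, 2, one_pos, one_lt_two⟩
  let χ : ℕ → 𝔼 → ℂ := fun N x => (f (((N : ℝ) + 1)⁻¹ • x) : ℂ)
  have hfc : ContDiff ℝ ∞ (fun x : 𝔼 => (f x : ℂ)) := Complex.ofRealCLM.contDiff.comp f.contDiff
  have hχc : ∀ N, ContDiff ℝ ∞ (χ N) := fun N => hfc.comp (contDiff_const_smul _)
  have hχs : ∀ N, HasCompactSupport (χ N) := fun N => by
    have h1 : HasCompactSupport (fun x : 𝔼 => (f x : ℂ)) :=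
      f.hasCompactSupport.comp_left (g := fun r : ℝ => (r : ℂ)) (by simp)
    exact h1.comp_homeomorph (Homeomorph.smulOfNeZero (((N : ℝ) + 1)⁻¹) (by positivity))
  have hχ1 : ∀ N x, ‖χ N x‖ ≤ 1 := fun N x => by
    simp only [χ, norm_real, Real.norm_of_nonneg f.nonneg]; exact f.le_one
  have hχlim : ∀ x, Tendsto (fun N => χ N x) atTop (𝓝 1) := fun x => by
    have h1 : Tendsto (fun N : ℕ => ((N : ℝ) + 1)⁻¹ • x) atTop (𝓝 ((0 : ℝ) • x)) :=
      (tendsto_natCast_atTop_atTop.atTop_add tendsto_const_nhds).inv_tendsto_atTop.smul_const x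
    rw [zero_smul] at h1
    have h2 := (hfc.continuous.tendsto 0).comp h1
    have h3 : (f (0 : 𝔼) : ℂ) = 1 := by
      rw [f.one_of_mem_closedBall (by simp [f])]; simp
    rw [h3] at h2
    exact h2
  obtain ⟨C, hC⟩ : ∃ C, ∀ x, ‖pd i (fun x : 𝔼 => (f x : ℂ)) x‖ ≤ C := by
    have h1 : HasCompactSupport (fun x : 𝔼 => (f x : ℂ)) :=
      f.hasCompactSupport.comp_left (g := fun r : ℝ => (r : ℂ)) (by simp)
    exact (contDiff_pd hfc i).continuous.bounded_above_of_compact_support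
      (h1.of_isClosed_subset (isClosed_tsupport _) (tsupport_pd_subset _ i))
  have hpd : ∀ N x, pd i (χ N) x =
      (((N : ℝ) + 1)⁻¹ : ℝ) * pd i (fun x : 𝔼 => (f x : ℂ)) (((N : ℝ) + 1)⁻¹ • x) := by
    intro N x
    have h1 := (hfc.differentiable (by simp)).differentiableAt
      (x := ((N : ℝ) + 1)⁻¹ • x)
    have h2 := (h1.hasFDerivAt.comp x ((hasFDerivAt_id x).const_smul ((N : ℝ) + 1)⁻¹)).fderiv
    have h3 : ((fun x : 𝔼 => (f x : ℂ)) ∘ (((N : ℝ) + 1)⁻¹ • id)) = χ N := rfl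
    simp only [pd]
    rw [← h3]
    erw [h2]
    simp
  have hC0 : 0 ≤ C := (norm_nonneg _).trans (hC 0)
  have eq : ∀ N, (∫ x, χ N x * (pd i φ x * u x)) + ∫ x, pd i (χ N) x * (φ x * u x) =
      -∫ x, χ N x * (φ x * g x) := by
    intro N
    have hφc : ContDiff ℝ ∞ (φ : 𝔼 → ℂ) := φ.smooth'
    have hT : IsComplexTest Set.univ (fun x => χ N x * φ x) :=
      ⟨(hχc N).mul hφc, (hχs N).mul_right, Set.subset_univ _⟩
    have key := h.ctest hT
    simp only [Measure.restrict_univ, pd_mul (hχc N) hφc] at key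
    have hpφ : Integrable (fun x => pd i φ x * u x) := by
      simp only [pd_schwartz]; exact integrable_schwartz_mul _ hu
    rw [← integral_add]
    · simp only [mul_assoc] at key
      rw [← key]
      refine integral_congr_ae (ae_of_all _ fun x => ?_)
      ring
    · exact hpφ.bdd_mul (hχc N).continuous.aestronglyMeasurable (ae_of_all _ (hχ1 N))
    · refine (integrable_schwartz_mul φ hu).bdd_mul (c := C)
        (contDiff_pd (hχc N) i).continuous.aestronglyMeasurable (ae_of_all _ fun x => ?_)
      rw [hpd, norm_mul, norm_real, Real.norm_of_nonneg (by positivity)]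
      have : ((N : ℝ) + 1)⁻¹ ≤ 1 := inv_le_one_of_one_le₀ (by simp)
      nlinarith [hC (((N : ℝ) + 1)⁻¹ • x), norm_nonneg (pd i (fun x : 𝔼 => (f x : ℂ)) (((N : ℝ) + 1)⁻¹ • x))]
  have lim1 : ∀ F : 𝔼 → ℂ, Integrable F →
      Tendsto (fun N => ∫ x, χ N x * F x) atTop (𝓝 (∫ x, F x)) := by
    intro F hF
    refine tendsto_integral_of_dominated_convergence (fun x => ‖F x‖) (fun N =>
      (hχc N).continuous.aestronglyMeasurable.mul hF.aestronglyMeasurable) hF.norm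
      (fun N => ae_of_all _ fun x => ?_) (ae_of_all _ fun x => ?_)
    · rw [norm_mul]; exact mul_le_of_le_one_left (norm_nonneg _) (hχ1 N x)
    · simpa using (hχlim x).mul_const (F x)
  have lim2 : Tendsto (fun N => ∫ x, pd i (χ N) x * (φ x * u x)) atTop (𝓝 0) := by
    have hF := integrable_schwartz_mul φ hu
    have : Tendsto (fun N : ℕ => ((N : ℝ) + 1)⁻¹ * (C * ∫ x, ‖φ x * u x‖)) atTop
        (𝓝 (0 * (C * ∫ x, ‖φ x * u x‖))) :=
      ((tendsto_natCast_atTop_atTop.atTop_add tendsto_const_nhds).inv_tendsto_atTop).mul_const _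
    rw [zero_mul] at this
    refine squeeze_zero_norm (fun N => ?_) this
    rw [← integral_const_mul, ← integral_const_mul]
    refine norm_integral_le_of_norm_le ((hF.norm.const_mul _).const_mul _) (ae_of_all _ fun x => ?_)
    rw [norm_mul, hpd, norm_mul, norm_real, Real.norm_of_nonneg (by positivity), mul_assoc]
    gcongr
    exact hC _
  have hpφ : Integrable (fun x => pd i φ x * u x) := by
    simp only [pd_schwartz]; exact integrable_schwartz_mul _ hu
  have l1 := (lim1 _ hpφ).add lim2
  have l2 := (lim1 _ (integrable_schwartz_mul φ hg)).neg
  rw [add_zero] at l1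
  simp only [eq] at l1
  exact tendsto_nhds_unique l1 l2

lemma ae_eq_of_integral_ctest {f g : 𝔼 → ℂ} (hf : LocallyIntegrable f) (hg : LocallyIntegrable g)
    (h : ∀ φ : 𝓢(𝔼, ℂ), HasCompactSupport φ → ∫ x, φ x * f x = ∫ x, φ x * g x) : f =ᵐ[volume] g := by
  refine ae_eq_of_integral_contDiff_smul_eq hf hg fun φ h1 h2 => ?_
  have h3 : HasCompactSupport (fun x => (φ x : ℂ)) :=
    h2.comp_left (g := fun r : ℝ => (r : ℂ)) (by simp)
  simp only [real_smul]
  exact h (h3.toSchwartzMap (Complex.ofRealCLM.contDiff.comp h1)) h3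

/-- The Fourier transform turns weak derivatives into multiplication by the symbol. -/
lemma fourier_weakPartial {i : Fin n} {u g : L2 n}
    (h : HasWeakPartialOn Set.univ i u g) :
    ∀ᵐ ξ, (𝓕 g : L2 n) ξ = dsym i ξ * (𝓕 u : L2 n) ξ := by
  refine ae_eq_of_integral_ctest ((Lp.memLp _).locallyIntegrable (by norm_num)) ?_ fun φ hφ => ?_
  · rw [← locallyIntegrableOn_univ]
    exact locallyIntegrableOn_mul_cutoff isOpen_univ
      (locallyIntegrableOn_L2 _ (Lp.memLp _) (U := Set.univ)) (continuous_dsym i) (Set.subset_univ _)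
  · have k : ∫ x, (𝓕 φ) x * g x = -∫ x, pd i (𝓕 φ : 𝓢(𝔼, ℂ)) x * u x := by
      rw [h.schwartz (Lp.memLp u) (Lp.memLp g) (𝓕 φ), neg_neg]
    rw [integral_mul_fourier, k]
    simp only [pd_schwartz, pd_fourier]
    rw [← integral_mul_fourier, ← integral_neg]
    refine integral_congr_ae (ae_of_all _ fun x => ?_)
    simp only [smul_apply, smulLeftCLM_apply_apply (hasTemperateGrowth_inner _), dsym]
    simp [EuclideanSpace.inner_single_right]
    ring

lemma weakPartial_fourierInv {i : Fin n} {v w : L2 n} (h : ∀ᵐ ξ, w ξ = dsym i ξ * v ξ) :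
    HasWeakPartialOn Set.univ i (𝓕⁻ v : L2 n) (𝓕⁻ w : L2 n) := by
  refine ⟨locallyIntegrableOn_L2 _ (Lp.memLp _), locallyIntegrableOn_L2 _ (Lp.memLp _),
    fun φ hφ => ?_⟩
  have hφc := hφ.complex
  let φs : 𝓢(𝔼, ℂ) := hφc.2.1.toSchwartzMap hφc.1
  have e1 : ∀ x, fderiv ℝ φ x (EuclideanSpace.single i 1) • (𝓕⁻ v : L2 n) x =
      (∂_{(EuclideanSpace.single i 1 : 𝔼)} φs) x * (𝓕⁻ v : L2 n) x := by
    intro x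
    rw [← pd_schwartz]
    have : pd i (φs : 𝔼 → ℂ) x = _ := pd_ofReal hφ.1 i x
    rw [this, real_smul]
  have e2 : ∀ x, φ x • (𝓕⁻ w : L2 n) x = φs x * (𝓕⁻ w : L2 n) x := fun x => real_smul
  simp only [Measure.restrict_univ, e1, e2]
  rw [integral_mul_fourierInv, integral_mul_fourierInv, ← integral_neg]
  refine integral_congr_ae ?_
  filter_upwards [h] with x hx
  rw [fourierInv_pd, hx]
  ring

/-- On `L¹ ∩ L²` the inverse Fourier transform is given by the integral. -/
lemma fourierInv_eq_integral {v : 𝔼 → ℂ} (h1 : Integrable v) (h2 : MemLp v 2) :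
    ∀ᵐ x, (𝓕⁻ (h2.toLp v) : L2 n) x = 𝓕⁻ v x := by
  have hcont : Continuous (𝓕⁻ v) := by
    have h := VectorFourier.fourierIntegral_continuous Real.continuous_fourierChar
      (L := -innerₗ 𝔼) ((continuous_inner (𝕜 := ℝ) (E := 𝔼)).neg) h1
    exact h
  refine ae_eq_of_integral_ctest ((Lp.memLp _).locallyIntegrable (by norm_num))
    hcont.locallyIntegrable fun φ hφ => ?_
  rw [integral_mul_fourierInv]
  have h3 := VectorFourier.integral_fourierIntegral_smul_eq_flip (μ := volume) (ν := volume)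
    (L := -innerₗ 𝔼) (f := (φ : 𝔼 → ℂ)) (g := v) Real.continuous_fourierChar
    ((continuous_inner (𝕜 := ℝ) (E := 𝔼)).neg) φ.integrable h1
  have h4 : (-innerₗ 𝔼).flip = -innerₗ 𝔼 := by
    ext x y; simp [real_inner_comm]
  rw [h4] at h3
  have e1 : ∀ w, (𝓕⁻ φ) w = VectorFourier.fourierIntegral Real.fourierChar volume (-innerₗ 𝔼) φ w := by
    intro w; rw [fourierInv_coe]; rfl
  refine Eq.trans (integral_congr_ae ?_) h3
  filter_upwards [h2.coeFn_toLp] with x hx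
  rw [hx, e1]; rfl

end FourierLemmas

/-! ### Weighted jets and Fourier multipliers -/

section Jets

open FourierTransform

/-- The weight `e^{c|x|²}`. -/
def wt (c : ℝ) (x : 𝔼) : ℂ := (Real.exp (c * ‖x‖ ^ 2) : ℝ)

lemma contDiff_wt (c : ℝ) : ContDiff ℝ ∞ (wt c : 𝔼 → ℂ) := by
  refine Complex.ofRealCLM.contDiff.comp ?_
  exact Real.contDiff_exp.comp (contDiff_const.mul (contDiff_norm_sq ℝ))

@[fun_prop]
lemma continuous_wt (c : ℝ) : Continuous (wt c : 𝔼 → ℂ) := (contDiff_wt c).continuous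

lemma wt_zero (x : 𝔼) : wt 0 x = 1 := by simp [wt]

lemma wt_ne_zero (c : ℝ) (x : 𝔼) : wt c x ≠ 0 := by
  simp [wt]

lemma norm_wt (c : ℝ) (x : 𝔼) : ‖wt c x‖ = Real.exp (c * ‖x‖ ^ 2) := by
  rw [wt, norm_real, Real.norm_of_nonneg (Real.exp_pos _).le]

lemma wt_neg_mul (c : ℝ) (x : 𝔼) : wt c x * wt (-c) x = 1 := by
  rw [wt, wt, ← ofReal_mul, ← Real.exp_add]
  simp

variable (n) in
/-- Pairs `(u, g)` in `L²` such that `e^{c|x|²} g` is the weak derivative `∂ᵢ (e^{c|x|²} u)`. -/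
def weakPair (c : ℝ) (i : Fin n) : Submodule ℂ (L2 n × L2 n) where
  carrier := {p | HasWeakPartialOn Set.univ i (fun x => wt c x * p.1 x) fun x => wt c x * p.2 x}
  add_mem' := by
    intro p q hp hq
    refine (hp.add hq).congr isOpen_univ ?_ ?_
    · rw [Measure.restrict_univ]
      filter_upwards [Lp.coeFn_add p.1 q.1] with x hx
      change wt c x * p.1 x + wt c x * q.1 x = wt c x * (p.1 + q.1 : L2 n) x
      rw [hx, Pi.add_apply, mul_add]
    · rw [Measure.restrict_univ]
      filter_upwards [Lp.coeFn_add p.2 q.2] with x hx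
      change wt c x * p.2 x + wt c x * q.2 x = wt c x * (p.2 + q.2 : L2 n) x
      rw [hx, Pi.add_apply, mul_add]
  zero_mem' := by
    have h0 : HasWeakPartialOn (Set.univ : Set 𝔼) i (fun _ => 0) (fun _ => 0) :=
      ⟨locallyIntegrableOn_zero, locallyIntegrableOn_zero, fun φ _ => by simp⟩
    refine h0.congr isOpen_univ ?_ ?_
    · rw [Measure.restrict_univ]
      filter_upwards [Lp.coeFn_zero ℂ 2 (volume : Measure 𝔼)] with x hx
      change 0 = wt c x * (0 : L2 n) x
      rw [hx, Pi.zero_apply, mul_zero]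
    · rw [Measure.restrict_univ]
      filter_upwards [Lp.coeFn_zero ℂ 2 (volume : Measure 𝔼)] with x hx
      change 0 = wt c x * (0 : L2 n) x
      rw [hx, Pi.zero_apply, mul_zero]
  smul_mem' := by
    intro a p hp
    refine (hp.smul a).congr isOpen_univ ?_ ?_
    · rw [Measure.restrict_univ]
      filter_upwards [Lp.coeFn_smul a p.1] with x hx
      change a * (wt c x * p.1 x) = wt c x * (a • p.1 : L2 n) x
      rw [hx, Pi.smul_apply, smul_eq_mul, mul_left_comm]
    · rw [Measure.restrict_univ]
      filter_upwards [Lp.coeFn_smul a p.2] with x hx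
      change a * (wt c x * p.2 x) = wt c x * (a • p.2 : L2 n) x
      rw [hx, Pi.smul_apply, smul_eq_mul, mul_left_comm]

lemma locallyIntegrableOn_wt_mul (c : ℝ) (u : L2 n) (U : Set 𝔼) :
    LocallyIntegrableOn (fun x => wt c x * u x) U :=
  (locallyIntegrableOn_mul_cutoff isOpen_univ (locallyIntegrableOn_L2 u (Lp.memLp u)
    (U := Set.univ)) (continuous_wt c) (Set.subset_univ _)).mono_set (Set.subset_univ _)

lemma isClosed_weakPair (c : ℝ) (i : Fin n) :
    IsClosed (weakPair n c i : Set (L2 n × L2 n)) := by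
  have : (weakPair n c i : Set (L2 n × L2 n)) = ⋂ (φ : 𝔼 → ℝ) (_ : IsTestOn Set.univ φ),
      {p | ∫ x, ((fderiv ℝ φ x (EuclideanSpace.single i 1) : ℝ) * wt c x) * p.1 x =
        -∫ x, ((φ x : ℂ) * wt c x) * p.2 x} := by
    ext p
    simp only [Set.mem_iInter, Set.mem_ofPred_eq, mul_assoc]
    constructor
    · intro h φ hφ
      simpa using h.2.2 φ hφ
    · intro h
      refine ⟨locallyIntegrableOn_wt_mul c _ _, locallyIntegrableOn_wt_mul c _ _, fun φ hφ => ?_⟩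
      simpa using h φ hφ
  rw [this]
  refine isClosed_iInter fun φ => isClosed_iInter fun hφ => ?_
  have hφ' := isTestOn_fderiv hφ i
  have key : ∀ ψ : 𝔼 → ℝ, IsTestOn Set.univ ψ → Continuous fun u : L2 n =>
      ∫ x, ((ψ x : ℂ) * wt c x) * u x := by
    intro ψ hψ
    refine continuous_integral_mul (memLp_of_continuous_compact
      (hψ.complex.1.continuous.mul (continuous_wt c)) (hψ.complex.2.1.mul_right) _)
  exact isClosed_eq ((key _ hφ').comp continuous_fst) ((key _ hφ).comp continuous_snd).neg

/-- Triples consisting of a function, its first and its second derivatives, all in `L²`. -/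
abbrev Jet (n : ℕ) := L2 n × (Fin n → L2 n) × (Fin n → Fin n → L2 n)

/-- The jets `(v, (vᵢ), (vᵢⱼ))` such that `e^{c|x|²} vᵢ` and `e^{c|x|²} vᵢⱼ` are the weak derivatives
of `e^{c|x|²} v`. For `c = 0` this is `H²(ℝⁿ)`, for `c = 1` it is a weighted version of `H²`, the
weights having been absorbed into the entries. -/
def jetSpace (n : ℕ) (c : ℝ) : Submodule ℂ (Jet n) where
  carrier := {v | (∀ i, (v.1, v.2.1 i) ∈ weakPair n c i) ∧
    ∀ i j, (v.2.1 i, v.2.2 i j) ∈ weakPair n c j}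
  add_mem' := by
    intro a b ha hb
    simp only [Set.mem_ofPred_eq, Prod.fst_add, Prod.snd_add, Pi.add_apply, ← Prod.mk_add_mk]
    exact ⟨fun i => (weakPair n c i).add_mem (ha.1 i) (hb.1 i),
      fun i j => (weakPair n c j).add_mem (ha.2 i j) (hb.2 i j)⟩
  zero_mem' := ⟨fun i => (weakPair n c i).zero_mem, fun _ j => (weakPair n c j).zero_mem⟩
  smul_mem' := by
    intro a v h
    simp only [Set.mem_ofPred_eq, Prod.smul_fst, Prod.smul_snd, Pi.smul_apply, ← Prod.smul_mk]
    exact ⟨fun i => (weakPair n c i).smul_mem a (h.1 i),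
      fun i j => (weakPair n c j).smul_mem a (h.2 i j)⟩

lemma weakTwo_of_mem_jetSpace {c : ℝ} {v : Jet n} (hv : v ∈ jetSpace n c) :
    WeakTwo Set.univ (fun x => wt c x * v.1 x) (fun i x => wt c x * v.2.1 i x)
      (fun i j x => wt c x * v.2.2 i j x) :=
  ⟨fun i => hv.1 i, fun i j => hv.2 i j⟩

lemma isClosed_jetSpace (c : ℝ) : IsClosed (jetSpace n c : Set (Jet n)) := by
  have : (jetSpace n c : Set (Jet n)) =
      (⋂ i, {v | (v.1, v.2.1 i) ∈ weakPair n c i}) ∩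
        ⋂ i, ⋂ j, {v | (v.2.1 i, v.2.2 i j) ∈ weakPair n c j} := by
    ext v
    simp only [Set.mem_inter_iff, Set.mem_iInter]
    exact Iff.rfl
  rw [this]
  refine (isClosed_iInter fun i => ?_).inter (isClosed_iInter fun i => isClosed_iInter fun j => ?_)
  · exact (isClosed_weakPair c i).preimage (f := fun v : Jet n => (v.1, v.2.1 i)) (by fun_prop)
  · exact (isClosed_weakPair c j).preimage (f := fun v : Jet n => (v.2.1 i, v.2.2 i j))
      (by fun_prop)

lemma jetSpace_ext {c : ℝ} {u v : Jet n} (hu : u ∈ jetSpace n c) (hv : v ∈ jetSpace n c)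
    (h : u.1 = v.1) : u = v := by
  have key : ∀ {i : Fin n} {a b b' : L2 n}, (a, b) ∈ weakPair n c i → (a, b') ∈ weakPair n c i →
      b = b' := by
    intro i a b b' h1 h2
    refine Lp.ext ?_
    have := HasWeakPartialOn.unique isOpen_univ h1 h2
    rw [Measure.restrict_univ] at this
    filter_upwards [this] with x hx
    exact mul_left_cancel₀ (wt_ne_zero c x) hx
  have h1 : u.2.1 = v.2.1 := funext fun i => key (hu.1 i) (h ▸ hv.1 i)
  refine Prod.ext h (Prod.ext h1 (funext fun i => funext fun j => ?_))
  exact key (hu.2 i j) ((congrFun h1 i) ▸ hv.2 i j)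

variable (n) in
/-- The Banach space of the jets in `jetSpace n c`. -/
def JetSpace (c : ℝ) : Type := jetSpace n c

instance (c : ℝ) : NormedAddCommGroup (JetSpace n c) :=
  inferInstanceAs (NormedAddCommGroup (jetSpace n c))

instance (c : ℝ) : NormedSpace ℂ (JetSpace n c) :=
  inferInstanceAs (NormedSpace ℂ (jetSpace n c))

instance (c : ℝ) : CompleteSpace (JetSpace n c) := (isClosed_jetSpace c).completeSpace_coe

variable {c : ℝ}

/-- The jet of an element. -/
def JetSpace.val : JetSpace n c →L[ℂ] Jet n := (jetSpace n c).subtypeL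

lemma JetSpace.val_mem (u : JetSpace n c) : u.val ∈ jetSpace n c := Subtype.mem u

lemma JetSpace.norm_val (u : JetSpace n c) : ‖u.val‖ = ‖u‖ := rfl

lemma JetSpace.ext {u v : JetSpace n c} (h : u.val.1 = v.val.1) : u = v :=
  Subtype.ext (jetSpace_ext u.val_mem v.val_mem h)

/-- An operator whose values are jets. -/
def JetSpace.lift {F : Type*} [NormedAddCommGroup F] [NormedSpace ℂ F] (T : F →L[ℂ] Jet n)
    (h : ∀ v, T v ∈ jetSpace n c) : F →L[ℂ] JetSpace n c := T.codRestrict (jetSpace n c) h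

/-- The Laplacian of a jet. -/
def jetLap (v : Jet n) : L2 n := ∑ i, v.2.2 i i

/-- The Fourier multiplier with symbol `m`. -/
def fourierMul (m : 𝔼 → ℂ) : L2 n →L[ℂ] L2 n :=
  (Lp.fourierTransformₗᵢ 𝔼 ℂ).symm.toContinuousLinearEquiv.toContinuousLinearMap ∘L
    mulOp m volume volume ∘L
      (Lp.fourierTransformₗᵢ 𝔼 ℂ).toContinuousLinearEquiv.toContinuousLinearMap

lemma fourierMul_apply (m : 𝔼 → ℂ) (v : L2 n) :
    fourierMul m v = 𝓕⁻ (mulOp m volume volume (𝓕 v)) := rfl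

lemma fourier_fourierMul (m : 𝔼 → ℂ) (v : L2 n) :
    𝓕 (fourierMul m v) = mulOp m volume volume (𝓕 v) := by
  rw [fourierMul_apply, fourier_fourierInv_eq]

lemma norm_fourierMul_le {m : 𝔼 → ℂ} {C : ℝ} (hm : Measurable m) (h : ∀ x, ‖m x‖ ≤ C) :
    ‖fourierMul m‖ ≤ C := by
  have hC : 0 ≤ C := (norm_nonneg _).trans (h 0)
  refine opNorm_le_bound _ hC fun v => ?_
  rw [← Lp.norm_fourier_eq, fourier_fourierMul, ← Lp.norm_fourier_eq v]
  exact le_of_opNorm_le _ (norm_mulOp_le (mulBound_volume hm h)) _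

lemma mulOp_lin {α : Type*} [MeasurableSpace α] {μ ν : Measure α} {m₁ m₂ m₃ : α → ℂ}
    {C₁ C₂ C₃ : ℝ} (h1 : MulBound m₁ μ ν C₁)
    (h2 : MulBound m₂ μ ν C₂) (h3 : MulBound m₃ μ ν C₃) (a : ℂ) (h : ∀ x, m₃ x = m₁ x + a * m₂ x) :
    mulOp m₃ μ ν = mulOp m₁ μ ν + a • mulOp m₂ μ ν := by
  ext1 f
  refine Lp.ext ?_
  rw [add_apply, smul_apply]
  filter_upwards [coeFn_mulOp h1 f, coeFn_mulOp h2 f, coeFn_mulOp h3 f,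
    Lp.coeFn_add (mulOp m₁ μ ν f) (a • mulOp m₂ μ ν f), Lp.coeFn_smul a (mulOp m₂ μ ν f)]
    with x e1 e2 e3 e4 e5
  rw [e3, e4, Pi.add_apply, e1, e5, Pi.smul_apply, e2, h, smul_eq_mul]
  ring

lemma fourierMul_lin {m₁ m₂ m₃ : 𝔼 → ℂ} {C₁ C₂ : ℝ} (hm₁ : Measurable m₁)
    (h1 : ∀ x, ‖m₁ x‖ ≤ C₁) (hm₂ : Measurable m₂) (h2 : ∀ x, ‖m₂ x‖ ≤ C₂) (a : ℂ)
    (h : ∀ x, m₃ x = m₁ x + a * m₂ x) :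
    fourierMul m₃ = fourierMul m₁ + a • fourierMul m₂ := by
  have hm₃ : Measurable m₃ := by
    rw [show m₃ = fun x => m₁ x + a * m₂ x from funext h]; fun_prop
  have h3 : ∀ x, ‖m₃ x‖ ≤ C₁ + ‖a‖ * C₂ := fun x => by
    rw [h]
    refine (norm_add_le _ _).trans ?_
    rw [norm_mul]
    have := h1 x
    have := h2 x
    gcongr
  simp only [fourierMul, mulOp_lin (mulBound_volume hm₁ h1) (mulBound_volume hm₂ h2)
    (mulBound_volume hm₃ h3) a h, add_comp, smul_comp,
    comp_add, comp_smul]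

/-- Symbols of order `-2`, with a bound. The multiplier maps `L²(ℝⁿ)` to `H²(ℝⁿ)`. -/
def JetSymbol (m : 𝔼 → ℂ) (M : ℝ) : Prop :=
  Measurable m ∧ ∀ ξ, (1 + ssq ξ) * ‖m ξ‖ ≤ M

lemma JetSymbol.bounds {m : 𝔼 → ℂ} {M : ℝ} (h : JetSymbol m M) :
    (∀ ξ, ‖m ξ‖ ≤ M) ∧ (∀ i ξ, ‖dsym i ξ * m ξ‖ ≤ M) ∧
      ∀ i j ξ, ‖dsym j ξ * (dsym i ξ * m ξ)‖ ≤ M := by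
  have key : ∀ (ξ : 𝔼) (t : ℝ), t ≤ 1 + ssq ξ → t * ‖m ξ‖ ≤ M := fun ξ t ht =>
    (mul_le_mul_of_nonneg_right ht (norm_nonneg _)).trans (h.2 ξ)
  have hs : ∀ ξ : 𝔼, Real.sqrt (ssq ξ) ≤ 1 + ssq ξ := fun ξ => by
    nlinarith [Real.sq_sqrt (ssq_nonneg ξ), Real.sqrt_nonneg (ssq ξ),
      sq_nonneg (Real.sqrt (ssq ξ) - 1)]
  refine ⟨fun ξ => ?_, fun i ξ => ?_, fun i j ξ => ?_⟩
  · simpa using key ξ 1 (by linarith [ssq_nonneg ξ])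
  · rw [norm_mul]
    exact key ξ _ ((norm_dsym_le i ξ).trans (hs ξ))
  · rw [norm_mul, norm_mul, ← mul_assoc]
    refine key ξ _ ?_
    have := mul_le_mul (norm_dsym_le j ξ) (norm_dsym_le i ξ) (norm_nonneg _) (Real.sqrt_nonneg _)
    rw [Real.mul_self_sqrt (ssq_nonneg ξ)] at this
    linarith

lemma fourierMul_weakPair {i : Fin n} {m : 𝔼 → ℂ} {C C' : ℝ} (hm : Measurable m)
    (h : ∀ x, ‖m x‖ ≤ C) (h' : ∀ x, ‖dsym i x * m x‖ ≤ C') (v : L2 n) :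
    (fourierMul m v, fourierMul (fun x => dsym i x * m x) v) ∈ weakPair n 0 i := by
  have := weakPartial_fourierInv (i := i) (v := mulOp m volume volume (𝓕 v))
    (w := mulOp (fun x => dsym i x * m x) volume volume (𝓕 v)) (by
      filter_upwards [coeFn_mulOp (mulBound_volume hm h) (𝓕 v),
        coeFn_mulOp (mulBound_volume (by fun_prop) h') (𝓕 v)] with x e1 e2
      rw [e1, e2, mul_assoc])
  refine this.congr isOpen_univ (ae_of_all _ fun x => ?_) (ae_of_all _ fun x => ?_) <;>
  simp [wt_zero, fourierMul_apply]

open Classical in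
/-- The operator `L²(ℝⁿ) → H²(ℝⁿ)` given by a symbol of order `-2`. -/
def jetMul (m : 𝔼 → ℂ) : L2 n →L[ℂ] JetSpace n 0 :=
  if h : ∃ M, JetSymbol m M then
    JetSpace.lift ((fourierMul m).prod ((pi fun i => fourierMul fun ξ => dsym i ξ * m ξ).prod
      (pi fun i => pi fun j =>
        fourierMul fun ξ => dsym j ξ * (dsym i ξ * m ξ)))) fun v =>
      ⟨fun i => fourierMul_weakPair h.choose_spec.1 h.choose_spec.bounds.1
          (h.choose_spec.bounds.2.1 i) v,
        fun i j => fourierMul_weakPair ((continuous_dsym i).measurable.mul h.choose_spec.1)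
          (h.choose_spec.bounds.2.1 i) (h.choose_spec.bounds.2.2 i j) v⟩
  else 0

lemma coe_jetMul {m : 𝔼 → ℂ} {M : ℝ} (h : JetSymbol m M) (v : L2 n) :
    (jetMul m v).val = (fourierMul m v, fun i => fourierMul (fun ξ => dsym i ξ * m ξ) v,
      fun i j => fourierMul (fun ξ => dsym j ξ * (dsym i ξ * m ξ)) v) := by
  have h' : ∃ M, JetSymbol m M := ⟨M, h⟩
  rw [jetMul, dif_pos h']
  rfl

attribute [irreducible] jetMul

lemma norm_jetMul_le {m : 𝔼 → ℂ} {M : ℝ} (h : JetSymbol m M) : ‖jetMul m‖ ≤ M := by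
  have hM : 0 ≤ M := (norm_nonneg _).trans (h.bounds.1 0)
  refine opNorm_le_bound _ hM fun v => ?_
  have hm := h.1
  rw [← JetSpace.norm_val, coe_jetMul h, Prod.norm_def, Prod.norm_def]
  have e1 := le_of_opNorm_le _ (norm_fourierMul_le hm h.bounds.1) v
  have e2 := fun i => le_of_opNorm_le _
    (norm_fourierMul_le (m := fun ξ => dsym i ξ * m ξ) (by fun_prop) (h.bounds.2.1 i)) v
  have e3 := fun i j => le_of_opNorm_le _
    (norm_fourierMul_le (m := fun ξ => dsym j ξ * (dsym i ξ * m ξ)) (by fun_prop)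
      (h.bounds.2.2 i j)) v
  have hMv : 0 ≤ M * ‖v‖ := by positivity
  refine max_le e1 (max_le ((pi_norm_le_iff_of_nonneg hMv).2 e2)
    ((pi_norm_le_iff_of_nonneg hMv).2 fun i => (pi_norm_le_iff_of_nonneg hMv).2 (e3 i)))

lemma jetMul_lin {m₁ m₂ m₃ : 𝔼 → ℂ} {M₁ M₂ M₃ : ℝ} (h1 : JetSymbol m₁ M₁) (h2 : JetSymbol m₂ M₂)
    (h3 : JetSymbol m₃ M₃) (a : ℂ) (h : ∀ x, m₃ x = m₁ x + a * m₂ x) :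
    jetMul m₃ = jetMul m₁ + a • jetMul m₂ := by
  have k1 := h1.1
  have k2 := h2.1
  ext1 v
  refine JetSpace.ext ?_
  rw [add_apply, smul_apply, map_add, map_smul, coe_jetMul h1, coe_jetMul h2, coe_jetMul h3]
  simp only [Prod.fst_add, Prod.smul_fst]
  rw [fourierMul_lin k1 h1.bounds.1 k2 h2.bounds.1 a h]; rfl

lemma hasDerivAt_of_quadratic {Y : Type*} [NormedAddCommGroup Y] [NormedSpace ℂ Y] {F : ℂ → Y}
    {F' : Y} {z₀ : ℂ} {r C : ℝ} (hr : 0 < r)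
    (h : ∀ z ∈ Metric.ball z₀ r, ∃ q, F z = F z₀ + (z - z₀) • F' + (1 : ℂ) • q ∧
      ‖q‖ ≤ C * ‖z - z₀‖ ^ 2) :
    HasDerivAt F F' z₀ := by
  rw [hasDerivAt_iff_isLittleO]
  refine Asymptotics.IsBigO.trans_isLittleO (g := fun z => ‖z - z₀‖ ^ 2) ?_ ?_
  · refine Asymptotics.IsBigO.of_bound C ?_
    filter_upwards [Metric.ball_mem_nhds z₀ hr] with z hz
    obtain ⟨q, h1, h2⟩ := h z hz
    rw [h1, one_smul, sub_sub, add_sub_cancel_left]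
    simpa using h2
  · simpa [norm_pow] using (Asymptotics.isLittleO_pow_sub_sub z₀ (m := 2) one_lt_two).norm_left

lemma measurable_deriv_of_measurable {α : Type*} [MeasurableSpace α] {m : ℂ → α → ℂ} {z₀ : ℂ}
    {r : ℝ} (hr : 0 < r) (hm : ∀ z ∈ Metric.ball z₀ r, Measurable (m z))
    (hd : ∀ ξ, DifferentiableOn ℂ (fun z => m z ξ) (Metric.ball z₀ r)) :
    Measurable fun ξ => deriv (fun z => m z ξ) z₀ := by
  have h0 : z₀ ∈ Metric.ball z₀ r := Metric.mem_ball_self hr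
  let zk : ℕ → ℂ := fun k => z₀ + ((r / (k + 2) : ℝ) : ℂ)
  have hzk : ∀ k, zk k ∈ Metric.ball z₀ r := fun k => by
    rw [Metric.mem_ball, dist_eq_norm]
    simp only [zk, add_sub_cancel_left, norm_real]
    rw [Real.norm_of_nonneg (by positivity), div_lt_iff₀ (by positivity)]
    nlinarith [(Nat.cast_nonneg k : (0:ℝ) ≤ k)]
  have hne : ∀ k, zk k - z₀ ≠ 0 := fun k => by
    simp only [zk, add_sub_cancel_left]
    exact Complex.ofReal_ne_zero.2 (by positivity)
  have hlim : Tendsto zk atTop (𝓝 z₀) := by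
    have h1 : Tendsto (fun k : ℕ => r / ((k : ℝ) + 2)) atTop (𝓝 0) :=
      tendsto_const_nhds.div_atTop (tendsto_natCast_atTop_atTop.atTop_add tendsto_const_nhds)
    have h2 := (Complex.continuous_ofReal.tendsto 0).comp h1
    simpa [zk] using tendsto_const_nhds.add h2
  refine measurable_of_tendsto_metrizable
    (f := fun k ξ => (zk k - z₀)⁻¹ * (m (zk k) ξ - m z₀ ξ)) (fun k => ?_) ?_
  · have := hm _ (hzk k)
    have := hm _ h0
    fun_prop
  · rw [tendsto_pi_nhds]
    intro ξ
    have hda := (hd ξ).differentiableAt (Metric.ball_mem_nhds _ hr)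
    have h1 := hda.hasDerivAt.tendsto_slope
    have h2 : Tendsto zk atTop (𝓝[≠] z₀) :=
      tendsto_nhdsWithin_iff.2 ⟨hlim, Eventually.of_forall fun k => sub_ne_zero.1 (hne k)⟩
    have h3 := h1.comp h2
    refine h3.congr fun k => ?_
    simp [slope_def_field, div_eq_inv_mul]

/-- A family of multipliers whose symbols are pointwise holomorphic and locally uniformly bounded is
holomorphic in operator norm: by the Schwarz lemma the Taylor remainder of the symbol is
controlled by its supremum. -/
lemma differentiableAt_jetMul {m : ℂ → 𝔼 → ℂ} {z₀ : ℂ} {r M : ℝ} (hr : 0 < r)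
    (hm : ∀ z ∈ Metric.ball z₀ r, JetSymbol (m z) M)
    (hd : ∀ ξ, DifferentiableOn ℂ (fun z => m z ξ) (Metric.ball z₀ r)) :
    DifferentiableAt ℂ (fun z => jetMul (m z)) z₀ := by
  have h0 : z₀ ∈ Metric.ball z₀ r := Metric.mem_ball_self hr
  have hM : 0 ≤ M := (norm_nonneg _).trans ((hm z₀ h0).bounds.1 0)
  set N := M + 1
  have hN : 0 < N := by positivity
  have hb : ∀ ξ : 𝔼, ∀ z ∈ Metric.ball z₀ r, ‖m z ξ‖ < N / (1 + ssq ξ) := by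
    intro ξ z hz
    have := (hm z hz).2 ξ
    have hs := ssq_nonneg ξ
    rw [lt_div_iff₀ (by positivity), mul_comm]
    linarith
  let m' : 𝔼 → ℂ := fun ξ => deriv (fun z => m z ξ) z₀
  have hd1 : ∀ ξ, DifferentiableOn ℂ (dslope (fun z => m z ξ) z₀) (Metric.ball z₀ r) := fun ξ =>
    (Complex.differentiableOn_dslope (Metric.ball_mem_nhds _ hr)).2 (hd ξ)
  have hb1 : ∀ (ξ : 𝔼), ∀ z ∈ Metric.ball z₀ r,
      ‖dslope (fun z => m z ξ) z₀ z‖ ≤ (2 * N / (1 + ssq ξ)) / r := by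
    intro ξ z hz
    refine Complex.norm_dslope_le_div_of_mapsTo_ball (hd ξ) (fun w hw => ?_) hz
    rw [Metric.mem_closedBall, dist_eq_norm]
    refine (norm_sub_le _ _).trans ?_
    have := hb ξ w hw
    have := hb ξ z₀ h0
    rw [mul_div_assoc]
    linarith
  have hb2 : ∀ (ξ : 𝔼), ∀ z ∈ Metric.ball z₀ r,
      ‖dslope (dslope (fun z => m z ξ) z₀) z₀ z‖ ≤ (5 * N / (1 + ssq ξ)) / r / r := by
    intro ξ z hz
    refine Complex.norm_dslope_le_div_of_mapsTo_ball (hd1 ξ) (fun w hw => ?_) hz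
    rw [Metric.mem_closedBall, dist_eq_norm]
    refine (norm_sub_le _ _).trans ?_
    have e1 := hb1 ξ w hw
    have e2 := hb1 ξ z₀ h0
    have hs := ssq_nonneg ξ
    have e3 : 0 < N / (1 + ssq ξ) / r := by positivity
    have e4 : 2 * N / (1 + ssq ξ) / r = 2 * (N / (1 + ssq ξ) / r) := by ring
    have e5 : 5 * N / (1 + ssq ξ) / r = 5 * (N / (1 + ssq ξ) / r) := by ring
    rw [e4] at e1 e2
    rw [e5]
    linarith
  have htaylor : ∀ ξ z, m z ξ = m z₀ ξ + (z - z₀) * m' ξ +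
      (z - z₀) ^ 2 * dslope (dslope (fun z => m z ξ) z₀) z₀ z := by
    intro ξ z
    have e1 := sub_smul_dslope (fun z => m z ξ) z₀ z
    have e2 := sub_smul_dslope (dslope (fun z => m z ξ) z₀) z₀ z
    rw [dslope_same] at e2
    simp only [smul_eq_mul] at e1 e2
    simp only [m']
    linear_combination -e1 - (z - z₀) * e2
  have hm'meas : Measurable m' :=
    measurable_deriv_of_measurable hr (fun z hz => (hm z hz).1) hd
  have hm' : JetSymbol m' (2 * N / r) := by
    refine ⟨hm'meas, fun ξ => ?_⟩
    have := hb1 ξ z₀ h0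
    rw [dslope_same] at this
    have hs := ssq_nonneg ξ
    calc (1 + ssq ξ) * ‖m' ξ‖ ≤ (1 + ssq ξ) * (2 * N / (1 + ssq ξ) / r) := by gcongr
      _ = _ := by field_simp
  have hrem : ∀ z ∈ Metric.ball z₀ r,
      ∃ q, jetMul (m z) = jetMul (m z₀) + (z - z₀) • jetMul m' + (1 : ℂ) • q ∧
        ‖q‖ ≤ 5 * N / r / r * ‖z - z₀‖ ^ 2 := by
    intro z hz
    let q : 𝔼 → ℂ := fun ξ => m z ξ - m z₀ ξ - (z - z₀) * m' ξ
    have hq : JetSymbol q (5 * N / r / r * ‖z - z₀‖ ^ 2) := by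
      have k1 := (hm z hz).1
      have k2 := (hm z₀ h0).1
      refine ⟨by fun_prop, fun ξ => ?_⟩
      have : q ξ = (z - z₀) ^ 2 * dslope (dslope (fun z => m z ξ) z₀) z₀ z := by
        simp only [q]; rw [htaylor ξ z]; ring
      have hs := ssq_nonneg ξ
      rw [this, norm_mul, norm_pow]
      calc (1 + ssq ξ) * (‖z - z₀‖ ^ 2 * ‖dslope (dslope (fun z => m z ξ) z₀) z₀ z‖)
          ≤ (1 + ssq ξ) * (‖z - z₀‖ ^ 2 * (5 * N / (1 + ssq ξ) / r / r)) := by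
            gcongr; exact hb2 ξ z hz
        _ = _ := by field_simp
    let q₁ : 𝔼 → ℂ := fun ξ => m z₀ ξ + (z - z₀) * m' ξ
    have hq₁ : JetSymbol q₁ (M + ‖z - z₀‖ * (2 * N / r)) := by
      have k2 := (hm z₀ h0).1
      refine ⟨by fun_prop, fun ξ => ?_⟩
      have hs := ssq_nonneg ξ
      calc (1 + ssq ξ) * ‖q₁ ξ‖ ≤ (1 + ssq ξ) * (‖m z₀ ξ‖ + ‖z - z₀‖ * ‖m' ξ‖) := by
            gcongr
            exact (norm_add_le _ _).trans (by rw [norm_mul])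
        _ = (1 + ssq ξ) * ‖m z₀ ξ‖ + ‖z - z₀‖ * ((1 + ssq ξ) * ‖m' ξ‖) := by ring
        _ ≤ _ := by
            have := (hm z₀ h0).2 ξ
            have := hm'.2 ξ
            gcongr
    have e1 := jetMul_lin (hm z₀ h0) hm' hq₁ (z - z₀) fun ξ => rfl
    have e2 := jetMul_lin hq₁ hq (hm z hz) 1 fun ξ => by simp only [q₁, q]; ring
    exact ⟨jetMul q, e2.trans (congrArg (· + (1 : ℂ) • jetMul q) e1), norm_jetMul_le hq⟩
  exact (hasDerivAt_of_quadratic (F := fun z => jetMul (m z)) (F' := jetMul m') (z₀ := z₀) hr hrem).differentiableAt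

end Jets

/-! ### The free resolvent in the upper half plane -/

section FreeResolvent

open FourierTransform

lemma weakPair_zero_iff {i : Fin n} {a b : L2 n} :
    (a, b) ∈ weakPair n 0 i ↔ HasWeakPartialOn Set.univ i a b := by
  change HasWeakPartialOn Set.univ i (fun x => wt 0 x * a x) (fun x => wt 0 x * b x) ↔ _
  simp only [wt_zero, one_mul]

lemma fourier_jet {v : Jet n} (hv : v ∈ jetSpace n 0) :
    (∀ i, ∀ᵐ ξ, (𝓕 (v.2.1 i) : L2 n) ξ = dsym i ξ * (𝓕 v.1 : L2 n) ξ) ∧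
      ∀ i j, ∀ᵐ ξ, (𝓕 (v.2.2 i j) : L2 n) ξ = dsym j ξ * (dsym i ξ * (𝓕 v.1 : L2 n) ξ) := by
  have h1 : ∀ i, ∀ᵐ ξ, (𝓕 (v.2.1 i) : L2 n) ξ = dsym i ξ * (𝓕 v.1 : L2 n) ξ := fun i =>
    fourier_weakPartial (weakPair_zero_iff.1 (hv.1 i))
  refine ⟨h1, fun i j => ?_⟩
  filter_upwards [h1 i, fourier_weakPartial (weakPair_zero_iff.1 (hv.2 i j))] with ξ e1 e2
  rw [e2, e1]

lemma coeFn_sum_L2 {ι : Type*} (s : Finset ι) (f : ι → L2 n) :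
    ∀ᵐ x, (∑ i ∈ s, f i : L2 n) x = ∑ i ∈ s, f i x := by
  classical
  induction s using Finset.induction_on with
  | empty =>
    filter_upwards [Lp.coeFn_zero ℂ 2 (volume : Measure 𝔼)] with x hx
    rw [Finset.sum_empty, Finset.sum_empty, hx, Pi.zero_apply]
  | insert a s ha ih =>
    rw [Finset.sum_insert ha]
    filter_upwards [ih, Lp.coeFn_add (f a) (∑ i ∈ s, f i)] with x h1 h2
    rw [h2, Pi.add_apply, h1, Finset.sum_insert ha]

lemma fourier_jetLap {v : Jet n} (hv : v ∈ jetSpace n 0) :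
    ∀ᵐ ξ, (𝓕 (jetLap v) : L2 n) ξ = -(ssq ξ : ℂ) * (𝓕 v.1 : L2 n) ξ := by
  have h1 : (𝓕 (jetLap v) : L2 n) = ∑ i, 𝓕 (v.2.2 i i) :=
    map_sum (Lp.fourierTransformₗᵢ 𝔼 ℂ) _ _
  have h2 : ∀ᵐ ξ, ∀ i, (𝓕 (v.2.2 i i) : L2 n) ξ = dsym i ξ * (dsym i ξ * (𝓕 v.1 : L2 n) ξ) :=
    ae_all_iff.2 fun i => (fourier_jet hv).2 i i
  rw [h1]
  filter_upwards [h2, coeFn_sum_L2 Finset.univ fun i => (𝓕 (v.2.2 i i) : L2 n)] with ξ e1 e2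
  rw [e2, ← sum_dsym_sq, Finset.sum_mul]
  exact Finset.sum_congr rfl fun i _ => by rw [e1 i, mul_assoc]

/-- Green's formula on `ℝⁿ`: the Laplacian is symmetric on `H²(ℝⁿ)`. -/
lemma inner_jetLap {u v : Jet n} (hu : u ∈ jetSpace n 0) (hv : v ∈ jetSpace n 0) :
    inner ℂ u.1 (jetLap v) = inner ℂ (jetLap u) v.1 := by
  rw [← Lp.inner_fourier_eq, ← Lp.inner_fourier_eq (jetLap u), L2.inner_def, L2.inner_def]
  refine integral_congr_ae ?_
  filter_upwards [fourier_jetLap hu, fourier_jetLap hv] with ξ e1 e2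
  rw [e1, e2]
  simp only [RCLike.inner_apply, map_mul, map_neg, Complex.conj_ofReal]
  ring

/-- The symbol of `(-Δ - k²)⁻¹`. -/
def rsym (k : ℂ) (ξ : 𝔼) : ℂ := ((ssq ξ : ℂ) - k ^ 2)⁻¹

lemma le_norm_ssq_sub {k : ℂ} {η : ℝ} (hη : 0 < η) (h : η ≤ k.im) (ξ : 𝔼) :
    η ^ 2 ≤ ‖(ssq ξ : ℂ) - k ^ 2‖ := by
  set t := Real.sqrt (ssq ξ)
  have h1 : (ssq ξ : ℂ) - k ^ 2 = ((t : ℂ) - k) * ((t : ℂ) + k) := by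
    have : (ssq ξ : ℂ) = (t : ℂ) ^ 2 := by
      rw [← Complex.ofReal_pow, Real.sq_sqrt (ssq_nonneg ξ)]
    rw [this]; ring
  rw [h1, norm_mul, sq]
  have h2 : η ≤ ‖(t : ℂ) - k‖ := by
    refine le_trans ?_ (Complex.abs_im_le_norm _)
    simp only [Complex.sub_im, Complex.ofReal_im, zero_sub, abs_neg]
    exact h.trans (le_abs_self _)
  have h3 : η ≤ ‖(t : ℂ) + k‖ := by
    refine le_trans ?_ (Complex.abs_im_le_norm _)
    simp only [Complex.add_im, Complex.ofReal_im, zero_add]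
    exact h.trans (le_abs_self _)
  gcongr

lemma jetSymbol_rsym {k : ℂ} {η L : ℝ} (hη : 0 < η) (h : η ≤ k.im) (hL : ‖k‖ ≤ L) :
    JetSymbol (rsym k : 𝔼 → ℂ) (2 + (2 * L ^ 2 + 2) / η ^ 2) := by
  refine ⟨by unfold rsym; fun_prop, fun ξ => ?_⟩
  have h1 := le_norm_ssq_sub hη h ξ
  have hs := ssq_nonneg ξ
  have hη2 : 0 < η ^ 2 := by positivity
  have hpos : 0 < ‖(ssq ξ : ℂ) - k ^ 2‖ := hη2.trans_le h1
  rw [rsym, norm_inv, ← div_eq_mul_inv, div_le_iff₀ hpos]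
  have h2 : ssq ξ - L ^ 2 ≤ ‖(ssq ξ : ℂ) - k ^ 2‖ := by
    have e1 := norm_sub_norm_le (ssq ξ : ℂ) (k ^ 2)
    rw [norm_real, Real.norm_of_nonneg hs, norm_pow] at e1
    have : ‖k‖ ^ 2 ≤ L ^ 2 := by gcongr
    linarith
  have h3 : 0 ≤ (2 * L ^ 2 + 2) / η ^ 2 := by positivity
  rcases le_total (2 * L ^ 2 + 1) (ssq ξ) with h4 | h4
  · nlinarith
  · have h5 : (2 * L ^ 2 + 2) / η ^ 2 * η ^ 2 = 2 * L ^ 2 + 2 := by field_simp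
    nlinarith

lemma JetSymbol.rsym {k : ℂ} (h : 0 < k.im) :
    JetSymbol (rsym k : 𝔼 → ℂ) (2 + (2 * ‖k‖ ^ 2 + 2) / k.im ^ 2) :=
  jetSymbol_rsym h le_rfl le_rfl

/-- The free resolvent `(-Δ - k²)⁻¹ : L²(ℝⁿ) → H²(ℝⁿ)` for `Im k > 0`. -/
def freeRes (k : ℂ) : L2 n →L[ℂ] JetSpace n 0 := jetMul (BlackBox.rsym k)

lemma rsym_mul {k : ℂ} (h : 0 < k.im) (ξ : 𝔼) : rsym k ξ * ((ssq ξ : ℂ) - k ^ 2) = 1 := by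
  have h1 := le_norm_ssq_sub h le_rfl ξ
  refine inv_mul_cancel₀ (norm_pos_iff.1 (lt_of_lt_of_le (by positivity) h1))

lemma analyticAt_freeRes {k₀ : ℂ} (h : 0 < k₀.im) :
    AnalyticAt ℂ (fun k => (freeRes k : L2 n →L[ℂ] JetSpace n 0)) k₀ := by
  have hopen : IsOpen {k : ℂ | 0 < k.im} := isOpen_lt continuous_const Complex.continuous_im
  have : DifferentiableOn ℂ (fun k => (freeRes k : L2 n →L[ℂ] JetSpace n 0)) {k : ℂ | 0 < k.im} := by
    intro k hk
    refine DifferentiableAt.differentiableWithinAt ?_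
    have hk0 : 0 < k.im := hk
    have hsub : ∀ z ∈ Metric.ball k (k.im / 2), k.im / 2 ≤ z.im ∧ ‖z‖ ≤ ‖k‖ + k.im := by
      intro z hz
      rw [Metric.mem_ball, dist_eq_norm] at hz
      have h1 := (Complex.abs_im_le_norm (z - k)).trans hz.le
      rw [Complex.sub_im] at h1
      have h2 := norm_sub_norm_le z k
      exact ⟨by linarith [neg_abs_le (z.im - k.im)], by linarith⟩
    refine differentiableAt_jetMul (m := fun z => rsym z) (half_pos hk0) (fun z hz =>
      jetSymbol_rsym (half_pos hk0) (hsub z hz).1 (hsub z hz).2) fun ξ z hz => ?_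
    have hz' : 0 < z.im := (half_pos hk0).trans_le (hsub z hz).1
    have h1 := le_norm_ssq_sub hz' le_rfl ξ
    have h2 : (ssq ξ : ℂ) - z ^ 2 ≠ 0 := norm_pos_iff.1 (lt_of_lt_of_le (by positivity) h1)
    unfold rsym
    refine DifferentiableAt.differentiableWithinAt ?_
    exact DifferentiableAt.inv (by fun_prop) h2
  exact this.analyticAt (hopen.mem_nhds h)

/-- `H²(ℝⁿ)` functions are recovered from `(-Δ - k²) v` by the free resolvent. -/
lemma freeRes_apply_sub {k : ℂ} (h : 0 < k.im) {v : Jet n} (hv : v ∈ jetSpace n 0) :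
    (freeRes k (-jetLap v - k ^ 2 • v.1)).val = v := by
  refine jetSpace_ext (JetSpace.val_mem _) hv ?_
  rw [freeRes, coe_jetMul (JetSymbol.rsym h)]
  have hinj : Function.Injective (𝓕 : L2 n → L2 n) := (Lp.fourierTransformₗᵢ 𝔼 ℂ).injective
  refine hinj ?_
  rw [fourier_fourierMul]
  refine Lp.ext ?_
  have e0 : (𝓕 (-jetLap v - k ^ 2 • v.1) : L2 n) = -𝓕 (jetLap v) - k ^ 2 • 𝓕 v.1 := by
    have := map_sub (Lp.fourierTransformₗᵢ 𝔼 ℂ) (-jetLap v) (k ^ 2 • v.1)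
    rw [map_neg, map_smul] at this
    exact this
  filter_upwards [coeFn_mulOp (mulBound_volume (JetSymbol.rsym h).1 (JetSymbol.rsym h).bounds.1)
    (𝓕 (-jetLap v - k ^ 2 • v.1) : L2 n), fourier_jetLap hv,
    Lp.coeFn_sub (-𝓕 (jetLap v) : L2 n) (k ^ 2 • 𝓕 v.1), Lp.coeFn_neg (𝓕 (jetLap v) : L2 n),
    Lp.coeFn_smul (k ^ 2) (𝓕 v.1 : L2 n)] with ξ e1 e2 e3 e4 e5
  rw [e1, e0, e3, Pi.sub_apply, e4, Pi.neg_apply, e5, Pi.smul_apply, e2, smul_eq_mul]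
  linear_combination (𝓕 v.1 : L2 n) ξ * rsym_mul h ξ

lemma sub_freeRes {k : ℂ} (h : 0 < k.im) (g : L2 n) :
    -jetLap (freeRes k g).val - k ^ 2 • (freeRes k g).val.1 = g := by
  set v : Jet n := (freeRes k g).val
  have hv : v ∈ jetSpace n 0 := (freeRes k g).val_mem
  have hinj : Function.Injective (𝓕 : L2 n → L2 n) := (Lp.fourierTransformₗᵢ 𝔼 ℂ).injective
  refine hinj (Lp.ext ?_)
  have e0 : (𝓕 (-jetLap v - k ^ 2 • v.1) : L2 n) = -𝓕 (jetLap v) - k ^ 2 • 𝓕 v.1 := by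
    have := map_sub (Lp.fourierTransformₗᵢ 𝔼 ℂ) (-jetLap v) (k ^ 2 • v.1)
    rw [map_neg, map_smul] at this
    exact this
  have e6 : (𝓕 v.1 : L2 n) = mulOp (rsym k) volume volume (𝓕 g) := by
    rw [← fourier_fourierMul]
    simp only [v, freeRes, coe_jetMul (JetSymbol.rsym h)]
  have e7 := coeFn_mulOp (mulBound_volume (JetSymbol.rsym h).1 (JetSymbol.rsym h).bounds.1)
    (𝓕 g : L2 n)
  rw [← e6] at e7
  filter_upwards [e7, fourier_jetLap hv,
    Lp.coeFn_sub (-𝓕 (jetLap v) : L2 n) (k ^ 2 • 𝓕 v.1), Lp.coeFn_neg (𝓕 (jetLap v) : L2 n),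
    Lp.coeFn_smul (k ^ 2) (𝓕 v.1 : L2 n)] with ξ e1 e2 e3 e4 e5
  rw [e0, e3, Pi.sub_apply, e4, Pi.neg_apply, e5, Pi.smul_apply, e2, smul_eq_mul, e1]
  linear_combination (𝓕 g : L2 n) ξ * rsym_mul h ξ

/-- The symbol `∫₀¹ e^{t(μ - |2πξ|²)} dt` of the part `∫₀¹ e^{tμ} e^{tΔ} dt` of `(-Δ - μ)⁻¹`. -/
def asym (μ : ℂ) (ξ : 𝔼) : ℂ := dslope Complex.exp 0 (μ - ssq ξ)

lemma continuous_dslope_exp : Continuous (dslope Complex.exp 0) := by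
  have : Differentiable ℂ (dslope Complex.exp 0) := by
    rw [← differentiableOn_univ, Complex.differentiableOn_dslope univ_mem]
    exact Complex.differentiable_exp.differentiableOn
  exact this.continuous

lemma mul_dslope_exp (z : ℂ) : z * dslope Complex.exp 0 z = Complex.exp z - 1 := by
  simpa using sub_smul_dslope Complex.exp 0 z

lemma jetSymbol_asym {μ : ℂ} {L : ℝ} (hL : ‖μ‖ ≤ L) :
    JetSymbol (asym μ : 𝔼 → ℂ) ((2 + L) * (Real.exp L + 1)) := by
  have hL0 : 0 ≤ L := (norm_nonneg _).trans hL
  refine ⟨by have := continuous_dslope_exp; unfold asym; fun_prop, fun ξ => ?_⟩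
  have hs := ssq_nonneg ξ
  set z := μ - ssq ξ with hz
  have hre : z.re ≤ L := by
    have := (Complex.re_le_norm μ).trans hL
    simp only [hz, Complex.sub_re, Complex.ofReal_re]
    linarith
  have h1 : ‖Complex.exp z - 1‖ ≤ Real.exp L + 1 := by
    refine (norm_sub_le _ _).trans ?_
    rw [Complex.norm_exp, norm_one]
    gcongr
  have h2 : ‖z‖ * ‖dslope Complex.exp 0 z‖ ≤ Real.exp L + 1 := by
    rw [← norm_mul, mul_dslope_exp]; exact h1
  have hE : 1 ≤ Real.exp L := Real.one_le_exp hL0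
  have h3 : ‖dslope Complex.exp 0 z‖ ≤ Real.exp L + 1 := by
    rcases le_total ‖z‖ 1 with hz1 | hz1
    · rcases eq_or_ne z 0 with h0 | h0
      · rw [h0, dslope_same]; simp; positivity
      · have h4 := Complex.norm_exp_sub_one_le hz1
        rw [← mul_dslope_exp, norm_mul, mul_comm] at h4
        have := le_of_mul_le_mul_right h4 (norm_pos_iff.2 h0)
        linarith
    · nlinarith [norm_nonneg (dslope Complex.exp 0 z)]
  have h5 : ssq ξ ≤ ‖z‖ + L := by
    have e1 := norm_sub_norm_le (ssq ξ : ℂ) μ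
    rw [norm_real, Real.norm_of_nonneg hs, norm_sub_rev] at e1
    linarith
  change (1 + ssq ξ) * ‖dslope Complex.exp 0 z‖ ≤ _
  nlinarith [norm_nonneg (dslope Complex.exp 0 z)]

/-- `∫₀¹ e^{tμ} e^{tΔ} dt : L²(ℝⁿ) → H²(ℝⁿ)`. -/
def heatPart (μ : ℂ) : L2 n →L[ℂ] JetSpace n 0 := jetMul (asym μ)

lemma differentiable_heatPart :
    Differentiable ℂ fun μ => (heatPart μ : L2 n →L[ℂ] JetSpace n 0) := by
  intro μ
  refine differentiableAt_jetMul (m := fun z => asym z) (r := 1) one_pos (fun z hz =>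
    jetSymbol_asym (L := ‖μ‖ + 1) ?_) fun ξ => ?_
  · rw [Metric.mem_ball, dist_eq_norm] at hz
    have h2 := norm_sub_norm_le z μ
    linarith
  · have : Differentiable ℂ (dslope Complex.exp 0) := by
      rw [← differentiableOn_univ, Complex.differentiableOn_dslope univ_mem]
      exact Complex.differentiable_exp.differentiableOn
    unfold asym
    exact (this.comp (differentiable_id.sub_const _)).differentiableOn

/-- The second term is the symbol of the part `∫₁^∞ e^{tk²} e^{tΔ} dt` of the free resolvent. -/
lemma rsym_eq {k : ℂ} (h : 0 < k.im) (ξ : 𝔼) :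
    rsym k ξ = asym (k ^ 2) ξ + Complex.exp (k ^ 2 - ssq ξ) * rsym k ξ := by
  have h1 := rsym_mul h ξ
  have h2 := mul_dslope_exp (k ^ 2 - ssq ξ)
  unfold asym
  linear_combination (rsym k ξ) * h2 + dslope Complex.exp 0 (k ^ 2 - ssq ξ) * h1

end FreeResolvent

/-! ### Hilbert–Schmidt operators -/

section HilbertSchmidt

variable {α H : Type*} [MeasurableSpace α] {μ : Measure α} [NormedAddCommGroup H] [NormedSpace ℂ H]

variable (μ H) in
/-- A square integrable function `k` with values in the dual of `H` defines the operator
`v ↦ (x ↦ k(x) v)` from `H` to `L²(μ)`. -/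
def hsOp : Lp (H →L[ℂ] ℂ) 2 μ →L[ℂ] H →L[ℂ] Lp ℂ 2 μ :=
  LinearMap.mkContinuous₂
    (LinearMap.mk₂ ℂ (fun k v => (ContinuousLinearMap.apply ℂ ℂ v).compLpL 2 μ k)
      (fun k k' v => map_add _ k k') (fun c k v => map_smul _ c k)
      (fun k v v' => by
        rw [map_add]
        exact ContinuousLinearMap.add_compLp _ _ k)
      (fun c k v => by
        rw [map_smul]
        exact ContinuousLinearMap.smul_compLp c _ k)) 1 fun k v => by
    rw [LinearMap.mk₂_apply, one_mul, mul_comm]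
    refine ((ContinuousLinearMap.apply ℂ ℂ v).norm_compLp_le k).trans ?_
    gcongr
    exact opNorm_le_bound _ (norm_nonneg _) fun f => by
      rw [ContinuousLinearMap.apply_apply, mul_comm]; exact f.le_opNorm v

lemma coeFn_hsOp (k : Lp (H →L[ℂ] ℂ) 2 μ) (v : H) : ∀ᵐ x ∂μ, hsOp H μ k v x = k x v :=
  (ContinuousLinearMap.apply ℂ ℂ v).coeFn_compLp k

lemma norm_hsOp_le (k : Lp (H →L[ℂ] ℂ) 2 μ) : ‖hsOp H μ k‖ ≤ ‖k‖ := by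
  refine ((hsOp H μ).le_opNorm k).trans ?_
  have : ‖hsOp H μ‖ ≤ 1 := LinearMap.mkContinuous₂_norm_le _ zero_le_one _
  nlinarith [norm_nonneg k]

/-- Step functions give operators of finite rank, and they are dense. -/
lemma isCompactOperator_hsOp (k : Lp (H →L[ℂ] ℂ) 2 μ) : IsCompactOperator (hsOp H μ k) := by
  refine Lp.induction (by norm_num) (motive := fun k => IsCompactOperator (hsOp H μ k))
    ?_ ?_ ?_ k
  · intro c s hs hμs
    let L : ℂ →L[ℂ] Lp ℂ 2 μ := ContinuousLinearMap.toSpanSingleton ℂ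
      (indicatorConstLp 2 hs hμs.ne (1 : ℂ))
    have e : hsOp H μ (Lp.simpleFunc.indicatorConst 2 hs hμs.ne c : Lp (H →L[ℂ] ℂ) 2 μ) =
        L.comp c := by
      ext1 v
      refine Lp.ext ?_
      rw [Lp.simpleFunc.coe_indicatorConst, comp_apply,
        ContinuousLinearMap.toSpanSingleton_apply]
      filter_upwards [coeFn_hsOp (indicatorConstLp 2 hs hμs.ne c) v,
        indicatorConstLp_coeFn (p := 2) (hs := hs) (hμs := hμs.ne) (c := c),
        indicatorConstLp_coeFn (p := 2) (hs := hs) (hμs := hμs.ne) (c := (1 : ℂ)),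
        Lp.coeFn_smul (c v) (indicatorConstLp 2 hs hμs.ne (1 : ℂ))] with x e1 e2 e3 e4
      rw [e1, e2, e4, Pi.smul_apply, e3]
      by_cases hx : x ∈ s <;> simp [hx]
    rw [e]
    have hL : IsCompactOperator L := by
      refine ⟨L '' Metric.closedBall 0 1, (isCompact_closedBall 0 1).image L.continuous, ?_⟩
      exact mem_of_superset (Metric.closedBall_mem_nhds 0 one_pos) (Set.subset_preimage_image _ _)
    exact hL.comp_clm c
  · intro f g hf hg _ h1 h2
    rw [map_add]
    exact h1.add h2
  · exact (isClosed_setOfPred_isCompactOperator (σ₁₂ := RingHom.id ℂ)).preimage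
      (hsOp H μ).continuous

end HilbertSchmidt

section Kernels

open FourierTransform

/-- Kernels `k(x, y)`, continuous in `x`, dominated by `a(x) b(y)` with `a`, `b` in `L²`. -/
structure HSKernel (k : 𝔼 → 𝔼 → ℂ)
    (a b : 𝔼 → ℝ) : Prop where
  cont : ∀ y, Continuous fun x => k x y
  meas : ∀ x, Measurable (k x)
  le : ∀ x y, ‖k x y‖ ≤ a x * b y
  cont_left : Continuous a
  memLp_left : MemLp a 2 volume
  memLp_right : MemLp b 2 volume

variable {k : EuclideanSpace ℝ (Fin n) → EuclideanSpace ℝ (Fin n) → ℂ}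
  {a b : EuclideanSpace ℝ (Fin n) → ℝ}

lemma HSKernel.memLp (h : HSKernel k a b) (x : 𝔼) :
    MemLp (fun y => (starRingEnd ℂ) (k x y)) 2 volume := by
  refine (h.memLp_right.const_mul (a x)).mono
    (Complex.continuous_conj.measurable.comp (h.meas x)).aestronglyMeasurable (ae_of_all _ fun y => ?_)
  rw [RCLike.norm_conj]
  exact (h.le x y).trans (le_abs_self _)

/-- The section `k(x, ·)` as a functional on `L²`. -/
def HSKernel.sec (h : HSKernel k a b) (x : 𝔼) : L2 n →L[ℂ] ℂ :=
  innerSL ℂ ((h.memLp x).toLp _)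

lemma HSKernel.sec_apply (h : HSKernel k a b) (x : 𝔼) (g : L2 n) :
    h.sec x g = ∫ y, k x y * g y := by
  rw [HSKernel.sec, innerSL_apply_apply, L2.inner_def]
  refine integral_congr_ae ?_
  filter_upwards [(h.memLp x).coeFn_toLp] with y hy
  rw [hy, RCLike.inner_apply, Complex.conj_conj, mul_comm]

lemma norm_toLp_le_of_bound {F : Type*} [NormedAddCommGroup F] {f : 𝔼 → F} (hf : MemLp f 2 volume) (hb : MemLp b 2 volume) {c : ℝ}
    (hc : 0 ≤ c) (h : ∀ y, ‖f y‖ ≤ c * b y) : ‖hf.toLp f‖ ≤ c * ‖hb.toLp b‖ := by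
  rw [← Real.norm_of_nonneg hc, ← norm_smul]
  refine Lp.norm_le_norm_of_ae_le ?_
  filter_upwards [hf.coeFn_toLp, hb.coeFn_toLp, Lp.coeFn_smul c (hb.toLp b)] with y e1 e2 e3
  rw [e1, e3, Pi.smul_apply, e2]
  exact (h y).trans (le_abs_self _)

lemma norm_sq_L2 {α : Type*} [MeasurableSpace α] {μ : Measure α} (f : Lp ℂ 2 μ) :
    ‖f‖ ^ 2 = ∫ x, ‖f x‖ ^ 2 ∂μ := by
  have h1 := inner_self_eq_norm_sq_to_K (𝕜 := ℂ) f
  rw [L2.inner_def] at h1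
  have h2 : ∀ x, inner ℂ (f x) (f x) = ((‖f x‖ ^ 2 : ℝ) : ℂ) := fun x => by
    rw [inner_self_eq_norm_sq_to_K]; norm_cast
  simp only [h2] at h1
  rw [integral_complex_ofReal] at h1
  apply Complex.ofReal_injective
  rw [Complex.ofReal_pow]
  exact h1.symm

lemma HSKernel.norm_sec_le (h : HSKernel k a b) (x : 𝔼) :
    ‖h.sec x‖ ≤ ‖a x * ‖h.memLp_right.norm.toLp _‖‖ := by
  rw [HSKernel.sec, innerSL_apply_norm, norm_mul, norm_norm]
  refine norm_toLp_le_of_bound _ _ (norm_nonneg _) fun y => ?_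
  rw [RCLike.norm_conj, ← norm_mul]
  exact (h.le x y).trans (le_abs_self _)

lemma HSKernel.continuous_sec (h : HSKernel k a b) : Continuous h.sec := by
  refine (innerSL ℂ).continuous.comp ?_
  rw [continuous_iff_continuousAt]
  intro x₀
  rw [ContinuousAt, tendsto_iff_norm_sub_tendsto_zero]
  have h1 : ∀ x, ‖(h.memLp x).toLp _ - (h.memLp x₀).toLp _‖ =
      Real.sqrt (∫ y, ‖k x y - k x₀ y‖ ^ 2) := fun x => by
    rw [← Real.sqrt_sq (norm_nonneg _), norm_sq_L2]
    congr 1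
    refine integral_congr_ae ?_
    filter_upwards [(h.memLp x).coeFn_toLp, (h.memLp x₀).coeFn_toLp,
      Lp.coeFn_sub ((h.memLp x).toLp _) ((h.memLp x₀).toLp _)] with y e1 e2 e3
    rw [e3, Pi.sub_apply, e1, e2, ← map_sub, RCLike.norm_conj]
  simp only [h1]
  have h2 : Tendsto (fun x => ∫ y, ‖k x y - k x₀ y‖ ^ 2) (𝓝 x₀) (𝓝 (∫ y : 𝔼, (0 : ℝ))) := by
    refine tendsto_integral_filter_of_dominated_convergence
      (fun y => (2 * |a x₀| + 1) ^ 2 * b y ^ 2) (Eventually.of_forall fun x => ?_) ?_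
      (h.memLp_right.integrable_sq.const_mul _) (ae_of_all _ fun y => ?_)
    · exact (((h.meas x).sub (h.meas x₀)).norm.pow_const 2).aestronglyMeasurable
    · have h3 : ∀ᶠ x in 𝓝 x₀, |a x| < |a x₀| + 1 :=
        h.cont_left.abs.continuousAt.eventually_lt continuousAt_const (by simp)
      filter_upwards [h3] with x hx
      refine ae_of_all _ fun y => ?_
      rw [Real.norm_of_nonneg (by positivity), ← sq_abs (b y), ← mul_pow]
      gcongr
      have e1 := (h.le x y).trans (le_abs_self _)
      have e2 := (h.le x₀ y).trans (le_abs_self _)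
      rw [abs_mul] at e1 e2
      have e3 := norm_sub_le (k x y) (k x₀ y)
      nlinarith [abs_nonneg (b y)]
    · have := (((h.cont y).sub continuous_const).norm.pow 2).tendsto (f := fun x => ‖k x y - k x₀ y‖ ^ 2) x₀
      simpa using this
  rw [integral_zero] at h2
  simpa using h2.sqrt

lemma HSKernel.memLp_sec (h : HSKernel k a b) : MemLp h.sec 2 volume :=
  (h.memLp_left.mul_const _).mono h.continuous_sec.aestronglyMeasurable
    (ae_of_all _ fun x => h.norm_sec_le x)

/-- The integral operator with kernel `k`. -/
def HSKernel.op (h : HSKernel k a b) : L2 n →L[ℂ] L2 n :=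
  hsOp (L2 n) volume (h.memLp_sec.toLp _)

lemma HSKernel.coeFn_op (h : HSKernel k a b) (g : L2 n) :
    ∀ᵐ x, h.op g x = ∫ y, k x y * g y := by
  filter_upwards [coeFn_hsOp (h.memLp_sec.toLp _) g, h.memLp_sec.coeFn_toLp] with x e1 e2
  rw [HSKernel.op, e1, e2, h.sec_apply]

lemma HSKernel.isCompactOperator_op (h : HSKernel k a b) : IsCompactOperator h.op :=
  isCompactOperator_hsOp _

lemma HSKernel.norm_op_le (h : HSKernel k a b) :
    ‖h.op‖ ≤ ‖h.memLp_left.norm.toLp _‖ * ‖h.memLp_right.norm.toLp _‖ := by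
  refine (norm_hsOp_le _).trans ?_
  rw [mul_comm, ← norm_norm (h.memLp_right.norm.toLp _), ← norm_smul]
  refine Lp.norm_le_norm_of_ae_le ?_
  filter_upwards [h.memLp_sec.coeFn_toLp, h.memLp_left.norm.coeFn_toLp,
    Lp.coeFn_smul ‖h.memLp_right.norm.toLp _‖ (h.memLp_left.norm.toLp _)] with x e1 e2 e3
  rw [e1, e3, Pi.smul_apply, e2, smul_eq_mul]
  refine (h.norm_sec_le x).trans ?_
  rw [mul_comm, norm_mul, norm_mul, norm_norm, norm_norm]

/-- Multiplication by a function of compact support, after a Fourier multiplier whose symbol decays,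
is a compact operator. Truncated symbols give Hilbert–Schmidt operators. -/
lemma isCompactOperator_mul_fourierMul {ψ m : 𝔼 → ℂ} (hψ : Continuous ψ) (hψc : HasCompactSupport ψ)
    {M : ℝ} (hm : Measurable m) (hM : ∀ ξ, (1 + ‖ξ‖) * ‖m ξ‖ ≤ M) :
    IsCompactOperator (mulOp ψ volume volume ∘L fourierMul m) := by
  have hM0 : 0 ≤ M := le_trans (by positivity) (hM 0)
  have hm1 : ∀ ξ, ‖m ξ‖ ≤ M := fun ξ => by nlinarith [hM ξ, norm_nonneg ξ, norm_nonneg (m ξ)]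
  obtain ⟨Cψ, hCψ⟩ := hψc.exists_bound_of_continuous hψ
  have hψb : MulBound ψ (volume : Measure 𝔼) volume Cψ := mulBound_volume hψ.measurable hCψ
  let mr : ℕ → 𝔼 → ℂ := fun r => (Metric.ball 0 r).indicator m
  have hmr : ∀ r, Measurable (mr r) := fun r => hm.indicator measurableSet_ball
  have hmr1 : ∀ r ξ, ‖mr r ξ‖ ≤ M := fun r ξ => (norm_indicator_le_norm_self _ _).trans (hm1 ξ)
  have hmr2 : ∀ r ξ, ‖m ξ - mr r ξ‖ ≤ M / (1 + r) := fun r ξ => by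
    by_cases hξ : ξ ∈ Metric.ball (0 : 𝔼) r
    · simp only [mr, Set.indicator_of_mem hξ, sub_self, norm_zero]; positivity
    · simp only [mr, Set.indicator_of_notMem hξ, sub_zero]
      rw [le_div_iff₀ (by positivity)]
      rw [Metric.mem_ball, dist_zero_right, not_lt] at hξ
      nlinarith [hM ξ, norm_nonneg (m ξ)]
  have hcomp : ∀ r, IsCompactOperator (mulOp ψ volume volume ∘L fourierMul (mr r)) := by
    intro r
    have hb : MemLp (fun ξ => ‖mr r ξ‖) 2 (volume : Measure 𝔼) := by
      refine MemLp.norm ?_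
      have h1 : MemLp ((Metric.ball (0 : 𝔼) r).indicator fun _ => M) 2 volume :=
        memLp_indicator_const 2 measurableSet_ball M (Or.inr measure_ball_lt_top.ne)
      refine h1.mono (hmr r).aestronglyMeasurable (ae_of_all _ fun ξ => ?_)
      by_cases hξ : ξ ∈ Metric.ball (0 : 𝔼) r
      · simp only [mr, Set.indicator_of_mem hξ, Real.norm_eq_abs, abs_of_nonneg hM0, hm1]
      · simp only [mr, Set.indicator_of_notMem hξ, norm_zero, le_refl]
    have hk : HSKernel (fun x ξ => ψ x * ((Real.fourierChar (inner ℝ ξ x) : ℂ) * mr r ξ))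
        (fun x => ‖ψ x‖) (fun ξ => ‖mr r ξ‖) := by
      refine ⟨fun ξ => ?_, fun x => ?_, fun x ξ => ?_, hψ.norm,
        (memLp_of_continuous_compact hψ hψc _).norm, hb⟩
      · have := Real.continuous_fourierChar
        fun_prop
      · have := Real.continuous_fourierChar
        have h2 : Measurable fun ξ : 𝔼 => (Real.fourierChar (inner ℝ ξ x) : ℂ) :=
          Continuous.measurable (by fun_prop)
        exact (h2.mul (hmr r)).const_mul _
      · rw [norm_mul, norm_mul, Circle.norm_coe, one_mul]
    have e : mulOp ψ volume volume ∘L fourierMul (mr r) = hk.op ∘L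
        (Lp.fourierTransformₗᵢ 𝔼 ℂ).toContinuousLinearEquiv.toContinuousLinearMap := by
      ext1 g
      refine Lp.ext ?_
      change (mulOp ψ volume volume (fourierMul (mr r) g) : L2 n) =ᵐ[volume] hk.op (𝓕 g : L2 n)
      have h2 : MemLp (fun ξ => mr r ξ * (𝓕 g : L2 n) ξ) 2 volume :=
        (mulBound_volume (hmr r) (hmr1 r)).memLp _
      have h1 : Integrable (fun ξ => mr r ξ * (𝓕 g : L2 n) ξ) := by
        have := (memLp_norm_iff (hmr r).aestronglyMeasurable).1 hb
        exact MemLp.integrable_mul this (Lp.memLp _)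
      have h3 : mulOp (mr r) volume volume (𝓕 g : L2 n) = h2.toLp _ := by
        refine Lp.ext ?_
        filter_upwards [coeFn_mulOp (mulBound_volume (hmr r) (hmr1 r)) (𝓕 g : L2 n),
          h2.coeFn_toLp] with x e1 e2
        rw [e1, e2]
      have h4 := fourierInv_eq_integral h1 h2
      rw [← h3] at h4
      filter_upwards [coeFn_mulOp hψb (fourierMul (mr r) g), hk.coeFn_op (𝓕 g : L2 n), h4]
        with x e1 e2 e3
      rw [e1, e2, fourierMul_apply, e3, Real.fourierInv_eq, ← integral_const_mul]
      refine integral_congr_ae (ae_of_all _ fun ξ => ?_)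
      simp only [Circle.smul_def, smul_eq_mul]
      ring
    rw [e]
    exact hk.isCompactOperator_op.comp_clm _
  refine isCompactOperator_of_tendsto (F := fun r => mulOp ψ volume volume ∘L fourierMul (mr r))
    (l := atTop) ?_ (Eventually.of_forall hcomp)
  rw [tendsto_iff_norm_sub_tendsto_zero]
  have hlim : Tendsto (fun r : ℕ => Cψ * (M / (1 + (r : ℝ)))) atTop (𝓝 0) := by
    have : Tendsto (fun r : ℕ => M / (1 + (r : ℝ))) atTop (𝓝 0) :=
      tendsto_const_nhds.div_atTop (tendsto_const_nhds.add_atTop tendsto_natCast_atTop_atTop)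
    simpa using this.const_mul Cψ
  refine squeeze_zero (fun _ => norm_nonneg _) (fun r => ?_) hlim
  have e1 : fourierMul m = fourierMul (mr r) + (1 : ℂ) • fourierMul fun ξ => m ξ - mr r ξ :=
    fourierMul_lin (hmr r) (hmr1 r) (hm.sub (hmr r)) (hmr2 r) 1 fun ξ => by simp
  have e2 : mulOp ψ volume volume ∘L fourierMul (mr r) - mulOp ψ volume volume ∘L fourierMul m =
      -(mulOp ψ volume volume ∘L fourierMul fun ξ => m ξ - mr r ξ) := by
    rw [e1, one_smul, comp_add]; abel
  rw [e2, norm_neg]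
  refine (ContinuousLinearMap.opNorm_comp_le _ _).trans ?_
  exact mul_le_mul (norm_mulOp_le hψb) (norm_fourierMul_le (hm.sub (hmr r)) (hmr2 r))
    (norm_nonneg _) ((norm_nonneg _).trans (hCψ 0))

end Kernels

/-! ### Convolution operators between Gaussian weights -/

section GaussKernels

open scoped BoundedContinuousFunction

/-- The Gaussian `e^{-|x|²/3}`. -/
def gs (x : 𝔼) : ℝ := Real.exp (-(1 / 3) * ‖x‖ ^ 2)

@[fun_prop]
lemma continuous_gs : Continuous (gs : 𝔼 → ℝ) := by unfold gs; fun_prop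

lemma gs_pos (x : 𝔼) : 0 < gs x := Real.exp_pos _

lemma integrable_exp_neg_mul_sq {c : ℝ} (hc : 0 < c) :
    Integrable fun x : 𝔼 => Real.exp (-c * ‖x‖ ^ 2) := by
  have h := (GaussianFourier.integrable_cexp_neg_mul_sq_norm_add (V := 𝔼) (b := (c : ℂ))
    (by simpa using hc) 0 0).re
  refine h.congr (ae_of_all _ fun x => ?_)
  simp only [zero_mul, add_zero]
  rw [← Complex.ofReal_neg, ← Complex.ofReal_pow, ← ofReal_mul, ← Complex.ofReal_exp]
  exact Complex.ofReal_re _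

lemma memLp_gs : MemLp (gs : 𝔼 → ℝ) 2 volume := by
  refine (memLp_two_iff_integrable_sq continuous_gs.aestronglyMeasurable).2 ?_
  refine (integrable_exp_neg_mul_sq (n := n) (c := 2 / 3) (by norm_num)).congr
    (ae_of_all _ fun x => ?_)
  simp only [gs]
  rw [← Real.exp_nat_mul]
  congr 1; push_cast; ring

/-- The kernel `e^{-|x|²} q(x - y) e^{-|y|²}` where `q(z) = e^{|z|²/3} r(z)`. -/
def gaussKernel (r : 𝔼 →ᵇ ℂ) (x y : 𝔼) : ℂ :=
  wt (-1) x * (wt (1 / 3) (x - y) * r (x - y)) * wt (-1) y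

lemma norm_wt_kernel_le (x y : 𝔼) :
    ‖wt (-1) x‖ * ‖wt (1 / 3) (x - y)‖ * ‖wt (-1) y‖ ≤ gs x * gs y := by
  rw [norm_wt, norm_wt, norm_wt, gs, gs, ← Real.exp_add, ← Real.exp_add, ← Real.exp_add]
  refine Real.exp_le_exp.2 ?_
  have h := norm_sub_le x y
  have h2 : ‖x - y‖ ^ 2 ≤ (‖x‖ + ‖y‖) ^ 2 := by gcongr
  nlinarith [sq_nonneg (‖x‖ - ‖y‖)]

lemma hsKernel_gaussKernel (r : 𝔼 →ᵇ ℂ) :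
    HSKernel (gaussKernel r) (fun x => ‖r‖ * gs x) gs := by
  refine ⟨fun y => ?_, fun x => ?_, fun x y => ?_, by fun_prop, memLp_gs.const_mul _, memLp_gs⟩
  · unfold gaussKernel; fun_prop
  · exact Continuous.measurable (by unfold gaussKernel; fun_prop)
  · rw [gaussKernel, norm_mul, norm_mul, norm_mul]
    have h1 := norm_wt_kernel_le x y
    have h2 := r.norm_coe_le_norm (x - y)
    calc ‖wt (-1) x‖ * (‖wt (1 / 3) (x - y)‖ * ‖r (x - y)‖) * ‖wt (-1) y‖
        = ‖r (x - y)‖ * (‖wt (-1) x‖ * ‖wt (1 / 3) (x - y)‖ * ‖wt (-1) y‖) := by ring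
      _ ≤ ‖r‖ * (gs x * gs y) := by gcongr
      _ = _ := by ring

lemma HSKernel.integrable {k : 𝔼 → 𝔼 → ℂ} {a b : 𝔼 → ℝ} (h : HSKernel k a b) (x : 𝔼) (g : L2 n) :
    Integrable fun y => k x y * g y := by
  have h1 : MemLp (k x) 2 volume := (h.memLp_right.const_mul (a x)).mono
    (h.meas x).aestronglyMeasurable (ae_of_all _ fun y => (h.le x y).trans (le_abs_self _))
  exact MemLp.integrable_mul h1 (Lp.memLp g)

/-- The operators with kernel `e^{-|x|²} e^{|x - y|²/3} r(x - y) e^{-|y|²}`. -/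
def gaussOp : (𝔼 →ᵇ ℂ) →L[ℂ] L2 n →L[ℂ] L2 n :=
  LinearMap.mkContinuous
    { toFun := fun r => (hsKernel_gaussKernel r).op
      map_add' := fun r s => by
        ext1 g
        refine Lp.ext ?_
        filter_upwards [(hsKernel_gaussKernel r).coeFn_op g, (hsKernel_gaussKernel s).coeFn_op g,
          (hsKernel_gaussKernel (r + s)).coeFn_op g,
          Lp.coeFn_add ((hsKernel_gaussKernel r).op g) ((hsKernel_gaussKernel s).op g)]
          with x e1 e2 e3 e4
        rw [e3, add_apply, e4, Pi.add_apply, e1, e2,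
          ← integral_add ((hsKernel_gaussKernel r).integrable x g)
            ((hsKernel_gaussKernel s).integrable x g)]
        refine integral_congr_ae (ae_of_all _ fun y => ?_)
        simp only [gaussKernel, BoundedContinuousFunction.add_apply]
        ring
      map_smul' := fun c r => by
        ext1 g
        refine Lp.ext ?_
        filter_upwards [(hsKernel_gaussKernel r).coeFn_op g,
          (hsKernel_gaussKernel (c • r)).coeFn_op g,
          Lp.coeFn_smul c ((hsKernel_gaussKernel r).op g)] with x e1 e3 e4
        rw [e3, RingHom.id_apply, smul_apply, e4, Pi.smul_apply, e1, smul_eq_mul,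
          ← integral_const_mul]
        refine integral_congr_ae (ae_of_all _ fun y => ?_)
        simp only [gaussKernel, BoundedContinuousFunction.smul_apply, smul_eq_mul]
        ring } (‖(memLp_gs (n := n)).toLp gs‖ * ‖(memLp_gs (n := n)).norm.toLp _‖) fun r => by
    refine (hsKernel_gaussKernel r).norm_op_le.trans ?_
    rw [mul_right_comm, mul_comm _ ‖r‖]
    gcongr
    refine norm_toLp_le_of_bound _ _ (norm_nonneg _) fun y => ?_
    rw [norm_norm, Real.norm_of_nonneg (by have := gs_pos y; positivity)]

lemma coeFn_gaussOp (r : 𝔼 →ᵇ ℂ) (g : L2 n) :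
    ∀ᵐ x, gaussOp r g x = ∫ y, gaussKernel r x y * g y :=
  (hsKernel_gaussKernel r).coeFn_op g

lemma isCompactOperator_gaussOp (r : 𝔼 →ᵇ ℂ) : IsCompactOperator (gaussOp r) :=
  (hsKernel_gaussKernel r).isCompactOperator_op

/-- Differentiating the convolution kernel differentiates the operator, up to the weight. -/
lemma gaussOp_weakPair {p : 𝔼 → ℂ} (hp : ContDiff ℝ ∞ p) {i : Fin n} {r s : 𝔼 →ᵇ ℂ}
    (hr : ∀ z, wt (1 / 3) z * r z = p z) (hs : ∀ z, wt (1 / 3) z * s z = pd i p z) (g : L2 n) :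
    (gaussOp r g, gaussOp s g) ∈ weakPair n 1 i := by
  refine ⟨locallyIntegrableOn_wt_mul _ _ _, locallyIntegrableOn_wt_mul _ _ _, fun φ hφ => ?_⟩
  rw [Measure.restrict_univ]
  -- the pairing with a test function, computed by Fubini's theorem
  have fub : ∀ (ψ : 𝔼 → ℝ) (t : 𝔼 →ᵇ ℂ), IsTestOn Set.univ ψ →
      ∫ x, ψ x • (wt 1 x * gaussOp t g x) =
        ∫ y, (∫ x, (ψ x : ℂ) * (wt (1 / 3) (x - y) * t (x - y))) * (wt (-1) y * g y) := by
    intro ψ t hψ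
    have e1 : ∫ x, ψ x • (wt 1 x * gaussOp t g x) =
        ∫ x, ∫ y, (ψ x : ℂ) * (wt (1 / 3) (x - y) * t (x - y)) * (wt (-1) y * g y) := by
      refine integral_congr_ae ?_
      filter_upwards [coeFn_gaussOp t g] with x hx
      rw [hx, ← integral_const_mul, real_smul, ← integral_const_mul]
      refine integral_congr_ae (ae_of_all _ fun y => ?_)
      simp only [gaussKernel]
      linear_combination (ψ x : ℂ) * (wt (1 / 3) (x - y) * t (x - y)) * (wt (-1) y * g y) *
        wt_neg_mul 1 x
    have h1 : Integrable fun x : 𝔼 => (ψ x : ℂ) * (wt 1 x * (gs x : ℂ)) := by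
      refine Continuous.integrable_of_hasCompactSupport ?_ (hψ.complex.2.1.mul_right)
      have := hψ.1.continuous
      fun_prop
    have h2 : Integrable fun y : 𝔼 => ((gs y : ℂ)) * g y := by
      refine MemLp.integrable_mul (p := 2) (q := 2) ?_ (Lp.memLp g)
      exact memLp_gs.ofReal
    have hint : Integrable (fun q : 𝔼 × 𝔼 => (ψ q.1 : ℂ) *
        (wt (1 / 3) (q.1 - q.2) * t (q.1 - q.2)) * (wt (-1) q.2 * g q.2))
        ((volume : Measure 𝔼).prod (volume : Measure 𝔼)) := by
      refine ((h1.mul_prod h2).const_mul (‖t‖ : ℂ)).mono ?_ (ae_of_all _ fun q => ?_)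
      · have := hψ.1.continuous
        refine AEStronglyMeasurable.mul (Continuous.aestronglyMeasurable (by fun_prop)) ?_
        exact (AEStronglyMeasurable.mul (Continuous.aestronglyMeasurable (by fun_prop))
          (Lp.aestronglyMeasurable g)).comp_snd
      · simp only [norm_mul, norm_real, norm_norm]
        have k1 := norm_wt_kernel_le q.1 q.2
        have k2 := t.norm_coe_le_norm (q.1 - q.2)
        have k3 : ‖wt 1 q.1‖ * ‖wt (-1) q.1‖ = 1 := by rw [← norm_mul, wt_neg_mul, norm_one]
        have k4 := (gs_pos q.1).le
        have k5 := (gs_pos q.2).le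
        rw [Real.norm_of_nonneg k4, Real.norm_of_nonneg k5]
        calc ‖ψ q.1‖ * (‖wt (1 / 3) (q.1 - q.2)‖ * ‖t (q.1 - q.2)‖) * (‖wt (-1) q.2‖ * ‖g q.2‖)
            = ‖t (q.1 - q.2)‖ * (‖ψ q.1‖ * (‖wt 1 q.1‖ * ‖wt (-1) q.1‖) *
              (‖wt (1 / 3) (q.1 - q.2)‖ * ‖wt (-1) q.2‖) * ‖g q.2‖) := by rw [k3]; ring
          _ = ‖t (q.1 - q.2)‖ * (‖ψ q.1‖ * ‖wt 1 q.1‖ * (‖wt (-1) q.1‖ *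
              ‖wt (1 / 3) (q.1 - q.2)‖ * ‖wt (-1) q.2‖) * ‖g q.2‖) := by ring
          _ ≤ ‖t‖ * (‖ψ q.1‖ * ‖wt 1 q.1‖ * (gs q.1 * gs q.2) * ‖g q.2‖) := by gcongr
          _ = _ := by ring
    rw [e1, integral_integral_swap hint]
    exact integral_congr_ae (ae_of_all _ fun y => integral_mul_const _ _)
  rw [fub _ r (isTestOn_fderiv hφ i), fub φ s hφ, ← integral_neg]
  refine integral_congr_ae (ae_of_all _ fun y => ?_)
  simp only [hr, hs]
  have hφc := hφ.complex
  have hpy : ContDiff ℝ ∞ fun x => p (x - y) := hp.comp (contDiff_id.sub contDiff_const)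
  have hpd : ∀ x, pd i (fun x => p (x - y)) x = pd i p (x - y) := fun x => by
    simp only [pd]
    rw [fderiv_comp_sub]
  have hib := integral_mul_fderiv_eq_neg_fderiv_mul_of_integrable (μ := volume) (𝕜 := ℂ)
    (f := fun x => (φ x : ℂ)) (g := fun x => p (x - y)) (v := EuclideanSpace.single i 1)
    (Continuous.integrable_of_hasCompactSupport
      ((contDiff_pd hφc.1 i).continuous.mul hpy.continuous)
      (HasCompactSupport.mul_right (hφc.2.1.of_isClosed_subset (isClosed_tsupport _)
        (tsupport_pd_subset _ i))))
    (Continuous.integrable_of_hasCompactSupport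
      (hφc.1.continuous.mul (contDiff_pd hpy i).continuous) hφc.2.1.mul_right)
    (Continuous.integrable_of_hasCompactSupport
      (hφc.1.continuous.mul hpy.continuous) hφc.2.1.mul_right)
    (fun x _ => (hφc.1.differentiable (by simp)) x) (fun x _ => (hpy.differentiable (by simp)) x)
  have k1 : ∀ x, ((fderiv ℝ φ x (EuclideanSpace.single i 1) : ℝ) : ℂ) =
      fderiv ℝ (fun x => (φ x : ℂ)) x (EuclideanSpace.single i 1) := fun x =>
    (pd_ofReal hφ.1 i x).symm
  have k2 : ∀ x, pd i p (x - y) =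
      fderiv ℝ (fun x => p (x - y)) x (EuclideanSpace.single i 1) := fun x => (hpd x).symm
  simp only [k1, k2, hib]
  ring

end GaussKernels

/-! ### The Taylor coefficients of the heat kernel -/

section GaussSeries

open scoped BoundedContinuousFunction

/-- The functions `(-|z|²/4)^k / k!`, whose sum is the Gaussian `e^{-|z|²/4}`. -/
def gp (k : ℕ) (z : 𝔼) : ℂ := (((-‖z‖ ^ 2 / 4 : ℝ)) : ℂ) ^ k / k.factorial

lemma gp_zero (z : 𝔼) : gp 0 z = 1 := by simp [gp]

lemma gp_succ (k : ℕ) (z : 𝔼) :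
    gp (k + 1) z = (((k : ℂ) + 1)⁻¹) * (((-‖z‖ ^ 2 / 4 : ℝ)) * gp k z) := by
  have : ((k : ℂ) + 1) ≠ 0 := Nat.cast_add_one_ne_zero k
  have h2 : (k.factorial : ℂ) ≠ 0 := by exact_mod_cast k.factorial_ne_zero
  simp only [gp, Nat.factorial_succ]
  push_cast
  rw [pow_succ]
  field_simp

lemma contDiff_quad : ContDiff ℝ ∞ fun z : 𝔼 => -‖z‖ ^ 2 / 4 :=
  ((contDiff_norm_sq ℝ).neg).div_const _

lemma contDiff_gp (k : ℕ) : ContDiff ℝ ∞ (gp k : 𝔼 → ℂ) :=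
  ((Complex.ofRealCLM.contDiff.comp contDiff_quad).pow k).div_const _

lemma pd_quad (i : Fin n) (z : 𝔼) :
    pd i (fun z : 𝔼 => ((-‖z‖ ^ 2 / 4 : ℝ) : ℂ)) z = -((z i : ℝ) : ℂ) / 2 := by
  rw [pd_ofReal contDiff_quad]
  have h : HasFDerivAt (fun z : 𝔼 => -‖z‖ ^ 2 / 4) ((-(1 / 4 : ℝ)) • (2 • innerSL ℝ z)) z := by
    have := ((hasStrictFDerivAt_norm_sq z).hasFDerivAt).const_mul (-(1 / 4 : ℝ))
    refine this.congr_of_eventuallyEq (Eventually.of_forall fun y => ?_)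
    ring
  rw [h.fderiv]
  simp [EuclideanSpace.inner_single_right]
  ring

lemma pd_const (i : Fin n) (c : ℂ) (x : 𝔼) : pd i (fun _ => c) x = 0 := by simp [pd]

lemma pd_const_mul {f : 𝔼 → ℂ} (hf : ContDiff ℝ ∞ f) (i : Fin n) (c : ℂ) (x : 𝔼) :
    pd i (fun x => c * f x) x = c * pd i f x := by
  rw [pd_mul contDiff_const hf, pd_const, zero_mul, zero_add]

lemma pd_gp_zero (i : Fin n) (z : 𝔼) : pd i (gp 0) z = 0 := by
  have : (gp 0 : 𝔼 → ℂ) = fun _ => 1 := funext gp_zero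
  rw [this, pd_const]

lemma pd_gp_succ (k : ℕ) (i : Fin n) (z : 𝔼) :
    pd i (gp (k + 1)) z = -((z i : ℝ) : ℂ) / 2 * gp k z := by
  have hq : ContDiff ℝ ∞ fun z : 𝔼 => ((-‖z‖ ^ 2 / 4 : ℝ) : ℂ) :=
    Complex.ofRealCLM.contDiff.comp contDiff_quad
  have step : ∀ k : ℕ, pd i (gp (k + 1)) z =
      (((k : ℂ) + 1)⁻¹) * (-((z i : ℝ) : ℂ) / 2 * gp k z +
        ((-‖z‖ ^ 2 / 4 : ℝ)) * pd i (gp k) z) := by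
    intro k
    rw [show (gp (k + 1) : 𝔼 → ℂ) = fun z => (((k : ℂ) + 1)⁻¹) *
      (((-‖z‖ ^ 2 / 4 : ℝ)) * gp k z) from funext (gp_succ k),
      pd_const_mul (hq.mul (contDiff_gp k)), pd_mul hq (contDiff_gp k), pd_quad]
  induction k with
  | zero => rw [step, pd_gp_zero]; simp
  | succ k ih =>
    rw [step, ih]
    have : ((k : ℂ) + 1) ≠ 0 := Nat.cast_add_one_ne_zero k
    have h2 : ((k : ℂ) + 1 + 1) ≠ 0 := by exact_mod_cast (k + 1).cast_add_one_ne_zero (R := ℂ)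
    rw [gp_succ k z]
    push_cast
    field_simp
    ring

lemma contDiff_coord (i : Fin n) : ContDiff ℝ ∞ fun z : 𝔼 => -((z i : ℝ) : ℂ) / 2 :=
  (Complex.ofRealCLM.contDiff.comp
    (EuclideanSpace.proj i : 𝔼 →L[ℝ] ℝ).contDiff).neg.div_const _

lemma pd_coord (i j : Fin n) (z : 𝔼) :
    pd j (fun z : 𝔼 => -((z i : ℝ) : ℂ) / 2) z = if i = j then -1 / 2 else 0 := by
  have h : HasFDerivAt (fun z : 𝔼 => -((z i : ℝ) : ℂ) / 2) ((-(1 / 2 : ℂ)) •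
      (ofRealCLM ∘L (EuclideanSpace.proj i : 𝔼 →L[ℝ] ℝ))) z := by
    have := ((ofRealCLM ∘L
      (EuclideanSpace.proj i : 𝔼 →L[ℝ] ℝ)).hasFDerivAt (x := z)).const_mul
        (-(1 / 2 : ℂ))
    refine this.congr_of_eventuallyEq (Eventually.of_forall fun y => ?_)
    simp
    ring
  rw [pd, h.fderiv]
  by_cases hij : i = j
  · subst hij; simp; norm_num
  · simp [hij]

lemma pd_pd_gp_zero (i j : Fin n) (z : 𝔼) : pd j (pd i (gp 0)) z = 0 := by
  rw [show pd i (gp 0 : 𝔼 → ℂ) = fun _ => 0 from funext (pd_gp_zero i), pd_const]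

lemma pd_pd_gp_succ (k : ℕ) (i j : Fin n) (z : 𝔼) :
    pd j (pd i (gp (k + 1))) z = (if i = j then -1 / 2 else 0) * gp k z +
      -((z i : ℝ) : ℂ) / 2 * pd j (gp k) z := by
  rw [show pd i (gp (k + 1) : 𝔼 → ℂ) = fun z => -((z i : ℝ) : ℂ) / 2 * gp k z from
    funext (pd_gp_succ k i), pd_mul (contDiff_coord i) (contDiff_gp k), pd_coord]

lemma norm_gp (k : ℕ) (z : 𝔼) : ‖gp k z‖ = (‖z‖ ^ 2 / 4) ^ k / k.factorial := by
  rw [gp, norm_div, norm_pow, norm_real, Complex.norm_natCast, neg_div, norm_neg,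
    Real.norm_of_nonneg (by positivity)]

/-- Bound for the Taylor terms and their derivatives. -/
def gpBound (k : ℕ) : ℝ := 4 * (k + 1) * (3 / 4) ^ k

lemma quad_pow_le (k : ℕ) {t : ℝ} (ht : 0 ≤ t) :
    (t / 4) ^ k / k.factorial ≤ (3 / 4) ^ k * Real.exp (t / 3) := by
  have h := Real.pow_div_factorial_le_exp (t / 3) (by positivity) k
  have e : (t / 4) ^ k / k.factorial = (3 / 4) ^ k * ((t / 3) ^ k / k.factorial) := by
    rw [← mul_div_assoc, ← mul_pow]; congr 2; ring
  rw [e]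
  gcongr

lemma norm_coord_le (i : Fin n) (z : 𝔼) : ‖-((z i : ℝ) : ℂ) / 2‖ ≤ ‖z‖ / 2 := by
  rw [norm_div, norm_neg, norm_real]
  have := PiLp.norm_apply_le z i
  simp only [Complex.norm_ofNat]
  gcongr

lemma norm_gp_le (k : ℕ) (z : 𝔼) : ‖gp k z‖ ≤ gpBound k * Real.exp (‖z‖ ^ 2 / 3) := by
  rw [norm_gp]
  refine (quad_pow_le k (sq_nonneg _)).trans ?_
  unfold gpBound
  gcongr
  have : (0 : ℝ) < (3 / 4) ^ k := by positivity
  have h2 : (0 : ℝ) ≤ k := Nat.cast_nonneg k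
  nlinarith

lemma norm_pd_gp_le (k : ℕ) (i : Fin n) (z : 𝔼) :
    ‖pd i (gp k) z‖ ≤ gpBound k * Real.exp (‖z‖ ^ 2 / 3) := by
  cases k with
  | zero => rw [pd_gp_zero, norm_zero, gpBound]; positivity
  | succ k =>
    rw [pd_gp_succ, norm_mul, norm_gp]
    have h1 := norm_coord_le i z
    set t := ‖z‖ ^ 2 with ht
    have ht0 : 0 ≤ t := sq_nonneg _
    have h2 : ‖z‖ / 2 ≤ 1 + t / 4 := by nlinarith [sq_nonneg (‖z‖ / 2 - 1)]
    have e : (t / 4) * ((t / 4) ^ k / k.factorial) =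
        (k + 1) * ((t / 4) ^ (k + 1) / (k + 1).factorial) := by
      have h2 : (k.factorial : ℝ) ≠ 0 := by exact_mod_cast k.factorial_ne_zero
      rw [Nat.factorial_succ, pow_succ]; push_cast; field_simp
    have q1 := quad_pow_le k ht0
    have q2 := quad_pow_le (k + 1) ht0
    have hE := Real.exp_pos (t / 3)
    have hk : (0 : ℝ) ≤ k := Nat.cast_nonneg k
    have hp : (0 : ℝ) < (3 / 4) ^ k := by positivity
    calc ‖-((z i : ℝ) : ℂ) / 2‖ * ((t / 4) ^ k / k.factorial)
        ≤ (1 + t / 4) * ((t / 4) ^ k / k.factorial) := by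
          gcongr; exact h1.trans h2
      _ = (t / 4) ^ k / k.factorial + (k + 1) * ((t / 4) ^ (k + 1) / (k + 1).factorial) := by
          rw [add_mul, one_mul, e]
      _ ≤ (3 / 4) ^ k * Real.exp (t / 3) + (k + 1) * ((3 / 4) ^ (k + 1) * Real.exp (t / 3)) := by
          gcongr
      _ ≤ gpBound (k + 1) * Real.exp (t / 3) := by
          have : 0 < (3 / 4) ^ k * Real.exp (t / 3) := by positivity
          rw [gpBound, pow_succ]; push_cast; nlinarith

lemma norm_pd_pd_gp_le (k : ℕ) (i j : Fin n) (z : 𝔼) :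
    ‖pd j (pd i (gp k)) z‖ ≤ gpBound k * Real.exp (‖z‖ ^ 2 / 3) := by
  have hδ : ∀ i j : Fin n, ‖(if i = j then -1 / 2 else 0 : ℂ)‖ ≤ 1 := by
    intro i j; split_ifs <;> norm_num
  set t := ‖z‖ ^ 2 with ht
  have ht0 : 0 ≤ t := sq_nonneg _
  have hE := Real.exp_pos (t / 3)
  rcases k with _ | _ | k
  · rw [pd_pd_gp_zero, norm_zero, gpBound]; positivity
  · rw [pd_pd_gp_succ, pd_gp_zero, mul_zero, add_zero, norm_mul, gp_zero, norm_one, mul_one, gpBound]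
    have := Real.one_le_exp (show 0 ≤ t / 3 by positivity)
    have := hδ i j
    norm_num
    linarith
  · rw [pd_pd_gp_succ, pd_gp_succ]
    have h1 := norm_coord_le i z
    have h2 := norm_coord_le j z
    have h3 : ‖-((z i : ℝ) : ℂ) / 2‖ * ‖-((z j : ℝ) : ℂ) / 2‖ ≤ t / 4 := by
      calc _ ≤ (‖z‖ / 2) * (‖z‖ / 2) := by gcongr
        _ = t / 4 := by rw [ht]; ring
    have e : (t / 4) * ((t / 4) ^ k / k.factorial) =
        (k + 1) * ((t / 4) ^ (k + 1) / (k + 1).factorial) := by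
      have h2 : (k.factorial : ℝ) ≠ 0 := by exact_mod_cast k.factorial_ne_zero
      rw [Nat.factorial_succ, pow_succ]; push_cast; field_simp
    have q2 := quad_pow_le (k + 1) ht0
    have hk : (0 : ℝ) ≤ k := Nat.cast_nonneg k
    calc _ ≤ 1 * ‖gp (k + 1) z‖ + t / 4 * ‖gp k z‖ := by
          refine (norm_add_le _ _).trans ?_
          rw [norm_mul, norm_mul, norm_mul, ← mul_assoc]
          have := hδ i j
          gcongr
      _ = (k + 2) * ((t / 4) ^ (k + 1) / (k + 1).factorial) := by
          rw [norm_gp, norm_gp, ← ht, e]; ring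
      _ ≤ (k + 2) * ((3 / 4) ^ (k + 1) * Real.exp (t / 3)) := by gcongr
      _ ≤ gpBound (k + 2) * Real.exp (t / 3) := by
          have h6 : (0 : ℝ) < (3 / 4) ^ k := by positivity
          rw [gpBound, pow_succ _ (k + 1), pow_succ _ k]
          push_cast
          generalize (3 / 4 : ℝ) ^ k = P at h6 ⊢
          generalize Real.exp (t / 3) = X at hE ⊢
          have h7 : 0 < P * X := by positivity
          have h8 : 0 ≤ k * (P * X) := by positivity
          linarith

lemma norm_wt_mul_le {p : 𝔼 → ℂ} {C : ℝ} (h : ∀ z, ‖p z‖ ≤ C * Real.exp (‖z‖ ^ 2 / 3)) (z : 𝔼) :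
    ‖wt (-(1 / 3)) z * p z‖ ≤ C := by
  rw [norm_mul, norm_wt]
  calc _ ≤ Real.exp (-(1 / 3) * ‖z‖ ^ 2) * (C * Real.exp (‖z‖ ^ 2 / 3)) := by gcongr; exact h z
    _ = C * Real.exp (-(1 / 3) * ‖z‖ ^ 2 + ‖z‖ ^ 2 / 3) := by rw [Real.exp_add]; ring
    _ = C := by rw [show -(1 / 3) * ‖z‖ ^ 2 + ‖z‖ ^ 2 / 3 = 0 by ring, Real.exp_zero, mul_one]

/-- A function of growth `e^{|z|²/3}`, divided by this weight. -/
def bcf (p : 𝔼 → ℂ) (hp : Continuous p) (C : ℝ)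
    (h : ∀ z, ‖p z‖ ≤ C * Real.exp (‖z‖ ^ 2 / 3)) : 𝔼 →ᵇ ℂ :=
  BoundedContinuousFunction.ofNormedAddCommGroup (fun z => wt (-(1 / 3)) z * p z)
    ((continuous_wt _).mul hp) C (norm_wt_mul_le h)

lemma norm_bcf_le {p : 𝔼 → ℂ} {hp : Continuous p} {C : ℝ} (hC : 0 ≤ C)
    {h : ∀ z, ‖p z‖ ≤ C * Real.exp (‖z‖ ^ 2 / 3)} : ‖bcf p hp C h‖ ≤ C :=
  BoundedContinuousFunction.norm_ofNormedAddCommGroup_le _ hC _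

lemma wt_mul_bcf {p : 𝔼 → ℂ} {hp : Continuous p} {C : ℝ}
    {h : ∀ z, ‖p z‖ ≤ C * Real.exp (‖z‖ ^ 2 / 3)} (z : 𝔼) :
    wt (1 / 3) z * bcf p hp C h z = p z := by
  change wt (1 / 3) z * (wt (-(1 / 3)) z * p z) = p z
  rw [← mul_assoc, wt_neg_mul, one_mul]

lemma gpBound_nonneg (k : ℕ) : 0 ≤ gpBound k := by unfold gpBound; positivity

variable (n) in
/-- The `k`-th Taylor term of the heat kernel as a weighted function. -/
def gbc (k : ℕ) : 𝔼 →ᵇ ℂ :=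
  bcf (gp k) (contDiff_gp k).continuous (gpBound k) (norm_gp_le k)

/-- The gradient of the `k`-th Taylor term of the heat kernel as a weighted function. -/
def gbcGrad (k : ℕ) (i : Fin n) : 𝔼 →ᵇ ℂ :=
  bcf (pd i (gp k)) (contDiff_pd (contDiff_gp k) i).continuous (gpBound k) (norm_pd_gp_le k i)

/-- The Hessian of the `k`-th Taylor term of the heat kernel as a weighted function. -/
def gbcHess (k : ℕ) (i j : Fin n) : 𝔼 →ᵇ ℂ :=
  bcf (pd j (pd i (gp k))) (contDiff_pd (contDiff_pd (contDiff_gp k) i) j).continuous (gpBound k)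
    (norm_pd_pd_gp_le k i j)

lemma gaussOp_gbc_mem (k : ℕ) (v : L2 n) : (gaussOp (gbc n k) v, (fun i => gaussOp (gbcGrad k i) v),
    fun i j => gaussOp (gbcHess k i j) v) ∈ jetSpace n 1 :=
  ⟨fun _ => gaussOp_weakPair (contDiff_gp k) wt_mul_bcf wt_mul_bcf v,
    fun i _ => gaussOp_weakPair (contDiff_pd (contDiff_gp k) i) wt_mul_bcf wt_mul_bcf v⟩

/-- The operator into jets with the given entries. -/
def JetSpace.ofEntries {c : ℝ} (S : L2 n →L[ℂ] L2 n) (S' : Fin n → L2 n →L[ℂ] L2 n)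
    (S'' : Fin n → Fin n → L2 n →L[ℂ] L2 n)
    (h : ∀ v, (S v, (fun i => S' i v), fun i j => S'' i j v) ∈ jetSpace n c) :
    L2 n →L[ℂ] JetSpace n c :=
  JetSpace.lift (S.prod ((pi S').prod
    (pi fun i => pi (S'' i)))) h

variable (n) in
/-- The convolution operators with the Taylor terms of the heat kernel, between Gaussian weights,
with values in the weighted Sobolev space. -/
def gaussJet (k : ℕ) : L2 n →L[ℂ] JetSpace n 1 :=
  JetSpace.ofEntries (gaussOp (gbc n k)) (fun i => gaussOp (gbcGrad k i))
    (fun i j => gaussOp (gbcHess k i j)) (gaussOp_gbc_mem k)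

lemma gaussJet_fst (k : ℕ) (v : L2 n) : (gaussJet n k v).val.1 = gaussOp (gbc n k) v := rfl

lemma norm_gaussJet_le (k : ℕ) :
    ‖gaussJet n k‖ ≤ ‖(gaussOp : (𝔼 →ᵇ ℂ) →L[ℂ] L2 n →L[ℂ] L2 n)‖ * gpBound k := by
  have key : ∀ r : 𝔼 →ᵇ ℂ, ‖r‖ ≤ gpBound k → ∀ v : L2 n, ‖gaussOp r v‖ ≤
      ‖(gaussOp : (𝔼 →ᵇ ℂ) →L[ℂ] L2 n →L[ℂ] L2 n)‖ * gpBound k * ‖v‖ := by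
    intro r hr v
    refine ((gaussOp r).le_opNorm v).trans ?_
    gcongr
    refine ((gaussOp).le_opNorm r).trans ?_
    gcongr
  have h0 := gpBound_nonneg k
  refine opNorm_le_bound _ (by positivity) fun v => ?_
  have hM : 0 ≤ ‖(gaussOp : (𝔼 →ᵇ ℂ) →L[ℂ] L2 n →L[ℂ] L2 n)‖ * gpBound k * ‖v‖ := by positivity
  rw [← JetSpace.norm_val]
  change max _ (max _ _) ≤ _
  exact max_le (key _ (norm_bcf_le h0) v) (max_le
    ((pi_norm_le_iff_of_nonneg hM).2 fun i => key _ (norm_bcf_le h0) v)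
    ((pi_norm_le_iff_of_nonneg hM).2 fun i =>
      (pi_norm_le_iff_of_nonneg hM).2 fun j => key _ (norm_bcf_le h0) v))

lemma summable_gpBound : Summable gpBound := by
  have h1 := summable_pow_mul_geometric_of_norm_lt_one (R := ℝ) 1 (r := 3 / 4) (by norm_num)
  have h2 := summable_geometric_of_lt_one (r := (3 / 4 : ℝ)) (by norm_num) (by norm_num)
  refine ((h1.add h2).mul_left 4).congr fun k => ?_
  unfold gpBound
  ring

/-- The entries of order at most one of a jet. -/
def jetLow (n : ℕ) (c : ℝ) : Option (Fin n) → JetSpace n c →L[ℂ] L2 n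
  | none => ContinuousLinearMap.fst ℂ _ _ ∘L JetSpace.val
  | some i => proj i ∘L ContinuousLinearMap.fst ℂ _ _ ∘L
      ContinuousLinearMap.snd ℂ _ _ ∘L JetSpace.val

lemma isCompactOperator_jetLow_gaussJet (k : ℕ) (α : Option (Fin n)) :
    IsCompactOperator (jetLow n 1 α ∘L gaussJet n k) := by
  cases α with
  | none => exact isCompactOperator_gaussOp (gbc n k)
  | some i => exact isCompactOperator_gaussOp (gbcGrad k i)

/-- As the zeroth Taylor term is constant, its convolution operator has rank one. -/
lemma finiteDimensional_range_gaussJet_zero :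
    FiniteDimensional ℂ (LinearMap.range (gaussJet n 0).toLinearMap) := by
  have hγ : MemLp (wt (-1) : 𝔼 → ℂ) 2 volume := by
    refine memLp_gs.mono (continuous_wt _).aestronglyMeasurable (ae_of_all _ fun x => ?_)
    rw [norm_wt, gs, Real.norm_eq_abs, Real.abs_exp]
    exact Real.exp_le_exp.2 (by nlinarith [sq_nonneg ‖x‖])
  have h1 : ∀ v : L2 n, (gaussJet n 0 v).val.1 = (∫ y, wt (-1) y * v y) • hγ.toLp _ := by
    intro v
    rw [gaussJet_fst]
    refine Lp.ext ?_
    filter_upwards [coeFn_gaussOp (gbc n 0) v, hγ.coeFn_toLp,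
      Lp.coeFn_smul (∫ y, wt (-1) y * v y) (hγ.toLp _)] with x e1 e2 e3
    rw [e1, e3, Pi.smul_apply, e2, smul_eq_mul, mul_comm, ← integral_const_mul]
    refine integral_congr_ae (ae_of_all _ fun y => ?_)
    simp only [gaussKernel, gbc, wt_mul_bcf, gp_zero]
    ring
  let f : LinearMap.range (gaussJet n 0).toLinearMap →ₗ[ℂ] L2 n :=
    (jetLow n 1 none).toLinearMap ∘ₗ Submodule.subtype _
  have hf : ∀ w, f w ∈ Submodule.span ℂ {hγ.toLp _} := by
    rintro ⟨_, v, rfl⟩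
    change (gaussJet n 0 v).val.1 ∈ _
    rw [h1]
    exact Submodule.smul_mem _ _ (Submodule.mem_span_singleton_self _)
  refine FiniteDimensional.of_injective (f.codRestrict _ hf) fun w w' h => ?_
  exact Subtype.ext (JetSpace.ext (congrArg Subtype.val h))

end GaussSeries

/-! ### Series of convolution operators -/

section GaussSum

open scoped BoundedContinuousFunction

lemma hasSum_smul_of_bounded {F : Type*} [NormedAddCommGroup F] [NormedSpace ℂ F] [CompleteSpace F]
    {T : ℕ → F} {M : ℕ → ℝ} (hM : Summable M) (hT : ∀ k, ‖T k‖ ≤ M k) {a : ℕ → ℂ} {C : ℝ}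
    (ha : ∀ k, ‖a k‖ ≤ C) : HasSum (fun k => a k • T k) (∑' k, a k • T k) := by
  refine (Summable.of_norm_bounded (hM.mul_left C) fun k => ?_).hasSum
  rw [norm_smul]
  have h0 : 0 ≤ C := (norm_nonneg _).trans (ha 0)
  exact mul_le_mul (ha k) (hT k) (norm_nonneg _) h0

lemma analyticAt_tsum_smul {F : Type*} [NormedAddCommGroup F] [NormedSpace ℂ F] [CompleteSpace F]
    {T : ℕ → F} {M : ℕ → ℝ} (hM : Summable M) (hT : ∀ k, ‖T k‖ ≤ M k) {a : ℂ → ℕ → ℂ}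
    (ha : ∀ k, Differentiable ℂ fun z => a z k) {z₀ : ℂ} {C : ℝ}
    (hC : ∀ z ∈ Metric.ball z₀ 1, ∀ k, ‖a z k‖ ≤ C) :
    AnalyticAt ℂ (fun z => ∑' k, a z k • T k) z₀ := by
  have h0 : 0 ≤ C := (norm_nonneg _).trans (hC z₀ (Metric.mem_ball_self one_pos) 0)
  have : DifferentiableOn ℂ (fun z => ∑' k, a z k • T k) (Metric.ball z₀ 1) :=
    Complex.differentiableOn_tsum_of_summable_norm (hM.mul_left C)
      (fun k => ((ha k).smul_const _).differentiableOn) Metric.isOpen_ball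
      fun k z hz => by
        rw [norm_smul]
        exact mul_le_mul (hC z hz k) (hT k) (norm_nonneg _) h0
  exact this.analyticAt (Metric.ball_mem_nhds _ one_pos)

/-- The solution of `a(j+1) = (e^μ + μ a(j)) / (s + j)`. The integrals `∫₁^∞ t^{-s-j} e^{μt} dt`
satisfy this recurrence, which makes sense for all `μ`. -/
def gammaSeq (s : ℝ) (μ g : ℂ) : ℕ → ℂ
  | 0 => g
  | j + 1 => (Complex.exp μ + μ * gammaSeq s μ g j) / (s + j)

lemma exists_bound_of_recurrence {s L : ℝ} (hs : 0 < s) (hL : 0 ≤ L) (G : ℝ) :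
    ∃ C, ∀ a : ℕ → ℝ, a 0 ≤ G → (∀ j, 0 ≤ a j) →
      (∀ j, a (j + 1) ≤ (Real.exp L + L * a j) / (s + j)) → ∀ j, a j ≤ C := by
  -- a majorizing sequence
  let b : ℕ → ℝ := fun j => Nat.rec |G| (fun j x => (Real.exp L + L * x) / (s + j)) j
  have hb0 : ∀ j, 0 ≤ b j := fun j => by
    induction j with
    | zero => exact abs_nonneg G
    | succ j ih => exact div_nonneg (by positivity) (by positivity)
  have hbs : ∀ j, b (j + 1) = (Real.exp L + L * b j) / (s + j) := fun j => rfl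
  obtain ⟨J, hJ⟩ := exists_nat_gt (2 * L + 1)
  have hJ' : ∀ j ≥ J, b (j + 1) ≤ Real.exp L + b j / 2 := fun j hj => by
    have h1 : (J : ℝ) ≤ j := by exact_mod_cast hj
    rw [hbs, div_le_iff₀ (by positivity)]
    have := Real.exp_pos L
    nlinarith [hb0 j]
  refine ⟨∑ i ∈ Finset.range (J + 1), b i + 2 * Real.exp L, fun a h0 hpos hrec j => ?_⟩
  have hab : ∀ j, a j ≤ b j := fun j => by
    induction j with
    | zero => exact h0.trans (le_abs_self G)
    | succ j ih =>
      refine (hrec j).trans ?_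
      rw [hbs]
      gcongr
  refine (hab j).trans ?_
  have hE := Real.exp_pos L
  have hsum : ∀ i ≤ J, b i ≤ ∑ i ∈ Finset.range (J + 1), b i := fun i hi =>
    Finset.single_le_sum (f := b) (fun i _ => hb0 i) (Finset.mem_range.2 (by omega))
  rcases le_total j J with hj | hj
  · linarith [hsum j hj]
  · induction j, hj using Nat.le_induction with
    | base => linarith [hsum J le_rfl]
    | succ j hj ih =>
      have h1 := hJ' j hj
      have h2 : 0 ≤ ∑ i ∈ Finset.range (J + 1), b i := Finset.sum_nonneg fun i _ => hb0 i
      linarith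

lemma exists_bound_gammaSeq {s L : ℝ} (hs : 0 < s) (hL : 0 ≤ L) (G : ℝ) :
    ∃ C, ∀ μ g : ℂ, ‖μ‖ ≤ L → ‖g‖ ≤ G → ∀ j, ‖gammaSeq s μ g j‖ ≤ C := by
  obtain ⟨C, hC⟩ := exists_bound_of_recurrence hs hL G
  refine ⟨C, fun μ g hμ hg => hC _ hg (fun j => norm_nonneg _) fun j => ?_⟩
  have h1 : ‖((s : ℂ) + j)‖ = s + j := by
    rw [← Complex.ofReal_natCast, ← Complex.ofReal_add, norm_real,
      Real.norm_of_nonneg (by positivity)]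
  rw [gammaSeq, norm_div, h1]
  gcongr
  refine (norm_add_le _ _).trans ?_
  rw [norm_mul, Complex.norm_exp]
  have := (Complex.re_le_norm μ).trans hμ
  gcongr

lemma differentiable_gammaSeq {s : ℝ} {μ g : ℂ → ℂ} (hμ : Differentiable ℂ μ)
    (hg : Differentiable ℂ g) (j : ℕ) : Differentiable ℂ fun z => gammaSeq s (μ z) (g z) j := by
  induction j with
  | zero => exact hg
  | succ j ih =>
    simp only [gammaSeq]
    fun_prop

variable (n) in
/-- The operator with kernel `e^{-|x|²} (∑ₖ aₖ (-|x - y|²/4)^k / k!) e^{-|y|²}`. -/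
def gaussSum (a : ℕ → ℂ) : L2 n →L[ℂ] JetSpace n 1 := ∑' k, a k • gaussJet n k

lemma hasSum_gaussSum {a : ℕ → ℂ} {C : ℝ} (ha : ∀ k, ‖a k‖ ≤ C) :
    HasSum (fun k => a k • gaussJet n k) (gaussSum n a) :=
  hasSum_smul_of_bounded (summable_gpBound.mul_left _) norm_gaussJet_le ha

lemma analyticAt_gaussSum {a : ℂ → ℕ → ℂ} (ha : ∀ k, Differentiable ℂ fun z => a z k) {z₀ : ℂ}
    {C : ℝ} (hC : ∀ z ∈ Metric.ball z₀ 1, ∀ k, ‖a z k‖ ≤ C) :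
    AnalyticAt ℂ (fun z => gaussSum n (a z)) z₀ :=
  analyticAt_tsum_smul (summable_gpBound.mul_left _) norm_gaussJet_le ha hC

lemma isCompactOperator_jetLow_gaussSum {a : ℕ → ℂ} {C : ℝ} (ha : ∀ k, ‖a k‖ ≤ C)
    (α : Option (Fin n)) : IsCompactOperator (jetLow n 1 α ∘L gaussSum n a) := by
  have h1 := (compL ℂ (L2 n) (JetSpace n 1) (L2 n) (jetLow n 1 α)).hasSum
    (hasSum_gaussSum ha)
  refine isCompactOperator_of_tendsto h1 (Eventually.of_forall fun s => ?_)
  refine Finset.sum_induction _ (fun T : L2 n →L[ℂ] L2 n => IsCompactOperator T)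
    (fun _ _ h h' => h.add h') isCompactOperator_zero fun k _ => ?_
  rw [map_smul]
  exact (isCompactOperator_jetLow_gaussJet k α).smul (a k)

lemma gaussSum_fst {a : ℕ → ℂ} {C : ℝ} (ha : ∀ k, ‖a k‖ ≤ C) :
    ∃ r : 𝔼 →ᵇ ℂ, (∀ v, (gaussSum n a v).val.1 = gaussOp r v) ∧
      ∀ z, HasSum (fun k => a k * gp k z) (wt (1 / 3) z * r z) := by
  have hr := hasSum_smul_of_bounded summable_gpBound
    (fun k => (norm_bcf_le (gpBound_nonneg k) : ‖gbc n k‖ ≤ gpBound k)) ha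
  refine ⟨∑' k, a k • gbc n k, fun v => ?_, fun z => ?_⟩
  · have h1 := (jetLow n 1 none).hasSum
      ((ContinuousLinearMap.apply ℂ (JetSpace n 1) v).hasSum (hasSum_gaussSum (n := n) ha))
    have h2 := (ContinuousLinearMap.apply ℂ (L2 n) v).hasSum (gaussOp.hasSum hr)
    refine h1.unique ((congrArg (HasSum · _) (funext fun k => ?_)).mp h2)
    change gaussOp (a k • gbc n k) v = (jetLow n 1 none) (a k • gaussJet n k v)
    rw [map_smul, map_smul]
    rfl
  · have h2 := ((BoundedContinuousFunction.evalCLM ℂ z).hasSum hr).mul_left (wt (1 / 3) z)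
    refine (congrArg (HasSum · _) (funext fun k => ?_)).mp h2
    change wt (1 / 3) z * (a k * gbc n k z) = _
    rw [mul_left_comm, gbc, wt_mul_bcf]

end GaussSum

/-! ### Exponential integrals -/

section ExpIntegrals

/-- The integrand `t^{-s} e^{-bt}`. -/
def expInt (s b t : ℝ) : ℝ := t ^ (-s) * Real.exp (-b * t)

/-- The exponential integral `∫₁^∞ t^{-s} e^{-bt} dt`. -/
def expE (s b : ℝ) : ℝ := ∫ t in Set.Ioi 1, expInt s b t

lemma expInt_nonneg {s b t : ℝ} (ht : 1 < t) : 0 ≤ expInt s b t := by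
  unfold expInt; positivity

lemma measurable_expInt (s b : ℝ) : Measurable (expInt s b) := by unfold expInt; fun_prop

lemma integrableOn_expInt {s b : ℝ} (hs : -1 ≤ s) (hb : 0 < b) :
    IntegrableOn (expInt s b) (Set.Ioi 1) := by
  have h := (integrableOn_rpow_mul_exp_neg_mul_rpow (s := 1) (p := 1) (b := b) (by norm_num)
    one_pos hb).mono_set (Set.Ioi_subset_Ioi zero_le_one)
  refine Integrable.mono' h (measurable_expInt s b).aestronglyMeasurable ?_
  filter_upwards [ae_restrict_mem measurableSet_Ioi] with t ht
  have ht : 1 < t := ht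
  rw [Real.norm_of_nonneg (expInt_nonneg ht), expInt, Real.rpow_one t]
  have h2 : t ^ (-s) ≤ t ^ (1 : ℝ) := Real.rpow_le_rpow_of_exponent_le ht.le (by linarith)
  rw [Real.rpow_one] at h2
  gcongr

lemma hasDerivAt_expInt {s b t : ℝ} (ht : 0 < t) :
    HasDerivAt (expInt s b) (-s * expInt (s + 1) b t - b * expInt s b t) t := by
  have h1 := Real.hasDerivAt_rpow_const (p := -s) (Or.inl ht.ne')
  have h2 : HasDerivAt (fun t => Real.exp (-b * t)) (Real.exp (-b * t) * (-b)) t := by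
    simpa using ((hasDerivAt_id t).const_mul (-b)).exp
  refine (h1.mul h2).congr_deriv ?_
  simp only [expInt]
  rw [show -s - 1 = -(s + 1) by ring]
  ring

/-- Integration by parts. -/
lemma expE_succ {s b : ℝ} (hs : -1 ≤ s) (hb : 0 < b) :
    s * expE (s + 1) b = Real.exp (-b) - b * expE s b := by
  have hlim : Tendsto (expInt s b) atTop (𝓝 0) := by
    have := tendsto_rpow_mul_exp_neg_mul_atTop_nhds_zero (-s) b hb
    exact this
  have i1 := (integrableOn_expInt (s := s + 1) (by linarith) hb).const_mul (-s)
  have i2 := (integrableOn_expInt hs hb).const_mul b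
  have h := integral_Ioi_of_hasDerivAt_of_tendsto (a := 1) (f := expInt s b)
    (hasDerivAt_expInt one_pos).continuousAt.continuousWithinAt
    (fun t ht => hasDerivAt_expInt (zero_lt_one.trans ht)) (i1.sub i2) hlim
  rw [integral_sub i1 i2, integral_const_mul, integral_const_mul] at h
  have e : expInt s b 1 = Real.exp (-b) := by simp [expInt]
  rw [e] at h
  unfold expE
  linarith

lemma hasDerivAt_expE {s b : ℝ} (hs : 0 ≤ s) (hb : 0 < b) :
    HasDerivAt (expE s) (-expE (s - 1) b) b := by
  have h := hasDerivAt_integral_of_dominated_loc_of_deriv_le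
    (μ := volume.restrict (Set.Ioi 1)) (F := fun b t => expInt s b t)
    (F' := fun b t => -expInt (s - 1) b t) (x₀ := b) (s := Metric.ball b (b / 2))
    (bound := expInt (s - 1) (b / 2)) (Metric.ball_mem_nhds _ (by positivity))
    (Eventually.of_forall fun b => (measurable_expInt s b).aestronglyMeasurable)
    (integrableOn_expInt (by linarith) hb) (measurable_expInt _ b).neg.aestronglyMeasurable ?_
    (integrableOn_expInt (by linarith) (by positivity)) ?_
  · have := h.2
    rw [integral_neg] at this
    exact this
  · filter_upwards [ae_restrict_mem measurableSet_Ioi] with t ht x hx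
    have ht : 1 < t := ht
    rw [norm_neg, Real.norm_of_nonneg (expInt_nonneg ht), expInt, expInt]
    rw [Metric.mem_ball, Real.dist_eq, abs_lt] at hx
    have : b / 2 ≤ x := by linarith
    gcongr
  · filter_upwards [ae_restrict_mem measurableSet_Ioi] with t ht x hx
    have ht : 1 < t := ht
    have h2 : HasDerivAt (fun b => Real.exp (-b * t)) (Real.exp (-x * t) * (-t)) x := by
      simpa using ((hasDerivAt_id x).neg.mul_const t).exp
    refine (h2.const_mul (t ^ (-s))).congr_deriv ?_
    simp only [expInt]
    rw [show -(s - 1) = -s + 1 by ring, Real.rpow_add_one (by positivity)]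
    ring

lemma expE_nonneg (s b : ℝ) : 0 ≤ expE s b :=
  setIntegral_nonneg measurableSet_Ioi fun _ ht => expInt_nonneg ht

lemma expE_le {s s' b : ℝ} (hs : -1 ≤ s) (hss : s ≤ s') (hb : 0 < b) : expE s' b ≤ expE s b := by
  refine setIntegral_mono_on (integrableOn_expInt (hs.trans hss) hb) (integrableOn_expInt hs hb)
    measurableSet_Ioi fun t ht => ?_
  have ht : 1 < t := ht
  unfold expInt
  gcongr
  linarith

/-- The exponential integrals satisfy the recurrence of `gammaSeq`. -/
lemma gammaSeq_expE {s b : ℝ} (hs : 0 < s) (hb : 0 < b) (j : ℕ) :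
    gammaSeq s (-b : ℝ) (expE s b : ℝ) j = (expE (s + j) b : ℝ) := by
  induction j with
  | zero => simp [gammaSeq]
  | succ j ih =>
    have hne : (0 : ℝ) < s + j := by positivity
    have h := expE_succ (s := s + j) (by linarith) hb
    have h' : ((s + j : ℝ) : ℂ) * (expE (s + j + 1) b : ℝ) = (Real.exp (-b) : ℝ) - b * (expE (s + j) b : ℝ) := by
      exact_mod_cast h
    rw [gammaSeq, ih, div_eq_iff (by exact_mod_cast hne.ne')]
    push_cast at h' ⊢
    rw [show s + ((j : ℝ) + 1) = s + j + 1 by ring]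
    linear_combination -h'

lemma exists_primitive {f : ℂ → ℂ} (hf : Differentiable ℂ f) (z₀ c : ℂ) :
    ∃ F : ℂ → ℂ, (∀ z, HasDerivAt F (f z) z) ∧ F z₀ = c := by
  obtain ⟨F, hF⟩ := hf.isExactOn_univ
  refine ⟨fun z => F z + (c - F z₀), fun z => (hF z (Set.mem_univ z)).add_const _, by ring⟩

/-- Two functions on an open half line with equal derivatives and a common value are equal. -/
lemma eq_of_hasDerivAt {f g f' : ℝ → ℂ} {s : Set ℝ} (hs : Convex ℝ s) (hso : IsOpen s)
    (hf : ∀ t ∈ s, HasDerivAt f (f' t) t) (hg : ∀ t ∈ s, HasDerivAt g (f' t) t) {t₀ : ℝ}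
    (h0 : t₀ ∈ s) (h : f t₀ = g t₀) : ∀ t ∈ s, f t = g t := by
  intro t ht
  have hd : ∀ x ∈ s, HasDerivAt (fun t => f t - g t) 0 x := fun x hx =>
    ((hf x hx).sub (hg x hx)).congr_deriv (sub_self _)
  have := hs.is_const_of_fderivWithin_eq_zero (𝕜 := ℝ) (f := fun t => f t - g t)
    (fun x hx => (hd x hx).differentiableAt.differentiableWithinAt) (fun x hx => by
      rw [fderivWithin_of_isOpen hso hx, (hd x hx).hasFDerivAt.fderiv]; ext; simp) ht h0
  simp only [h, sub_self] at this
  exact sub_eq_zero.1 this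

/-- For half-integral order the exponential integral continues to the punctured plane, with a
pole at the origin. -/
lemma exists_expE_half : ∃ y : ℂ → ℂ, Differentiable ℂ y ∧
    ∀ t : ℝ, 0 < t → y (t * I) = t * (expE (1 / 2) (t ^ 2) : ℝ) := by
  obtain ⟨y, hy, hy0⟩ := exists_primitive (f := fun z => 2 * I * Complex.exp (z ^ 2))
    (by fun_prop) I ((expE (1 / 2) 1 : ℝ) : ℂ)
  refine ⟨y, fun z => (hy z).differentiableAt, ?_⟩
  refine eq_of_hasDerivAt (f' := fun t => -2 * Complex.exp (-((t ^ 2 : ℝ) : ℂ))) (convex_Ioi 0)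
    isOpen_Ioi (fun t _ => ?_) (fun t ht => ?_) (t₀ := 1) (Set.mem_Ioi.2 one_pos) ?_
  · have h1 : HasDerivAt (fun t : ℝ => (t : ℂ) * I) I t := by
      simpa using (Complex.ofRealCLM.hasDerivAt (x := t)).mul_const I
    refine ((hy _).comp t h1).congr_deriv ?_
    have : ((t : ℂ) * I) ^ 2 = -((t ^ 2 : ℝ) : ℂ) := by
      rw [mul_pow, I_sq]; push_cast; ring
    rw [this]
    linear_combination 2 * Complex.exp (-((t ^ 2 : ℝ) : ℂ)) * Complex.I_mul_I
  · have ht : 0 < t := ht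
    have h1 : HasDerivAt (fun t : ℝ => t * expE (1 / 2) (t ^ 2)) (-2 * Real.exp (-t ^ 2)) t := by
      have h2 := (hasDerivAt_expE (s := 1 / 2) (b := t ^ 2) (by norm_num) (by positivity)).comp t
        (hasDerivAt_pow 2 t)
      refine ((hasDerivAt_id t).mul h2).congr_deriv ?_
      have h3 := expE_succ (s := -(1 / 2)) (b := t ^ 2) (by norm_num) (by positivity)
      norm_num at h3 ⊢
      linarith
    have := h1.ofReal_comp
    convert this using 1
    · funext t; push_cast; rfl
    · push_cast; rfl
  · rw [Complex.ofReal_one, one_mul, hy0]; simp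

/-- For order one the exponential integral continues to the logarithmic plane. -/
lemma exists_expE_one : ∃ y : ℂ → ℂ, Differentiable ℂ y ∧
    ∀ t : ℝ, y (t + Real.pi / 2 * I) = (expE 1 (Real.exp t ^ 2) : ℝ) := by
  obtain ⟨y, hy, hy0⟩ := exists_primitive (f := fun z => -2 * Complex.exp (Complex.exp z ^ 2))
    (by fun_prop) (Real.pi / 2 * I) ((expE 1 1 : ℝ) : ℂ)
  refine ⟨y, fun z => (hy z).differentiableAt, fun t => ?_⟩
  refine eq_of_hasDerivAt (f := fun t : ℝ => y (t + Real.pi / 2 * I))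
    (g := fun t : ℝ => ((expE 1 (Real.exp t ^ 2) : ℝ) : ℂ))
    (f' := fun t => -2 * Complex.exp (-((Real.exp t ^ 2 : ℝ) : ℂ))) convex_univ
    isOpen_univ (fun t _ => ?_) (fun t ht => ?_) (t₀ := 0) (Set.mem_univ _) ?_ t (Set.mem_univ _)
  · have h1 : HasDerivAt (fun t : ℝ => (t : ℂ) + Real.pi / 2 * I) 1 t :=
      (Complex.ofRealCLM.hasDerivAt (x := t)).add_const _
    refine ((hy _).comp t h1).congr_deriv ?_
    have : Complex.exp ((t : ℂ) + Real.pi / 2 * I) ^ 2 = -((Real.exp t ^ 2 : ℝ) : ℂ) := by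
      rw [Complex.exp_add, Complex.exp_pi_div_two_mul_I, mul_pow, I_sq]
      push_cast; ring
    rw [this, mul_one]
  · have h1 : HasDerivAt (fun t : ℝ => expE 1 (Real.exp t ^ 2)) (-2 * Real.exp (-Real.exp t ^ 2)) t := by
      have h2 := (hasDerivAt_expE (s := 1) (by norm_num) (by positivity : 0 < Real.exp t ^ 2)).comp t
        ((Real.hasDerivAt_exp t).pow 2)
      refine h2.congr_deriv ?_
      have h3 := expE_succ (s := 0) (b := Real.exp t ^ 2) (by norm_num) (by positivity)
      norm_num at h3 ⊢
      linarith
    have := h1.ofReal_comp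
    convert this using 1
    push_cast; rfl
  · simp [hy0]

end ExpIntegrals

/-! ### The resolvent kernel on the imaginary axis -/

section HeatKernel

open FourierTransform SchwartzMap
open scoped BoundedContinuousFunction

/-- On `L¹ ∩ L²` the Fourier transform is given by the integral. -/
lemma fourier_eq_integral {v : 𝔼 → ℂ} (h1 : Integrable v) (h2 : MemLp v 2) :
    ∀ᵐ x, (𝓕 (h2.toLp v) : L2 n) x = 𝓕 v x := by
  have hcont : Continuous (𝓕 v) :=
    VectorFourier.fourierIntegral_continuous Real.continuous_fourierChar
      (L := innerₗ 𝔼) (continuous_inner (𝕜 := ℝ) (E := 𝔼)) h1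
  refine ae_eq_of_integral_ctest ((Lp.memLp _).locallyIntegrable (by norm_num))
    hcont.locallyIntegrable fun φ hφ => ?_
  rw [integral_mul_fourier]
  have h3 := VectorFourier.integral_fourierIntegral_smul_eq_flip (μ := volume) (ν := volume)
    (L := innerₗ 𝔼) (f := (φ : 𝔼 → ℂ)) (g := v) Real.continuous_fourierChar
    (continuous_inner (𝕜 := ℝ) (E := 𝔼)) φ.integrable h1
  rw [flip_innerₗ] at h3
  have e1 : ∀ w, (𝓕 φ) w = VectorFourier.fourierIntegral Real.fourierChar volume (innerₗ 𝔼) φ w := by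
    intro w; rw [fourier_coe]; rfl
  refine Eq.trans (integral_congr_ae ?_) h3
  filter_upwards [h2.coeFn_toLp] with x hx
  rw [hx, e1]; rfl

/-- The symbol `∫₁^∞ e^{-t(b + |2πξ|²)} dt`. -/
def bsym (b : ℝ) (ξ : 𝔼) : ℝ := Real.exp (-(b + ssq ξ)) / (b + ssq ξ)

lemma continuous_bsym {b : ℝ} (hb : 0 < b) : Continuous (bsym b : 𝔼 → ℝ) := by
  unfold bsym
  refine Continuous.div (by fun_prop) (by fun_prop) fun ξ => ?_
  have := ssq_nonneg ξ
  positivity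

lemma bsym_nonneg {b : ℝ} (hb : 0 < b) (ξ : 𝔼) : 0 ≤ bsym b ξ := by
  have := ssq_nonneg ξ
  unfold bsym
  positivity

lemma bsym_le {b : ℝ} (hb : 0 < b) (ξ : 𝔼) : bsym b ξ ≤ b⁻¹ * Real.exp (-(2 * Real.pi) ^ 2 * ‖ξ‖ ^ 2) := by
  have hs := ssq_nonneg ξ
  rw [bsym, div_eq_inv_mul]
  have h1 : Real.exp (-(b + ssq ξ)) ≤ Real.exp (-(2 * Real.pi) ^ 2 * ‖ξ‖ ^ 2) := by
    refine Real.exp_le_exp.2 ?_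
    rw [neg_mul]
    change _ ≤ -ssq ξ
    linarith
  have h2 : (b + ssq ξ)⁻¹ ≤ b⁻¹ := inv_anti₀ hb (by linarith)
  gcongr

lemma integrable_bsym {b : ℝ} (hb : 0 < b) : Integrable (fun ξ : 𝔼 => (bsym b ξ : ℂ)) := by
  refine ((integrable_exp_neg_mul_sq (n := n) (c := (2 * Real.pi) ^ 2) (by positivity)).const_mul
    b⁻¹).mono' (Complex.continuous_ofReal.comp (continuous_bsym hb)).aestronglyMeasurable
    (ae_of_all _ fun ξ => ?_)
  rw [norm_real, Real.norm_of_nonneg (bsym_nonneg hb ξ)]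
  exact bsym_le hb ξ

lemma bsym_eq_integral {b : ℝ} (hb : 0 < b) (ξ : 𝔼) :
    bsym b ξ = ∫ t in Set.Ioi 1, Real.exp (-(b + ssq ξ) * t) := by
  have hs := ssq_nonneg ξ
  rw [integral_exp_mul_Ioi (by linarith), bsym, mul_one, neg_div_neg_eq]

lemma gaussian_integral {t : ℝ} (ht : 0 < t) (z : 𝔼) :
    ∫ ξ : 𝔼, (Real.fourierChar (inner ℝ ξ z) : ℂ) * Real.exp (-ssq ξ * t) =
      (((4 * Real.pi) ^ (-(n : ℝ) / 2) * t ^ (-(n : ℝ) / 2) * Real.exp (-‖z‖ ^ 2 / 4 / t) : ℝ) : ℂ) := by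
  have hb : 0 < (((4 * Real.pi ^ 2 * t : ℝ)) : ℂ).re := by
    rw [Complex.ofReal_re]; positivity
  have h := GaussianFourier.integral_cexp_neg_mul_sq_norm_add (V := 𝔼) hb (2 * Real.pi * I) z
  have e1 : ∀ ξ : 𝔼, (Real.fourierChar (inner ℝ ξ z) : ℂ) * Real.exp (-ssq ξ * t) =
      Complex.exp (-((4 * Real.pi ^ 2 * t : ℝ) : ℂ) * ‖ξ‖ ^ 2 +
        2 * Real.pi * I * (inner ℝ z ξ : ℝ)) := by
    intro ξ
    rw [Real.fourierChar_apply, Complex.ofReal_exp, ← Complex.exp_add, ssq, real_inner_comm]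
    congr 1
    push_cast
    ring
  simp only [e1]
  rw [h]
  have e2 : ((Real.pi : ℂ) / ((4 * Real.pi ^ 2 * t : ℝ) : ℂ)) = (((4 * Real.pi * t)⁻¹ : ℝ) : ℂ) := by
    have := Real.pi_pos.ne'
    push_cast
    have h1 : (Real.pi : ℂ) ≠ 0 := by exact_mod_cast this
    have h2 : (t : ℂ) ≠ 0 := by exact_mod_cast ht.ne'
    field_simp
  have e3 : ((Module.finrank ℝ 𝔼 : ℂ) / 2) = (((n : ℝ) / 2 : ℝ) : ℂ) := by
    rw [finrank_euclideanSpace_fin]; push_cast; rfl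
  rw [e2, e3, ← Complex.ofReal_cpow (by positivity)]
  have e4 : Complex.exp ((2 * Real.pi * I) ^ 2 * ‖z‖ ^ 2 / (4 * ((4 * Real.pi ^ 2 * t : ℝ) : ℂ))) =
      ((Real.exp (-‖z‖ ^ 2 / 4 / t) : ℝ) : ℂ) := by
    rw [Complex.ofReal_exp]
    congr 1
    have h1 : (Real.pi : ℂ) ≠ 0 := by exact_mod_cast Real.pi_pos.ne'
    have h2 : (t : ℂ) ≠ 0 := by exact_mod_cast ht.ne'
    rw [mul_pow, I_sq]
    push_cast
    field_simp
    ring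
  rw [e4, ← ofReal_mul]
  congr 2
  rw [Real.inv_rpow (by positivity), ← Real.rpow_neg (by positivity), neg_div,
    Real.mul_rpow (by positivity) ht.le]

/-- The kernel of `∫₁^∞ e^{-bt} e^{tΔ} dt`, expanded into a series. -/
lemma hasSum_kernel {b : ℝ} (hb : 0 < b) (z : 𝔼) :
    HasSum (fun k : ℕ => ((((4 * Real.pi) ^ (-(n : ℝ) / 2) : ℝ) : ℂ) *
      (expE ((n : ℝ) / 2 + k) b : ℝ)) * gp k z)
      (∫ ξ : 𝔼, (Real.fourierChar (inner ℝ ξ z) : ℂ) * (bsym b ξ : ℂ)) := by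
  have e1 : ∀ ξ : 𝔼, (Real.fourierChar (inner ℝ ξ z) : ℂ) * (bsym b ξ : ℂ) =
      ∫ t in Set.Ioi (1 : ℝ), (Real.fourierChar (inner ℝ ξ z) : ℂ) *
        (Real.exp (-(b + ssq ξ) * t) : ℂ) := by
    intro ξ
    rw [integral_const_mul, integral_complex_ofReal, bsym_eq_integral hb]
  have hint : Integrable (fun q : 𝔼 × ℝ => (Real.fourierChar (inner ℝ q.1 z) : ℂ) *
      (Real.exp (-(b + ssq q.1) * q.2) : ℂ)) ((volume : Measure 𝔼).prod (volume.restrict (Set.Ioi 1))) := by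
    have h1 := integrable_exp_neg_mul_sq (n := n) (c := (2 * Real.pi) ^ 2) (by positivity)
    have h2 : IntegrableOn (fun t : ℝ => Real.exp (-b * t)) (Set.Ioi 1) :=
      integrableOn_exp_mul_Ioi (by linarith) 1
    refine (h1.mul_prod h2).mono' ?_ ?_
    · have := Real.continuous_fourierChar
      exact Continuous.aestronglyMeasurable (by fun_prop)
    · have hq : ∀ᵐ q ∂((volume : Measure 𝔼).prod (volume.restrict (Set.Ioi (1 : ℝ)))), 1 < q.2 := by
        have : ∀ᵐ t ∂(volume.restrict (Set.Ioi (1 : ℝ))), 1 < t := ae_restrict_mem measurableSet_Ioi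
        exact Measure.quasiMeasurePreserving_snd.ae this
      filter_upwards [hq] with q hq
      rw [norm_mul, Circle.norm_coe, one_mul, norm_real, Real.norm_of_nonneg (Real.exp_pos _).le,
        ← Real.exp_add]
      refine Real.exp_le_exp.2 ?_
      have := ssq_nonneg q.1
      change _ ≤ -(2 * Real.pi) ^ 2 * ‖q.1‖ ^ 2 + -b * q.2
      have h3 : (2 * Real.pi) ^ 2 * ‖q.1‖ ^ 2 = ssq q.1 := rfl
      nlinarith
  simp only [e1]
  rw [integral_integral_swap hint]
  have e2 : ∀ t ∈ Set.Ioi (1 : ℝ), ∫ ξ : 𝔼, (Real.fourierChar (inner ℝ ξ z) : ℂ) *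
      (Real.exp (-(b + ssq ξ) * t) : ℂ) = ∑' k : ℕ, (((4 * Real.pi) ^ (-(n : ℝ) / 2) : ℝ) : ℂ) *
        ((expInt ((n : ℝ) / 2 + k) b t : ℝ) : ℂ) * gp k z := by
    intro t ht
    have ht : 0 < t := zero_lt_one.trans ht
    have h1 : ∀ ξ : 𝔼, (Real.fourierChar (inner ℝ ξ z) : ℂ) * (Real.exp (-(b + ssq ξ) * t) : ℂ) =
        (Real.exp (-b * t) : ℂ) * ((Real.fourierChar (inner ℝ ξ z) : ℂ) * Real.exp (-ssq ξ * t)) := by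
      intro ξ
      rw [mul_left_comm, ← ofReal_mul, ← Real.exp_add]
      congr 4; ring
    simp only [h1]
    rw [integral_const_mul, gaussian_integral ht]
    have h2 := (NormedSpace.expSeries_div_hasSum_exp (((-‖z‖ ^ 2 / 4 / t : ℝ)) : ℂ))
    rw [← Complex.exp_eq_exp_ℂ] at h2
    have h3 := h2.mul_left ((Real.exp (-b * t) : ℂ) * (((4 * Real.pi) ^ (-(n : ℝ) / 2) : ℝ) : ℂ) *
      ((t ^ (-(n : ℝ) / 2) : ℝ) : ℂ))
    have h4 : (Real.exp (-b * t) : ℂ) * (((4 * Real.pi) ^ (-(n : ℝ) / 2) * t ^ (-(n : ℝ) / 2) *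
        Real.exp (-‖z‖ ^ 2 / 4 / t) : ℝ) : ℂ) = (Real.exp (-b * t) : ℂ) *
        (((4 * Real.pi) ^ (-(n : ℝ) / 2) : ℝ) : ℂ) * ((t ^ (-(n : ℝ) / 2) : ℝ) : ℂ) *
        Complex.exp ((-‖z‖ ^ 2 / 4 / t : ℝ) : ℂ) := by
      push_cast; ring
    rw [h4, ← h3.tsum_eq]
    refine tsum_congr fun k => ?_
    have h5 : t ^ (-((n : ℝ) / 2 + k)) = t ^ (-(n : ℝ) / 2) * (t ^ k)⁻¹ := by
      rw [neg_add, Real.rpow_add ht, Real.rpow_neg ht.le (k : ℝ), Real.rpow_natCast, neg_div]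
    simp only [expInt, h5, gp]
    push_cast
    rw [div_pow]
    field_simp
  rw [setIntegral_congr_fun measurableSet_Ioi e2]
  have hsn : ∀ k : ℕ, -1 ≤ (n : ℝ) / 2 + k := fun k => by
    have : (0 : ℝ) ≤ (n : ℝ) / 2 + k := by positivity
    linarith
  have hI : ∀ k : ℕ, Integrable (fun t => (((4 * Real.pi) ^ (-(n : ℝ) / 2) : ℝ) : ℂ) *
      ((expInt ((n : ℝ) / 2 + k) b t : ℝ) : ℂ) * gp k z) (volume.restrict (Set.Ioi (1 : ℝ))) := fun k =>
    (((integrableOn_expInt (hsn k) hb).ofReal).const_mul _).mul_const _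
  have hI2 : ∀ k : ℕ, ∫ t in Set.Ioi (1 : ℝ), ‖(((4 * Real.pi) ^ (-(n : ℝ) / 2) : ℝ) : ℂ) *
      ((expInt ((n : ℝ) / 2 + k) b t : ℝ) : ℂ) * gp k z‖ =
      (4 * Real.pi) ^ (-(n : ℝ) / 2) * expE ((n : ℝ) / 2 + k) b * ‖gp k z‖ := fun k => by
    rw [expE, ← integral_const_mul, ← integral_mul_const]
    refine setIntegral_congr_fun measurableSet_Ioi fun t ht => ?_
    simp only [norm_mul, norm_real]
    rw [Real.norm_of_nonneg (expInt_nonneg ht), Real.norm_of_nonneg (by positivity)]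
  have h6 := hasSum_integral_of_summable_integral_norm hI ?_
  · refine (congrArg (HasSum · _) (funext fun k => ?_)).mp h6
    rw [integral_mul_const, integral_const_mul, integral_complex_ofReal]
    rfl
  · simp only [hI2]
    have h7 : Summable fun k : ℕ => ‖gp k z‖ := by
      simp only [norm_gp]
      exact Real.summable_pow_div_factorial _
    refine Summable.of_nonneg_of_le (fun k => ?_) (fun k => ?_)
      (h7.mul_left ((4 * Real.pi) ^ (-(n : ℝ) / 2) * expE ((n : ℝ) / 2) b))
    · have := expE_nonneg ((n : ℝ) / 2 + k) b
      positivity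
    · have h8 := expE_le (s := (n : ℝ) / 2) (s' := (n : ℝ) / 2 + k)
        (by have : (0 : ℝ) ≤ (n : ℝ) / 2 := by positivity
            linarith) (by simp) hb
      gcongr

lemma mulBound_wt_neg_one : MulBound (wt (-1)) (volume : Measure 𝔼) volume 1 :=
  mulBound_volume (continuous_wt _).measurable fun x => by
    rw [norm_wt, Real.exp_le_one_iff]; nlinarith [sq_nonneg ‖x‖]

/-- The remaining part of the free resolvent on the imaginary axis, between Gaussian weights, is the
convolution operator with the kernel above. -/
lemma gaussOp_eq_fourierMul {b : ℝ} (hb : 0 < b) {r : 𝔼 →ᵇ ℂ}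
    (hr : ∀ z, wt (1 / 3) z * r z =
      ∫ ξ : 𝔼, (Real.fourierChar (inner ℝ ξ z) : ℂ) * (bsym b ξ : ℂ)) (g : L2 n) :
    mulOp (wt (-1)) volume volume
      (fourierMul (fun ξ => (bsym b ξ : ℂ)) (mulOp (wt (-1)) volume volume g)) = gaussOp r g := by
  have hW := mulBound_wt_neg_one (n := n)
  have hbm : Measurable fun ξ : 𝔼 => (bsym b ξ : ℂ) :=
    (Complex.continuous_ofReal.comp (continuous_bsym hb)).measurable
  have hbb : ∀ ξ : 𝔼, ‖(bsym b ξ : ℂ)‖ ≤ b⁻¹ := fun ξ => by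
    rw [norm_real, Real.norm_of_nonneg (bsym_nonneg hb ξ)]
    refine (bsym_le hb ξ).trans (mul_le_of_le_one_right (by positivity) (Real.exp_le_one_iff.2 ?_))
    rw [neg_mul]
    exact neg_nonpos.2 (by positivity)
  have hγ : MemLp (wt (-1) : 𝔼 → ℂ) 2 volume := by
    refine memLp_gs.mono (continuous_wt _).aestronglyMeasurable (ae_of_all _ fun x => ?_)
    rw [norm_wt, gs, Real.norm_eq_abs, Real.abs_exp]
    exact Real.exp_le_exp.2 (by nlinarith [sq_nonneg ‖x‖])
  have hv2 : MemLp (fun y => wt (-1) y * g y) 2 volume := hW.memLp g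
  have hv1 : Integrable (fun y => wt (-1) y * g y) := MemLp.integrable_mul hγ (Lp.memLp g)
  have hv : mulOp (wt (-1)) volume volume g = hv2.toLp _ := by
    refine Lp.ext ?_
    filter_upwards [coeFn_mulOp hW g, hv2.coeFn_toLp] with x e1 e2
    rw [e1, e2]
  set V := mulOp (wt (-1)) volume volume g
  have hb2 : MemLp (fun ξ => (bsym b ξ : ℂ) * (𝓕 V : L2 n) ξ) 2 volume :=
    (mulBound_volume hbm hbb).memLp _
  have hbL2 : MemLp (fun ξ : 𝔼 => (bsym b ξ : ℂ)) 2 volume := by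
    refine ((memLp_gs (n := n)).const_mul b⁻¹).mono hbm.aestronglyMeasurable (ae_of_all _ fun ξ => ?_)
    rw [norm_real, Real.norm_of_nonneg (bsym_nonneg hb ξ), Real.norm_eq_abs]
    refine (bsym_le hb ξ).trans (le_trans ?_ (le_abs_self _))
    rw [gs]
    gcongr
    nlinarith [Real.pi_gt_three]
  have hb1 : Integrable (fun ξ => (bsym b ξ : ℂ) * (𝓕 V : L2 n) ξ) :=
    MemLp.integrable_mul hbL2 (Lp.memLp _)
  have hB : mulOp (fun ξ => (bsym b ξ : ℂ)) volume volume (𝓕 V : L2 n) = hb2.toLp _ := by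
    refine Lp.ext ?_
    filter_upwards [coeFn_mulOp (mulBound_volume hbm hbb) (𝓕 V : L2 n), hb2.coeFn_toLp] with x e1 e2
    rw [e1, e2]
  have h4 := fourierInv_eq_integral hb1 hb2
  rw [← hB] at h4
  have h5 := fourier_eq_integral hv1 hv2
  rw [← hv] at h5
  refine Lp.ext ?_
  filter_upwards [coeFn_mulOp hW (fourierMul (fun ξ => (bsym b ξ : ℂ)) V), h4, coeFn_gaussOp r g]
    with x e1 e2 e3
  rw [e1, e3, fourierMul_apply, e2, Real.fourierInv_eq]
  have hf : Integrable fun ξ : 𝔼 => (Real.fourierChar (inner ℝ ξ x) : ℂ) * (bsym b ξ : ℂ) := by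
    refine (integrable_bsym hb).bdd_mul (c := 1) ?_ (ae_of_all _ fun ξ => ?_)
    · have := Real.continuous_fourierChar
      exact Continuous.aestronglyMeasurable (by fun_prop)
    · rw [Circle.norm_coe]
  have h3 := VectorFourier.integral_fourierIntegral_smul_eq_flip (μ := volume) (ν := volume)
    (L := innerₗ 𝔼) (f := fun y => wt (-1) y * g y)
    (g := fun ξ : 𝔼 => (Real.fourierChar (inner ℝ ξ x) : ℂ) * (bsym b ξ : ℂ)) Real.continuous_fourierChar
    (continuous_inner (𝕜 := ℝ) (E := 𝔼)) hv1 hf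
  rw [flip_innerₗ] at h3
  have e4 : ∫ ξ, Real.fourierChar (inner ℝ ξ x) • ((bsym b ξ : ℂ) * (𝓕 V : L2 n) ξ) =
      ∫ y, (wt (-1) y * g y) • VectorFourier.fourierIntegral Real.fourierChar volume (innerₗ 𝔼)
        (fun ξ : 𝔼 => (Real.fourierChar (inner ℝ ξ x) : ℂ) * (bsym b ξ : ℂ)) y := by
    rw [← h3]
    refine integral_congr_ae ?_
    filter_upwards [h5] with ξ hξ
    rw [hξ]
    simp only [Circle.smul_def, smul_eq_mul]
    change _ = 𝓕 (fun y => wt (-1) y * g y) ξ * _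
    ring
  rw [e4, ← integral_const_mul]
  refine integral_congr_ae (ae_of_all _ fun y => ?_)
  simp only [gaussKernel, hr, smul_eq_mul]
  have e5 : VectorFourier.fourierIntegral Real.fourierChar volume (innerₗ 𝔼)
        (fun ξ : 𝔼 => (Real.fourierChar (inner ℝ ξ x) : ℂ) * (bsym b ξ : ℂ)) y =
      ∫ ξ : 𝔼, (Real.fourierChar (inner ℝ ξ (x - y)) : ℂ) * (bsym b ξ : ℂ) := by
    rw [VectorFourier.fourierIntegral]
    refine integral_congr_ae (ae_of_all _ fun ξ => ?_)
    simp only [innerₗ_apply_apply, Circle.smul_def, smul_eq_mul]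
    rw [← mul_assoc, ← Circle.coe_mul, ← AddChar.map_add_eq_mul, inner_sub_right,
      show -inner ℝ ξ y + inner ℝ ξ x = inner ℝ ξ x - inner ℝ ξ y by ring]
  rw [e5]
  ring

end HeatKernel

/-! ### Continuation of the weighted free resolvent -/

section FreeContinuation

open FourierTransform

variable (n) in
/-- Multiplication by `e^{-|x|²}` on `L²(ℝⁿ)`. -/
def wMul : L2 n →L[ℂ] L2 n := mulOp (wt (-1)) volume volume

lemma coeFn_wMul (g : L2 n) : ∀ᵐ x, wMul n g x = wt (-1) x * g x :=
  coeFn_mulOp mulBound_wt_neg_one g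

lemma wMul_weakPair {i : Fin n} {a b : L2 n} (h : (a, b) ∈ weakPair n 0 i) :
    (wMul n a, wMul n b) ∈ weakPair n 1 i := by
  have key : ∀ f : L2 n, (fun x => wt 0 x * f x) =ᵐ[volume.restrict Set.univ]
      fun x => wt 1 x * wMul n f x := fun f => by
    rw [Measure.restrict_univ]
    filter_upwards [coeFn_wMul f] with x hx
    rw [hx, ← mul_assoc, wt_neg_mul, wt_zero]
  exact HasWeakPartialOn.congr isOpen_univ h (key a) (key b)

lemma wMul_mem_jetSpace {p : Jet n} (hp : p ∈ jetSpace n 0) :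
    ((wMul n p.1, fun i => wMul n (p.2.1 i), fun i j => wMul n (p.2.2 i j)) : Jet n) ∈
      jetSpace n 1 :=
  ⟨fun i => wMul_weakPair (hp.1 i), fun i j => wMul_weakPair (hp.2 i j)⟩

/-- Apply an operator to each entry of a triple of arrays. -/
def mapJet {X : Type*} [NormedAddCommGroup X] [NormedSpace ℂ X] (T : X →L[ℂ] X) :
    (X × (Fin n → X) × (Fin n → Fin n → X)) →L[ℂ] X × (Fin n → X) × (Fin n → Fin n → X) :=
  T.prodMap ((pi fun i => T ∘L proj i).prodMap
    (pi fun i => pi fun j =>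
      T ∘L proj j ∘L proj i))

lemma mapJet_apply {X : Type*} [NormedAddCommGroup X] [NormedSpace ℂ X] (T : X →L[ℂ] X)
    (p : X × (Fin n → X) × (Fin n → Fin n → X)) :
    mapJet T p = (T p.1, fun i => T (p.2.1 i), fun i j => T (p.2.2 i j)) := rfl

variable (n) in
/-- Multiplication by `e^{-|x|²}`, from `H²(ℝⁿ)` to the weighted Sobolev space. -/
def weightJet : JetSpace n 0 →L[ℂ] JetSpace n 1 :=
  JetSpace.lift (mapJet (wMul n) ∘L JetSpace.val) fun v => wMul_mem_jetSpace v.val_mem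

lemma weightJet_val (v : JetSpace n 0) : (weightJet n v).val = mapJet (wMul n) v.val := rfl

lemma weightJet_fst (v : JetSpace n 0) : (weightJet n v).val.1 = wMul n v.val.1 := by
  rw [weightJet_val, mapJet_apply]

lemma weightJet_snd (v : JetSpace n 0) (i : Fin n) :
    (weightJet n v).val.2.1 i = wMul n (v.val.2.1 i) := by
  rw [weightJet_val, mapJet_apply]

lemma jetLow_weightJet (α : Option (Fin n)) :
    jetLow n 1 α ∘L weightJet n = wMul n ∘L jetLow n 0 α := by
  cases α with
  | none => exact ContinuousLinearMap.ext fun v => weightJet_fst v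
  | some i => exact ContinuousLinearMap.ext fun v => weightJet_snd v i

/-- The free resolvent between Gaussian weights. -/
def wRes (k : ℂ) : L2 n →L[ℂ] JetSpace n 1 := weightJet n ∘L freeRes k ∘L wMul n

/-- The operator `heatPart` between Gaussian weights. -/
def wHeat (μ : ℂ) : L2 n →L[ℂ] JetSpace n 1 := weightJet n ∘L heatPart μ ∘L wMul n

lemma analyticAt_wRes {k : ℂ} (h : 0 < k.im) :
    AnalyticAt ℂ (fun k => (wRes k : L2 n →L[ℂ] JetSpace n 1)) k :=
  analyticAt_clm_comp analyticAt_const (analyticAt_clm_comp (analyticAt_freeRes h) analyticAt_const)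

lemma analyticAt_wHeat (μ : ℂ) :
    AnalyticAt ℂ (fun k => (wHeat k : L2 n →L[ℂ] JetSpace n 1)) μ :=
  analyticAt_clm_comp analyticAt_const (analyticAt_clm_comp
    (differentiable_heatPart.analyticAt μ) analyticAt_const)

/-- The order zero and one parts of `H²(ℝⁿ)`-valued multipliers are compact after multiplication
by a function of compact support. -/
lemma isCompactOperator_jetLow_jetMul {m : 𝔼 → ℂ} {M : ℝ} (hm : JetSymbol m M) {ψ : 𝔼 → ℂ}
    (hψ : Continuous ψ) (hψc : HasCompactSupport ψ) (α : Option (Fin n)) :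
    IsCompactOperator (mulOp ψ volume volume ∘L jetLow n 0 α ∘L jetMul m) := by
  have hp : ∀ ξ : 𝔼, ssq ξ = (2 * Real.pi * ‖ξ‖) ^ 2 := fun ξ => by rw [ssq]; ring
  have hle : ∀ ξ : 𝔼, ‖ξ‖ ≤ 2 * Real.pi * ‖ξ‖ := fun ξ => by
    nlinarith [Real.pi_gt_three, norm_nonneg ξ]
  have h1 : ∀ ξ : 𝔼, 1 + ‖ξ‖ ≤ 3 * (1 + ssq ξ) := fun ξ => by
    have := hle ξ
    rw [hp]; nlinarith [sq_nonneg (2 * Real.pi * ‖ξ‖ - 1)]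
  have h2 : ∀ ξ : 𝔼, (1 + ‖ξ‖) * (2 * Real.pi * ‖ξ‖) ≤ 3 * (1 + ssq ξ) := fun ξ => by
    have := hle ξ
    have h0 := norm_nonneg ξ
    rw [hp]
    have h3 : 0 ≤ 2 * Real.pi * ‖ξ‖ := by positivity
    nlinarith [sq_nonneg (2 * Real.pi * ‖ξ‖ - 1)]
  have hmm := hm.1
  cases α with
  | none =>
    have : mulOp ψ volume volume ∘L jetLow n 0 none ∘L jetMul m =
        mulOp ψ volume volume ∘L fourierMul m := by
      ext1 v
      change mulOp ψ volume volume (jetMul m v).val.1 = _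
      rw [coe_jetMul hm]; rfl
    rw [this]
    refine isCompactOperator_mul_fourierMul hψ hψc (M := 3 * M) hmm fun ξ => ?_
    have := hm.2 ξ
    calc (1 + ‖ξ‖) * ‖m ξ‖ ≤ (3 * (1 + ssq ξ)) * ‖m ξ‖ := by gcongr; exact h1 ξ
      _ ≤ 3 * M := by linarith
  | some i =>
    have : mulOp ψ volume volume ∘L jetLow n 0 (some i) ∘L jetMul m =
        mulOp ψ volume volume ∘L fourierMul fun ξ => dsym i ξ * m ξ := by
      ext1 v
      change mulOp ψ volume volume ((jetMul m v).val.2.1 i) = _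
      rw [coe_jetMul hm]; rfl
    rw [this]
    refine isCompactOperator_mul_fourierMul hψ hψc (M := 3 * M) (by fun_prop) fun ξ => ?_
    have := hm.2 ξ
    have hd : ‖dsym i ξ‖ ≤ 2 * Real.pi * ‖ξ‖ := by
      refine (norm_dsym_le i ξ).trans_eq ?_
      rw [hp, Real.sqrt_sq (by positivity)]
    calc (1 + ‖ξ‖) * ‖dsym i ξ * m ξ‖ ≤ (1 + ‖ξ‖) * ((2 * Real.pi * ‖ξ‖) * ‖m ξ‖) := by
          rw [norm_mul]; gcongr
      _ = ((1 + ‖ξ‖) * (2 * Real.pi * ‖ξ‖)) * ‖m ξ‖ := by ring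
      _ ≤ (3 * (1 + ssq ξ)) * ‖m ξ‖ := mul_le_mul_of_nonneg_right (h2 ξ) (norm_nonneg _)
      _ ≤ 3 * M := by linarith

lemma mulOp_comp_comm {ψ φ : 𝔼 → ℂ} {C D : ℝ} (hψ : MulBound ψ (volume : Measure 𝔼) volume C)
    (hφ : MulBound φ (volume : Measure 𝔼) volume D) :
    mulOp ψ volume volume ∘L mulOp φ volume volume =
      mulOp φ volume volume ∘L (mulOp ψ volume volume : L2 n →L[ℂ] L2 n) := by
  ext1 v
  refine Lp.ext ?_
  rw [comp_apply, comp_apply]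
  filter_upwards [coeFn_mulOp hψ (mulOp φ volume volume v), coeFn_mulOp hφ v,
    coeFn_mulOp hφ (mulOp ψ volume volume v), coeFn_mulOp hψ v] with x e1 e2 e3 e4
  rw [e1, e2, e3, e4, mul_left_comm]

lemma exists_mulBound {ψ : 𝔼 → ℂ} (hψ : Continuous ψ) (hψc : HasCompactSupport ψ) :
    ∃ C, MulBound ψ (volume : Measure 𝔼) volume C := by
  obtain ⟨C, hC⟩ := hψc.exists_bound_of_continuous hψ
  exact ⟨C, mulBound_volume hψ.measurable hC⟩

lemma comp_intertwine {X Y Z : Type*} [NormedAddCommGroup X] [NormedSpace ℂ X]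
    [NormedAddCommGroup Y] [NormedSpace ℂ Y] [NormedAddCommGroup Z] [NormedSpace ℂ Z]
    {S W : X →L[ℂ] X} {A : Z →L[ℂ] X} {J : Y →L[ℂ] Z} {A₀ : Y →L[ℂ] X} (T : X →L[ℂ] Y)
    (h₁ : A ∘L J = W ∘L A₀) (h₂ : S ∘L W = W ∘L S) :
    S ∘L A ∘L J ∘L T ∘L W = W ∘L (S ∘L A₀ ∘L T) ∘L W := by
  ext x
  have e₁ := fun y => DFunLike.congr_fun h₁ y
  have e₂ := fun y => DFunLike.congr_fun h₂ y
  simp only [comp_apply] at e₁ e₂ ⊢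
  rw [e₁, e₂]

lemma isCompactOperator_jetLow_wHeat (μ : ℂ) {ψ : 𝔼 → ℂ}
    (hψ : Continuous ψ) (hψc : HasCompactSupport ψ) (α : Option (Fin n)) :
    IsCompactOperator (mulOp ψ volume volume ∘L jetLow n 1 α ∘L wHeat μ) := by
  obtain ⟨C, hC⟩ := exists_mulBound hψ hψc
  rw [wHeat, comp_intertwine _ (jetLow_weightJet (n := n) α)
    (mulOp_comp_comm hC (mulBound_wt_neg_one (n := n)))]
  exact ((isCompactOperator_jetLow_jetMul (jetSymbol_asym le_rfl) hψ hψc α).comp_clm _).clm_comp _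

/-- The constant `(4π)^{-n/2}` of the heat kernel. -/
def cHeat (n : ℕ) : ℂ := ((4 * Real.pi) ^ (-(n : ℝ) / 2) : ℝ)

lemma wRes_eq {k : ℂ} (hk : 0 < k.im) {b : ℝ} (hb : 0 < b) (hkb : k ^ 2 = -(b : ℂ)) {a : ℕ → ℂ}
    (ha : ∀ j : ℕ, a j = cHeat n * (expE ((n : ℝ) / 2 + j) b : ℝ)) :
    wRes k = wHeat (k ^ 2) + gaussSum n a := by
  have hbd : ∀ j, ‖a j‖ ≤ ‖cHeat n‖ * expE ((n : ℝ) / 2) b := fun j => by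
    rw [ha, norm_mul, norm_real, Real.norm_of_nonneg (expE_nonneg _ _)]
    gcongr
    refine expE_le ?_ (by simp) hb
    have : (0 : ℝ) ≤ (n : ℝ) / 2 := by positivity
    linarith
  obtain ⟨r, hr1, hr2⟩ := gaussSum_fst (n := n) hbd
  have hr3 : ∀ z, wt (1 / 3) z * r z =
      ∫ ξ : 𝔼, (Real.fourierChar (inner ℝ ξ z) : ℂ) * (bsym b ξ : ℂ) := fun z => by
    refine (hr2 z).unique ((congrArg (HasSum · _) (funext fun j => ?_)).mp (hasSum_kernel hb z))
    rw [ha]; rfl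
  ext1 g
  refine JetSpace.ext ?_
  rw [add_apply, map_add, Prod.fst_add, hr1, ← gaussOp_eq_fourierMul hb hr3]
  have e1 : (wRes k g).val.1 = wMul n (freeRes k (wMul n g)).val.1 := weightJet_fst _
  have e2 : (wHeat (k ^ 2) g).val.1 = wMul n (heatPart (k ^ 2) (wMul n g)).val.1 :=
    weightJet_fst _
  change _ = _ + wMul n (fourierMul _ (wMul n g))
  rw [e1, e2]
  rw [← map_add, freeRes, heatPart, coe_jetMul (JetSymbol.rsym hk),
    coe_jetMul (jetSymbol_asym le_rfl)]
  congr 1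
  have hbs : ∀ ξ : 𝔼, (bsym b ξ : ℂ) = Complex.exp (k ^ 2 - ssq ξ) * rsym k ξ := fun ξ => by
    rw [bsym, rsym, hkb]
    push_cast
    rw [div_eq_mul_inv]
    congr 2 <;> ring_nf
  have hbm : Measurable fun ξ : 𝔼 => (bsym b ξ : ℂ) :=
    (Complex.continuous_ofReal.comp (continuous_bsym hb)).measurable
  have hbb : ∀ ξ : 𝔼, ‖(bsym b ξ : ℂ)‖ ≤ b⁻¹ := fun ξ => by
    rw [norm_real, Real.norm_of_nonneg (bsym_nonneg hb ξ)]
    refine (bsym_le hb ξ).trans (mul_le_of_le_one_right (by positivity) (Real.exp_le_one_iff.2 ?_))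
    rw [neg_mul]
    exact neg_nonpos.2 (by positivity)
  rw [fourierMul_lin (m₃ := rsym k) (jetSymbol_asym (μ := k ^ 2) le_rfl).1
    (jetSymbol_asym (μ := k ^ 2) le_rfl).bounds.1 hbm hbb 1 fun ξ => by
      rw [one_mul, hbs]; exact rsym_eq hk ξ, one_smul]
  rfl

lemma gaussSum_add_single {a : ℕ → ℂ} {C : ℝ} (ha : ∀ j, ‖a j‖ ≤ C) (c : ℂ) :
    gaussSum n (fun j => a j + if j = 0 then c else 0) = gaussSum n a + c • gaussJet n 0 := by
  have h1 := hasSum_gaussSum (n := n) ha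
  have h2 := hasSum_ite_eq (0 : ℕ) (c • gaussJet n 0)
  have h3 := h1.add h2
  have h4 : ∀ j, ‖a j + if j = 0 then c else 0‖ ≤ C + ‖c‖ := fun j => by
    refine (norm_add_le _ _).trans (add_le_add (ha j) ?_)
    split_ifs <;> simp
  refine (hasSum_gaussSum (n := n) h4).unique ?_
  refine (congrArg (HasSum · _) (funext fun j => ?_)).mp h3
  by_cases hj : j = 0
  · subst hj; simp [add_smul]
  · simp [hj]

/-- `z ↦ D(z) + z⁻¹ B` continues the weighted free resolvent `wRes (ℓ z)` from the region `S` to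
`ℂ`, with `D` entire and `B` of finite rank. -/
structure IsFreeContinuation (ℓ : ℂ → ℂ) (S : Set ℂ) (D : ℂ → L2 n →L[ℂ] JetSpace n 1)
    (B : L2 n →L[ℂ] JetSpace n 1) : Prop where
  analytic : ∀ z, AnalyticAt ℂ D z
  finite : FiniteDimensional ℂ (LinearMap.range B.toLinearMap)
  compact : ∀ z α, ∀ ψ : 𝔼 → ℂ, Continuous ψ → HasCompactSupport ψ →
    IsCompactOperator (mulOp ψ volume volume ∘L jetLow n 1 α ∘L D z)
  eq : ∀ z ∈ S, D z + z⁻¹ • B = wRes (ℓ z)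

/-- The continuation of the coefficients continues the resolvent, by the identity theorem on a
path on which `ℓ(z)²` is negative. -/
lemma isFreeContinuation_of_coeff {ℓ : ℂ → ℂ} {S : Set ℂ} (hS : IsPreconnected S)
    (hS0 : ∀ z ∈ S, z ≠ 0) (hℓ : Differentiable ℂ ℓ) (hℓS : ∀ z ∈ S, 0 < (ℓ z).im)
    {a : ℂ → ℕ → ℂ} (ha : ∀ j, Differentiable ℂ fun z => a z j)
    (hbd : ∀ z₀, ∃ C, ∀ z ∈ Metric.ball z₀ 1, ∀ j, ‖a z j‖ ≤ C) {c : ℂ} {p : ℝ → ℂ} {q : ℝ → ℝ}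
    (hp : Continuous p) (hpi : Function.Injective p) (hpS : ∀ t, 0 < t → p t ∈ S)
    (hq : ∀ t, 0 < t → 0 < q t) (hpq : ∀ t, 0 < t → ℓ (p t) ^ 2 = -(q t : ℂ))
    (hcoef : ∀ t, 0 < t → ∀ j : ℕ, a (p t) j + (if j = 0 then (p t)⁻¹ * c else 0) =
      cHeat n * (expE ((n : ℝ) / 2 + j) (q t) : ℝ)) :
    IsFreeContinuation ℓ S (fun z => wHeat (ℓ z ^ 2) + gaussSum n (a z)) (c • gaussJet n 0) := by
  have han : ∀ z, AnalyticAt ℂ (fun z => wHeat (ℓ z ^ 2) + gaussSum n (a z)) z := by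
    intro z
    obtain ⟨C, hC⟩ := hbd z
    have h1 : AnalyticAt ℂ (fun z => ℓ z ^ 2) z := (hℓ.analyticAt z).pow 2
    exact ((analyticAt_wHeat _).comp_of_eq h1 rfl).add (analyticAt_gaussSum ha hC)
  refine ⟨han, ?_, fun z α ψ hψ hψc => ?_, ?_⟩
  · have hle : LinearMap.range (c • gaussJet n 0).toLinearMap ≤
        LinearMap.range (gaussJet n 0).toLinearMap := by
      rintro _ ⟨v, rfl⟩
      exact Submodule.smul_mem _ c ⟨v, rfl⟩
    have := finiteDimensional_range_gaussJet_zero (n := n)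
    exact Submodule.finiteDimensional_of_le hle
  · obtain ⟨C, hC⟩ := hbd z
    have h1 := isCompactOperator_jetLow_wHeat (ℓ z ^ 2) hψ hψc α
    have h2 := (isCompactOperator_jetLow_gaussSum (n := n)
      (hC z (Metric.mem_ball_self one_pos)) α).clm_comp (mulOp ψ volume volume)
    rw [comp_add, comp_add]
    exact h1.add h2
  · have hf : AnalyticOnNhd ℂ (fun z => wHeat (ℓ z ^ 2) + gaussSum n (a z) +
        z⁻¹ • c • gaussJet n 0) S := fun z hz =>
      (han z).add ((analyticAt_id.inv (hS0 z hz)).smul analyticAt_const)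
    have hg : AnalyticOnNhd ℂ (fun z => wRes (n := n) (ℓ z)) S := fun z hz =>
      (analyticAt_wRes (hℓS z hz)).comp_of_eq (hℓ.analyticAt z) rfl
    have hpt : ∀ t, 0 < t → wHeat (ℓ (p t) ^ 2) + gaussSum n (a (p t)) +
        (p t)⁻¹ • c • gaussJet n 0 = wRes (ℓ (p t)) := fun t ht => by
      obtain ⟨C, hC⟩ := hbd (p t)
      rw [wRes_eq (hℓS _ (hpS t ht)) (hq t ht) (hpq t ht) (hcoef t ht),
        gaussSum_add_single (hC _ (Metric.mem_ball_self one_pos)), smul_smul, add_assoc]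
    -- The path `p` accumulates at `p 1`.
    refine hf.eqOn_of_preconnected_of_frequently_eq hg hS (hpS 1 one_pos) ?_
    have ht : Tendsto p (𝓝[≠] 1) (𝓝[≠] (p 1)) :=
      tendsto_nhdsWithin_iff.2 ⟨hp.continuousAt.tendsto.mono_left nhdsWithin_le_nhds,
        eventually_nhdsWithin_of_forall fun t ht h => ht (hpi h)⟩
    refine ht.frequently (Eventually.frequently ?_)
    filter_upwards [mem_nhdsWithin_of_mem_nhds (lt_mem_nhds one_pos)] with t ht
    exact hpt t ht

lemma exists_bound_ball {f : ℂ → ℂ} (hf : Differentiable ℂ f) (z₀ : ℂ) :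
    ∃ C, 0 ≤ C ∧ ∀ z ∈ Metric.ball z₀ 1, ‖f z‖ ≤ C := by
  obtain ⟨C, hC⟩ := (isCompact_closedBall z₀ 1).exists_bound_of_continuousOn
    hf.continuous.continuousOn
  exact ⟨C, (norm_nonneg _).trans (hC z₀ (Metric.mem_closedBall_self zero_le_one)),
    fun z hz => hC z (Metric.ball_subset_closedBall hz)⟩

lemma exists_bound_gammaSeq_ball {s : ℝ} (hs : 0 < s) {μ g : ℂ → ℂ} (hμ : Differentiable ℂ μ)
    (hg : Differentiable ℂ g) (c z₀ : ℂ) :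
    ∃ C, 0 ≤ C ∧ ∀ z ∈ Metric.ball z₀ 1, ∀ j, ‖c * gammaSeq s (μ z) (g z) j‖ ≤ C := by
  obtain ⟨L, hL0, hL⟩ := exists_bound_ball hμ z₀
  obtain ⟨G, hG0, hG⟩ := exists_bound_ball hg z₀
  obtain ⟨C, hC⟩ := exists_bound_gammaSeq hs hL0 G
  refine ⟨‖c‖ * |C|, by positivity, fun z hz j => ?_⟩
  rw [norm_mul]
  gcongr
  exact (hC _ _ (hL z hz) (hG z hz) j).trans (le_abs_self C)

/-- In even dimensions the weighted free resolvent continues to the logarithmic plane. -/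
lemma exists_freeContinuation_even (hn : 1 ≤ n) (he : Even n) :
    ∃ D B, IsFreeContinuation (n := n) Complex.exp {w | 0 < w.im ∧ w.im < Real.pi} D B ∧ B = 0 := by
  obtain ⟨m, hm⟩ : ∃ m, n = 2 * m + 2 := by
    obtain ⟨r, hr⟩ := he
    exact ⟨r - 1, by omega⟩
  obtain ⟨y, hy, hy1⟩ := exists_expE_one
  have hμ : Differentiable ℂ fun z => Complex.exp z ^ 2 := by fun_prop
  have hS : IsPreconnected {w : ℂ | 0 < w.im ∧ w.im < Real.pi} :=
    ((convex_halfSpace_im_gt 0).inter (convex_halfSpace_im_lt Real.pi)).isPreconnected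
  -- On the line `Im w = π/2` the square of `e^w` is negative.
  have h := isFreeContinuation_of_coeff (n := n) (ℓ := Complex.exp) hS
    (fun z hz h0 => by simp [h0] at hz) Complex.differentiable_exp
    (fun z hz => by
      rw [Complex.exp_im]
      exact mul_pos (Real.exp_pos _) (Real.sin_pos_of_pos_of_lt_pi hz.1 hz.2))
    (a := fun z j => cHeat n * gammaSeq 1 (Complex.exp z ^ 2) (y z) (m + j))
    (fun j => (differentiable_gammaSeq hμ hy _).const_mul _)
    (fun z₀ => by
      obtain ⟨C, -, hC⟩ := exists_bound_gammaSeq_ball one_pos hμ hy (cHeat n) z₀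
      exact ⟨C, fun z hz j => hC z hz _⟩)
    (c := 0) (p := fun t => t + Real.pi / 2 * I) (q := fun t => Real.exp t ^ 2)
    (by fun_prop) (fun s t h => by simpa using h)
    (fun t _ => by
      have h1 : ((t : ℂ) + Real.pi / 2 * I).im = Real.pi / 2 := by simp
      rw [Set.mem_ofPred_eq, h1]
      constructor <;> linarith [Real.pi_pos])
    (fun t _ => by positivity)
    (fun t _ => by
      rw [Complex.exp_add, Complex.exp_pi_div_two_mul_I, mul_pow, I_sq]
      push_cast; ring)
    (fun t _ j => by
      have h2 : Complex.exp ((t : ℂ) + Real.pi / 2 * I) ^ 2 = ((-(Real.exp t ^ 2) : ℝ) : ℂ) := by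
        rw [Complex.exp_add, Complex.exp_pi_div_two_mul_I, mul_pow, I_sq]
        push_cast; ring
      have h3 : (n : ℝ) / 2 + j = 1 + ((m + j : ℕ) : ℝ) := by rw [hm]; push_cast; ring
      simp only [mul_zero, ite_self, add_zero]
      rw [h2, hy1, gammaSeq_expE one_pos (by positivity), h3])
  rw [zero_smul] at h
  exact ⟨_, _, h, rfl⟩

/-- In odd dimensions the weighted free resolvent continues to the complex plane; in dimension one
it has a pole at the origin. -/
lemma exists_freeContinuation_odd (ho : Odd n) :
    ∃ D B, IsFreeContinuation (n := n) id {z | 0 < z.im} D B := by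
  obtain ⟨m, hm⟩ := ho
  obtain ⟨y, hy, hy1⟩ := exists_expE_half
  have hμ : Differentiable ℂ fun z : ℂ => z ^ 2 := by fun_prop
  -- the exponential integral of order `3/2`, which has no pole
  let g : ℂ → ℂ := fun z => 2 * (Complex.exp (z ^ 2) + I * z * y z)
  have hg : Differentiable ℂ g := by fun_prop
  have hg1 : ∀ t : ℝ, 0 < t → g (t * I) = (expE (3 / 2) (t ^ 2) : ℝ) := by
    intro t ht
    have h1 := expE_succ (s := 1 / 2) (b := t ^ 2) (by norm_num) (by positivity)
    have h2 : expE (3 / 2) (t ^ 2) = 2 * (Real.exp (-t ^ 2) - t * (t * expE (1 / 2) (t ^ 2))) := by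
      norm_num at h1 ⊢
      linarith
    have h3 : ((t : ℂ) * I) ^ 2 = -(t : ℂ) ^ 2 := by rw [mul_pow, I_sq]; ring
    simp only [g]
    rw [h2, hy1 t ht, h3]
    push_cast
    linear_combination 2 * (t : ℂ) * (t * (expE (1 / 2) (t ^ 2) : ℝ)) * Complex.I_mul_I
  have hS : IsPreconnected {z : ℂ | 0 < z.im} := (convex_halfSpace_im_gt 0).isPreconnected
  have h32 : (0 : ℝ) < 3 / 2 := by norm_num
  have hsq : ∀ t : ℝ, (id ((t : ℂ) * I)) ^ 2 = -((t ^ 2 : ℝ) : ℂ) := fun t => by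
    rw [id, mul_pow, I_sq]; push_cast; ring
  have hsq' : ∀ t : ℝ, ((t : ℂ) * I) ^ 2 = ((-(t ^ 2) : ℝ) : ℂ) := fun t => by
    rw [mul_pow, I_sq]; push_cast; ring
  have main : ∀ (a : ℂ → ℕ → ℂ) (c : ℂ), (∀ j, Differentiable ℂ fun z => a z j) →
      (∀ z₀, ∃ C, ∀ z ∈ Metric.ball z₀ 1, ∀ j, ‖a z j‖ ≤ C) →
      (∀ t : ℝ, 0 < t → ∀ j : ℕ, a (t * I) j + (if j = 0 then (t * I)⁻¹ * c else 0) =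
        cHeat n * (expE ((n : ℝ) / 2 + j) (t ^ 2) : ℝ)) →
      ∃ D B, IsFreeContinuation (n := n) id {z | 0 < z.im} D B := by
    intro a c ha hbd hco
    exact ⟨_, _, isFreeContinuation_of_coeff (n := n) hS (fun z hz h0 => by simp [h0] at hz)
      differentiable_id (fun z hz => hz) ha hbd (c := c) (p := fun t => t * I)
      (q := fun t => t ^ 2) (by fun_prop) (fun s t h => by simpa using h)
      (fun t ht => by simpa using ht) (fun t ht => by positivity) (fun t _ => hsq t) hco⟩
  -- For `n = 1` the term `j = 0` is the integral of order `1/2`, which has a pole.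
  rcases Nat.eq_zero_or_pos m with rfl | hm0
  · refine main (fun z j => Nat.casesOn j (cHeat n * (I * dslope y 0 z))
      fun j => cHeat n * gammaSeq (3 / 2) (z ^ 2) (g z) j) (cHeat n * (I * y 0)) ?_ ?_ ?_
    · have hd : Differentiable ℂ (dslope y 0) := by
        rw [← differentiableOn_univ, Complex.differentiableOn_dslope univ_mem]
        exact hy.differentiableOn
      rintro (_ | j)
      · exact (hd.const_mul _).const_mul _
      · exact (differentiable_gammaSeq hμ hg j).const_mul _
    · intro z₀
      have hd : Differentiable ℂ (dslope y 0) := by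
        rw [← differentiableOn_univ, Complex.differentiableOn_dslope univ_mem]
        exact hy.differentiableOn
      obtain ⟨C, hC0, hC⟩ := exists_bound_gammaSeq_ball h32 hμ hg (cHeat n) z₀
      obtain ⟨C', hC0', hC'⟩ := exists_bound_ball
        (f := fun z => cHeat n * (I * dslope y 0 z)) ((hd.const_mul _).const_mul _) z₀
      refine ⟨C + C', fun z hz => ?_⟩
      rintro (_ | j)
      · exact (hC' z hz).trans (by linarith)
      · exact (hC z hz j).trans (by linarith)
    · intro t ht j
      have ht' : (t : ℂ) ≠ 0 := by exact_mod_cast ht.ne'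
      cases j with
      | zero =>
        have h1 := sub_smul_dslope y 0 ((t : ℂ) * I)
        rw [hy1 t ht, sub_zero, smul_eq_mul] at h1
        have h2 : ((t : ℂ) * I)⁻¹ = -I / t := by
          rw [mul_inv, Complex.inv_I]; ring
        have h3 : (n : ℝ) / 2 + ((0 : ℕ) : ℝ) = 1 / 2 := by rw [hm]; push_cast; ring
        have h4 : I * dslope y 0 ((t : ℂ) * I) + -I / t *
            (I * y 0) = (expE (1 / 2) (t ^ 2) : ℝ) := by
          generalize dslope y 0 ((t : ℂ) * I) = d at h1 ⊢
          field_simp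
          linear_combination h1 - y 0 * I_sq
        change cHeat n * (I * dslope y 0 ((t : ℂ) * I)) +
          (if (0 : ℕ) = 0 then ((t : ℂ) * I)⁻¹ * (cHeat n * (I * y 0)) else 0) = _
        rw [if_pos rfl, h3, h2, ← h4]
        ring
      | succ j =>
        have h3 : (n : ℝ) / 2 + ((j + 1 : ℕ) : ℝ) = 3 / 2 + (j : ℝ) := by rw [hm]; push_cast; ring
        simp only [Nat.add_eq_zero_iff, one_ne_zero, and_false, if_false, add_zero]
        rw [hsq', hg1 t ht, gammaSeq_expE h32 (by positivity), h3]
  · refine main (fun z j => cHeat n * gammaSeq (3 / 2) (z ^ 2) (g z) (m - 1 + j)) 0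
      (fun j => (differentiable_gammaSeq hμ hg _).const_mul _) (fun z₀ => ?_) fun t ht j => ?_
    · obtain ⟨C, -, hC⟩ := exists_bound_gammaSeq_ball h32 hμ hg (cHeat n) z₀
      exact ⟨C, fun z hz j => hC z hz _⟩
    · have h3 : (n : ℝ) / 2 + j = 3 / 2 + ((m - 1 + j : ℕ) : ℝ) := by
        rw [hm]; push_cast [Nat.cast_sub hm0]; ring
      simp only [mul_zero, ite_self, add_zero]
      rw [hsq', hg1 t ht, gammaSeq_expE h32 (by positivity), h3]

end FreeContinuation

/-! ### Self-adjoint operators and their resolvents -/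

section Resolvent

/-- A bounded operator whose values lie in the range of an injective bounded operator factors
through it, by the closed graph theorem. -/
lemma exists_lift_of_injective {F Y Z : Type*} [NormedAddCommGroup F] [NormedSpace ℂ F]
    [CompleteSpace F] [NormedAddCommGroup Y] [NormedSpace ℂ Y] [CompleteSpace Y]
    [NormedAddCommGroup Z] [NormedSpace ℂ Z] (T : F →L[ℂ] Z) (J : Y →L[ℂ] Z)
    (hJ : Function.Injective J) (h : ∀ x, ∃ y, J y = T x) :
    ∃ S : F →L[ℂ] Y, ∀ x, J (S x) = T x := by
  choose s hs using h
  let S₀ : F →ₗ[ℂ] Y :=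
    { toFun := s
      map_add' := fun a b => hJ (by rw [map_add, hs, hs, hs, map_add])
      map_smul' := fun c a => hJ (by rw [map_smul, hs, hs, map_smul, RingHom.id_apply]) }
  refine ⟨ContinuousLinearMap.ofSeqClosedGraph (g := S₀) fun u x y hu hy => hJ ?_, hs⟩
  have h1 := (J.continuous.tendsto y).comp hy
  have h2 := (T.continuous.tendsto x).comp hu
  refine tendsto_nhds_unique h1 ?_
  rw [show J (S₀ x) = T x from hs x]
  exact h2.congr fun k => (hs _).symm

variable {H : Type*} [NormedAddCommGroup H] [InnerProductSpace ℂ H] {P : H →ₗ.[ℂ] H}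

variable (P) in
/-- The inclusion of the domain, with its graph norm. -/
def domFst : P.graph →L[ℂ] H := ContinuousLinearMap.fst ℂ H H ∘L P.graph.subtypeL

variable (P) in
/-- The operator as a bounded operator on its domain. -/
def domSnd : P.graph →L[ℂ] H := ContinuousLinearMap.snd ℂ H H ∘L P.graph.subtypeL

lemma graph_ext {u v : P.graph} (h : domFst P u = domFst P v) : u = v :=
  Subtype.ext (P.mem_graph_snd_inj' u.2 v.2 h |> Prod.ext h)

lemma IsResolventAt.unique {z : ℂ} {S T : H →L[ℂ] P.graph} (hS : IsResolventAt P z S)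
    (hT : IsResolventAt P z T) : S = T := by
  ext1 f
  have h1 := hT.1 f
  obtain ⟨u, hu1, hu2⟩ := P.mem_graph_iff.1 (T f).2
  have h2 := hS.2 u
  rw [hu1, hu2, h1] at h2
  exact graph_ext h2

lemma resolvent_eq {z : ℂ} {T : H →L[ℂ] P.graph} (hT : IsResolventAt P z T) :
    resolvent P z = T := by
  have h : ∃ T, IsResolventAt P z T := ⟨T, hT⟩
  rw [resolvent, dif_pos h]
  exact h.choose_spec.unique hT

lemma isResolventAt_resolvent {z : ℂ} (h : z ∈ resolventSet P) :
    IsResolventAt P z (resolvent P z) := by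
  obtain ⟨T, hT⟩ := h
  rwa [resolvent_eq hT]

variable [CompleteSpace H]

lemma completeSpace_graph (hP : IsSelfAdjoint P) : CompleteSpace P.graph := by
  have h : IsClosed (P.graph : Set (H × H)) := hP.isClosed
  exact h.completeSpace_coe

lemma inner_graph (hP : IsSelfAdjoint P) {a b : H × H} (ha : a ∈ P.graph) (hb : b ∈ P.graph) :
    inner ℂ a.2 b.1 = inner ℂ a.1 b.2 := by
  have h := LinearPMap.adjoint_graph_eq_graph_adjoint hP.dense_domain
  rw [LinearPMap.isSelfAdjoint_def.1 hP] at h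
  rw [h, Submodule.mem_adjoint_iff] at hb
  exact sub_eq_zero.1 (hb a.1 a.2 ha)

lemma mem_graph_of_inner (hP : IsSelfAdjoint P) {b : H × H}
    (h : ∀ a ∈ P.graph, inner ℂ a.2 b.1 = inner ℂ a.1 b.2) : b ∈ P.graph := by
  have h1 := LinearPMap.adjoint_graph_eq_graph_adjoint hP.dense_domain
  rw [LinearPMap.isSelfAdjoint_def.1 hP] at h1
  rw [h1, Submodule.mem_adjoint_iff]
  exact fun x y hxy => sub_eq_zero.2 (h _ hxy)

/-- An eigenvector of a self-adjoint operator is orthogonal to the range of `P - z`. -/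
lemma eq_zero_of_eigenvector (hP : IsSelfAdjoint P) {z : ℂ} {u : H} (hu : (u, z • u) ∈ P.graph)
    {a : H × H} (ha : a ∈ P.graph) (hau : a.2 - z • a.1 = u) : u = 0 := by
  have h1 := inner_graph hP hu hu
  simp only [inner_smul_left, inner_smul_right] at h1
  by_contra h0
  have h2 : (inner ℂ u u : ℂ) ≠ 0 := inner_self_ne_zero.2 h0
  have h3 : (starRingEnd ℂ) z = z := mul_right_cancel₀ h2 h1
  have h4 := inner_graph hP hu ha
  simp only [inner_smul_left, h3] at h4
  refine h2 ?_
  calc inner ℂ u u = inner ℂ u (a.2 - z • a.1) := by rw [hau]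
    _ = 0 := by rw [inner_sub_right, inner_smul_right, ← h4, sub_self]

/-- For a self-adjoint operator, a bounded right inverse of `P - z` is the resolvent. -/
lemma isResolventAt_of_rightInverse (hP : IsSelfAdjoint P) {z : ℂ} {T : H →L[ℂ] P.graph}
    (h : ∀ f, (T f).1.2 - z • (T f).1.1 = f) : IsResolventAt P z T := by
  refine ⟨h, fun u => ?_⟩
  set f := P u - z • (u : H) with hf
  have h1 := P.graph.sub_mem (T f).2 (P.mem_graph u)
  have h2 := h f
  have h3 : (T f).1 - ((u : H), P u) = ((T f).1.1 - u, z • ((T f).1.1 - u)) := by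
    refine Prod.ext rfl ?_
    change (T f).1.2 - P u = z • ((T f).1.1 - u)
    rw [smul_sub, sub_eq_sub_iff_sub_eq_sub, h2]
  rw [h3] at h1
  exact sub_eq_zero.1 (eq_zero_of_eigenvector hP h1 (T _).2 (h _))

lemma neg_I_mem_resolventSet (hP : IsSelfAdjoint P) : -I ∈ resolventSet P := by
  have := completeSpace_graph hP
  let A : P.graph →L[ℂ] H := domSnd P + I • domFst P
  have hA : ∀ u, A u = u.1.2 + I • u.1.1 := fun u => rfl
  have hn : ∀ u : P.graph, ‖A u‖ ^ 2 = ‖u.1.2‖ ^ 2 + ‖u.1.1‖ ^ 2 := by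
    intro u
    have h1 := inner_graph hP u.2 u.2
    rw [hA, norm_add_sq (𝕜 := ℂ), inner_smul_right, norm_smul, Complex.norm_I, one_mul]
    have h2 : (inner ℂ u.1.2 u.1.1 : ℂ).im = 0 := by
      have h3 := inner_conj_symm (𝕜 := ℂ) u.1.2 u.1.1
      rw [← h1] at h3
      exact Complex.conj_eq_iff_im.1 h3
    simp [h2]
  have hb : ∀ u : P.graph, ‖u‖ ≤ ‖A u‖ := by
    intro u
    have h1 := hn u
    refine (max_le ?_ ?_ : max ‖u.1.1‖ ‖u.1.2‖ ≤ _)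
    · exact abs_le_of_sq_le_sq' (by nlinarith [sq_nonneg ‖u.1.2‖]) (norm_nonneg _) |>.2
    · exact abs_le_of_sq_le_sq' (by nlinarith [sq_nonneg ‖u.1.1‖]) (norm_nonneg _) |>.2
  have hanti : AntilipschitzWith 1 A := A.antilipschitz_of_bound (by simpa using hb)
  have hker : A.ker = ⊥ := LinearMap.ker_eq_bot.2 hanti.injective
  have hcl : IsClosed (A.range : Set H) := by
    rw [show (A.range : Set H) = Set.range A from LinearMap.coe_range _]
    exact hanti.isClosed_range A.uniformContinuous
  have hr : A.range = ⊤ := by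
    have : CompleteSpace A.range := hcl.completeSpace_coe
    rw [← Submodule.orthogonal_eq_bot_iff, Submodule.eq_bot_iff]
    intro w hw
    have h1 : ∀ u : P.graph, inner ℂ (A u) w = 0 := fun u =>
      (Submodule.mem_orthogonal _ _).1 hw _ ⟨u, rfl⟩
    have h2 : (w, I • w) ∈ P.graph := by
      refine mem_graph_of_inner hP fun a ha => ?_
      have := h1 ⟨a, ha⟩
      rw [hA, inner_add_left, inner_smul_left, Complex.conj_I] at this
      rw [inner_smul_right]
      linear_combination this
    have h3 := hn ⟨_, h2⟩
    have h4 : inner ℂ w w = (0 : ℂ) := by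
      have := h1 ⟨_, h2⟩
      rw [hA] at this
      simp only [← add_smul, inner_smul_left] at this
      simpa using this
    exact inner_self_eq_zero.1 h4
  let e := ContinuousLinearEquiv.ofBijective A hker hr
  refine ⟨e.symm.toContinuousLinearMap, isResolventAt_of_rightInverse hP fun f => ?_⟩
  have h1 : A (e.symm f) = f := e.apply_symm_apply f
  rw [hA] at h1
  rw [neg_smul, sub_neg_eq_add]
  exact h1

end Resolvent

/-! ### Products of Sobolev functions and cutoffs -/

section MulJet

/-- The property `p` holds for `ψ` and for its derivatives of first and second order. -/
def UpToTwo (p : (𝔼 → ℂ) → Prop) (ψ : 𝔼 → ℂ) :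
    Prop :=
  p ψ ∧ (∀ i, p (pd i ψ)) ∧ ∀ i j, p (pd j (pd i ψ))

lemma UpToTwo.imp {p q : (𝔼 → ℂ) → Prop} {ψ : 𝔼 → ℂ} (h : UpToTwo p ψ) (hpq : ∀ φ, p φ → q φ) :
    UpToTwo q ψ :=
  ⟨hpq _ h.1, fun i => hpq _ (h.2.1 i), fun i j => hpq _ (h.2.2 i j)⟩

lemma UpToTwo.and {p q : (𝔼 → ℂ) → Prop} {ψ : 𝔼 → ℂ} (h : UpToTwo p ψ) (h' : UpToTwo q ψ) :
    UpToTwo (fun φ => p φ ∧ q φ) ψ :=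
  ⟨⟨h.1, h'.1⟩, fun i => ⟨h.2.1 i, h'.2.1 i⟩, fun i j => ⟨h.2.2 i j, h'.2.2 i j⟩⟩

lemma upToTwo_contDiff {ψ : 𝔼 → ℂ} (h : ContDiff ℝ ∞ ψ) : UpToTwo (ContDiff ℝ ∞) ψ :=
  ⟨h, contDiff_pd h, fun i => contDiff_pd (contDiff_pd h i)⟩

lemma upToTwo_tsupport (ψ : 𝔼 → ℂ) : UpToTwo (fun φ => tsupport φ ⊆ tsupport ψ) ψ :=
  ⟨subset_rfl, fun i => tsupport_pd_subset ψ i, fun i j =>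
    (tsupport_pd_subset _ j).trans (tsupport_pd_subset ψ i)⟩

lemma pd_one_sub (i : Fin n) (ψ : 𝔼 → ℂ) : pd i (fun x => 1 - ψ x) = fun x => -pd i ψ x := by
  ext x
  rw [pd, fderiv_const_sub]
  rfl

lemma pd_neg (i : Fin n) (ψ : 𝔼 → ℂ) : pd i (fun x => -ψ x) = fun x => -pd i ψ x := by
  ext x
  simp [pd]

/-- A function with compact support, or a constant plus such a function, is bounded together with
its derivatives. -/
lemma upToTwo_bounded {ψ : 𝔼 → ℂ} (h : ContDiff ℝ ∞ ψ) (hc : HasCompactSupport fun x => 1 - ψ x) :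
    UpToTwo (fun φ => ∃ C, ∀ x, ‖φ x‖ ≤ C) ψ := by
  have h1 : UpToTwo (fun φ => ∃ C, ∀ x, ‖φ x‖ ≤ C) fun x => 1 - ψ x :=
    ((upToTwo_contDiff (contDiff_const.sub h)).and (upToTwo_tsupport _)).imp fun φ hφ =>
      (HasCompactSupport.exists_bound_of_continuous
        (hc.of_isClosed_subset (isClosed_tsupport _) hφ.2) hφ.1.continuous)
  refine ⟨?_, fun i => ?_, fun i j => ?_⟩
  · obtain ⟨C, hC⟩ := h1.1
    refine ⟨1 + C, fun x => ?_⟩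
    calc ‖ψ x‖ = ‖1 - (1 - ψ x)‖ := by ring_nf
      _ ≤ ‖(1 : ℂ)‖ + ‖1 - ψ x‖ := norm_sub_le _ _
      _ ≤ 1 + C := by rw [norm_one]; linarith [hC x]
  · simpa only [pd_one_sub, norm_neg] using h1.2.1 i
  · simpa only [pd_one_sub, pd_neg, norm_neg] using h1.2.2 i j

/-- Products of `ψ` with square integrable functions that have square integrable derivatives are
jets. -/
lemma exists_jet {U : Set 𝔼} {u ψ : 𝔼 → ℂ} {g : Fin n → 𝔼 → ℂ} {h : Fin n → Fin n → 𝔼 → ℂ}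
    {c : ℝ} (H : WeakTwo U u g h) (hψ : ContDiff ℝ ∞ ψ) (hs : tsupport ψ ⊆ U)
    {q : (𝔼 → ℂ) → Prop} (hu : q u) (hg : ∀ i, q (g i)) (hh : ∀ i j, q (h i j))
    (hq : ∀ f, q f → UpToTwo (fun φ => MemLp (fun x => wt (-c) x * (φ x * f x)) 2) ψ) :
    ∃ w : JetSpace n c, (∀ᵐ x, wt c x * w.val.1 x = ψ x * u x) ∧
      ∀ᵐ x, wt c x * jetLap w.val x = lap ψ x * u x + 2 * ∑ i, pd i ψ x * g i x +
        ψ x * ∑ i, h i i x := by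
  have hM := H.mul isOpen_univ hψ (by rwa [Set.univ_inter])
  have m1 : MemLp (fun x => wt (-c) x * (ψ x * u x)) 2 := (hq u hu).1
  have m2 : ∀ i, MemLp (fun x => wt (-c) x * (pd i ψ x * u x + ψ x * g i x)) 2 := fun i => by
    simp only [mul_add]
    exact ((hq u hu).2.1 i).add (hq _ (hg i)).1
  have m3 : ∀ i j, MemLp (fun x => wt (-c) x * ((pd j (pd i ψ) x * u x + pd i ψ x * g j x) +
      (pd j ψ x * g i x + ψ x * h i j x))) 2 := fun i j => by
    simp only [mul_add]
    exact (((hq u hu).2.2 i j).add ((hq _ (hg j)).2.1 i)).add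
      (((hq _ (hg i)).2.1 j).add (hq _ (hh i j)).1)
  have key : ∀ {f : 𝔼 → ℂ} (hf : MemLp (fun x => wt (-c) x * f x) 2),
      ∀ᵐ x, wt c x * hf.toLp _ x = f x := fun {f} hf => by
    filter_upwards [hf.coeFn_toLp] with x hx
    rw [hx, ← mul_assoc, wt_neg_mul, one_mul]
  have key' : ∀ {f : 𝔼 → ℂ} (hf : MemLp (fun x => wt (-c) x * f x) 2),
      f =ᵐ[volume.restrict Set.univ] fun x => wt c x * hf.toLp _ x := fun {f} hf => by
    rw [Measure.restrict_univ]
    filter_upwards [key hf] with x hx using hx.symm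
  let w : Jet n := (m1.toLp _, fun i => (m2 i).toLp _, fun i j => (m3 i j).toLp _)
  have hw : w ∈ jetSpace n c :=
    ⟨fun i => (hM.first i).congr isOpen_univ (key' m1) (key' (m2 i)),
      fun i j => (hM.second i j).congr isOpen_univ (key' (m2 i)) (key' (m3 i j))⟩
  refine ⟨⟨w, hw⟩, key m1, ?_⟩
  have h1 : ∀ᵐ x, ∀ i, wt c x * (m3 i i).toLp _ x = _ := ae_all_iff.2 fun i => key (m3 i i)
  filter_upwards [coeFn_sum_L2 Finset.univ fun i => w.2.2 i i, h1] with x e1 e2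
  change wt c x * (∑ i, w.2.2 i i : L2 n) x = _
  rw [e1, Finset.mul_sum, lap, Finset.sum_congr rfl fun i _ => e2 i, Finset.sum_mul,
    Finset.mul_sum, Finset.mul_sum, ← Finset.sum_add_distrib, ← Finset.sum_add_distrib]
  exact Finset.sum_congr rfl fun i _ => by ring

variable (n) in
/-- The function of a jet. -/
def jetFun (c : ℝ) : JetSpace n c →L[ℂ] L2 n := jetLow n c none

lemma jetFun_apply {c : ℝ} (v : JetSpace n c) : jetFun n c v = v.val.1 := rfl

lemma injective_jetFun (c : ℝ) : Function.Injective (jetFun n c) := fun _ _ h => JetSpace.ext h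

variable (n) in
/-- The Laplacian of a jet. -/
def jetLapL (c : ℝ) : JetSpace n c →L[ℂ] L2 n :=
  (∑ i, proj i ∘L proj i ∘L
    ContinuousLinearMap.snd ℂ (Fin n → L2 n) (Fin n → Fin n → L2 n) ∘L
      ContinuousLinearMap.snd ℂ (L2 n) _) ∘L JetSpace.val

lemma jetLapL_apply {c : ℝ} (v : JetSpace n c) : jetLapL n c v = jetLap v.val := by
  rw [jetLapL, comp_apply, sum_apply]
  rfl

/-- The terms of order zero and one in `Δ(ψ v)`, in `L²(ν)`. -/
def commOp (ψ : 𝔼 → ℂ) (c : ℝ) (ν : Measure 𝔼) :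
    JetSpace n c →L[ℂ] Lp ℂ 2 ν :=
  mulOp (fun x => wt c x * lap ψ x) volume ν ∘L jetLow n c none +
    ∑ i, mulOp (fun x => wt c x * (2 * pd i ψ x)) volume ν ∘L jetLow n c (some i)

lemma coeFn_sum_Lp {α ι : Type*} [MeasurableSpace α] {μ : Measure α} (s : Finset ι)
    (f : ι → Lp ℂ 2 μ) : ∀ᵐ x ∂μ, (∑ i ∈ s, f i : Lp ℂ 2 μ) x = ∑ i ∈ s, f i x := by
  classical
  induction s using Finset.induction_on with
  | empty =>
    filter_upwards [Lp.coeFn_zero ℂ 2 μ] with x hx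
    rw [Finset.sum_empty, Finset.sum_empty, hx]; rfl
  | insert a s ha ih =>
    filter_upwards [ih, Lp.coeFn_add (f a) (∑ i ∈ s, f i)] with x h1 h2
    rw [Finset.sum_insert ha, Finset.sum_insert ha, h2, Pi.add_apply, h1]

lemma coeFn_commOp {ψ : 𝔼 → ℂ} {c C : ℝ} {ν : Measure 𝔼}
    (h0 : MulBound (fun x => wt c x * lap ψ x) volume ν C)
    (h1 : ∀ i, MulBound (fun x => wt c x * (2 * pd i ψ x)) volume ν C) (v : JetSpace n c) :
    ∀ᵐ x ∂ν, commOp ψ c ν v x =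
      wt c x * (lap ψ x * v.val.1 x + 2 * ∑ i, pd i ψ x * v.val.2.1 i x) := by
  have e3 : ∀ᵐ x ∂ν, ∀ i, mulOp (fun x => wt c x * (2 * pd i ψ x)) volume ν (v.val.2.1 i) x =
      wt c x * (2 * pd i ψ x) * v.val.2.1 i x := ae_all_iff.2 fun i => coeFn_mulOp (h1 i) _
  filter_upwards [coeFn_mulOp h0 v.val.1, e3, Lp.coeFn_add
    (mulOp (fun x => wt c x * lap ψ x) volume ν v.val.1)
    (∑ i, mulOp (fun x => wt c x * (2 * pd i ψ x)) volume ν (v.val.2.1 i)),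
    coeFn_sum_Lp Finset.univ fun i =>
      mulOp (fun x => wt c x * (2 * pd i ψ x)) volume ν (v.val.2.1 i)] with x e1 e2 e3 e4
  rw [commOp, add_apply, sum_apply]
  change (mulOp (fun x => wt c x * lap ψ x) volume ν v.val.1 +
    ∑ i, mulOp (fun x => wt c x * (2 * pd i ψ x)) volume ν (v.val.2.1 i) : Lp ℂ 2 ν) x = _
  rw [e3, Pi.add_apply, e1, e4, Finset.sum_congr rfl fun i _ => e2 i, mul_add, Finset.mul_sum,
    Finset.mul_sum, mul_assoc]
  congr 1
  exact Finset.sum_congr rfl fun i _ => by ring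

/-- Multiplication by `ψ` is bounded between weighted Sobolev spaces. -/
lemma exists_mulJet {ψ : 𝔼 → ℂ} {c c' : ℝ} (hψ : ContDiff ℝ ∞ ψ)
    (hb : UpToTwo (fun φ => ∃ C, ∀ x, ‖wt (c - c') x * φ x‖ ≤ C) ψ) :
    ∃ S : JetSpace n c →L[ℂ] JetSpace n c', ∀ v,
      (∀ᵐ x, wt c' x * (S v).val.1 x = ψ x * (wt c x * v.val.1 x)) ∧
      ∀ᵐ x, wt c' x * jetLap (S v).val x =
        wt c x * (lap ψ x * v.val.1 x + 2 * ∑ i, pd i ψ x * v.val.2.1 i x) +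
          ψ x * (wt c x * jetLap v.val x) := by
  have hwt : ∀ x : 𝔼, wt (-c') x * wt c x = wt (c - c') x := fun x => by
    simp only [wt]
    rw [← ofReal_mul, ← Real.exp_add]
    congr 2; ring
  have hb' := (upToTwo_contDiff hψ).and hb
  have hex : ∀ v : JetSpace n c, ∃ w : JetSpace n c',
      (∀ᵐ x, wt c' x * w.val.1 x = ψ x * (wt c x * v.val.1 x)) ∧
      ∀ᵐ x, wt c' x * jetLap w.val x =
        wt c x * (lap ψ x * v.val.1 x + 2 * ∑ i, pd i ψ x * v.val.2.1 i x) +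
          ψ x * (wt c x * jetLap v.val x) := by
    intro v
    obtain ⟨w, h1, h2⟩ := exists_jet (c := c') (weakTwo_of_mem_jetSpace v.val_mem) hψ
      (Set.subset_univ _) (q := fun f => ∃ p : L2 n, f = fun x => wt c x * p x)
      ⟨_, rfl⟩ (fun i => ⟨_, rfl⟩) (fun i j => ⟨_, rfl⟩) (by
        rintro f ⟨p, rfl⟩
        refine hb'.imp fun φ hφ => ?_
        obtain ⟨h1, C, hC⟩ := hφ
        refine ((mulBound_volume (((continuous_wt _).mul h1.continuous).measurable)
          hC).memLp p).ae_eq (ae_of_all _ fun x => ?_)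
        change wt (c - c') x * φ x * p x = wt (-c') x * (φ x * (wt c x * p x))
        rw [← hwt]; ring)
    refine ⟨w, h1, ?_⟩
    filter_upwards [h2, coeFn_sum_L2 Finset.univ fun i => v.val.2.2 i i] with x e1 e2
    rw [e1, jetLap, e2]
    simp only [Finset.mul_sum, mul_add]
    congr 1
    · congr 1
      · ring
      · exact Finset.sum_congr rfl fun i _ => by ring
  obtain ⟨C, hC⟩ := hb.1
  have hm : MulBound (fun x => wt (c - c') x * ψ x) (volume : Measure 𝔼) volume C :=
    mulBound_volume ((continuous_wt _).mul hψ.continuous).measurable hC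
  have hval : ∀ {v : JetSpace n c} {w : JetSpace n c'},
      (∀ᵐ x, wt c' x * w.val.1 x = ψ x * (wt c x * v.val.1 x)) →
      jetFun n c' w = (mulOp (fun x => wt (c - c') x * ψ x) volume volume ∘L jetFun n c) v := by
    intro v w h
    refine Lp.ext ?_
    filter_upwards [h, coeFn_mulOp hm v.val.1] with x e1 e2
    refine (mul_left_cancel₀ (wt_ne_zero c' x) ?_).trans e2.symm
    rw [jetFun_apply, e1, ← hwt]
    linear_combination (-ψ x * wt c x * v.val.1 x) * wt_neg_mul c' x
  obtain ⟨S, hS⟩ := exists_lift_of_injective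
    (mulOp (fun x => wt (c - c') x * ψ x) volume volume ∘L jetFun n c) (jetFun n c')
    (injective_jetFun c') fun v => by
      obtain ⟨w, hw, -⟩ := hex v
      exact ⟨w, hval hw⟩
  refine ⟨S, fun v => ?_⟩
  obtain ⟨w, hw, hw'⟩ := hex v
  have : S v = w := injective_jetFun c' ((hS v).trans (hval hw).symm)
  rw [this]
  exact ⟨hw, hw'⟩

end MulJet

/-! ### The black box Hamiltonian away from the ball -/

section Outer

lemma extMeasure_eq (hR₀ : 0 < R₀) : extMeasure n R₀ = volume.restrict (openExterior n R₀) := by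
  refine Measure.restrict_congr_set ?_
  have h : ∀ᵐ x : 𝔼, x ∉ Metric.sphere (0 : 𝔼) R₀ :=
    measure_eq_zero_iff_ae_notMem.1 (Measure.addHaar_sphere_of_ne_zero _ _ hR₀.ne')
  filter_upwards [h] with x hx
  refine propext ⟨fun h1 h2 => ?_, fun h1 => openExterior_subset h1⟩
  refine hx (le_antisymm h2 (not_lt.1 fun hlt => ?_))
  exact (show x ∈ (Metric.ball (0 : 𝔼) R₀)ᶜ from h1) hlt

lemma pd_lap_eq_zero_of_eventuallyEq {ψ : 𝔼 → ℂ} {x : 𝔼} {c : ℂ} (h : ψ =ᶠ[𝓝 x] fun _ => c) :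
    (∀ i, pd i ψ x = 0) ∧ lap ψ x = 0 := by
  have h1 : ∀ i, pd i ψ =ᶠ[𝓝 x] fun _ => 0 := fun i => by
    filter_upwards [h.eventuallyEq_nhds] with y hy
    rw [pd, hy.fderiv_eq]
    simp
  refine ⟨fun i => (h1 i).eq_of_nhds, Finset.sum_eq_zero fun i _ => ?_⟩
  rw [pd, (h1 i).fderiv_eq]
  simp

/-- `ψ` is smooth, equal to `1` near infinity, and vanishes near the closed ball of radius `R₀`. -/
structure IsOuter (R₀ : ℝ) (ψ : 𝔼 → ℂ) : Prop where
  contDiff : ContDiff ℝ ∞ ψ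
  compact : HasCompactSupport fun x => 1 - ψ x
  vanish : ∃ ε > 0, ∀ x, ‖x‖ < R₀ + ε → ψ x = 0

lemma IsOuter.tsupport_subset {ψ : 𝔼 → ℂ} (h : IsOuter R₀ ψ) : tsupport ψ ⊆ openExterior n R₀ := by
  obtain ⟨ε, hε, h0⟩ := h.vanish
  have h1 : tsupport ψ ⊆ {x | R₀ + ε ≤ ‖x‖} := by
    refine closure_minimal (fun x hx => ?_) (isClosed_le continuous_const continuous_norm)
    by_contra hlt
    exact hx (h0 x (not_le.1 hlt))
  refine h1.trans fun x hx => ?_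
  simp only [Set.mem_ofPred_eq] at hx
  simp only [openExterior, Set.mem_compl_iff, Metric.mem_closedBall, dist_zero_right, not_le]
  linarith

lemma IsOuter.eq_zero {ψ : 𝔼 → ℂ} (h : IsOuter R₀ ψ) {x : 𝔼} (hx : x ∉ openExterior n R₀) :
    ψ x = 0 := by
  by_contra h0
  exact hx (h.tsupport_subset (subset_tsupport _ h0))

lemma IsOuter.bounded {ψ : 𝔼 → ℂ} (h : IsOuter R₀ ψ) :
    UpToTwo (fun φ => ∃ C, ∀ x, ‖φ x‖ ≤ C) ψ := upToTwo_bounded h.contDiff h.compact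

/-- Bounded functions that vanish in the ball multiply `L²` of the exterior into `L²(ℝⁿ)`. -/
lemma mulBound_ext_volume {φ : 𝔼 → ℂ} {C : ℝ} (hφ : Measurable φ)
    (h0 : ∀ x, x ∉ exterior n R₀ → φ x = 0) (hC : ∀ x, ‖φ x‖ ≤ C) :
    MulBound φ (extMeasure n R₀) volume C := by
  have hC0 : 0 ≤ C := (norm_nonneg _).trans (hC 0)
  refine hasDens_extMeasure.mulBound hasDens_volume hφ hC0 fun x => ?_
  by_cases hx : x ∈ exterior n R₀
  · rw [Set.indicator_of_mem hx, mul_one, mul_one]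
    exact pow_le_pow_left₀ (norm_nonneg _) (hC x) 2
  · simp [h0 x hx, Set.indicator_of_notMem hx]

lemma IsOuter.mulBound {ψ : 𝔼 → ℂ} (h : IsOuter R₀ ψ) :
    ∃ C, MulBound ψ (extMeasure n R₀) volume C := by
  obtain ⟨C, hC⟩ := h.bounded.1
  exact ⟨C, mulBound_ext_volume h.contDiff.continuous.measurable
    (fun x hx => h.eq_zero fun h' => hx (openExterior_subset h')) hC⟩

/-- A cutoff between two concentric balls. -/
lemma exists_isOuter {a b : ℝ} (ha : 0 < a) (hab : a < b) (hR : R₀ < a) :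
    ∃ ψ : 𝔼 → ℂ, IsOuter R₀ ψ ∧ (∀ x, ‖x‖ ≤ a → ψ x = 0) ∧
      ∀ x, b ≤ ‖x‖ → ψ x = 1 ∧ (∀ i, pd i ψ x = 0) ∧ lap ψ x = 0 := by
  let f : ContDiffBump (0 : 𝔼) := ⟨a, (a + b) / 2, ha, by linarith⟩
  have hf : ContDiff ℝ ∞ fun x => ((1 - f x : ℝ) : ℂ) :=
    Complex.ofRealCLM.contDiff.comp (contDiff_const.sub f.contDiff)
  have h0 : ∀ x : 𝔼, ‖x‖ ≤ a → ((1 - f x : ℝ) : ℂ) = 0 := fun x hx => by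
    rw [f.one_of_mem_closedBall (by simpa using hx)]; simp
  have h1 : ∀ x : 𝔼, (a + b) / 2 ≤ ‖x‖ → ((1 - f x : ℝ) : ℂ) = 1 := fun x hx => by
    rw [f.zero_of_le_dist (by simpa using hx)]; simp
  refine ⟨fun x => ((1 - f x : ℝ) : ℂ), ⟨hf, ?_, a - R₀, by linarith, fun x hx =>
    h0 x (by linarith)⟩, h0, fun x hx => ⟨h1 x (by linarith), ?_⟩⟩
  · refine HasCompactSupport.intro (isCompact_closedBall (0 : 𝔼) b) fun x hx => ?_
    rw [h1 x (by simp at hx; linarith), sub_self]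
  · refine pd_lap_eq_zero_of_eventuallyEq (c := 1) ?_
    filter_upwards [continuous_norm.continuousAt.eventually (lt_mem_nhds
      (show (a + b) / 2 < ‖x‖ by linarith))] with y hy
    exact h1 y hy.le

variable (n R₀) in
/-- Restriction to the exterior. -/
def resExt : L2 n →L[ℂ] Lp ℂ 2 (extMeasure n R₀) := mulOp (fun _ => 1) volume (extMeasure n R₀)

lemma coeFn_resExt (g : L2 n) : ∀ᵐ x ∂extMeasure n R₀, resExt n R₀ g x = g x := by
  have h : MulBound (fun _ => 1) volume (extMeasure n R₀) 1 := by
    refine hasDens_volume.mulBound hasDens_extMeasure measurable_const zero_le_one fun x => ?_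
    by_cases hx : x ∈ exterior n R₀
    · simp [Set.indicator_of_mem hx]
    · simp [Set.indicator_of_notMem hx]
  filter_upwards [coeFn_mulOp h g] with x hx
  rw [resExt, hx, one_mul]

/-- The inner product with a function that vanishes in the ball is an integral over `ℝⁿ`. -/
lemma inner_resExt (f : Lp ℂ 2 (extMeasure n R₀)) {g : L2 n}
    (hg : ∀ᵐ x, x ∉ exterior n R₀ → g x = 0) :
    inner ℂ f (resExt n R₀ g) = ∫ x, inner ℂ (f x) (g x) := by
  rw [L2.inner_def]
  have h1 : ∫ x, inner ℂ (f x) (resExt n R₀ g x) ∂extMeasure n R₀ =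
      ∫ x in exterior n R₀, inner ℂ (f x) (g x) :=
    integral_congr_ae ((coeFn_resExt g).mono fun x hx => by simp only [hx])
  rw [h1]
  refine setIntegral_eq_integral_of_ae_compl_eq_zero ?_
  filter_upwards [hg] with x hx h
  rw [hx h, inner_zero_right]

lemma ae_ext_iff {p : 𝔼 → Prop} : (∀ᵐ x ∂extMeasure n R₀, p x) ↔ ∀ᵐ x, x ∈ exterior n R₀ → p x :=
  ae_restrict_iff' measurableSet_exterior

/-- The Laplacian of a jet vanishes where the function does. -/
lemma jetLap_eq_zero_of_ball {w : JetSpace n 0} {r : ℝ} (h : ∀ᵐ x, ‖x‖ < r → w.val.1 x = 0) :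
    ∀ᵐ x, ‖x‖ < r → jetLap w.val x = 0 := by
  have hU : IsOpen (Metric.ball (0 : 𝔼) r) := Metric.isOpen_ball
  have hW := (weakTwo_of_mem_jetSpace w.val_mem).mono hU (Set.subset_univ _)
  have h1 := hW.hasWeakLaplacianOn (locallyIntegrableOn_wt_mul 0 w.val.1 _)
  have h2 : HasWeakLaplacianOn (Metric.ball (0 : 𝔼) r) (fun x => wt 0 x * w.val.1 x) 0 := by
    refine HasWeakLaplacianOn.zero.congr hU ?_ EventuallyEq.rfl
    filter_upwards [ae_restrict_of_ae h, ae_restrict_mem hU.measurableSet] with x hx hx'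
    rw [hx (by simpa using hx'), mul_zero]; rfl
  have h3 := (ae_restrict_iff' hU.measurableSet).1 (HasWeakLaplacianOn.unique hU h1 h2)
  filter_upwards [h3, coeFn_sum_L2 Finset.univ fun i => w.val.2.2 i i] with x hx hx' hlt
  have := hx (by simpa using hlt)
  simp only [wt_zero, one_mul, Pi.zero_apply] at this
  rw [jetLap, hx', this]

variable {E : Type*} [NormedAddCommGroup E] [InnerProductSpace ℂ E] [CompleteSpace E]
  {P : Space n R₀ E →ₗ.[ℂ] Space n R₀ E}

variable (P) in
/-- The part of `u ∈ 𝒟(P)` outside the ball. -/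
def domExt : P.graph →L[ℂ] Lp ℂ 2 (extMeasure n R₀) := WithLp.sndL 2 ℂ _ _ ∘L domFst P

variable (P) in
/-- The part of `P u` outside the ball. -/
def imgExt : P.graph →L[ℂ] Lp ℂ 2 (extMeasure n R₀) := WithLp.sndL 2 ℂ _ _ ∘L domSnd P

lemma imgExt_apply (u : P.graph) : imgExt P u = u.1.2.snd := rfl

/-- Elements of the domain have two weak derivatives in `L²` of the exterior. -/
lemma IsBlackBoxHamiltonian.weakTwo (hP : IsBlackBoxHamiltonian P) (u : P.graph) :
    MemLp (domExt P u) 2 (volume.restrict (openExterior n R₀)) ∧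
    ∃ g h, WeakTwo (openExterior n R₀) (domExt P u) g h ∧
      (∀ i, MemLp (g i) 2 (volume.restrict (openExterior n R₀))) ∧
      (∀ i j, MemLp (h i j) 2 (volume.restrict (openExterior n R₀))) ∧
      ∀ᵐ x ∂volume.restrict (openExterior n R₀), ∑ i, h i i x = -imgExt P u x := by
  have hu := P.mem_domain_of_mem_graph u.2
  obtain ⟨h1, g, h, h2, h3⟩ := hP.sobolev _ hu
  have hW : WeakTwo (openExterior n R₀) (domExt P u) g h :=
    ⟨fun i => (h2 i).2, fun i j => (h3 i j).2⟩
  refine ⟨h1, g, h, hW, fun i => (h2 i).1, fun i j => (h3 i j).1, ?_⟩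
  have h4 := hP.laplacian ⟨_, hu⟩
  have h5 : P ⟨u.1.1, hu⟩ = u.1.2 := ((P.image_iff hu).2 u.2).symm
  rw [h5] at h4
  have h6 : LocallyIntegrableOn (domExt P u) (openExterior n R₀) := h4.1
  exact HasWeakLaplacianOn.unique isOpen_openExterior (hW.hasWeakLaplacianOn h6) h4

lemma IsOuter.exists_jet {ψ u : 𝔼 → ℂ} {g : Fin n → 𝔼 → ℂ} {h : Fin n → Fin n → 𝔼 → ℂ}
    (hψ : IsOuter R₀ ψ) (H : WeakTwo (openExterior n R₀) u g h)
    (m1 : MemLp u 2 (volume.restrict (openExterior n R₀)))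
    (m2 : ∀ i, MemLp (g i) 2 (volume.restrict (openExterior n R₀)))
    (m3 : ∀ i j, MemLp (h i j) 2 (volume.restrict (openExterior n R₀))) :
    ∃ w : JetSpace n 0, (∀ᵐ x, w.val.1 x = ψ x * u x) ∧
      ∀ᵐ x, jetLap w.val x = lap ψ x * u x + 2 * ∑ i, pd i ψ x * g i x +
        ψ x * ∑ i, h i i x := by
  have hU := (isOpen_openExterior (n := n) (R₀ := R₀)).measurableSet
  have hb := ((upToTwo_contDiff hψ.contDiff).and hψ.bounded).and (upToTwo_tsupport ψ)
  obtain ⟨w, h1, h2⟩ := BlackBox.exists_jet (c := 0) H hψ.contDiff hψ.tsupport_subset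
    (q := fun f => MemLp f 2 (volume.restrict (openExterior n R₀))) m1 m2 m3 (by
      intro f hf
      refine hb.imp fun φ hφ => ?_
      obtain ⟨⟨c1, C, hC⟩, c2⟩ := hφ
      have h3 := (memLp_indicator_iff_restrict hU).2 hf
      refine ((mulBound_volume c1.continuous.measurable hC).memLp (h3.toLp _)).ae_eq ?_
      filter_upwards [h3.coeFn_toLp] with x hx
      rw [hx, neg_zero, wt_zero, one_mul]
      by_cases hxU : x ∈ openExterior n R₀
      · rw [Set.indicator_of_mem hxU]
      · have : φ x = 0 := by
          by_contra h0
          exact hxU (hψ.tsupport_subset (c2 (subset_tsupport _ h0)))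
        simp [this])
  refine ⟨w, ?_, ?_⟩
  · filter_upwards [h1] with x hx
    rwa [wt_zero, one_mul] at hx
  · filter_upwards [h2] with x hx
    rwa [wt_zero, one_mul] at hx

/-- `ψ u ∈ H²(ℝⁿ)` for `u` in the domain and `ψ` vanishing near the ball. -/
lemma IsBlackBoxHamiltonian.exists_outerJet (hR₀ : 0 < R₀) (hP : IsBlackBoxHamiltonian P)
    {ψ : 𝔼 → ℂ} (hψ : IsOuter R₀ ψ) :
    ∃ T : P.graph →L[ℂ] JetSpace n 0, ∀ u, (∀ᵐ x, (T u).val.1 x = ψ x * domExt P u x) ∧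
      ∀ᵐ x, lap ψ x = 0 → (∀ i, pd i ψ x = 0) →
        jetLap (T u).val x = -(ψ x * imgExt P u x) := by
  have := completeSpace_graph hP.selfAdjoint
  have hU := (isOpen_openExterior (n := n) (R₀ := R₀)).measurableSet
  have hex : ∀ u : P.graph, ∃ w : JetSpace n 0, (∀ᵐ x, w.val.1 x = ψ x * domExt P u x) ∧
      ∀ᵐ x, lap ψ x = 0 → (∀ i, pd i ψ x = 0) →
        jetLap w.val x = -(ψ x * imgExt P u x) := by
    intro u
    obtain ⟨m1, g, h, hW, m2, m3, hl⟩ := hP.weakTwo u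
    obtain ⟨w, h1, h2⟩ := hψ.exists_jet hW m1 m2 m3
    refine ⟨w, h1, ?_⟩
    filter_upwards [h2, (ae_restrict_iff' hU).1 hl] with x hx hx' e1 e2
    rw [hx, e1, Finset.sum_eq_zero fun i _ => by rw [e2 i, zero_mul]]
    by_cases hxU : x ∈ openExterior n R₀
    · rw [hx' hxU]; ring
    · rw [hψ.eq_zero hxU]; ring
  obtain ⟨C, hC⟩ := hψ.mulBound
  have hval : ∀ {u : P.graph} {w : JetSpace n 0}, (∀ᵐ x, w.val.1 x = ψ x * domExt P u x) →
      jetFun n 0 w = (mulOp ψ (extMeasure n R₀) volume ∘L domExt P) u := by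
    intro u w h
    refine Lp.ext ?_
    filter_upwards [h, coeFn_mulOp hC (domExt P u)] with x e1 e2
    exact e1.trans e2.symm
  obtain ⟨T, hT⟩ := exists_lift_of_injective (mulOp ψ (extMeasure n R₀) volume ∘L domExt P)
    (jetFun n 0) (injective_jetFun 0) fun u => by
      obtain ⟨w, hw, -⟩ := hex u
      exact ⟨w, hval hw⟩
  refine ⟨T, fun u => ?_⟩
  obtain ⟨w, hw, hw'⟩ := hex u
  have : T u = w := injective_jetFun 0 ((hT u).trans (hval hw).symm)
  rw [this]
  exact ⟨hw, hw'⟩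

/-- Functions in `H²(ℝⁿ)` that vanish near the ball belong to the domain, and `P` acts on them as
`-Δ`. Both statements come from the maximality of self-adjoint operators. -/
lemma IsBlackBoxHamiltonian.outer_mem (hR₀ : 0 < R₀) (hP : IsBlackBoxHamiltonian P)
    {w : JetSpace n 0} {ε : ℝ} (hε : 0 < ε) (hw : ∀ᵐ x, ‖x‖ < R₀ + ε → w.val.1 x = 0) :
    ((WithLp.toLp 2 (0, resExt n R₀ w.val.1), WithLp.toLp 2 (0, -resExt n R₀ (jetLap w.val))) :
      Space n R₀ E × Space n R₀ E) ∈ P.graph := by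
  obtain ⟨ψ, hψ, -, hψ1⟩ := exists_isOuter (n := n) (R₀ := R₀) (a := R₀ + ε / 2) (b := R₀ + ε)
    (by linarith) (by linarith) (by linarith)
  obtain ⟨T, hT⟩ := hP.exists_outerJet hR₀ hψ
  have hlw := jetLap_eq_zero_of_ball hw
  have hvan : ∀ {g : L2 n}, (∀ᵐ x, ‖x‖ < R₀ + ε → g x = 0) →
      ∀ᵐ x, x ∉ exterior n R₀ → g x = 0 := fun h => h.mono fun x hx hx' => hx (by
    simp only [exterior, Set.mem_compl_iff, not_not, Metric.mem_ball, dist_zero_right] at hx'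
    linarith)
  refine mem_graph_of_inner hP.selfAdjoint fun a ha => ?_
  set u : P.graph := ⟨a, ha⟩
  obtain ⟨h1, h2⟩ := hT u
  simp only [WithLp.prod_inner_apply, WithLp.ofLp_fst, WithLp.ofLp_snd, inner_zero_right, zero_add,
    inner_neg_right]
  change inner ℂ (imgExt P u) _ = -inner ℂ (domExt P u) _
  rw [inner_resExt _ (hvan hw), inner_resExt _ (hvan hlw)]
  have e1 : ∫ x, inner ℂ (imgExt P u x) (w.val.1 x) = -inner ℂ (jetLap (T u).val) w.val.1 := by
    rw [L2.inner_def, ← integral_neg]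
    refine integral_congr_ae ?_
    filter_upwards [h2, hw] with x hx hx'
    by_cases hlt : ‖x‖ < R₀ + ε
    · rw [hx' hlt, inner_zero_right, inner_zero_right, neg_zero]
    · obtain ⟨p1, p2, p3⟩ := hψ1 x (not_lt.1 hlt)
      rw [hx p3 p2, p1, one_mul, inner_neg_left, neg_neg]
  have e2 : ∫ x, inner ℂ (domExt P u x) (jetLap w.val x) =
      inner ℂ (T u).val.1 (jetLap w.val) := by
    rw [L2.inner_def]
    refine integral_congr_ae ?_
    filter_upwards [h1, hlw] with x hx hx'
    by_cases hlt : ‖x‖ < R₀ + ε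
    · rw [hx' hlt, inner_zero_right, inner_zero_right]
    · rw [hx, (hψ1 x (not_lt.1 hlt)).1, one_mul]
  rw [e1, e2, inner_jetLap (T u).val_mem w.val_mem]

end Outer

/-! ### Compactness up to the sphere -/

section Shell

/-- A smooth bounded profile that vanishes up to `a + ε` and has a large slope between `a + 2ε` and
`a + δ`. -/
lemma exists_profile (a : ℝ) {ε δ : ℝ} (hε : 0 < ε) (hδ : 0 < δ) :
    ∃ Φ : ℝ → ℝ, ContDiff ℝ ∞ Φ ∧ (∀ s, 0 ≤ Φ s ∧ Φ s ≤ 2) ∧ (∀ s, s ≤ a + ε → Φ s = 0) ∧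
      (∀ s, 0 ≤ deriv Φ s) ∧ ∀ s, a + 2 * ε < s → s < a + δ → 1 / (2 * δ) ≤ deriv Φ s := by
  let τ : ℝ → ℝ := fun s => Real.smoothTransition ((s - a) / ε - 1)
  let A : ℝ → ℝ := fun s => Real.arctan ((s - a) / δ)
  have h0 : ∀ s, s ≤ a + ε → τ s = 0 := fun s hs => by
    refine Real.smoothTransition.zero_of_nonpos ?_
    rw [sub_nonpos, div_le_one hε]; linarith
  have h1 : ∀ s, a + 2 * ε ≤ s → τ s = 1 := fun s hs => by
    refine Real.smoothTransition.one_of_one_le ?_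
    rw [le_sub_iff_add_le, le_div_iff₀ hε]; linarith
  have hA : ∀ s, a ≤ s → 0 ≤ A s := fun s hs => by
    rw [← Real.arctan_zero]
    exact Real.arctan_mono (div_nonneg (sub_nonneg.2 hs) hδ.le)
  have hA2 : ∀ s, A s ≤ 2 := fun s =>
    (Real.arctan_lt_pi_div_two _).le.trans (by linarith [Real.pi_lt_four])
  have hτ0 : ∀ s, 0 ≤ τ s := fun s => Real.smoothTransition.nonneg _
  have hτ1 : ∀ s, τ s ≤ 1 := fun s => Real.smoothTransition.le_one _
  have hτm : Monotone τ := fun s t hst => Real.smoothTransition.monotone (by gcongr)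
  have hAm : Monotone A := fun s t hst => Real.arctan_mono (by gcongr)
  have hmono : Monotone fun s => τ s * A s := by
    intro s t hst
    change τ s * A s ≤ τ t * A t
    rcases le_or_gt s (a + ε) with hs | hs
    · rw [h0 s hs, zero_mul]
      rcases le_or_gt t (a + ε) with ht | ht
      · rw [h0 t ht, zero_mul]
      · exact mul_nonneg (hτ0 t) (hA t (by linarith))
    · exact mul_le_mul (hτm hst) (hAm hst) (hA s (by linarith)) (hτ0 t)
  refine ⟨fun s => τ s * A s, ?_, fun s => ?_, fun s hs => ?_, fun s => hmono.deriv_nonneg,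
    fun s hs hs' => ?_⟩
  · refine ContDiff.mul (Real.smoothTransition.contDiff.comp (by fun_prop)) ?_
    exact Real.contDiff_arctan.comp (by fun_prop)
  · rcases le_or_gt s (a + ε) with hs | hs
    · simp [h0 s hs]
    · exact ⟨mul_nonneg (hτ0 s) (hA s (by linarith)),
        (mul_le_of_le_one_left (hA s (by linarith)) (hτ1 s)).trans (hA2 s)⟩
  · simp [h0 s hs]
  · have h2 : (fun s => τ s * A s) =ᶠ[𝓝 s] A := by
      filter_upwards [lt_mem_nhds hs] with t ht
      rw [h1 t ht.le, one_mul]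
    have h3 : HasDerivAt A ((1 + ((s - a) / δ) ^ 2)⁻¹ * (1 / δ)) s :=
      (Real.hasDerivAt_arctan' _).comp s (((hasDerivAt_id s).sub_const a).div_const δ)
    rw [h2.deriv_eq, h3.deriv]
    have h4 : ((s - a) / δ) ^ 2 ≤ 1 := by
      have : 0 ≤ (s - a) / δ := div_nonneg (by linarith) hδ.le
      have : (s - a) / δ ≤ 1 := by rw [div_le_one hδ]; linarith
      nlinarith
    have h5 : (2 : ℝ)⁻¹ ≤ (1 + ((s - a) / δ) ^ 2)⁻¹ := inv_anti₀ (by positivity) (by linarith)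
    calc 1 / (2 * δ) = 2⁻¹ * (1 / δ) := by field_simp
      _ ≤ _ := by gcongr

/-- A compactly supported radial field near the sphere, with large divergence in a thin shell. -/
lemma exists_field (hR₀ : 0 < R₀) : ∃ K : ℝ, 0 ≤ K ∧ ∀ ε δ : ℝ, 0 < ε → 0 < δ → δ < 1 →
    ∃ (X : Fin n → 𝔼 → ℝ) (b : ℝ), R₀ < b ∧ (∀ i, ContDiff ℝ ∞ (X i)) ∧
      (∀ i, HasCompactSupport (X i)) ∧ (∀ i x, ‖x‖ < b → X i x = 0) ∧ (∀ i x, |X i x| ≤ K) ∧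
      (∀ x, -K ≤ ∑ i, fderiv ℝ (X i) x (EuclideanSpace.single i 1)) ∧
      ∀ x, R₀ ^ 2 + 2 * ε < ‖x‖ ^ 2 → ‖x‖ ^ 2 < R₀ ^ 2 + δ →
        R₀ ^ 2 / δ - K ≤ ∑ i, fderiv ℝ (X i) x (EuclideanSpace.single i 1) := by
  let f : ContDiffBump (0 : 𝔼) := ⟨R₀ + 1, R₀ + 2, by linarith, by linarith⟩
  have hf : ContDiff ℝ ∞ f := f.contDiff
  have hfc : HasCompactSupport fun x : 𝔼 => fderiv ℝ f x x := by
    refine (f.hasCompactSupport.fderiv (𝕜 := ℝ)).mono fun x hx h0 => hx ?_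
    simp [h0]
  obtain ⟨K₁, hK₁⟩ := hfc.exists_bound_of_continuous
    ((hf.continuous_fderiv (by simp)).clm_apply continuous_id)
  have hK₁0 : 0 ≤ K₁ := (norm_nonneg _).trans (hK₁ 0)
  refine ⟨2 * K₁ + 2 * (R₀ + 2), by positivity, fun ε δ hε hδ hδ1 => ?_⟩
  obtain ⟨Φ, hΦ, hΦ2, hΦ0, hΦd, hΦs⟩ := exists_profile (R₀ ^ 2) hε hδ
  let Y : 𝔼 → ℝ := fun x => f x * Φ (‖x‖ ^ 2)
  have hY : ContDiff ℝ ∞ Y := hf.mul (hΦ.comp (contDiff_norm_sq ℝ))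
  have hYr : ∀ x : 𝔼, fderiv ℝ Y x x =
      fderiv ℝ f x x * Φ (‖x‖ ^ 2) + f x * (2 * ‖x‖ ^ 2 * deriv Φ (‖x‖ ^ 2)) := by
    intro x
    have h1 : HasFDerivAt f (fderiv ℝ f x) x := (hf.differentiable (by simp) x).hasFDerivAt
    have h2 : HasDerivAt Φ (deriv Φ (‖x‖ ^ 2)) (‖x‖ ^ 2) :=
      (hΦ.differentiable (by simp) _).hasDerivAt
    have h3 := h1.mul (h2.comp_hasFDerivAt x (hasStrictFDerivAt_norm_sq x).hasFDerivAt)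
    rw [show fderiv ℝ Y x = _ from h3.fderiv]
    simp
    ring
  have hX : ∀ (i : Fin n) (x : 𝔼), fderiv ℝ (fun y : 𝔼 => Y y * y i) x (EuclideanSpace.single i 1) =
      Y x + fderiv ℝ Y x (EuclideanSpace.single i 1) * x i := by
    intro i x
    have h1 : HasFDerivAt Y (fderiv ℝ Y x) x := (hY.differentiable (by simp) x).hasFDerivAt
    have h2 : HasFDerivAt (fun y : 𝔼 => y i) (EuclideanSpace.proj i : 𝔼 →L[ℝ] ℝ) x :=
      (EuclideanSpace.proj i : 𝔼 →L[ℝ] ℝ).hasFDerivAt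
    rw [show fderiv ℝ (fun y : 𝔼 => Y y * y i) x = _ from (h1.mul h2).fderiv]
    simp
    ring
  have hsum : ∀ x : 𝔼, ∑ i, fderiv ℝ (fun y : 𝔼 => Y y * y i) x (EuclideanSpace.single i 1) =
      n * Y x + fderiv ℝ Y x x := by
    intro x
    have h1 : fderiv ℝ Y x x = ∑ i, fderiv ℝ Y x (EuclideanSpace.single i 1) * x i := by
      have hx : x = ∑ i, x i • (EuclideanSpace.single i 1 : 𝔼) := by
        ext j
        simp [Finset.sum_apply, Pi.single_apply]
      conv_lhs => arg 2; rw [hx]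
      rw [map_sum]
      exact Finset.sum_congr rfl fun i _ => by rw [map_smul, smul_eq_mul, mul_comm]
    rw [Finset.sum_congr rfl fun i _ => hX i x, Finset.sum_add_distrib, h1]
    simp
  have hY0 : ∀ x, 0 ≤ Y x := fun x => mul_nonneg f.nonneg (hΦ2 _).1
  have hlow : ∀ x : 𝔼, f x * (2 * ‖x‖ ^ 2 * deriv Φ (‖x‖ ^ 2)) - 2 * K₁ ≤
      ∑ i, fderiv ℝ (fun y : 𝔼 => Y y * y i) x (EuclideanSpace.single i 1) := by
    intro x
    rw [hsum, hYr]
    have h1 : |fderiv ℝ f x x * Φ (‖x‖ ^ 2)| ≤ K₁ * 2 := by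
      rw [abs_mul]
      refine mul_le_mul (hK₁ x) ?_ (abs_nonneg _) hK₁0
      rw [abs_of_nonneg (hΦ2 _).1]
      exact (hΦ2 _).2
    have h2 : (0 : ℝ) ≤ n * Y x := mul_nonneg (by positivity) (hY0 x)
    linarith [(abs_le.1 h1).1]
  refine ⟨fun i x => Y x * x i, Real.sqrt (R₀ ^ 2 + ε), ?_, fun i => ?_, fun i => ?_,
    fun i x hx => ?_, fun i x => ?_, fun x => ?_, fun x hx hx' => ?_⟩
  · exact Real.lt_sqrt_of_sq_lt (by linarith)
  · exact hY.mul (EuclideanSpace.proj i : 𝔼 →L[ℝ] ℝ).contDiff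
  · exact f.hasCompactSupport.mul_right.mul_right
  · have : ‖x‖ ^ 2 < R₀ ^ 2 + ε := (Real.lt_sqrt (norm_nonneg x)).1 hx
    simp only [Y]
    rw [hΦ0 _ this.le]; ring
  · have h1 : |x i| ≤ ‖x‖ := by simpa using PiLp.norm_apply_le x i
    rcases le_or_gt (R₀ + 2) ‖x‖ with h | h
    · have : f x = 0 := f.zero_of_le_dist (by simpa using h)
      simp only [Y, this, zero_mul, abs_zero]
      positivity
    · rw [abs_mul, abs_of_nonneg (hY0 x)]
      have h2 : Y x ≤ 1 * 2 := mul_le_mul f.le_one (hΦ2 _).2 (hΦ2 _).1 zero_le_one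
      calc Y x * |x i| ≤ 2 * (R₀ + 2) :=
            mul_le_mul (by linarith) (by linarith) (abs_nonneg _) (by norm_num)
        _ ≤ _ := by linarith
  · refine le_trans ?_ (hlow x)
    have : 0 ≤ f x * (2 * ‖x‖ ^ 2 * deriv Φ (‖x‖ ^ 2)) :=
      mul_nonneg f.nonneg (mul_nonneg (by positivity) (hΦd _))
    linarith
  · refine le_trans ?_ (hlow x)
    have h1 : f x = 1 := by
      refine f.one_of_mem_closedBall ?_
      rw [mem_closedBall_zero_iff]
      exact (abs_le_of_sq_le_sq' (by nlinarith) (by linarith : (0 : ℝ) ≤ R₀ + 1)).2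
    have h2 := hΦs _ hx hx'
    have h3 : R₀ ^ 2 / δ ≤ 2 * ‖x‖ ^ 2 * deriv Φ (‖x‖ ^ 2) := by
      calc R₀ ^ 2 / δ = 2 * R₀ ^ 2 * (1 / (2 * δ)) := by field_simp
        _ ≤ _ := by
          refine mul_le_mul (by linarith) h2 (by positivity) (by positivity)
    rw [h1, one_mul]
    linarith

/-- Integration by parts in `H¹(ℝⁿ)`. -/
lemma inner_weakPair {i : Fin n} {a b a' b' : L2 n} (h : (a, b) ∈ weakPair n 0 i)
    (h' : (a', b') ∈ weakPair n 0 i) : inner ℂ a b' = -inner ℂ b a' := by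
  rw [weakPair_zero_iff] at h h'
  rw [← Lp.inner_fourier_eq, ← Lp.inner_fourier_eq b, L2.inner_def, L2.inner_def, ← integral_neg]
  refine integral_congr_ae ?_
  filter_upwards [fourier_weakPartial h, fourier_weakPartial h'] with ξ e1 e2
  rw [e1, e2]
  simp only [RCLike.inner_apply, map_mul, dsym, Complex.conj_ofReal, Complex.conj_I, map_ofNat]
  ring

variable (n R₀) in
/-- Pairs `(u, g)` in `L²` of the exterior such that `g` is the weak derivative `∂ᵢ u`. -/
def extPair (i : Fin n) :
    Submodule ℂ (Lp ℂ 2 (extMeasure n R₀) × Lp ℂ 2 (extMeasure n R₀)) where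
  carrier := {p | HasWeakPartialOn (openExterior n R₀) i p.1 p.2}
  add_mem' {p q} hp hq := (hp.add hq).congr isOpen_openExterior
    (EventuallyEq.symm (ae_mono restrict_openExterior_le (Lp.coeFn_add p.1 q.1)))
    (EventuallyEq.symm (ae_mono restrict_openExterior_le (Lp.coeFn_add p.2 q.2)))
  zero_mem' := by
    have h : HasWeakPartialOn (openExterior n R₀) i (0 : 𝔼 → ℂ) 0 :=
      ⟨locallyIntegrableOn_zero, locallyIntegrableOn_zero, fun φ _ => by simp⟩
    exact h.congr isOpen_openExterior
      (EventuallyEq.symm (ae_mono restrict_openExterior_le (Lp.coeFn_zero ℂ 2 _)))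
      (EventuallyEq.symm (ae_mono restrict_openExterior_le (Lp.coeFn_zero ℂ 2 _)))
  smul_mem' c p hp := (hp.smul c).congr isOpen_openExterior
    (EventuallyEq.symm (ae_mono restrict_openExterior_le (Lp.coeFn_smul c p.1)))
    (EventuallyEq.symm (ae_mono restrict_openExterior_le (Lp.coeFn_smul c p.2)))

lemma locallyIntegrableOn_ext (u : Lp ℂ 2 (extMeasure n R₀)) :
    LocallyIntegrableOn u (openExterior n R₀) := by
  have hU := (isOpen_openExterior (n := n) (R₀ := R₀)).measurableSet
  have h := (Lp.memLp u).mono_measure restrict_openExterior_le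
  refine locallyIntegrableOn_congr isOpen_openExterior (locallyIntegrableOn_L2 _
    ((memLp_indicator_iff_restrict hU).2 h)) ?_
  filter_upwards [ae_restrict_mem hU] with x hx
  rw [Set.indicator_of_mem hx]

lemma isClosed_extPair (hR₀ : 0 < R₀) (i : Fin n) :
    IsClosed (extPair n R₀ i : Set (Lp ℂ 2 (extMeasure n R₀) × Lp ℂ 2 (extMeasure n R₀))) := by
  have : (extPair n R₀ i : Set (Lp ℂ 2 (extMeasure n R₀) × Lp ℂ 2 (extMeasure n R₀))) =
      ⋂ (φ : 𝔼 → ℝ) (_ : IsTestOn (openExterior n R₀) φ),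
      {p | ∫ x, ((fderiv ℝ φ x (EuclideanSpace.single i 1) : ℝ) : ℂ) * p.1 x ∂extMeasure n R₀ =
        -∫ x, (φ x : ℂ) * p.2 x ∂extMeasure n R₀} := by
    ext p
    simp only [Set.mem_iInter, Set.mem_ofPred_eq, extMeasure_eq hR₀]
    constructor
    · intro h φ hφ
      simpa using h.2.2 φ hφ
    · intro h
      refine ⟨locallyIntegrableOn_ext _, locallyIntegrableOn_ext _, fun φ hφ => ?_⟩
      simpa using h φ hφ
  rw [this]
  refine isClosed_iInter fun φ => isClosed_iInter fun hφ => ?_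
  have hφ' := isTestOn_fderiv hφ i
  have key : ∀ ψ : 𝔼 → ℝ, IsTestOn (openExterior n R₀) ψ →
      Continuous fun u : Lp ℂ 2 (extMeasure n R₀) => ∫ x, (ψ x : ℂ) * u x ∂extMeasure n R₀ :=
    fun ψ hψ => continuous_integral_mul (memLp_of_continuous_compact hψ.complex.1.continuous
      hψ.complex.2.1 _)
  exact isClosed_eq ((key _ hφ').comp continuous_fst) ((key _ hφ).comp continuous_snd).neg

/-- The identity `∫ div(X) |u|² = -2 Re ∫ X ū ∂u` for one component of a field `X` that vanishes near
the ball. -/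
lemma integral_div_eq_zero (hR₀ : 0 < R₀) {i : Fin n} {u g : Lp ℂ 2 (extMeasure n R₀)}
    (h : (u, g) ∈ extPair n R₀ i) {X : 𝔼 → ℝ} {b : ℝ} (hb : R₀ < b) (hX : ContDiff ℝ ∞ X)
    (hXc : HasCompactSupport X) (hX0 : ∀ x, ‖x‖ < b → X x = 0) :
    Integrable (fun x => fderiv ℝ X x (EuclideanSpace.single i 1) * ‖u x‖ ^ 2 +
      2 * X x * (inner ℂ (u x) (g x)).re) (extMeasure n R₀) ∧
    ∫ x, fderiv ℝ X x (EuclideanSpace.single i 1) * ‖u x‖ ^ 2 +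
      2 * X x * (inner ℂ (u x) (g x)).re ∂extMeasure n R₀ = 0 := by
  obtain ⟨ψ, hψ, -, hψ1⟩ := exists_isOuter (n := n) (R₀ := R₀) (a := (R₀ + b) / 2) (b := b)
    (by linarith) (by linarith) (by linarith)
  set Xc : 𝔼 → ℂ := fun x => (X x : ℂ) with hXcdef
  have hXs : ContDiff ℝ ∞ Xc := Complex.ofRealCLM.contDiff.comp hX
  have hXcc : HasCompactSupport Xc := hXc.comp_left (g := fun t : ℝ => (t : ℂ)) (by simp)
  have hX0' : ∀ x, ‖x‖ < b → Xc x = 0 ∧ pd i Xc x = 0 := fun x hx => by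
    refine ⟨by simp [hXcdef, hX0 x hx], (pd_lap_eq_zero_of_eventuallyEq (c := 0) ?_).1 i⟩
    filter_upwards [continuous_norm.continuousAt.eventually (gt_mem_nhds hx)] with y hy
    simp [hXcdef, hX0 y hy]
  obtain ⟨C₀, hC₀⟩ := hψ.mulBound
  have hvan : ∀ x, x ∉ exterior n R₀ → pd i ψ x = 0 := fun x hx => by
    by_contra h0
    exact hx (openExterior_subset (hψ.tsupport_subset (tsupport_pd_subset ψ i
      (subset_tsupport _ h0))))
  obtain ⟨C₁, hC₁⟩ := hψ.bounded.2.1 i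
  have hC₁' := mulBound_ext_volume (contDiff_pd hψ.contDiff i).continuous.measurable hvan hC₁
  obtain ⟨C₂, hC₂⟩ := exists_mulBound hXs.continuous hXcc
  obtain ⟨C₃, hC₃⟩ := exists_mulBound (contDiff_pd hXs i).continuous
    (hXcc.of_isClosed_subset (isClosed_tsupport _) (tsupport_pd_subset Xc i))
  -- the cut off function, its derivative, and their products with the field
  set a : L2 n := mulOp ψ (extMeasure n R₀) volume u with ha
  set d : L2 n := mulOp (pd i ψ) (extMeasure n R₀) volume u +
    mulOp ψ (extMeasure n R₀) volume g with hd
  have ea : ∀ᵐ x, a x = ψ x * u x := coeFn_mulOp hC₀ u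
  have ed : ∀ᵐ x, d x = pd i ψ x * u x + ψ x * g x := by
    filter_upwards [coeFn_mulOp hC₀ g, coeFn_mulOp hC₁' u, Lp.coeFn_add
      (mulOp (pd i ψ) (extMeasure n R₀) volume u) (mulOp ψ (extMeasure n R₀) volume g)]
      with x e1 e2 e3
    rw [hd, e3, Pi.add_apply, e1, e2]
  set a' : L2 n := mulOp Xc volume volume a with ha'
  set d' : L2 n := mulOp (pd i Xc) volume volume a + mulOp Xc volume volume d with hd'
  have ea' : ∀ᵐ x, a' x = Xc x * a x := coeFn_mulOp hC₂ a
  have ed' : ∀ᵐ x, d' x = pd i Xc x * a x + Xc x * d x := by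
    filter_upwards [coeFn_mulOp hC₂ d, coeFn_mulOp hC₃ a, Lp.coeFn_add
      (mulOp (pd i Xc) volume volume a) (mulOp Xc volume volume d)] with x e1 e2 e3
    rw [hd', e3, Pi.add_apply, e1, e2]
  have w1 : HasWeakPartialOn Set.univ i a d := by
    have h1 : HasWeakPartialOn (openExterior n R₀) i u g := h
    refine (h1.mul isOpen_univ hψ.contDiff (by rw [Set.univ_inter]; exact hψ.tsupport_subset)).congr
      isOpen_univ ?_ ?_
    · rw [Measure.restrict_univ]; filter_upwards [ea] with x hx using hx.symm
    · rw [Measure.restrict_univ]; filter_upwards [ed] with x hx using hx.symm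
  have w2 : HasWeakPartialOn Set.univ i a' d' := by
    refine (w1.mul isOpen_univ hXs (Set.subset_univ _)).congr isOpen_univ ?_ ?_
    · rw [Measure.restrict_univ]; filter_upwards [ea'] with x hx using hx.symm
    · rw [Measure.restrict_univ]; filter_upwards [ed'] with x hx using hx.symm
  have key := inner_weakPair (weakPair_zero_iff.2 w1) (weakPair_zero_iff.2 w2)
  rw [← add_eq_zero_iff_eq_neg, L2.inner_def, L2.inner_def,
    ← integral_add (L2.integrable_inner a d') (L2.integrable_inner d a')] at key
  have hint := (L2.integrable_inner (𝕜 := ℂ) a d').add (L2.integrable_inner (𝕜 := ℂ) d a')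
  have hre : ∀ᵐ x, (inner ℂ (a x) (d' x) + inner ℂ (d x) (a' x)).re =
      fderiv ℝ X x (EuclideanSpace.single i 1) * ‖u x‖ ^ 2 +
        2 * X x * (inner ℂ (u x) (g x)).re := by
    filter_upwards [ea, ed, ea', ed'] with x e1 e2 e3 e4
    have e5 := pd_ofReal hX i x
    rw [e4, e3]
    by_cases hx : ‖x‖ < b
    · rw [(hX0' x hx).1, (hX0' x hx).2]
      have h1 : X x = 0 := hX0 x hx
      have h2 : fderiv ℝ X x (EuclideanSpace.single i 1) = 0 := by
        have := (hX0' x hx).2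
        rw [e5] at this
        exact_mod_cast this
      rw [h1, h2]
      simp
    · obtain ⟨p1, p2, -⟩ := hψ1 x (not_lt.1 hx)
      rw [e1, e2, p1, p2 i, one_mul, zero_mul, zero_add, one_mul, e5]
      have h3 : ‖u x‖ ^ 2 = (u x).re * (u x).re + (u x).im * (u x).im := by
        rw [← Complex.normSq_eq_norm_sq, Complex.normSq_apply]
      rw [h3]
      simp only [hXcdef, RCLike.inner_apply, Complex.add_re, Complex.mul_re, Complex.conj_re,
        Complex.conj_im, Complex.ofReal_re, Complex.ofReal_im, Complex.add_im, Complex.mul_im]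
      ring
  have hvan' : ∀ x, x ∉ exterior n R₀ → fderiv ℝ X x (EuclideanSpace.single i 1) * ‖u x‖ ^ 2 +
        2 * X x * (inner ℂ (u x) (g x)).re = 0 := by
    intro x hx
    have hlt : ‖x‖ < b := by
      simp only [exterior, Set.mem_compl_iff, not_not, Metric.mem_ball, dist_zero_right] at hx
      linarith
    have h2 : fderiv ℝ X x (EuclideanSpace.single i 1) = 0 := by
      have := (hX0' x hlt).2
      rw [pd_ofReal hX i x] at this
      exact_mod_cast this
    rw [hX0 x hlt, h2]; ring
  have hint' := hint.re.congr hre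
  refine ⟨hint'.integrableOn, ?_⟩
  rw [setIntegral_eq_integral_of_forall_compl_eq_zero hvan', ← integral_congr_ae hre]
  have h4 := integral_re hint
  simp only [Pi.add_apply] at h4
  exact h4.trans (by rw [key]; simp)

end Shell

section Rellich

variable {E : Type*} [NormedAddCommGroup E] [InnerProductSpace ℂ E] [CompleteSpace E]
  {P : Space n R₀ E →ₗ.[ℂ] Space n R₀ E}

/-- The gradient outside the ball is bounded on the domain. -/
lemma IsBlackBoxHamiltonian.exists_gradient (hR₀ : 0 < R₀) (hP : IsBlackBoxHamiltonian P)
    (i : Fin n) : ∃ G : P.graph →L[ℂ] Lp ℂ 2 (extMeasure n R₀),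
      ∀ u, (domExt P u, G u) ∈ extPair n R₀ i := by
  have := completeSpace_graph hP.selfAdjoint
  have : CompleteSpace (extPair n R₀ i) := (isClosed_extPair hR₀ i).completeSpace_coe
  let J : extPair n R₀ i →L[ℂ] Lp ℂ 2 (extMeasure n R₀) :=
    ContinuousLinearMap.fst ℂ _ _ ∘L (extPair n R₀ i).subtypeL
  have hJ : Function.Injective J := by
    intro p q hpq
    have h0 : p.1.1 = q.1.1 := hpq
    have h1 : HasWeakPartialOn (openExterior n R₀) i p.1.1 p.1.2 := p.2
    have h2 : HasWeakPartialOn (openExterior n R₀) i q.1.1 q.1.2 := q.2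
    rw [← h0] at h2
    have h3 := HasWeakPartialOn.unique isOpen_openExterior h1 h2
    rw [← extMeasure_eq hR₀] at h3
    exact Subtype.ext (Prod.ext h0 (Lp.ext h3))
  obtain ⟨S, hS⟩ := exists_lift_of_injective (domExt P) J hJ fun u => by
    obtain ⟨-, g, h, hW, m2, -, -⟩ := hP.weakTwo u
    have m3 : MemLp (g i) 2 (extMeasure n R₀) := by rw [extMeasure_eq hR₀]; exact m2 i
    have h4 : g i =ᵐ[volume.restrict (openExterior n R₀)] m3.toLp (g i) :=
      ae_mono restrict_openExterior_le m3.coeFn_toLp.symm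
    exact ⟨⟨(domExt P u, m3.toLp (g i)),
      (hW.first i).congr isOpen_openExterior EventuallyEq.rfl h4⟩, rfl⟩
  refine ⟨ContinuousLinearMap.snd ℂ _ _ ∘L (extPair n R₀ i).subtypeL ∘L S, fun u => ?_⟩
  have h := (S u).2
  have h1 : (S u).1.1 = domExt P u := hS u
  rwa [← Prod.mk.eta (p := (S u).1), h1] at h

/-- Elements of the domain have little mass in a thin shell near the sphere. -/
lemma IsBlackBoxHamiltonian.shell_estimate (hR₀ : 0 < R₀) (hP : IsBlackBoxHamiltonian P) :
    ∃ C : ℝ, 0 ≤ C ∧ ∀ δ : ℝ, 0 < δ → δ < 1 → ∀ u : P.graph,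
      ∫ x in {x : 𝔼 | R₀ ^ 2 < ‖x‖ ^ 2 ∧ ‖x‖ ^ 2 < R₀ ^ 2 + δ}, ‖domExt P u x‖ ^ 2
        ∂extMeasure n R₀ ≤ C * δ * ‖u‖ ^ 2 := by
  choose G hG using fun i => hP.exists_gradient hR₀ i
  obtain ⟨K, hK, hX⟩ := exists_field (n := n) hR₀
  set N : ℝ := K * (‖domExt P‖ ^ 2 + ∑ i, (‖domExt P‖ ^ 2 + ‖G i‖ ^ 2)) with hN
  have hN0 : 0 ≤ N := by positivity
  refine ⟨N / R₀ ^ 2, by positivity, fun δ hδ hδ1 u => ?_⟩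
  set f := domExt P u with hf
  have hfi : Integrable (fun x => ‖f x‖ ^ 2) (extMeasure n R₀) :=
    (memLp_two_iff_integrable_sq_norm (Lp.memLp f).1).1 (Lp.memLp f)
  have hgi : ∀ i, Integrable (fun x => ‖G i u x‖ ^ 2) (extMeasure n R₀) := fun i =>
    (memLp_two_iff_integrable_sq_norm (Lp.memLp (G i u)).1).1 (Lp.memLp (G i u))
  have hfg : ∀ i, Integrable (fun x => ‖f x‖ ^ 2 + ‖G i u x‖ ^ 2) (extMeasure n R₀) :=
    fun i => hfi.add (hgi i)
  have hS : ∀ ε : ℝ, MeasurableSet {x : 𝔼 | R₀ ^ 2 + 2 * ε < ‖x‖ ^ 2 ∧ ‖x‖ ^ 2 < R₀ ^ 2 + δ} :=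
    fun ε => measurableSet_Ioo.preimage (by fun_prop : Measurable fun x : 𝔼 => ‖x‖ ^ 2)
  have hint : K * (∫ x, ‖f x‖ ^ 2 ∂extMeasure n R₀ +
      ∑ i, (∫ x, ‖f x‖ ^ 2 ∂extMeasure n R₀ + ∫ x, ‖G i u x‖ ^ 2 ∂extMeasure n R₀)) ≤
      N * ‖u‖ ^ 2 := by
    rw [hN, mul_assoc]
    refine mul_le_mul_of_nonneg_left ?_ hK
    simp only [← norm_sq_L2]
    rw [add_mul, Finset.sum_mul]
    have h1 : ∀ T : P.graph →L[ℂ] Lp ℂ 2 (extMeasure n R₀), ‖T u‖ ^ 2 ≤ ‖T‖ ^ 2 * ‖u‖ ^ 2 :=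
      fun T => by
        rw [← mul_pow]
        exact pow_le_pow_left₀ (norm_nonneg _) (T.le_opNorm u) 2
    refine add_le_add (h1 _) (Finset.sum_le_sum fun i _ => ?_)
    rw [add_mul]
    exact add_le_add (h1 _) (h1 _)
  have main : ∀ ε : ℝ, 0 < ε → ∫ x in {x : 𝔼 | R₀ ^ 2 + 2 * ε < ‖x‖ ^ 2 ∧ ‖x‖ ^ 2 < R₀ ^ 2 + δ},
      ‖f x‖ ^ 2 ∂extMeasure n R₀ ≤ N / R₀ ^ 2 * δ * ‖u‖ ^ 2 := by
    intro ε hε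
    -- The flux of `|u|² X` vanishes for a field `X` whose divergence is of order `δ⁻¹` on the shell
    -- and bounded below elsewhere.
    obtain ⟨X, b, hb, hXs, hXc, hX0, hXK, hX1, hX2⟩ := hX ε δ hε hδ hδ1
    have h1 := fun i => integral_div_eq_zero hR₀ (hG i u) hb (hXs i) (hXc i) (hX0 i)
    have h2 := integral_finsetSum (μ := extMeasure n R₀) Finset.univ fun i _ => (h1 i).1
    rw [Finset.sum_eq_zero fun i _ => (h1 i).2] at h2
    set S := {x : 𝔼 | R₀ ^ 2 + 2 * ε < ‖x‖ ^ 2 ∧ ‖x‖ ^ 2 < R₀ ^ 2 + δ}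
    have h3 : Integrable (fun x => R₀ ^ 2 / δ * S.indicator (fun x => ‖f x‖ ^ 2) x)
        (extMeasure n R₀) := (hfi.indicator (hS ε)).const_mul _
    have h4 : Integrable (fun x => K * (‖f x‖ ^ 2 + ∑ i, (‖f x‖ ^ 2 + ‖G i u x‖ ^ 2)))
        (extMeasure n R₀) :=
      (hfi.add (integrable_finsetSum _ fun i _ => hfg i)).const_mul _
    have h5 : ∀ x, R₀ ^ 2 / δ * S.indicator (fun x => ‖f x‖ ^ 2) x -
        K * (‖f x‖ ^ 2 + ∑ i, (‖f x‖ ^ 2 + ‖G i u x‖ ^ 2)) ≤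
        ∑ i, (fderiv ℝ (X i) x (EuclideanSpace.single i 1) * ‖f x‖ ^ 2 +
          2 * X i x * (inner ℂ (f x) (G i u x)).re) := by
      intro x
      have e1 : ∑ i, (fderiv ℝ (X i) x (EuclideanSpace.single i 1) * ‖f x‖ ^ 2 +
          2 * X i x * (inner ℂ (f x) (G i u x)).re) =
          (∑ i, fderiv ℝ (X i) x (EuclideanSpace.single i 1)) * ‖f x‖ ^ 2 +
            ∑ i, 2 * X i x * (inner ℂ (f x) (G i u x)).re := by
        rw [Finset.sum_add_distrib, Finset.sum_mul]
      rw [e1]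
      have h6 : R₀ ^ 2 / δ * S.indicator (fun x => ‖f x‖ ^ 2) x - K * ‖f x‖ ^ 2 ≤
          (∑ i, fderiv ℝ (X i) x (EuclideanSpace.single i 1)) * ‖f x‖ ^ 2 := by
        by_cases hx : x ∈ S
        · rw [Set.indicator_of_mem hx, ← sub_mul]
          exact mul_le_mul_of_nonneg_right (hX2 x hx.1 hx.2) (sq_nonneg _)
        · rw [Set.indicator_of_notMem hx, mul_zero, zero_sub, ← neg_mul]
          exact mul_le_mul_of_nonneg_right (hX1 x) (sq_nonneg _)
      have h7 : -(K * ∑ i, (‖f x‖ ^ 2 + ‖G i u x‖ ^ 2)) ≤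
          ∑ i, 2 * X i x * (inner ℂ (f x) (G i u x)).re := by
        rw [Finset.mul_sum, ← Finset.sum_neg_distrib]
        refine Finset.sum_le_sum fun i _ => ?_
        have h8 : |(inner ℂ (f x) (G i u x)).re| ≤ ‖f x‖ * ‖G i u x‖ :=
          (Complex.abs_re_le_norm _).trans (norm_inner_le_norm _ _)
        have h9 : |X i x * (inner ℂ (f x) (G i u x)).re| ≤ K * (‖f x‖ * ‖G i u x‖) := by
          rw [abs_mul]
          exact mul_le_mul (hXK i x) h8 (abs_nonneg _) hK
        have h10 : K * (2 * (‖f x‖ * ‖G i u x‖)) ≤ K * (‖f x‖ ^ 2 + ‖G i u x‖ ^ 2) :=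
          mul_le_mul_of_nonneg_left (by nlinarith [sq_nonneg (‖f x‖ - ‖G i u x‖)]) hK
        linarith [(abs_le.1 h9).1]
      rw [mul_add]
      linarith
    have h6 := integral_mono (h3.sub h4) (integrable_finsetSum _ fun i _ => (h1 i).1) h5
    simp only [Pi.sub_apply] at h6
    rw [h2, integral_sub h3 h4, integral_const_mul, integral_const_mul, integral_indicator (hS ε),
      integral_add hfi (integrable_finsetSum _ fun i _ => hfg i),
      integral_finsetSum _ fun i _ => hfg i,
      Finset.sum_congr rfl fun i _ => integral_add hfi (hgi i)] at h6
    have h7 : R₀ ^ 2 / δ * ∫ x in S, ‖f x‖ ^ 2 ∂extMeasure n R₀ ≤ N * ‖u‖ ^ 2 := by linarith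
    have h8 : 0 < R₀ ^ 2 / δ := by positivity
    calc _ ≤ N * ‖u‖ ^ 2 / (R₀ ^ 2 / δ) := by rwa [le_div_iff₀' h8]
      _ = N / R₀ ^ 2 * δ * ‖u‖ ^ 2 := by field_simp
  -- the shells exhaust the region up to the sphere
  let s : ℕ → Set 𝔼 := fun k =>
    {x : 𝔼 | R₀ ^ 2 + 2 * (1 / ((k : ℝ) + 1)) < ‖x‖ ^ 2 ∧ ‖x‖ ^ 2 < R₀ ^ 2 + δ}
  have hsm : Monotone s := fun j k hjk x hx => by
    refine ⟨lt_of_le_of_lt ?_ hx.1, hx.2⟩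
    have := one_div_le_one_div_of_le (by positivity : (0 : ℝ) < j + 1)
      (by exact_mod_cast Nat.succ_le_succ hjk : (j : ℝ) + 1 ≤ k + 1)
    linarith
  have hsU : ⋃ k, s k = {x : 𝔼 | R₀ ^ 2 < ‖x‖ ^ 2 ∧ ‖x‖ ^ 2 < R₀ ^ 2 + δ} := by
    ext x
    simp only [Set.mem_iUnion, s, Set.mem_ofPred_eq]
    constructor
    · rintro ⟨k, h1, h2⟩
      have : (0 : ℝ) < 1 / ((k : ℝ) + 1) := by positivity
      exact ⟨by linarith, h2⟩
    · rintro ⟨h1, h2⟩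
      obtain ⟨k, hk⟩ := exists_nat_one_div_lt (show 0 < (‖x‖ ^ 2 - R₀ ^ 2) / 2 by linarith)
      exact ⟨k, by linarith, h2⟩
  have hlim := tendsto_setIntegral_of_monotone (μ := extMeasure n R₀) (f := fun x => ‖f x‖ ^ 2)
    (fun k => hS _) hsm hfi.integrableOn
  rw [← hsU]
  exact le_of_tendsto' hlim fun k => main _ (by positivity)

lemma isCompactOperator_comp_of_leftInverse {X Y Z V F : Type*} [NormedAddCommGroup X] [NormedSpace ℂ X]
    [NormedAddCommGroup Y] [NormedSpace ℂ Y] [NormedAddCommGroup Z] [NormedSpace ℂ Z]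
    [NormedAddCommGroup V] [NormedSpace ℂ V] [NormedAddCommGroup F] [NormedSpace ℂ F]
    {A : Y →L[ℂ] Z} {J : V →L[ℂ] Y} {S : X →L[ℂ] V} {W : V →L[ℂ] X} (T : F →L[ℂ] V)
    (hc : IsCompactOperator (A ∘L J ∘L S)) (hW : ∀ v, S (W v) = v) :
    IsCompactOperator (A ∘L J ∘L T) := by
  have h : A ∘L J ∘L T = (A ∘L J ∘L S) ∘L (W ∘L T) := by
    ext u
    simp [hW]
  rw [h]
  exact hc.comp_clm _

/-- The free resolvent has a bounded left inverse. -/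
lemma exists_freeRes_leftInverse {k : ℂ} (hk : 0 < k.im) :
    ∃ W : JetSpace n 0 →L[ℂ] L2 n, ∀ v, freeRes k (W v) = v := by
  refine ⟨-jetLapL n 0 - k ^ 2 • jetFun n 0, fun v => JetSpace.ext ?_⟩
  have h2 := freeRes_apply_sub hk v.val_mem
  rw [← jetLapL_apply, ← jetFun_apply] at h2
  exact congrArg Prod.fst h2

lemma isCompactOperator_cutoff_jetFun {F : Type*} [NormedAddCommGroup F] [NormedSpace ℂ F]
    (T : F →L[ℂ] JetSpace n 0) {ψ : 𝔼 → ℂ} (hψ : Continuous ψ) (hψc : HasCompactSupport ψ) :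
    IsCompactOperator (mulOp ψ volume volume ∘L jetFun n 0 ∘L T) := by
  have hk : 0 < Complex.I.im := by simp
  obtain ⟨W, hW⟩ := exists_freeRes_leftInverse (n := n) hk
  exact isCompactOperator_comp_of_leftInverse T
    (isCompactOperator_jetLow_jetMul (JetSymbol.rsym hk) hψ hψc none) hW

lemma mulBound_ext {m : 𝔼 → ℂ} {C : ℝ} (hm : Measurable m) (h : ∀ x, ‖m x‖ ≤ C) :
    MulBound m (extMeasure n R₀) (extMeasure n R₀) C :=
  hasDens_extMeasure.mulBound hasDens_extMeasure hm ((norm_nonneg _).trans (h 0)) fun x => by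
    refine mul_le_mul_of_nonneg_right (pow_le_pow_left₀ (norm_nonneg _) (h x) 2) ?_
    exact Set.indicator_nonneg (fun _ _ => zero_le_one) _

lemma measurableSet_far (δ : ℝ) : MeasurableSet {x : 𝔼 | R₀ ^ 2 + δ ≤ ‖x‖ ^ 2} :=
  measurableSet_le measurable_const (by fun_prop)

/-- Cutting off to a bounded region at positive distance from the ball is compact on spaces of
functions that are `H²` there. -/
lemma isCompactOperator_far {F : Type*} [NormedAddCommGroup F] [NormedSpace ℂ F]
    (A : F →L[ℂ] Lp ℂ 2 (extMeasure n R₀)) {S : F →L[ℂ] JetSpace n 0} {δ : ℝ}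
    (hS : ∀ u, ∀ᵐ x, R₀ ^ 2 + δ ≤ ‖x‖ ^ 2 → (S u).val.1 x = A u x)
    {θ : 𝔼 → ℂ} (hθ : Continuous θ) (hθc : HasCompactSupport θ) :
    IsCompactOperator (mulOp ({x : 𝔼 | R₀ ^ 2 + δ ≤ ‖x‖ ^ 2}.indicator θ) (extMeasure n R₀)
      (extMeasure n R₀) ∘L A) := by
  obtain ⟨M, hM⟩ := hθc.exists_bound_of_continuous hθ
  obtain ⟨D, hD⟩ := exists_mulBound hθ hθc
  have hs := measurableSet_far (n := n) (R₀ := R₀) δ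
  set s := {x : 𝔼 | R₀ ^ 2 + δ ≤ ‖x‖ ^ 2}
  have b2 : MulBound (s.indicator θ) (extMeasure n R₀) (extMeasure n R₀) M :=
    mulBound_ext (hθ.measurable.indicator hs) fun x => (norm_indicator_le_norm_self _ _).trans (hM x)
  have b3 : MulBound (s.indicator fun _ => (1 : ℂ)) volume (extMeasure n R₀) 1 := by
    refine hasDens_volume.mulBound hasDens_extMeasure (measurable_const.indicator hs)
      zero_le_one fun x => ?_
    have h1 : ‖s.indicator (fun _ => (1 : ℂ)) x‖ ≤ 1 :=
      (norm_indicator_le_norm_self _ _).trans (by simp)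
    have h2 : (exterior n R₀).indicator (fun _ => (1 : ℝ)) x ≤ 1 :=
      Set.indicator_le_self' (fun _ _ => zero_le_one) _
    have h3 : 0 ≤ (exterior n R₀).indicator (fun _ => (1 : ℝ)) x :=
      Set.indicator_nonneg (fun _ _ => zero_le_one) _
    nlinarith [norm_nonneg (s.indicator (fun _ => (1 : ℂ)) x)]
  have h1 : mulOp (s.indicator θ) (extMeasure n R₀) (extMeasure n R₀) ∘L A =
      mulOp (s.indicator fun _ => (1 : ℂ)) volume (extMeasure n R₀) ∘L
        (mulOp θ volume volume ∘L jetFun n 0 ∘L S) := by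
    ext1 u
    refine Lp.ext ?_
    filter_upwards [coeFn_mulOp b2 (A u), coeFn_mulOp b3
      (mulOp θ volume volume (jetFun n 0 (S u))), ae_restrict_of_ae
      (coeFn_mulOp hD (jetFun n 0 (S u))), ae_restrict_of_ae (hS u)] with x e1 e2 e3 e4
    refine e1.trans (Eq.trans ?_ e2.symm)
    rw [e3, jetFun_apply]
    by_cases hx : x ∈ s
    · rw [Set.indicator_of_mem hx, Set.indicator_of_mem hx, e4 hx, one_mul]
    · rw [Set.indicator_of_notMem hx, Set.indicator_of_notMem hx, zero_mul, zero_mul]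
  rw [h1]
  exact (isCompactOperator_cutoff_jetFun S hθ hθc).clm_comp _

lemma norm_near_le (hR₀ : 0 < R₀) {F : Type*} [NormedAddCommGroup F] [NormedSpace ℂ F]
    (A : F →L[ℂ] Lp ℂ 2 (extMeasure n R₀)) {δ C M : ℝ} (hC0 : 0 ≤ C)
    (hC : ∀ u : F, ∫ x in {x : 𝔼 | R₀ ^ 2 < ‖x‖ ^ 2 ∧ ‖x‖ ^ 2 < R₀ ^ 2 + δ}, ‖A u x‖ ^ 2
      ∂extMeasure n R₀ ≤ C * ‖u‖ ^ 2) {θ : 𝔼 → ℂ} (hθ : Continuous θ) (hM : ∀ x, ‖θ x‖ ≤ M) :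
    ‖mulOp ({x : 𝔼 | R₀ ^ 2 + δ ≤ ‖x‖ ^ 2}.indicator θ) (extMeasure n R₀) (extMeasure n R₀) ∘L A -
      mulOp θ (extMeasure n R₀) (extMeasure n R₀) ∘L A‖ ≤ M * Real.sqrt C := by
  have hM0 : 0 ≤ M := (norm_nonneg _).trans (hM 0)
  have hs := measurableSet_far (n := n) (R₀ := R₀) δ
  set s := {x : 𝔼 | R₀ ^ 2 + δ ≤ ‖x‖ ^ 2}
  have b1 : MulBound θ (extMeasure n R₀) (extMeasure n R₀) M := mulBound_ext hθ.measurable hM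
  have b2 : MulBound (s.indicator θ) (extMeasure n R₀) (extMeasure n R₀) M :=
    mulBound_ext (hθ.measurable.indicator hs) fun x => (norm_indicator_le_norm_self _ _).trans (hM x)
  set T₁ := mulOp (s.indicator θ) (extMeasure n R₀) (extMeasure n R₀)
  set T₂ := mulOp θ (extMeasure n R₀) (extMeasure n R₀)
  refine opNorm_le_bound _ (by positivity) fun u => ?_
  refine abs_le_of_sq_le_sq' ?_ (by positivity) |>.2
  have hval : (T₁ ∘L A - T₂ ∘L A) u = T₁ (A u) - T₂ (A u) := rfl
  rw [mul_pow, mul_pow, Real.sq_sqrt hC0, mul_assoc, hval]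
  refine le_trans ?_ (mul_le_mul_of_nonneg_left (hC u) (sq_nonneg M))
  generalize A u = f
  rw [norm_sq_L2]
  have hfi : Integrable (fun x => ‖f x‖ ^ 2) (extMeasure n R₀) :=
    (memLp_two_iff_integrable_sq_norm (Lp.memLp _).1).1 (Lp.memLp _)
  have hSm : MeasurableSet {x : 𝔼 | R₀ ^ 2 < ‖x‖ ^ 2 ∧ ‖x‖ ^ 2 < R₀ ^ 2 + δ} :=
    measurableSet_Ioo.preimage (by fun_prop : Measurable fun x : 𝔼 => ‖x‖ ^ 2)
  rw [← integral_indicator hSm, ← integral_const_mul]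
  refine integral_mono_ae ((memLp_two_iff_integrable_sq_norm (Lp.memLp _).1).1 (Lp.memLp _))
    ((hfi.indicator hSm).const_mul _) ?_
  have hext : ∀ᵐ x ∂extMeasure n R₀, x ∈ openExterior n R₀ := by
    rw [extMeasure_eq hR₀]
    exact ae_restrict_mem isOpen_openExterior.measurableSet
  filter_upwards [hext, coeFn_mulOp b2 f, coeFn_mulOp b1 f, Lp.coeFn_sub (T₁ f) (T₂ f)]
    with x hx e1 e2 e3
  have hx' : R₀ < ‖x‖ := by simpa [openExterior] using hx
  rw [e3, Pi.sub_apply, e1, e2]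
  by_cases hxs : x ∈ s
  · rw [Set.indicator_of_mem hxs, sub_self, norm_zero, zero_pow two_ne_zero]
    exact mul_nonneg (sq_nonneg _) (Set.indicator_nonneg (fun _ _ => sq_nonneg _) _)
  · have h6 : x ∈ {x : 𝔼 | R₀ ^ 2 < ‖x‖ ^ 2 ∧ ‖x‖ ^ 2 < R₀ ^ 2 + δ} :=
      ⟨by nlinarith, not_le.1 hxs⟩
    rw [Set.indicator_of_notMem hxs, Set.indicator_of_mem h6, zero_mul, zero_sub, norm_neg,
      norm_mul, mul_pow]
    exact mul_le_mul_of_nonneg_right (pow_le_pow_left₀ (norm_nonneg _) (hM x) 2) (sq_nonneg _)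

/-- Rellich's theorem for the domain: cutting off to a bounded exterior region is compact. -/
lemma IsBlackBoxHamiltonian.isCompactOperator_cutoff (hR₀ : 0 < R₀) (hP : IsBlackBoxHamiltonian P)
    {θ : 𝔼 → ℂ} (hθ : Continuous θ) (hθc : HasCompactSupport θ) :
    IsCompactOperator (mulOp θ (extMeasure n R₀) (extMeasure n R₀) ∘L domExt P) := by
  obtain ⟨M, hM⟩ := hθc.exists_bound_of_continuous hθ
  obtain ⟨C, hC0, hC⟩ := hP.shell_estimate hR₀
  have hδk : ∀ k : ℕ, 0 < 1 / ((k : ℝ) + 2) ∧ 1 / ((k : ℝ) + 2) < 1 := fun k =>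
    ⟨by positivity, by rw [div_lt_one (by positivity)]; linarith [(Nat.cast_nonneg k : (0 : ℝ) ≤ k)]⟩
  refine isCompactOperator_of_tendsto (F := fun k : ℕ =>
    mulOp ({x : 𝔼 | R₀ ^ 2 + 1 / ((k : ℝ) + 2) ≤ ‖x‖ ^ 2}.indicator θ) (extMeasure n R₀)
      (extMeasure n R₀) ∘L domExt P) (l := atTop) ?_ (Eventually.of_forall fun k => ?_)
  · rw [tendsto_iff_norm_sub_tendsto_zero]
    refine squeeze_zero (fun _ => norm_nonneg _) (fun k => norm_near_le hR₀ (domExt P)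
      (mul_nonneg hC0 (hδk k).1.le) (hC _ (hδk k).1 (hδk k).2) hθ hM) ?_
    have h1 : Tendsto (fun k : ℕ => 1 / ((k : ℝ) + 2)) atTop (𝓝 0) :=
      tendsto_const_nhds.div_atTop (tendsto_atTop_add_const_right _ _ tendsto_natCast_atTop_atTop)
    have h2 := ((Real.continuous_sqrt.tendsto _).comp (h1.const_mul C)).const_mul M
    simpa using h2
  · have hδ := (hδk k).1
    set b := Real.sqrt (R₀ ^ 2 + 1 / ((k : ℝ) + 2))
    have hb : R₀ < b := Real.lt_sqrt_of_sq_lt (by linarith)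
    obtain ⟨ψ, hψ, -, hψ1⟩ := exists_isOuter (n := n) (R₀ := R₀) (a := (R₀ + b) / 2) (b := b)
      (by linarith) (by linarith) (by linarith)
    obtain ⟨S, hS⟩ := hP.exists_outerJet hR₀ hψ
    refine isCompactOperator_far (domExt P) (S := S) (fun u => ?_) hθ hθc
    filter_upwards [(hS u).1] with x hx hle
    rw [hx, (hψ1 x (Real.sqrt_le_iff.2 ⟨norm_nonneg _, hle⟩)).1, one_mul]

end Rellich

/-! ### Gluing the resolvent at one point to the free resolvent -/

section Gluing

variable {E : Type*} [NormedAddCommGroup E] [InnerProductSpace ℂ E] [CompleteSpace E]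
  {P : Space n R₀ E →ₗ.[ℂ] Space n R₀ E}

/-- The ingredients of the parametrix: a cutoff `ψ` to the outside of the ball, a bump function `η`
that is `1` on the region where `ψ` varies, the resolvent `R` at the point `k₀²`, the source
`G f = (-Δ - k₀²)(ψ R f)` on `ℝⁿ`, and the operator `Q v = ψ v` into the domain of `P`. -/
structure GluingData (P : Space n R₀ E →ₗ.[ℂ] Space n R₀ E) (k₀ : ℂ) where
  ψ : 𝔼 → ℂ
  η : 𝔼 → ℂ
  R : Space n R₀ E →L[ℂ] P.graph
  G : Space n R₀ E →L[ℂ] L2 n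
  Q : JetSpace n 0 →L[ℂ] P.graph
  outer : IsOuter R₀ ψ
  bump_continuous : Continuous η
  bump_compact : HasCompactSupport η
  bump_one : ∀ x, ‖x‖ ≤ R₀ + 2 → η x = 1
  far : ∀ x, R₀ + 2 ≤ ‖x‖ → ψ x = 1 ∧ (∀ i, pd i ψ x = 0) ∧ lap ψ x = 0
  resolvent : ∀ f, (R f).1.2 - k₀ ^ 2 • (R f).1.1 = f
  compact : IsCompactOperator fun f => (R f).1.1.fst
  freeRes_source : ∀ f, ∀ᵐ x, (freeRes k₀ (G f)).val.1 x = ψ x * (R f).1.1.snd x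
  source_far : ∀ f, ∀ᵐ x, R₀ + 2 ≤ ‖x‖ → G f x = f.snd x
  glue_fst : ∀ v, (Q v).1.1.fst = 0 ∧ (Q v).1.2.fst = 0
  glue_snd : ∀ v, ∀ᵐ x ∂extMeasure n R₀, (Q v).1.1.snd x = ψ x * v.val.1 x
  apply_glue : ∀ v, ∀ᵐ x ∂extMeasure n R₀, (Q v).1.2.snd x =
    -(lap ψ x * v.val.1 x + 2 * ∑ i, pd i ψ x * v.val.2.1 i x + ψ x * jetLap v.val x)

/-- Embedding of the outer part. -/
def outerEmb (ν : Measure 𝔼) (E : Type*) [NormedAddCommGroup E]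
    [InnerProductSpace ℂ E] : Lp ℂ 2 ν →L[ℂ] WithLp 2 (E × Lp ℂ 2 ν) :=
  (WithLp.prodContinuousLinearEquiv 2 ℂ E (Lp ℂ 2 ν)).symm.toContinuousLinearMap ∘L
    ContinuousLinearMap.inr ℂ E (Lp ℂ 2 ν)

/-- Embedding of the inner part. -/
def innerEmb (ν : Measure 𝔼) (E : Type*) [NormedAddCommGroup E]
    [InnerProductSpace ℂ E] : E →L[ℂ] WithLp 2 (E × Lp ℂ 2 ν) :=
  (WithLp.prodContinuousLinearEquiv 2 ℂ E (Lp ℂ 2 ν)).symm.toContinuousLinearMap ∘L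
    ContinuousLinearMap.inl ℂ E (Lp ℂ 2 ν)

lemma outerEmb_apply (ν : Measure 𝔼) (g : Lp ℂ 2 ν) : outerEmb ν E g = WithLp.toLp 2 (0, g) := rfl

/-- Functions in `H²(ℝⁿ)` that vanish near the ball, as elements of the domain of `P`. -/
lemma IsBlackBoxHamiltonian.exists_graph_of_jet (hR₀ : 0 < R₀) (hP : IsBlackBoxHamiltonian P)
    {X : Type*} [NormedAddCommGroup X] [NormedSpace ℂ X] (S : X →L[ℂ] JetSpace n 0) {ε : ℝ}
    (hε : 0 < ε) (hS : ∀ v, ∀ᵐ x, ‖x‖ < R₀ + ε → (S v).val.1 x = 0) :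
    ∃ Q : X →L[ℂ] P.graph, ∀ v, (Q v).1 = (WithLp.toLp 2 (0, resExt n R₀ (S v).val.1),
      WithLp.toLp 2 (0, -resExt n R₀ (jetLap (S v).val))) := by
  let q : JetSpace n 0 →L[ℂ] Space n R₀ E × Space n R₀ E :=
    (outerEmb (extMeasure n R₀) E ∘L resExt n R₀ ∘L jetFun n 0).prod
      (outerEmb (extMeasure n R₀) E ∘L (-resExt n R₀) ∘L jetLapL n 0)
  have hq : ∀ v, q v = (WithLp.toLp 2 (0, resExt n R₀ v.val.1),
      WithLp.toLp 2 (0, -resExt n R₀ (jetLap v.val))) := fun v => by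
    rw [← jetLapL_apply]; rfl
  have hmem : ∀ v, (q ∘L S) v ∈ P.graph := fun v => by
    rw [comp_apply, hq]
    exact hP.outer_mem hR₀ hε (hS v)
  exact ⟨(q ∘L S).codRestrict P.graph hmem, fun v => hq (S v)⟩

/-- The map `v ↦ (ψ v, -Δ(ψ v))` into the graph of `P`. -/
lemma IsBlackBoxHamiltonian.exists_glue (hR₀ : 0 < R₀) (hP : IsBlackBoxHamiltonian P)
    {ψ : 𝔼 → ℂ} (hψ : IsOuter R₀ ψ) :
    ∃ Q : JetSpace n 0 →L[ℂ] P.graph, (∀ v, (Q v).1.1.fst = 0 ∧ (Q v).1.2.fst = 0) ∧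
      (∀ v, ∀ᵐ x ∂extMeasure n R₀, (Q v).1.1.snd x = ψ x * v.val.1 x) ∧
      ∀ v, ∀ᵐ x ∂extMeasure n R₀, (Q v).1.2.snd x =
        -(lap ψ x * v.val.1 x + 2 * ∑ i, pd i ψ x * v.val.2.1 i x + ψ x * jetLap v.val x) := by
  obtain ⟨S, hS⟩ := exists_mulJet (c := 0) (c' := 0) hψ.contDiff
    (hψ.bounded.imp fun φ h => by simpa only [sub_self, wt_zero, one_mul] using h)
  obtain ⟨ε, hε, h0⟩ := hψ.vanish
  obtain ⟨Q, hval⟩ := hP.exists_graph_of_jet hR₀ S hε fun v => by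
    filter_upwards [(hS v).1] with x hx hlt
    rw [wt_zero, one_mul, h0 x hlt, zero_mul] at hx
    exact hx
  refine ⟨Q, fun v => ?_, fun v => ?_, fun v => ?_⟩
  · rw [hval]
    exact ⟨rfl, rfl⟩
  · rw [hval]
    filter_upwards [coeFn_resExt (S v).val.1, ae_restrict_of_ae (hS v).1] with x e1 e2
    rw [wt_zero, one_mul, one_mul] at e2
    exact e1.trans e2
  · rw [hval]
    filter_upwards [coeFn_resExt (R₀ := R₀) (jetLap (S v).val), ae_restrict_of_ae (hS v).2,
      Lp.coeFn_neg (resExt n R₀ (jetLap (S v).val))] with x e1 e2 e3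
    simp only [wt_zero, one_mul] at e2
    rw [← e2, ← e1]
    exact e3

lemma IsBlackBoxHamiltonian.nonempty_gluingData (hR₀ : 0 < R₀) (hP : IsBlackBoxHamiltonian P)
    {k₀ : ℂ} (hk₀ : 0 < k₀.im) (hk₀' : k₀ ^ 2 = -I) : Nonempty (GluingData P k₀) := by
  obtain ⟨ψ, hψ, hψ0, hψ1⟩ := exists_isOuter (n := n) (R₀ := R₀) (a := R₀ + 1) (b := R₀ + 2)
    (by linarith) (by linarith) (by linarith)
  obtain ⟨φ, hφ, hφ0, -⟩ := exists_isOuter (n := n) (R₀ := R₀) (a := R₀ + 2) (b := R₀ + 3)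
    (by linarith) (by linarith) (by linarith)
  have hR := isResolventAt_resolvent (neg_I_mem_resolventSet hP.selfAdjoint)
  have hc := hP.compact
  rw [← hk₀'] at hR hc
  obtain ⟨T, hT⟩ := hP.exists_outerJet hR₀ hψ
  obtain ⟨Q, hQ1, hQ2, hQ3⟩ := hP.exists_glue hR₀ hψ
  let W : JetSpace n 0 →L[ℂ] L2 n := -jetLapL n 0 - k₀ ^ 2 • jetFun n 0
  have hW : ∀ v, W v = -jetLap v.val - k₀ ^ 2 • v.val.1 := fun v => by
    rw [← jetLapL_apply]; rfl
  refine ⟨⟨ψ, fun x => 1 - φ x, BlackBox.resolvent P (k₀ ^ 2),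
    W ∘L T ∘L BlackBox.resolvent P (k₀ ^ 2), Q, hψ, continuous_const.sub hφ.contDiff.continuous,
    hφ.compact, fun x hx => by rw [hφ0 x hx, sub_zero], hψ1, hR.1, hc, fun f => ?_, fun f => ?_, hQ1, hQ2, hQ3⟩⟩
  · have h1 : (freeRes k₀ ((W ∘L T ∘L BlackBox.resolvent P (k₀ ^ 2)) f)).val =
        (T (BlackBox.resolvent P (k₀ ^ 2) f)).val := by
      rw [comp_apply, hW]
      exact freeRes_apply_sub hk₀ (T _).val_mem
    rw [h1]
    exact (hT _).1
  · rw [comp_apply, hW]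
    set u := BlackBox.resolvent P (k₀ ^ 2) f with hu
    have h2 := hR.1 f
    rw [← hu] at h2
    have h3 : imgExt P u - k₀ ^ 2 • domExt P u = f.snd := by
      rw [← h2]; rfl
    have h4 : ∀ᵐ x, x ∈ exterior n R₀ → f.snd x = imgExt P u x - k₀ ^ 2 * domExt P u x := by
      refine ae_ext_iff.1 ?_
      filter_upwards [Lp.coeFn_sub (imgExt P u) (k₀ ^ 2 • domExt P u),
        Lp.coeFn_smul (k₀ ^ 2) (domExt P u)] with x e1 e2
      rw [← h3, e1, Pi.sub_apply, e2, Pi.smul_apply, smul_eq_mul]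
    change ∀ᵐ x, _ → (-jetLap (T u).val - k₀ ^ 2 • (T u).val.1 : L2 n) x = _
    filter_upwards [h4, (hT u).1, (hT u).2, Lp.coeFn_sub (-jetLap (T u).val)
      (k₀ ^ 2 • (T u).val.1), Lp.coeFn_neg (jetLap (T u).val),
      Lp.coeFn_smul (k₀ ^ 2) (T u).val.1] with x e1 e2 e3 e4 e5 e6 hx
    obtain ⟨p1, p2, p3⟩ := hψ1 x hx
    have hxe : x ∈ exterior n R₀ := by
      simp only [exterior, Set.mem_compl_iff, Metric.mem_ball, dist_zero_right, not_lt]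
      linarith
    rw [e1 hxe, e4, Pi.sub_apply, e5, Pi.neg_apply, e6, Pi.smul_apply, e3 p3 p2, e2, p1,
      smul_eq_mul]
    ring

end Gluing

section Parametrix

variable {E : Type*} [NormedAddCommGroup E] [InnerProductSpace ℂ E] [CompleteSpace E]
  {P : Space n R₀ E →ₗ.[ℂ] Space n R₀ E} {k₀ : ℂ}

/-- The measure `e^{2c|x|²} dx` on the exterior. -/
abbrev IsExtWeight (R₀ c : ℝ) (ν : Measure 𝔼) : Prop :=
  HasDens ν ((exterior n R₀).indicator fun x => Real.exp (2 * c * ‖x‖ ^ 2))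

lemma isExtWeight_extMeasure : IsExtWeight R₀ 0 (extMeasure n R₀) := by
  have h := hasDens_extMeasure (n := n) (R₀ := R₀)
  have e : (fun x : 𝔼 => Real.exp (2 * 0 * ‖x‖ ^ 2)) = fun _ => 1 := by
    ext x; simp
  rw [IsExtWeight, e]
  exact h

lemma isCompactOperator_sum {ι F Y : Type*} [NormedAddCommGroup F] [NormedSpace ℂ F]
    [NormedAddCommGroup Y] [NormedSpace ℂ Y] (s : Finset ι) (f : ι → F →L[ℂ] Y)
    (h : ∀ i, IsCompactOperator (f i)) : IsCompactOperator (∑ i ∈ s, f i : F →L[ℂ] Y) := by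
  classical
  induction s using Finset.induction_on with
  | empty => rw [Finset.sum_empty]; exact isCompactOperator_zero
  | insert a s ha ih => rw [Finset.sum_insert ha]; exact (h a).add ih

variable {c : ℝ} {ν : Measure (EuclideanSpace ℝ (Fin n))}

lemma IsExtWeight.mulBound_ext (hν : IsExtWeight R₀ c ν) {m : 𝔼 → ℂ} (hm : Continuous m)
    (hmc : HasCompactSupport m) : ∃ C, MulBound m (extMeasure n R₀) ν C := by
  obtain ⟨C, hC⟩ := (hmc.mul_left (f := wt c)).exists_bound_of_continuous
    ((continuous_wt c).mul hm)
  have hC0 : 0 ≤ C := (norm_nonneg _).trans (hC 0)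
  refine ⟨C, hasDens_extMeasure.mulBound hν hm.measurable hC0 fun x => ?_⟩
  by_cases hx : x ∈ exterior n R₀
  · rw [Set.indicator_of_mem hx, Set.indicator_of_mem hx, mul_one]
    have h1 := pow_le_pow_left₀ (norm_nonneg _) (hC x) 2
    rw [Pi.mul_apply, norm_mul, norm_wt, mul_pow, ← Real.exp_nat_mul] at h1
    have e : Real.exp (2 * c * ‖x‖ ^ 2) = Real.exp ((2 : ℕ) * (c * ‖x‖ ^ 2)) := by
      congr 1; push_cast; ring
    rw [mul_comm, e]
    exact h1
  · simp [Set.indicator_of_notMem hx]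

lemma IsExtWeight.mulBound_vol (hν : IsExtWeight R₀ c ν) {m : 𝔼 → ℂ} (hm : Continuous m)
    (hmc : HasCompactSupport m) : ∃ C, MulBound m volume ν C := by
  obtain ⟨C, hC⟩ := (hmc.mul_left (f := wt c)).exists_bound_of_continuous
    ((continuous_wt c).mul hm)
  have hC0 : 0 ≤ C := (norm_nonneg _).trans (hC 0)
  refine ⟨C, hasDens_volume.mulBound hν hm.measurable hC0 fun x => ?_⟩
  by_cases hx : x ∈ exterior n R₀
  · rw [Set.indicator_of_mem hx, mul_one]
    have h1 := pow_le_pow_left₀ (norm_nonneg _) (hC x) 2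
    rw [Pi.mul_apply, norm_mul, norm_wt, mul_pow, ← Real.exp_nat_mul] at h1
    have e : Real.exp (2 * c * ‖x‖ ^ 2) = Real.exp ((2 : ℕ) * (c * ‖x‖ ^ 2)) := by
      congr 1; push_cast; ring
    rw [mul_comm, e]
    exact h1
  · simp [Set.indicator_of_notMem hx, sq_nonneg]

namespace GluingData

variable (d : GluingData P k₀)

/-- The function `1 - ψ²`. -/
def θ (x : 𝔼) : ℂ := 1 - d.ψ x * d.ψ x

lemma continuous_θ : Continuous d.θ :=
  continuous_const.sub (d.outer.contDiff.continuous.mul d.outer.contDiff.continuous)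

lemma hasCompactSupport_θ : HasCompactSupport d.θ := by
  have h : d.θ = fun x => (1 - d.ψ x) * (1 + d.ψ x) := by
    ext x; rw [θ]; ring
  rw [h]
  exact d.outer.compact.mul_right

lemma bump_mul_θ (x : 𝔼) : d.η x * d.θ x = d.θ x := by
  rcases le_total ‖x‖ (R₀ + 2) with h | h
  · rw [d.bump_one x h, one_mul]
  · rw [θ, (d.far x h).1]; ring

lemma bump_mul_pd (i : Fin n) (x : 𝔼) : d.η x * pd i d.ψ x = pd i d.ψ x := by
  rcases le_total ‖x‖ (R₀ + 2) with h | h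
  · rw [d.bump_one x h, one_mul]
  · rw [(d.far x h).2.1 i, mul_zero]

lemma bump_mul_lap (x : 𝔼) : d.η x * lap d.ψ x = lap d.ψ x := by
  rcases le_total ‖x‖ (R₀ + 2) with h | h
  · rw [d.bump_one x h, one_mul]
  · rw [(d.far x h).2.2, mul_zero]

lemma hasCompactSupport_of_bump {m : 𝔼 → ℂ} (h : ∀ x, d.η x * m x = m x) : HasCompactSupport m := by
  rw [← show (fun x => d.η x * m x) = m from funext h]
  exact d.bump_compact.mul_right

/-- The operator `(1 - ψ²)`, equal to the identity on the inner part. -/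
def cutX (ν : Measure 𝔼) : Space n R₀ E →L[ℂ] WithLp 2 (E × Lp ℂ 2 ν) :=
  innerEmb ν E ∘L WithLp.fstL 2 ℂ _ _ +
    outerEmb ν E ∘L mulOp d.η (extMeasure n R₀) ν ∘L
      mulOp d.θ (extMeasure n R₀) (extMeasure n R₀) ∘L WithLp.sndL 2 ℂ _ _

/-- The commutator `[Δ, ψ]`. -/
def commX (c : ℝ) (ν : Measure 𝔼) :
    JetSpace n c →L[ℂ] WithLp 2 (E × Lp ℂ 2 ν) :=
  outerEmb ν E ∘L commOp d.ψ c ν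

lemma cutX_fst (u : Space n R₀ E) : (d.cutX ν u).fst = u.fst := by
  change u.fst + 0 = u.fst
  rw [add_zero]

lemma cutX_snd (hν : IsExtWeight R₀ c ν) (u : Space n R₀ E) :
    ∀ᵐ x ∂ν, (d.cutX ν u).snd x = d.θ x * u.snd x := by
  obtain ⟨C, hC⟩ := hν.mulBound_ext d.bump_continuous d.bump_compact
  obtain ⟨M, hM⟩ := d.hasCompactSupport_θ.exists_bound_of_continuous d.continuous_θ
  have hb := BlackBox.mulBound_ext (R₀ := R₀) d.continuous_θ.measurable hM
  set g := mulOp d.θ (extMeasure n R₀) (extMeasure n R₀) u.snd with hg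
  have h1 : (d.cutX ν u).snd = mulOp d.η (extMeasure n R₀) ν g := by
    change 0 + mulOp d.η (extMeasure n R₀) ν g = _
    rw [zero_add]
  rw [h1]
  filter_upwards [coeFn_mulOp hC g, hC.ae_mul_eq (coeFn_mulOp hb u.snd)] with x e1 e2
  rw [e1, e2, ← mul_assoc, bump_mul_θ]

lemma commX_fst (v : JetSpace n c) : (d.commX c ν v).fst = 0 := rfl

lemma exists_commBound (hν : IsExtWeight R₀ c ν) : ∃ C,
    MulBound (fun x => wt c x * lap d.ψ x) volume ν C ∧
    ∀ i, MulBound (fun x => wt c x * (2 * pd i d.ψ x)) volume ν C := by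
  have hs := d.outer.contDiff
  obtain ⟨C, hC⟩ := hν.mulBound_vol ((continuous_wt c).mul (contDiff_lap hs).continuous)
    (d.hasCompactSupport_of_bump d.bump_mul_lap).mul_left
  have h2 : ∀ i, ∃ C, MulBound (fun x => wt c x * (2 * pd i d.ψ x)) volume ν C := fun i =>
    hν.mulBound_vol ((continuous_wt c).mul (continuous_const.mul (contDiff_pd hs i).continuous))
      (d.hasCompactSupport_of_bump (d.bump_mul_pd i)).mul_left.mul_left
  choose D hD using h2
  have hmono : ∀ {m : 𝔼 → ℂ} {A B : ℝ}, MulBound m volume ν A → A ≤ B → MulBound m volume ν B :=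
    fun h hAB => ⟨h.1, h.2.1.trans hAB, h.2.2.trans (by
      refine Measure.le_iff.2 fun s _ => ?_
      simp only [Measure.smul_apply, smul_eq_mul]
      gcongr
      exact h.2.1)⟩
  have hD0 : ∀ i, 0 ≤ D i := fun i => (hD i).2.1
  refine ⟨C + ∑ i, D i, hmono hC (by linarith [Finset.sum_nonneg fun i (_ : i ∈ Finset.univ) => hD0 i]),
    fun i => hmono (hD i) ?_⟩
  have := Finset.single_le_sum (fun i _ => hD0 i) (Finset.mem_univ i)
  linarith [hC.2.1]

lemma commX_snd (hν : IsExtWeight R₀ c ν) (v : JetSpace n c) :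
    ∀ᵐ x ∂ν, (d.commX (E := E) c ν v).snd x =
      wt c x * (lap d.ψ x * v.val.1 x + 2 * ∑ i, pd i d.ψ x * v.val.2.1 i x) := by
  obtain ⟨C, h1, h2⟩ := d.exists_commBound hν
  exact coeFn_commOp h1 h2 v

lemma mulOp_bump (hν : IsExtWeight R₀ c ν) {m : 𝔼 → ℂ} (hm : Continuous m)
    (h : ∀ x, d.η x * m x = m x) : mulOp (fun x => wt c x * m x) volume ν =
      mulOp (fun x => wt c x * d.η x) volume ν ∘L mulOp m volume volume := by
  have hmc := d.hasCompactSupport_of_bump h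
  obtain ⟨C, hC⟩ := hν.mulBound_vol ((continuous_wt c).mul hm) hmc.mul_left
  obtain ⟨D, hD⟩ := hν.mulBound_vol ((continuous_wt c).mul d.bump_continuous)
    d.bump_compact.mul_left
  obtain ⟨M, hM⟩ := exists_mulBound hm hmc
  change MulBound (fun x => wt c x * m x) _ _ _ at hC
  change MulBound (fun x => wt c x * d.η x) _ _ _ at hD
  ext1 g
  refine Lp.ext ?_
  rw [comp_apply]
  filter_upwards [coeFn_mulOp hC g, coeFn_mulOp hD (mulOp m volume volume g),
    hD.ae_mul_eq (coeFn_mulOp hM g)] with x e1 e2 e3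
  rw [e1, e2, e3]
  rw [← mul_assoc _ (m x), mul_assoc (wt c x) (d.η x), h, mul_assoc]

lemma isCompactOperator_commX (hν : IsExtWeight R₀ c ν) {F : Type*} [NormedAddCommGroup F]
    [NormedSpace ℂ F] {T : F →L[ℂ] JetSpace n c}
    (hT : ∀ α, ∀ φ : 𝔼 → ℂ, Continuous φ → HasCompactSupport φ →
      IsCompactOperator (mulOp φ volume volume ∘L jetLow n c α ∘L T)) :
    IsCompactOperator (d.commX (E := E) c ν ∘L T) := by
  have hs := d.outer.contDiff
  have key : ∀ {m : 𝔼 → ℂ} (α : Option (Fin n)), Continuous m → (∀ x, d.η x * m x = m x) →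
      IsCompactOperator ((mulOp (fun x => wt c x * m x) volume ν ∘L jetLow n c α) ∘L T) := by
    intro m α hm h
    rw [d.mulOp_bump hν hm h]
    exact (hT α m hm (d.hasCompactSupport_of_bump h)).clm_comp
      (mulOp (fun x => wt c x * d.η x) volume ν)
  have h1 : IsCompactOperator (commOp d.ψ c ν ∘L T) := by
    have e : commOp d.ψ c ν ∘L T = (mulOp (fun x => wt c x * lap d.ψ x) volume ν ∘L
        jetLow n c none) ∘L T + ∑ i, (mulOp (fun x => wt c x * (2 * pd i d.ψ x)) volume ν ∘L
          jetLow n c (some i)) ∘L T := by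
      ext1 v
      simp only [commOp, comp_apply, add_apply, sum_apply]
    rw [e]
    refine (key none (contDiff_lap hs).continuous d.bump_mul_lap).add
      (isCompactOperator_sum Finset.univ _ fun a => key (m := fun x => 2 * pd a d.ψ x) (some a)
        (continuous_const.mul (contDiff_pd hs a).continuous) fun x => ?_)
    rw [mul_left_comm, bump_mul_pd]
  exact h1.clm_comp (outerEmb ν E)

lemma isCompactOperator_cutX (hR₀ : 0 < R₀) (hP : IsBlackBoxHamiltonian P) :
    IsCompactOperator (d.cutX ν ∘L domFst P ∘L d.R) := by
  have h1 : IsCompactOperator (innerEmb ν E ∘L (WithLp.fstL 2 ℂ _ _ ∘L domFst P ∘L d.R)) :=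
    IsCompactOperator.clm_comp (f := WithLp.fstL 2 ℂ _ _ ∘L domFst P ∘L d.R) d.compact
      (innerEmb ν E)
  have h2 : IsCompactOperator ((outerEmb ν E ∘L mulOp d.η (extMeasure n R₀) ν) ∘L
      ((mulOp d.θ (extMeasure n R₀) (extMeasure n R₀) ∘L domExt P) ∘L d.R)) :=
    ((hP.isCompactOperator_cutoff hR₀ d.continuous_θ d.hasCompactSupport_θ).comp_clm d.R).clm_comp
      (outerEmb ν E ∘L mulOp d.η (extMeasure n R₀) ν)
  exact h1.add h2

end GluingData

end Parametrix

section Identity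

variable {E : Type*} [NormedAddCommGroup E] [InnerProductSpace ℂ E]

lemma space_ext {ν : Measure 𝔼} {u v : WithLp 2 (E × Lp ℂ 2 ν)} (h1 : u.fst = v.fst)
    (h2 : ∀ᵐ x ∂ν, u.snd x = v.snd x) : u = v :=
  WithLp.ofLp_injective 2 (Prod.ext h1 (Lp.ext h2))

lemma coeFn_snd_add {ν : Measure 𝔼} (u v : WithLp 2 (E × Lp ℂ 2 ν)) :
    ∀ᵐ x ∂ν, (u + v).snd x = u.snd x + v.snd x := Lp.coeFn_add u.snd v.snd

lemma coeFn_snd_sub {ν : Measure 𝔼} (u v : WithLp 2 (E × Lp ℂ 2 ν)) :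
    ∀ᵐ x ∂ν, (u - v).snd x = u.snd x - v.snd x := Lp.coeFn_sub u.snd v.snd

lemma coeFn_snd_smul {ν : Measure 𝔼} (a : ℂ) (u : WithLp 2 (E × Lp ℂ 2 ν)) :
    ∀ᵐ x ∂ν, (a • u).snd x = a * u.snd x := Lp.coeFn_smul a u.snd

/-- The operator `1 ⊕ T`. -/
def sndMap (E : Type*) [NormedAddCommGroup E] [InnerProductSpace ℂ E] {F F' : Type*}
    [NormedAddCommGroup F] [NormedSpace ℂ F] [NormedAddCommGroup F'] [NormedSpace ℂ F']
    (T : F →L[ℂ] F') : WithLp 2 (E × F) →L[ℂ] WithLp 2 (E × F') :=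
  (WithLp.prodContinuousLinearEquiv 2 ℂ E F').symm.toContinuousLinearMap ∘L
    (WithLp.fstL 2 ℂ E F).prod (T ∘L WithLp.sndL 2 ℂ E F)

lemma sndMap_fst {F F' : Type*} [NormedAddCommGroup F] [NormedSpace ℂ F] [NormedAddCommGroup F']
    [NormedSpace ℂ F'] (T : F →L[ℂ] F') (u : WithLp 2 (E × F)) : (sndMap E T u).fst = u.fst := rfl

lemma sndMap_mulOp_eq_incl {α : Type*} [MeasurableSpace α] {μ ν : Measure α} (h : μ ≤ ν)
    (hb : MulBound (fun _ => 1) ν μ 1) (u : WithLp 2 (E × Lp ℂ 2 ν)) :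
    sndMap E (mulOp (fun _ => 1) ν μ) u = incl h u := by
  refine WithLp.ofLp_injective 2 (Prod.ext rfl ?_)
  refine Lp.ext ?_
  change mulOp (fun _ => 1) ν μ u.snd =ᵐ[μ] ((Lp.memLp u.snd).mono_measure h).toLp u.snd
  filter_upwards [coeFn_mulOp hb u.snd, ((Lp.memLp u.snd).mono_measure h).coeFn_toLp] with x e1 e2
  rw [e1, one_mul, e2]

variable (n R₀ E) in
/-- The inclusion `ℋ₀ ⊆ ℋ` as a bounded operator. -/
def zeroL : SpaceZero n R₀ E →L[ℂ] Space n R₀ E :=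
  sndMap E (mulOp (fun _ => 1) (weightMeasure n R₀ 1) (extMeasure n R₀))

variable (n R₀ E) in
/-- The inclusion `ℋ ⊆ ℋ₁` as a bounded operator. -/
def oneL : Space n R₀ E →L[ℂ] SpaceOne n R₀ E :=
  sndMap E (mulOp (fun _ => 1) (extMeasure n R₀) (weightMeasure n R₀ (-1)))

lemma weight_ac (c : ℝ) : weightMeasure n R₀ c ≪ extMeasure n R₀ :=
  withDensity_absolutelyContinuous _ _

lemma mulBound_weight_ext :
    MulBound (fun _ => 1) (weightMeasure n R₀ 1) (extMeasure n R₀) 1 := by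
  refine (hasDens_weightMeasure 1).mulBound hasDens_extMeasure measurable_const zero_le_one
    fun x => ?_
  by_cases hx : x ∈ exterior n R₀
  · have : 1 ≤ Real.exp (2 * 1 * ‖x‖ ^ 2) := Real.one_le_exp (by positivity)
    rw [Set.indicator_of_mem hx, Set.indicator_of_mem hx, norm_one, one_pow, one_mul, one_mul]
    exact this
  · rw [Set.indicator_of_notMem hx, Set.indicator_of_notMem hx, mul_zero, mul_zero]

lemma mulBound_ext_weight :
    MulBound (fun _ => 1) (extMeasure n R₀) (weightMeasure n R₀ (-1)) 1 := by
  refine hasDens_extMeasure.mulBound (hasDens_weightMeasure (-1)) measurable_const zero_le_one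
    fun x => ?_
  by_cases hx : x ∈ exterior n R₀
  · have : Real.exp (2 * -1 * ‖x‖ ^ 2) ≤ 1 :=
      Real.exp_le_one_iff.2 (by nlinarith [sq_nonneg ‖x‖])
    rw [Set.indicator_of_mem hx, Set.indicator_of_mem hx, norm_one, one_pow, one_mul, one_mul]
    exact this
  · rw [Set.indicator_of_notMem hx, Set.indicator_of_notMem hx, mul_zero, mul_zero]

lemma zeroL_eq (f : SpaceZero n R₀ E) : zeroL n R₀ E f =
    sndMap E (mulOp (fun _ => 1) (weightMeasure n R₀ 1) (extMeasure n R₀)) f := rfl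

lemma oneL_eq (f : Space n R₀ E) : oneL n R₀ E f =
    sndMap E (mulOp (fun _ => 1) (extMeasure n R₀) (weightMeasure n R₀ (-1))) f := rfl

lemma sndMap_eq_zeroToSpace (f : SpaceZero n R₀ E) :
    sndMap E (mulOp (fun _ => 1) (weightMeasure n R₀ 1) (extMeasure n R₀)) f =
      incl (extMeasure_le_weight n R₀) f :=
  sndMap_mulOp_eq_incl (extMeasure_le_weight n R₀) mulBound_weight_ext f

lemma sndMap_eq_spaceToOne (f : Space n R₀ E) :
    sndMap E (mulOp (fun _ => 1) (extMeasure n R₀) (weightMeasure n R₀ (-1))) f =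
      incl (weight_le_extMeasure n R₀) f :=
  sndMap_mulOp_eq_incl (weight_le_extMeasure n R₀) mulBound_ext_weight f

lemma zeroL_apply (f : SpaceZero n R₀ E) : zeroL n R₀ E f = zeroToSpace f :=
  (zeroL_eq f).trans (sndMap_eq_zeroToSpace f)

lemma oneL_apply (f : Space n R₀ E) : oneL n R₀ E f = spaceToOne f :=
  (oneL_eq f).trans (sndMap_eq_spaceToOne f)

lemma zeroL_fst (f : SpaceZero n R₀ E) : (zeroL n R₀ E f).fst = f.fst :=
  (congrArg WithLp.fst (zeroL_eq f)).trans (sndMap_fst _ f)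

lemma zeroL_snd (f : SpaceZero n R₀ E) :
    ∀ᵐ x ∂extMeasure n R₀, (zeroL n R₀ E f).snd x = f.snd x := by
  rw [zeroL_apply]
  exact ((Lp.memLp f.snd).mono_measure (extMeasure_le_weight n R₀)).coeFn_toLp

lemma oneL_fst (f : Space n R₀ E) : (oneL n R₀ E f).fst = f.fst :=
  (congrArg WithLp.fst (oneL_eq f)).trans (sndMap_fst _ f)

lemma oneL_snd (f : Space n R₀ E) :
    ∀ᵐ x ∂extMeasure n R₀, (oneL n R₀ E f).snd x = f.snd x := by
  rw [oneL_apply]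
  exact (extMeasure_ac (-1)).ae_le
    ((Lp.memLp f.snd).mono_measure (weight_le_extMeasure n R₀)).coeFn_toLp

/-- The difference of two free resolvents. -/
def freeDiff (n : ℕ) (k k₀ : ℂ) : L2 n →L[ℂ] JetSpace n 0 := freeRes k - freeRes k₀

variable [CompleteSpace E] {P : Space n R₀ E →ₗ.[ℂ] Space n R₀ E} {k₀ : ℂ}

namespace GluingData

variable (d : GluingData P k₀)

/-- The parametrix for `P - k²`. -/
def F (k : ℂ) : Space n R₀ E →L[ℂ] P.graph := d.R + d.Q ∘L freeDiff n k k₀ ∘L d.G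

/-- The error of the parametrix, on a space `E ⊕ L²(ν)` that is mapped to `ℋ` by `ι`. The operator
`T` produces the outer part of the parametrix. -/
def K {c : ℝ} {ν : Measure 𝔼}
    (ι : WithLp 2 (E × Lp ℂ 2 ν) →L[ℂ] Space n R₀ E)
    (T : WithLp 2 (E × Lp ℂ 2 ν) →L[ℂ] JetSpace n c) (k : ℂ) :
    WithLp 2 (E × Lp ℂ 2 ν) →L[ℂ] WithLp 2 (E × Lp ℂ 2 ν) :=
  (k₀ ^ 2 - k ^ 2) • (d.cutX ν ∘L domFst P ∘L d.R ∘L ι) - d.commX c ν ∘L T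

lemma K_fst {c : ℝ} {ν : Measure 𝔼} (ι : WithLp 2 (E × Lp ℂ 2 ν) →L[ℂ] Space n R₀ E)
    (T : WithLp 2 (E × Lp ℂ 2 ν) →L[ℂ] JetSpace n c) (k : ℂ) (f : WithLp 2 (E × Lp ℂ 2 ν)) :
    (d.K ι T k f).fst = (k₀ ^ 2 - k ^ 2) • (d.R (ι f)).1.1.fst := by
  have h : d.K ι T k f = (k₀ ^ 2 - k ^ 2) • d.cutX ν (d.R (ι f)).1.1 - d.commX c ν (T f) := rfl
  rw [h, WithLp.sub_fst, WithLp.smul_fst, cutX_fst, commX_fst, sub_zero]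

lemma K_snd {c : ℝ} {ν : Measure 𝔼} (hν : IsExtWeight R₀ c ν)
    (ι : WithLp 2 (E × Lp ℂ 2 ν) →L[ℂ] Space n R₀ E)
    (T : WithLp 2 (E × Lp ℂ 2 ν) →L[ℂ] JetSpace n c) (k : ℂ) (f : WithLp 2 (E × Lp ℂ 2 ν)) :
    ∀ᵐ x ∂ν, (d.K ι T k f).snd x = (k₀ ^ 2 - k ^ 2) * (d.θ x * (d.R (ι f)).1.1.snd x) -
      wt c x * (lap d.ψ x * (T f).val.1 x + 2 * ∑ i, pd i d.ψ x * (T f).val.2.1 i x) := by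
  have h : d.K ι T k f = (k₀ ^ 2 - k ^ 2) • d.cutX ν (d.R (ι f)).1.1 - d.commX c ν (T f) := rfl
  rw [h]
  filter_upwards [coeFn_snd_sub ((k₀ ^ 2 - k ^ 2) • d.cutX ν (d.R (ι f)).1.1) (d.commX c ν (T f)),
    coeFn_snd_smul (k₀ ^ 2 - k ^ 2) (d.cutX ν (d.R (ι f)).1.1),
    d.cutX_snd hν (d.R (ι f)).1.1, d.commX_snd (E := E) hν (T f)] with x e1 e2 e3 e4
  rw [e1, e2, e3, e4]

/-- The free part of the parametrix solves the Helmholtz equation with source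
`(k² - k₀²) R₀(k₀) g`. -/
lemma jetLap_sub_freeRes {k : ℂ} (hk₀ : 0 < k₀.im) (hk : 0 < k.im) (g : L2 n) :
    ∀ᵐ x, jetLap (freeDiff n k k₀ g).val x = -(k ^ 2) *
      (freeDiff n k k₀ g).val.1 x - (k ^ 2 - k₀ ^ 2) * (freeRes k₀ g).val.1 x := by
  have h1 := sub_freeRes hk g
  have h2 := sub_freeRes hk₀ g
  have h3 : jetLap (freeDiff n k k₀ g).val =
      -(k ^ 2) • (freeDiff n k k₀ g).val.1 -
        (k ^ 2 - k₀ ^ 2) • (freeRes k₀ g).val.1 := by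
    rw [← jetLapL_apply] at h1 h2 ⊢
    rw [← jetFun_apply] at h1 h2 ⊢
    rw [← jetFun_apply, freeDiff, sub_apply, map_sub, map_sub]
    have h4 : jetLapL n 0 (freeRes k g) = -g - k ^ 2 • jetFun n 0 (freeRes k g) := by
      rw [eq_sub_iff_add_eq, ← neg_inj, neg_neg, neg_add, ← sub_eq_add_neg]; exact h1
    have h5 : jetLapL n 0 (freeRes k₀ g) = -g - k₀ ^ 2 • jetFun n 0 (freeRes k₀ g) := by
      rw [eq_sub_iff_add_eq, ← neg_inj, neg_neg, neg_add, ← sub_eq_add_neg]; exact h2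
    rw [h4, h5]
    module
  rw [h3]
  filter_upwards [Lp.coeFn_sub (-(k ^ 2) • (freeDiff n k k₀ g).val.1)
    ((k ^ 2 - k₀ ^ 2) • (freeRes k₀ g).val.1),
    Lp.coeFn_smul (-(k ^ 2)) (freeDiff n k k₀ g).val.1,
    Lp.coeFn_smul (k ^ 2 - k₀ ^ 2) (freeRes k₀ g).val.1] with x e1 e2 e3
  rw [e1, Pi.sub_apply, e2, e3, Pi.smul_apply, Pi.smul_apply, smul_eq_mul, smul_eq_mul]

/-- `(P - k²) F(k) = 1 + K(k)`. -/
lemma parametrix_identity (hk₀ : 0 < k₀.im) {k : ℂ} (hk : 0 < k.im) (f : Space n R₀ E) :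
    (d.F k f).1.2 - k ^ 2 • (d.F k f).1.1 =
      f + d.K (ContinuousLinearMap.id ℂ _) (freeDiff n k k₀ ∘L d.G) k f := by
  set v := freeDiff n k k₀ (d.G f) with hv
  set u := d.R f with hu
  have h1 : (d.F k f).1 = u.1 + (d.Q v).1 := rfl
  have hf : f = u.1.2 - k₀ ^ 2 • u.1.1 := (d.resolvent f).symm
  refine space_ext ?_ ?_
  · rw [WithLp.add_fst, K_fst, h1]
    change u.1.2.fst + (d.Q v).1.2.fst - k ^ 2 • (u.1.1.fst + (d.Q v).1.1.fst) = f.fst + _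
    have h2 : f.fst = u.1.2.fst - k₀ ^ 2 • u.1.1.fst := by
      conv_lhs => rw [hf]
      rfl
    rw [(d.glue_fst v).1, (d.glue_fst v).2, h2]
    change _ = _ + (k₀ ^ 2 - k ^ 2) • u.1.1.fst
    module
  · have hff : ∀ᵐ x ∂extMeasure n R₀, f.snd x = u.1.2.snd x - k₀ ^ 2 * u.1.1.snd x := by
      filter_upwards [coeFn_snd_sub u.1.2 (k₀ ^ 2 • u.1.1), coeFn_snd_smul (k₀ ^ 2) u.1.1]
        with x e1 e2
      rw [← e2, ← e1, ← hf]
    have hK := d.K_snd isExtWeight_extMeasure (ContinuousLinearMap.id ℂ _)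
      (freeDiff n k k₀ ∘L d.G) k f
    rw [h1]
    filter_upwards [hff, hK, d.glue_snd v, d.apply_glue v,
      ae_restrict_of_ae (jetLap_sub_freeRes hk₀ hk (d.G f)),
      ae_restrict_of_ae (d.freeRes_source f), coeFn_snd_sub (u.1.2 + (d.Q v).1.2)
        (k ^ 2 • (u.1.1 + (d.Q v).1.1)), coeFn_snd_smul (k ^ 2) (u.1.1 + (d.Q v).1.1),
      coeFn_snd_add u.1.1 (d.Q v).1.1, coeFn_snd_add u.1.2 (d.Q v).1.2,
      coeFn_snd_add f (d.K (ContinuousLinearMap.id ℂ _) (freeDiff n k k₀ ∘L d.G) k f)]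
      with x e1 e2 e3 e4 e5 e6 e7 e8 e9 e10 e11
    have e2' : (d.K (ContinuousLinearMap.id ℂ _) (freeDiff n k k₀ ∘L d.G) k f).snd x =
      (k₀ ^ 2 - k ^ 2) * (d.θ x * u.1.1.snd x) -
        wt 0 x * (lap d.ψ x * v.val.1 x + 2 * ∑ i, pd i d.ψ x * v.val.2.1 i x) := e2
    refine e7.trans (Eq.trans ?_ e11.symm)
    rw [e8, e9, e10, e2', e4, e3, e1, e5, e6, wt_zero, one_mul, θ]
    ring

/-- The source of the parametrix between Gaussian weights. -/
def sourceZero : SpaceZero n R₀ E →L[ℂ] L2 n :=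
  mulOp (fun x => wt 1 x * (1 - d.η x)) (weightMeasure n R₀ 1) volume ∘L WithLp.sndL 2 ℂ _ _ +
    mulOp (fun x => wt 1 x * d.η x) volume volume ∘L d.G ∘L zeroL n R₀ E

lemma wMul_sourceZero (f : SpaceZero n R₀ E) :
    wMul n (d.sourceZero f) = d.G (zeroL n R₀ E f) := by
  obtain ⟨M, hM⟩ := d.bump_compact.exists_bound_of_continuous d.bump_continuous
  have hM0 : 0 ≤ M := (norm_nonneg _).trans (hM 0)
  have b1 : MulBound (fun x => wt 1 x * (1 - d.η x)) (weightMeasure n R₀ 1) volume (1 + M) := by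
    refine (hasDens_weightMeasure 1).mulBound hasDens_volume
      ((continuous_wt 1).mul (continuous_const.sub d.bump_continuous)).measurable (by positivity)
      fun x => ?_
    by_cases hx : x ∈ exterior n R₀
    · have h1 : ‖1 - d.η x‖ ≤ 1 + M :=
        (norm_sub_le _ _).trans (by rw [norm_one]; linarith [hM x])
      have e : Real.exp (2 * 1 * ‖x‖ ^ 2) = Real.exp ((2 : ℕ) * (1 * ‖x‖ ^ 2)) := by
        congr 1; push_cast; ring
      rw [Set.indicator_of_mem hx, mul_one, norm_mul, norm_wt, mul_pow, e, Real.exp_nat_mul,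
        mul_comm]
      exact mul_le_mul_of_nonneg_right (pow_le_pow_left₀ (norm_nonneg _) h1 2) (sq_nonneg _)
    · have h1 : ‖x‖ ≤ R₀ + 2 := by
        simp only [exterior, Set.mem_compl_iff, not_not, Metric.mem_ball, dist_zero_right] at hx
        linarith
      simp [d.bump_one x h1, Set.indicator_of_notMem hx]
  obtain ⟨C, b2⟩ := exists_mulBound ((continuous_wt 1).mul d.bump_continuous)
    d.bump_compact.mul_left
  change MulBound (fun x => wt 1 x * d.η x) _ _ _ at b2
  set g := d.G (zeroL n R₀ E f) with hg
  have h1 : d.sourceZero f = mulOp (fun x => wt 1 x * (1 - d.η x)) (weightMeasure n R₀ 1) volume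
      f.snd + mulOp (fun x => wt 1 x * d.η x) volume volume g := rfl
  refine Lp.ext ?_
  rw [h1]
  filter_upwards [coeFn_wMul (mulOp (fun x => wt 1 x * (1 - d.η x)) (weightMeasure n R₀ 1) volume
      f.snd + mulOp (fun x => wt 1 x * d.η x) volume volume g),
    Lp.coeFn_add (mulOp (fun x => wt 1 x * (1 - d.η x)) (weightMeasure n R₀ 1) volume f.snd)
      (mulOp (fun x => wt 1 x * d.η x) volume volume g), coeFn_mulOp b1 f.snd, coeFn_mulOp b2 g,
    d.source_far (zeroL n R₀ E f), ae_ext_iff.1 (zeroL_snd f)] with x e1 e2 e3 e4 e5 e6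
  rw [e1, e2, Pi.add_apply, e3, e4]
  have h2 := wt_neg_mul 1 x
  by_cases hx : R₀ + 2 ≤ ‖x‖
  · have hxe : x ∈ exterior n R₀ := by
      simp only [exterior, Set.mem_compl_iff, Metric.mem_ball, dist_zero_right, not_lt]
      linarith
    rw [← hg, e6 hxe] at e5
    rw [e5 hx]
    linear_combination (f.snd x) * h2
  · rw [d.bump_one x (not_le.1 hx).le]
    linear_combination (g x) * h2

/-- The errors of the parametrix on `ℋ₀` and on `ℋ` are intertwined by the inclusion. -/
lemma zeroL_K {T₁ : SpaceZero n R₀ E →L[ℂ] JetSpace n 1} {T₀ : Space n R₀ E →L[ℂ] JetSpace n 0}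
    (h : ∀ f, T₁ f = weightJet n (T₀ (zeroL n R₀ E f))) (k : ℂ) (f : SpaceZero n R₀ E) :
    zeroL n R₀ E (d.K (zeroL n R₀ E) T₁ k f) =
      d.K (ContinuousLinearMap.id ℂ _) T₀ k (zeroL n R₀ E f) := by
  refine space_ext ?_ ?_
  · rw [zeroL_fst, K_fst, K_fst]; rfl
  · set w := T₀ (zeroL n R₀ E f) with hw
    have e4 : ∀ᵐ x, ∀ i, wMul n (w.val.2.1 i) x = wt (-1) x * w.val.2.1 i x :=
      ae_all_iff.2 fun i => coeFn_wMul _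
    filter_upwards [zeroL_snd (d.K (zeroL n R₀ E) T₁ k f),
      (extMeasure_ac 1).ae_le (d.K_snd (hasDens_weightMeasure 1) (zeroL n R₀ E) T₁ k f),
      d.K_snd isExtWeight_extMeasure (ContinuousLinearMap.id ℂ _) T₀ k (zeroL n R₀ E f),
      ae_restrict_of_ae (coeFn_wMul w.val.1), ae_restrict_of_ae e4] with x e1 e2 e3 e5 e6
    have h2 := wt_neg_mul 1 x
    have h3 : ∑ i, pd i d.ψ x * (weightJet n w).val.2.1 i x =
        wt (-1) x * ∑ i, pd i d.ψ x * w.val.2.1 i x := by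
      rw [Finset.mul_sum]
      refine Finset.sum_congr rfl fun i _ => ?_
      rw [weightJet_snd, e6 i]; ring
    refine e1.trans (e2.trans (Eq.trans ?_ e3.symm))
    rw [h f, ← hw, weightJet_fst, e5, h3, wt_zero]
    change _ = (k₀ ^ 2 - k ^ 2) * (d.θ x * (d.R (zeroL n R₀ E f)).1.1.snd x) - _
    linear_combination (-(lap d.ψ x * w.val.1 x + 2 * ∑ i, pd i d.ψ x * w.val.2.1 i x)) * h2

end GluingData

end Identity

/-! ### The resolvent in the upper half-plane -/

section UpperHalfPlane

variable {E : Type*} [NormedAddCommGroup E] [InnerProductSpace ℂ E] [CompleteSpace E]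
  {P : Space n R₀ E →ₗ.[ℂ] Space n R₀ E} {k₀ : ℂ}

lemma analyticAt_freeDiff {k : ℂ} (h : 0 < k.im) (k₀ : ℂ) :
    AnalyticAt ℂ (fun k => freeDiff n k k₀) k :=
  (analyticAt_freeRes h).sub analyticAt_const

lemma freeDiff_self (k₀ : ℂ) : freeDiff n k₀ k₀ = 0 := sub_self _

lemma isCompactOperator_freeRes {k : ℂ} (hk : 0 < k.im) (α : Option (Fin n)) {φ : 𝔼 → ℂ}
    (hφ : Continuous φ) (hφc : HasCompactSupport φ) :
    IsCompactOperator (mulOp φ volume volume ∘L jetLow n 0 α ∘L freeRes k) :=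
  isCompactOperator_jetLow_jetMul (JetSymbol.rsym hk) hφ hφc α

lemma isCompactOperator_freeDiff {k : ℂ} (hk₀ : 0 < k₀.im) (hk : 0 < k.im) (α : Option (Fin n))
    {φ : 𝔼 → ℂ} (hφ : Continuous φ) (hφc : HasCompactSupport φ) :
    IsCompactOperator (mulOp φ volume volume ∘L jetLow n 0 α ∘L freeDiff n k k₀) := by
  rw [freeDiff, comp_sub, comp_sub]
  exact (isCompactOperator_freeRes hk α hφ hφc).sub (isCompactOperator_freeRes hk₀ α hφ hφc)

/-- The identity is invertible up to small perturbations. -/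
lemma eventually_isUnit_one_add {X : Type*} [NormedAddCommGroup X] [NormedSpace ℂ X]
    [CompleteSpace X] {K : ℂ → X →L[ℂ] X} {z₀ : ℂ} (h : ContinuousAt K z₀) (h0 : K z₀ = 0) :
    ∀ᶠ z in 𝓝[≠] z₀, IsUnit (1 + K z) := by
  have h1 : ContinuousAt (fun z => 1 + K z) z₀ := continuousAt_const.add h
  have h2 : {T : X →L[ℂ] X | IsUnit T} ∈ 𝓝 (1 + K z₀) :=
    Units.isOpen.mem_nhds (by rw [h0, add_zero]; exact isUnit_one)
  exact (h1.eventually h2).filter_mono nhdsWithin_le_nhds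

namespace GluingData

variable (d : GluingData P k₀)

section Family

variable {c : ℝ} {ν : Measure (EuclideanSpace ℝ (Fin n))}
  {ι : WithLp 2 (E × Lp ℂ 2 ν) →L[ℂ] Space n R₀ E}

lemma analyticAt_K {T : ℂ → WithLp 2 (E × Lp ℂ 2 ν) →L[ℂ] JetSpace n c} {ℓ : ℂ → ℂ} {z₀ : ℂ}
    (hT : AnalyticAt ℂ T z₀) (hℓ : AnalyticAt ℂ ℓ z₀) :
    AnalyticAt ℂ (fun z => d.K ι (T z) (ℓ z)) z₀ :=
  ((analyticAt_const.sub (hℓ.pow 2)).smul analyticAt_const).sub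
    (analyticAt_clm_comp analyticAt_const hT)

lemma isCompactOperator_K (hR₀ : 0 < R₀) (hP : IsBlackBoxHamiltonian P) (hν : IsExtWeight R₀ c ν)
    {T : WithLp 2 (E × Lp ℂ 2 ν) →L[ℂ] JetSpace n c}
    (hT : ∀ α, ∀ φ : 𝔼 → ℂ, Continuous φ → HasCompactSupport φ →
      IsCompactOperator (mulOp φ volume volume ∘L jetLow n c α ∘L T)) (k : ℂ) :
    IsCompactOperator (d.K ι T k) :=
  IsCompactOperator.sub (((d.isCompactOperator_cutX (ν := ν) hR₀ hP).comp_clm ι).smul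
    (k₀ ^ 2 - k ^ 2)) (d.isCompactOperator_commX hν hT)

end Family

/-- The error of the parametrix on `ℋ`. -/
def K₀ (k : ℂ) : Space n R₀ E →L[ℂ] Space n R₀ E :=
  d.K (ContinuousLinearMap.id ℂ _) (freeDiff n k k₀ ∘L d.G) k

lemma K_eq_zero {c : ℝ} {ν : Measure 𝔼} (ι : WithLp 2 (E × Lp ℂ 2 ν) →L[ℂ] Space n R₀ E)
    {T : WithLp 2 (E × Lp ℂ 2 ν) →L[ℂ] JetSpace n c} (hT : T = 0) : d.K ι T k₀ = 0 := by
  ext1 f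
  have h : d.K ι T k₀ f = (k₀ ^ 2 - k₀ ^ 2) • d.cutX ν (d.R (ι f)).1.1 - d.commX c ν (T f) := rfl
  rw [h, hT, zero_apply, zero_apply, map_zero, sub_zero, sub_self]
  exact zero_smul ℂ _

lemma analyticAt_K₀ {k : ℂ} (hk : 0 < k.im) : AnalyticAt ℂ d.K₀ k :=
  d.analyticAt_K (T := fun k => freeDiff n k k₀ ∘L d.G) (ℓ := fun k => k)
    (analyticAt_clm_comp (analyticAt_freeDiff hk k₀) analyticAt_const) analyticAt_id

lemma isCompactOperator_K₀ (hR₀ : 0 < R₀) (hP : IsBlackBoxHamiltonian P) (hk₀ : 0 < k₀.im) {k : ℂ}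
    (hk : 0 < k.im) : IsCompactOperator (d.K₀ k) :=
  d.isCompactOperator_K hR₀ hP isExtWeight_extMeasure (T := freeDiff n k k₀ ∘L d.G)
    (fun α φ hφ hφc => (isCompactOperator_freeDiff hk₀ hk α hφ hφc).comp_clm d.G) k

lemma K₀_inverse (hR₀ : 0 < R₀) (hP : IsBlackBoxHamiltonian P) (hk₀ : 0 < k₀.im) {k : ℂ}
    (hk : 0 < k.im) : (∀ᶠ z in 𝓝[≠] k, IsUnit (1 + d.K₀ z)) ∧
      FiniteRankMeromorphicAt (fun z => Ring.inverse (1 + d.K₀ z)) k := by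
  refine fredholm_meromorphic (Ω := {k | 0 < k.im})
    (isOpen_lt continuous_const Complex.continuous_im)
    (convex_halfSpace_im_gt 0).isPreconnected (fun z hz => ⟨d.K₀, 0, d.analyticAt_K₀ hz,
      d.isCompactOperator_K₀ hR₀ hP hk₀ hz, ?_, ?_⟩) hk₀ ?_ k hk
  · rw [toLinearMap_zero, LinearMap.range_zero]
    infer_instance
  · exact Eventually.of_forall fun z => by rw [smul_zero, add_zero]
  · refine eventually_isUnit_one_add (d.analyticAt_K₀ hk₀).continuousAt (d.K_eq_zero _ ?_)
    rw [freeDiff_self, ContinuousLinearMap.zero_comp]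

lemma isResolventAt_of_isUnit (hP : IsBlackBoxHamiltonian P) (hk₀ : 0 < k₀.im) {k : ℂ}
    (hk : 0 < k.im) (hu : IsUnit (1 + d.K₀ k)) :
    IsResolventAt P (k ^ 2) (d.F k ∘L Ring.inverse (1 + d.K₀ k)) := by
  refine isResolventAt_of_rightInverse hP.selfAdjoint fun f => ?_
  have h1 : (1 + d.K₀ k) * Ring.inverse (1 + d.K₀ k) = 1 := Ring.mul_inverse_cancel _ hu
  have h2 : Ring.inverse (1 + d.K₀ k) f + d.K₀ k (Ring.inverse (1 + d.K₀ k) f) = f :=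
    DFunLike.congr_fun h1 f
  exact (d.parametrix_identity hk₀ hk _).trans h2

lemma analyticAt_F {k : ℂ} (hk : 0 < k.im) : AnalyticAt ℂ d.F k :=
  analyticAt_const.add (analyticAt_clm_comp analyticAt_const
    (analyticAt_clm_comp (analyticAt_freeDiff hk k₀) analyticAt_const))

end GluingData

theorem IsBlackBoxHamiltonian.resolvent_meromorphic (hR₀ : 0 < R₀) (hP : IsBlackBoxHamiltonian P)
    (d : GluingData P k₀) (hk₀ : 0 < k₀.im) :
    (∀ k : ℂ, 0 < k.im → ∀ᶠ z in 𝓝[≠] k, z ^ 2 ∈ resolventSet P) ∧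
      IsMeromorphicFamilyOn (fun k => resolvent P (k ^ 2)) {k | 0 < k.im} := by
  have him : ∀ k : ℂ, 0 < k.im → ∀ᶠ z : ℂ in 𝓝[≠] k, 0 < z.im := fun k hk =>
    Eventually.filter_mono nhdsWithin_le_nhds
      ((isOpen_lt continuous_const Complex.continuous_im).mem_nhds hk)
  refine ⟨fun k hk => ?_, isMeromorphicFamilyOn_of_finiteRank fun k hk => ?_⟩
  · filter_upwards [him k hk, (d.K₀_inverse hR₀ hP hk₀ hk).1] with z hz hu
    exact ⟨_, d.isResolventAt_of_isUnit hP hk₀ hz hu⟩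
  · refine ((d.K₀_inverse hR₀ hP hk₀ hk).2.clm_comp (d.analyticAt_F hk)).congr ?_
    filter_upwards [him k hk, (d.K₀_inverse hR₀ hP hk₀ hk).1] with z hz hu
    exact (resolvent_eq (d.isResolventAt_of_isUnit hP hk₀ hz hu)).symm

end UpperHalfPlane

/-! ### Cutoffs that are flat on the boundary of the ball -/

section FlatCutoff

lemma tendsto_inner_mulOp {c : ℕ → 𝔼 → ℂ} {c₀ : 𝔼 → ℂ} {C : ℝ} (hc : ∀ m, Continuous (c m))
    (hc₀ : Continuous c₀) (hb : ∀ m x, ‖c m x‖ ≤ C)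
    (ht : ∀ x, Tendsto (fun m => c m x) atTop (𝓝 (c₀ x))) (A f : Lp ℂ 2 (extMeasure n R₀)) :
    Tendsto (fun m => inner ℂ A (mulOp (c m) (extMeasure n R₀) (extMeasure n R₀) f)) atTop
      (𝓝 (inner ℂ A (mulOp c₀ (extMeasure n R₀) (extMeasure n R₀) f))) := by
  have hb₀ : ∀ x, ‖c₀ x‖ ≤ C := fun x =>
    le_of_tendsto (ht x).norm (Eventually.of_forall fun m => hb m x)
  have key : ∀ {a : 𝔼 → ℂ}, Continuous a → (∀ x, ‖a x‖ ≤ C) →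
      inner ℂ A (mulOp a (extMeasure n R₀) (extMeasure n R₀) f) =
        ∫ x, inner ℂ (A x) (a x * f x) ∂extMeasure n R₀ := by
    intro a ha hC
    rw [L2.inner_def]
    refine integral_congr_ae ?_
    filter_upwards [coeFn_mulOp (mulBound_ext ha.measurable hC) f] with x hx
    rw [hx]
  simp only [fun m => key (hc m) (hb m)]
  rw [key hc₀ hb₀]
  refine tendsto_integral_of_dominated_convergence (fun x => C * (‖A x‖ * ‖f x‖)) (fun m => ?_) ?_
    (fun m => ae_of_all _ fun x => ?_) (ae_of_all _ fun x => ?_)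
  · exact (Lp.aestronglyMeasurable A).inner
      ((hc m).aestronglyMeasurable.mul (Lp.aestronglyMeasurable f))
  · exact ((Lp.memLp A).norm.integrable_mul (Lp.memLp f).norm).const_mul C
  · refine (norm_inner_le_norm _ _).trans ?_
    rw [norm_mul]
    nlinarith [mul_le_mul_of_nonneg_right (hb m x)
      (mul_nonneg (norm_nonneg (A x)) (norm_nonneg (f x)))]
  · exact tendsto_const_nhds.inner ((ht x).mul_const _)

lemma exists_bound_lap {ψ : 𝔼 → ℂ} (hb : UpToTwo (fun φ => ∃ C, ∀ x, ‖φ x‖ ≤ C) ψ) :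
    ∃ C, (∀ x, ‖ψ x‖ ≤ C) ∧ (∀ i x, ‖2 * pd i ψ x‖ ≤ C) ∧ ∀ x, ‖lap ψ x‖ ≤ C := by
  obtain ⟨⟨C, hC⟩, h1, h2⟩ := hb
  choose D hD using h1
  choose B hB using h2
  have hC0 : 0 ≤ C := (norm_nonneg _).trans (hC 0)
  have hD0 : ∀ i, 0 ≤ D i := fun i => (norm_nonneg _).trans (hD i 0)
  have hB0 : ∀ i, 0 ≤ B i i := fun i => (norm_nonneg _).trans (hB i i 0)
  have s1 : 0 ≤ ∑ i, D i := Finset.sum_nonneg fun i _ => hD0 i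
  have s2 : 0 ≤ ∑ i, B i i := Finset.sum_nonneg fun i _ => hB0 i
  refine ⟨C + 2 * ∑ i, D i + ∑ i, B i i, fun x => by linarith [hC x], fun i x => ?_, fun x => ?_⟩
  · have := Finset.single_le_sum (fun i _ => hD0 i) (Finset.mem_univ i)
    rw [norm_mul, Complex.norm_ofNat]
    linarith [hD i x]
  · have : ‖lap ψ x‖ ≤ ∑ i, B i i :=
      (norm_sum_le _ _).trans (Finset.sum_le_sum fun i _ => hB i i x)
    linarith

variable {E : Type*} [NormedAddCommGroup E] [InnerProductSpace ℂ E] [CompleteSpace E]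
  {P : Space n R₀ E →ₗ.[ℂ] Space n R₀ E}

/-- The operator `u ↦ -Δ(ψ u)`, where `G i u` is the derivative `∂ᵢ u`. -/
def cutImg (G : Fin n → P.graph →L[ℂ] Lp ℂ 2 (extMeasure n R₀))
    (ψ : 𝔼 → ℂ) : P.graph →L[ℂ] Lp ℂ 2 (extMeasure n R₀) :=
  mulOp ψ (extMeasure n R₀) (extMeasure n R₀) ∘L imgExt P -
    mulOp (lap ψ) (extMeasure n R₀) (extMeasure n R₀) ∘L domExt P -
      ∑ i, mulOp (fun x => 2 * pd i ψ x) (extMeasure n R₀) (extMeasure n R₀) ∘L G i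

lemma cutImg_apply (G : Fin n → P.graph →L[ℂ] Lp ℂ 2 (extMeasure n R₀)) (ψ : 𝔼 → ℂ) (u : P.graph) :
    cutImg G ψ u = mulOp ψ (extMeasure n R₀) (extMeasure n R₀) (imgExt P u) -
      mulOp (lap ψ) (extMeasure n R₀) (extMeasure n R₀) (domExt P u) -
        ∑ i, mulOp (fun x => 2 * pd i ψ x) (extMeasure n R₀) (extMeasure n R₀) (G i u) := by
  rw [cutImg, sub_apply, sub_apply, sum_apply]
  rfl

/-- The operator `u ↦ (ψ u, -Δ(ψ u))`. -/
def cutPair (G : Fin n → P.graph →L[ℂ] Lp ℂ 2 (extMeasure n R₀))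
    (ψ : 𝔼 → ℂ) : P.graph →L[ℂ] Space n R₀ E × Space n R₀ E :=
  (outerEmb (extMeasure n R₀) E ∘L mulOp ψ (extMeasure n R₀) (extMeasure n R₀) ∘L domExt P).prod
    (outerEmb (extMeasure n R₀) E ∘L cutImg G ψ)

lemma cutPair_apply (G : Fin n → P.graph →L[ℂ] Lp ℂ 2 (extMeasure n R₀)) (ψ : 𝔼 → ℂ)
    (u : P.graph) : cutPair G ψ u =
      (WithLp.toLp 2 (0, mulOp ψ (extMeasure n R₀) (extMeasure n R₀) (domExt P u)),
        WithLp.toLp 2 (0, cutImg G ψ u)) := rfl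

lemma coeFn_cutImg (G : Fin n → P.graph →L[ℂ] Lp ℂ 2 (extMeasure n R₀)) {ψ : 𝔼 → ℂ}
    (hψ : ContDiff ℝ ∞ ψ) (hb : UpToTwo (fun φ => ∃ C, ∀ x, ‖φ x‖ ≤ C) ψ) (u : P.graph) :
    ∀ᵐ x ∂extMeasure n R₀, cutImg G ψ u x = ψ x * imgExt P u x - lap ψ x * domExt P u x -
      2 * ∑ i, pd i ψ x * G i u x := by
  obtain ⟨C, h0, h1, h2⟩ := exists_bound_lap hb
  rw [cutImg_apply]
  set a := mulOp ψ (extMeasure n R₀) (extMeasure n R₀) (imgExt P u)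
  set b := mulOp (lap ψ) (extMeasure n R₀) (extMeasure n R₀) (domExt P u)
  set f := fun i => mulOp (fun x => 2 * pd i ψ x) (extMeasure n R₀) (extMeasure n R₀) (G i u)
  have h3 : ∀ᵐ x ∂extMeasure n R₀, ∀ i, f i x = 2 * pd i ψ x * G i u x := ae_all_iff.2 fun i =>
    coeFn_mulOp (mulBound_ext (continuous_const.mul
      (contDiff_pd hψ i).continuous).measurable (h1 i)) (G i u)
  filter_upwards [Lp.coeFn_sub (a - b) (∑ i, f i), Lp.coeFn_sub a b, coeFn_sum_Lp Finset.univ f, h3,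
    coeFn_mulOp (mulBound_ext hψ.continuous.measurable h0) (imgExt P u),
    coeFn_mulOp (mulBound_ext (contDiff_lap hψ).continuous.measurable h2) (domExt P u)]
    with x e1 e2 e3 e4 e5 e6
  rw [e1, Pi.sub_apply, e2, Pi.sub_apply, e3, e5, e6, Finset.mul_sum]
  congr 1
  exact Finset.sum_congr rfl fun i _ => by rw [e4 i]; ring

lemma IsBlackBoxHamiltonian.cutPair_mem_of_isOuter (hR₀ : 0 < R₀) (hP : IsBlackBoxHamiltonian P)
    {G : Fin n → P.graph →L[ℂ] Lp ℂ 2 (extMeasure n R₀)}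
    (hG : ∀ i u, (domExt P u, G i u) ∈ extPair n R₀ i) {ψ : 𝔼 → ℂ}
    (hψ : IsOuter R₀ ψ) (u : P.graph) : cutPair G ψ u ∈ P.graph := by
  obtain ⟨m1, g, h, hW, m2, m3, hl⟩ := hP.weakTwo u
  obtain ⟨w, h1, h2⟩ := hψ.exists_jet hW m1 m2 m3
  obtain ⟨ε, hε, h0⟩ := hψ.vanish
  have hmem := hP.outer_mem hR₀ hε (h1.mono fun x hx hlt => by rw [hx, h0 x hlt, zero_mul])
  have hle : ae (extMeasure n R₀) ≤ ae (volume.restrict (openExterior n R₀)) :=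
    (extMeasure_eq hR₀).absolutelyContinuous.ae_le
  have hg : ∀ᵐ x ∂extMeasure n R₀, ∀ i, g i x = G i u x := ae_all_iff.2 fun i =>
    hle (HasWeakPartialOn.unique isOpen_openExterior (hW.first i) (hG i u))
  replace hl : ∀ᵐ x ∂extMeasure n R₀, ∑ i, h i i x = -imgExt P u x := hle hl
  obtain ⟨C, hC, -⟩ := exists_bound_lap hψ.bounded
  have e1 : resExt n R₀ w.val.1 =
      mulOp ψ (extMeasure n R₀) (extMeasure n R₀) (domExt P u) := by
    refine Lp.ext ?_
    filter_upwards [coeFn_resExt (R₀ := R₀) w.val.1, ae_restrict_of_ae h1,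
      coeFn_mulOp (mulBound_ext hψ.contDiff.continuous.measurable hC) (domExt P u)] with x p1 p2 p3
    rw [p1, p2, p3]
  have e2 : -resExt n R₀ (jetLap w.val) = cutImg G ψ u := by
    refine Lp.ext ?_
    filter_upwards [Lp.coeFn_neg (resExt n R₀ (jetLap w.val)),
      coeFn_resExt (R₀ := R₀) (jetLap w.val), ae_restrict_of_ae h2,
      coeFn_cutImg G hψ.contDiff hψ.bounded u, hl, hg] with x p1 p2 p3 p4 p5 p6
    rw [p1, Pi.neg_apply, p2, p3, p4, p5, Finset.sum_congr rfl fun i _ => by rw [p6 i]]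
    ring
  rw [e1, e2] at hmem
  exact hmem

/-- The domain of a self-adjoint operator is closed under limits of multiplications. -/
lemma IsBlackBoxHamiltonian.cutPair_mem_of_tendsto (hP : IsBlackBoxHamiltonian P)
    {G : Fin n → P.graph →L[ℂ] Lp ℂ 2 (extMeasure n R₀)} {ψ : ℕ → 𝔼 → ℂ}
    {φ : 𝔼 → ℂ} {C : ℝ} (hφ : ContDiff ℝ ∞ φ)
    (hψ : ∀ m, ContDiff ℝ ∞ (ψ m)) (hmem : ∀ m u, cutPair G (ψ m) u ∈ P.graph)
    (hb : ∀ m, (∀ x, ‖ψ m x‖ ≤ C) ∧ (∀ i x, ‖2 * pd i (ψ m) x‖ ≤ C) ∧ ∀ x, ‖lap (ψ m) x‖ ≤ C)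
    (h0 : ∀ x, Tendsto (fun m => ψ m x) atTop (𝓝 (φ x)))
    (h1 : ∀ i x, Tendsto (fun m => pd i (ψ m) x) atTop (𝓝 (pd i φ x)))
    (h2 : ∀ x, Tendsto (fun m => lap (ψ m) x) atTop (𝓝 (lap φ x))) (u : P.graph) :
    cutPair G φ u ∈ P.graph := by
  refine mem_graph_of_inner hP.selfAdjoint fun a ha => ?_
  have hfst : ∀ χ : 𝔼 → ℂ, inner ℂ a.2 (cutPair G χ u).1 =
      inner ℂ a.2.snd (mulOp χ (extMeasure n R₀) (extMeasure n R₀) (domExt P u)) := fun χ => by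
    rw [cutPair_apply, WithLp.prod_inner_apply]
    change inner ℂ a.2.fst (0 : E) + _ = _
    rw [inner_zero_right, zero_add]
    rfl
  have hsnd : ∀ χ : 𝔼 → ℂ, inner ℂ a.1 (cutPair G χ u).2 = inner ℂ a.1.snd (cutImg G χ u) :=
    fun χ => by
      rw [cutPair_apply, WithLp.prod_inner_apply]
      change inner ℂ a.1.fst (0 : E) + _ = _
      rw [inner_zero_right, zero_add]
      rfl
  have t1 : Tendsto (fun m => inner ℂ a.2 (cutPair G (ψ m) u).1) atTop
      (𝓝 (inner ℂ a.2 (cutPair G φ u).1)) := by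
    simp only [hfst]
    exact tendsto_inner_mulOp (fun m => (hψ m).continuous) hφ.continuous (fun m => (hb m).1) h0 _ _
  have t2 : Tendsto (fun m => inner ℂ a.1 (cutPair G (ψ m) u).2) atTop
      (𝓝 (inner ℂ a.1 (cutPair G φ u).2)) := by
    simp only [hsnd, cutImg_apply, inner_sub_right, inner_sum]
    refine ((tendsto_inner_mulOp (fun m => (hψ m).continuous) hφ.continuous (fun m => (hb m).1) h0
      _ _).sub (tendsto_inner_mulOp (fun m => (contDiff_lap (hψ m)).continuous)
      (contDiff_lap hφ).continuous (fun m => (hb m).2.2) h2 _ _)).sub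
      (tendsto_finsetSum _ fun i _ => tendsto_inner_mulOp
        (fun m => continuous_const.mul (contDiff_pd (hψ m) i).continuous)
        (continuous_const.mul (contDiff_pd hφ i).continuous) (fun m => (hb m).2.1 i)
        (fun x => (h1 i x).const_mul 2) _ _)
  refine tendsto_nhds_unique t1 (t2.congr fun m => ?_)
  exact (inner_graph hP.selfAdjoint ha (hmem m u)).symm

lemma pd_dilate {g : 𝔼 → ℂ} (hg : ContDiff ℝ ∞ g) (s : ℝ) (i : Fin n) (x : 𝔼) :
    pd i (fun y => g (s • y)) x = s * pd i g (s • x) := by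
  have h1 : HasFDerivAt (fun y : 𝔼 => s • y) (s • ContinuousLinearMap.id ℝ 𝔼) x :=
    (hasFDerivAt_id x).const_smul s
  have h2 := ((hg.differentiable (by norm_num)) (s • x)).hasFDerivAt.comp x h1
  rw [pd, show fderiv ℝ (fun y => g (s • y)) x = _ from h2.fderiv]
  simp [pd]

lemma lap_dilate {g : 𝔼 → ℂ} (hg : ContDiff ℝ ∞ g) (s : ℝ) (x : 𝔼) :
    lap (fun y => g (s • y)) x = s ^ 2 * lap g (s • x) := by
  rw [lap, lap, Finset.mul_sum]
  refine Finset.sum_congr rfl fun i _ => ?_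
  rw [show pd i (fun y => g (s • y)) = fun y => (s : ℂ) * pd i g (s • y) from
    funext fun y => pd_dilate hg s i y]
  have hc : ContDiff ℝ ∞ fun y : 𝔼 => pd i g (s • y) :=
    (contDiff_pd hg i).comp (contDiff_id.const_smul _)
  rw [pd_mul contDiff_const hc, pd_dilate (contDiff_pd hg i)]
  simp [pd]
  ring

/-- For a cutoff `χ` equal to `1` on the ball, the dilated functions `1 - χ(s x)`, `s < 1`, vanish
near the ball, so that multiplication by `1 - χ` maps the domain to itself. -/
lemma IsBlackBoxHamiltonian.cutPair_mem (hR₀ : 0 < R₀) (hP : IsBlackBoxHamiltonian P)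
    {G : Fin n → P.graph →L[ℂ] Lp ℂ 2 (extMeasure n R₀)}
    (hG : ∀ i u, (domExt P u, G i u) ∈ extPair n R₀ i) {χ : 𝔼 → ℂ}
    (hχ : IsCutoff R₀ χ) (u : P.graph) : cutPair G (fun x => 1 - χ x) u ∈ P.graph := by
  set g : 𝔼 → ℂ := fun x => 1 - χ x with hg
  have hgs : ContDiff ℝ ∞ g := contDiff_const.sub hχ.1
  have hgc : HasCompactSupport fun x => 1 - g x := by simpa [hg] using hχ.2.1
  obtain ⟨C, c0, c1, c2⟩ := exists_bound_lap (upToTwo_bounded hgs hgc)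
  set s : ℕ → ℝ := fun m => 1 - 1 / ((m : ℝ) + 2) with hs
  have hs0 : ∀ m, 0 < s m := fun m => by
    have : 1 / ((m : ℝ) + 2) < 1 := by
      rw [div_lt_one (by positivity)]; linarith [Nat.cast_nonneg (α := ℝ) m]
    simp only [hs]; linarith
  have hs1 : ∀ m, s m < 1 := fun m => by
    have : 0 < 1 / ((m : ℝ) + 2) := by positivity
    simp only [hs]; linarith
  have hst : Tendsto s atTop (𝓝 1) := by
    have h1 : Tendsto (fun m : ℕ => 1 / ((m : ℝ) + 2)) atTop (𝓝 0) := by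
      refine Tendsto.div_atTop tendsto_const_nhds ?_
      exact tendsto_atTop_add_const_right _ _ tendsto_natCast_atTop_atTop
    have h2 := h1.const_sub 1
    rwa [sub_zero] at h2
  have hsn : ∀ m, ‖((s m : ℝ) : ℂ)‖ ≤ 1 := fun m => by
    rw [norm_real, Real.norm_of_nonneg (hs0 m).le]; exact (hs1 m).le
  have hsC : Tendsto (fun m => ((s m : ℝ) : ℂ)) atTop (𝓝 1) := by
    exact_mod_cast (Complex.continuous_ofReal.tendsto 1).comp hst
  have hsx : ∀ x : 𝔼, Tendsto (fun m => s m • x) atTop (𝓝 x) := fun x => by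
    simpa using hst.smul_const x
  have hlim : ∀ {f : 𝔼 → ℂ}, Continuous f → ∀ x, Tendsto (fun m => f (s m • x)) atTop (𝓝 (f x)) :=
    fun hf x => (hf.tendsto x).comp (hsx x)
  have hmul : ∀ {a b : ℂ}, ‖a‖ ≤ 1 → ‖b‖ ≤ C → ‖a * b‖ ≤ C := fun {a b} ha hb => by
    rw [norm_mul]
    nlinarith [norm_nonneg a, norm_nonneg b]
  have hd : ∀ m, ContDiff ℝ ∞ fun x : 𝔼 => g (s m • x) := fun m =>
    hgs.comp (contDiff_id.const_smul _)
  refine hP.cutPair_mem_of_tendsto (ψ := fun m x => g (s m • x)) (C := C) hgs hd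
    (fun m => hP.cutPair_mem_of_isOuter hR₀ hG ⟨hd m, ?_, R₀ / s m - R₀, ?_, fun x hx => ?_⟩)
    (fun m => ⟨fun x => c0 _, fun i x => ?_, fun x => ?_⟩) (hlim hgs.continuous)
    (fun i x => ?_) (fun x => ?_) u
  · exact hgc.comp_smul (hs0 m).ne'
  · rw [gt_iff_lt, sub_pos, lt_div_iff₀ (hs0 m)]
    nlinarith [hs1 m]
  · have : s m • x ∈ Metric.ball (0 : 𝔼) R₀ := by
      rw [mem_ball_zero_iff, norm_smul, Real.norm_of_nonneg (hs0 m).le, mul_comm,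
        ← lt_div_iff₀ (hs0 m)]
      linarith
    simp only [hg]
    rw [hχ.2.2 _ this, sub_self]
  · rw [pd_dilate hgs, mul_left_comm]
    exact hmul (hsn m) (c1 i _)
  · rw [lap_dilate hgs]
    exact hmul (by rw [norm_pow]; exact pow_le_one₀ (norm_nonneg _) (hsn m)) (c2 _)
  · simp only [pd_dilate hgs]
    simpa using hsC.mul (hlim (contDiff_pd hgs i).continuous x)
  · simp only [lap_dilate hgs]
    simpa using (hsC.pow 2).mul (hlim (contDiff_lap hgs).continuous x)

/-- Multiplication by `1 - χ` on the domain of `P`. -/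
lemma IsBlackBoxHamiltonian.exists_mul_one_sub (hR₀ : 0 < R₀) (hP : IsBlackBoxHamiltonian P)
    {χ : 𝔼 → ℂ} (hχ : IsCutoff R₀ χ) :
    ∃ N : P.graph →L[ℂ] P.graph, ∀ u, (N u).1.1.fst = 0 ∧
      ∀ᵐ x ∂extMeasure n R₀, (N u).1.1.snd x = (1 - χ x) * u.1.1.snd x := by
  choose G hG using fun i => hP.exists_gradient hR₀ i
  have hgs : ContDiff ℝ ∞ fun x : 𝔼 => 1 - χ x := contDiff_const.sub hχ.1
  have hgc : HasCompactSupport fun x => 1 - (1 - χ x) := by simpa using hχ.2.1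
  obtain ⟨C, hC, -⟩ := exists_bound_lap (upToTwo_bounded hgs hgc)
  refine ⟨(cutPair G fun x => 1 - χ x).codRestrict P.graph (hP.cutPair_mem hR₀ hG hχ),
    fun u => ⟨rfl, ?_⟩⟩
  exact coeFn_mulOp (mulBound_ext hgs.continuous.measurable hC) (domExt P u)

end FlatCutoff

/-! ### Operators with values in `𝒟₁(P)` -/

section DomainOne

variable {E : Type*} [NormedAddCommGroup E] [InnerProductSpace ℂ E]
  {P : Space n R₀ E →ₗ.[ℂ] Space n R₀ E}

/-- The space `𝒟₁(P)` with the norm given by the cutoff `χ`. -/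
def DomOne (P : Space n R₀ E →ₗ.[ℂ] Space n R₀ E) (χ : 𝔼 → ℂ) : Type _ :=
  domainOneGraph P χ

instance (χ : 𝔼 → ℂ) : NormedAddCommGroup (DomOne P χ) :=
  inferInstanceAs (NormedAddCommGroup (domainOneGraph P χ))

instance (χ : 𝔼 → ℂ) : NormedSpace ℂ (DomOne P χ) :=
  inferInstanceAs (NormedSpace ℂ (domainOneGraph P χ))

/-- The triple `(u, χ u, Δ((1 - χ) u))` of `u ∈ 𝒟₁(P)`. -/
def DomOne.val {χ : 𝔼 → ℂ} :
    DomOne P χ →L[ℂ] SpaceOne n R₀ E × P.graph × Lp ℂ 2 (weightMeasure n R₀ (-1)) :=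
  (domainOneGraph P χ).subtypeL

lemma DomOne.val_mem {χ : 𝔼 → ℂ} (t : DomOne P χ) :
    t.val ∈ domainOneGraph P χ := Subtype.mem t

lemma DomOne.ext {χ : 𝔼 → ℂ} {s t : DomOne P χ} (h : s.val = t.val) :
    s = t := Subtype.ext h

/-- An operator whose values are triples in `𝒟₁(P)`. -/
def DomOne.lift {X : Type*} [NormedAddCommGroup X] [NormedSpace ℂ X]
    {χ : 𝔼 → ℂ}
    (T : X →L[ℂ] SpaceOne n R₀ E × P.graph × Lp ℂ 2 (weightMeasure n R₀ (-1)))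
    (h : ∀ x, T x ∈ domainOneGraph P χ) : X →L[ℂ] DomOne P χ :=
  T.codRestrict (domainOneGraph P χ) h

lemma DomOne.val_lift {X : Type*} [NormedAddCommGroup X] [NormedSpace ℂ X]
    {χ : 𝔼 → ℂ}
    (T : X →L[ℂ] SpaceOne n R₀ E × P.graph × Lp ℂ 2 (weightMeasure n R₀ (-1)))
    (h : ∀ x, T x ∈ domainOneGraph P χ) (x : X) : (DomOne.lift T h x).val = T x := rfl

variable (P) in
/-- The inclusion `𝒟₁(P) ⊆ ℋ₁`. -/
def domOneFst (χ : 𝔼 → ℂ) : DomOne P χ →L[ℂ] SpaceOne n R₀ E :=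
  ContinuousLinearMap.fst ℂ _ _ ∘L DomOne.val

lemma domOneFst_apply {χ : 𝔼 → ℂ} (t : DomOne P χ) :
    domOneFst P χ t = t.val.1 := rfl

/-- An operator into `ℋ₁` is a bounded operator into `𝒟₁(P)`, for each of its norms, if the
products with cutoffs and their Laplacians are given by bounded operators. -/
lemma exists_domainOneMap {X : Type*} [NormedAddCommGroup X] [NormedSpace ℂ X]
    (a : X →L[ℂ] SpaceOne n R₀ E)
    (h : ∀ χ : 𝔼 → ℂ, IsCutoff R₀ χ →
      ∃ (b : X →L[ℂ] P.graph) (c : X →L[ℂ] Lp ℂ 2 (weightMeasure n R₀ (-1))),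
        ∀ x, IsCutoffMul χ (a x) (b x).1.1 ∧ IsCutoffLaplacian χ (a x) (c x))
    {χ : 𝔼 → ℂ} (hχ : IsCutoff R₀ χ) :
    ∃ J : X →L[ℂ] DomOne P χ, ∀ x, domOneFst P χ (J x) = a x := by
  have h1 : ∀ x, a x ∈ domainOne P := fun x χ' hχ' => by
    obtain ⟨b, c, hbc⟩ := h χ' hχ'
    exact ⟨⟨_, P.mem_domain_of_mem_graph (b x).2, (hbc x).1⟩, _, (hbc x).2⟩
  obtain ⟨b, c, hbc⟩ := h χ hχ
  have hm : ∀ x, (a.prod (b.prod c)) x ∈ domainOneGraph P χ := fun x => ⟨h1 x, hbc x⟩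
  exact ⟨DomOne.lift (a.prod (b.prod c)) hm, fun x =>
    (domOneFst_apply _).trans (congrArg Prod.fst (DomOne.val_lift _ hm x))⟩

variable (n R₀) in
/-- Restriction to the exterior of functions with the weight `e^{-|x|²}`. -/
def resOne : Lp ℂ 2 (extMeasure n R₀) →L[ℂ] Lp ℂ 2 (weightMeasure n R₀ (-1)) :=
  mulOp (fun _ => 1) (extMeasure n R₀) (weightMeasure n R₀ (-1))

lemma coeFn_resOne (g : Lp ℂ 2 (extMeasure n R₀)) :
    ∀ᵐ x ∂weightMeasure n R₀ (-1), resOne n R₀ g x = g x := by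
  filter_upwards [coeFn_mulOp mulBound_ext_weight g] with x hx
  rw [resOne, hx, one_mul]

lemma isCutoffLaplacian_outer {χ : 𝔼 → ℂ} {f w : Lp ℂ 2 (weightMeasure n R₀ (-1))}
    (h : HasWeakLaplacianOn (openExterior n R₀) (fun x => (1 - χ x) * f x) w) :
    IsCutoffLaplacian χ (outerEmb (weightMeasure n R₀ (-1)) E f) w := h

lemma ae_open_of_ae_ext {p : 𝔼 → Prop} (h : ∀ᵐ x ∂extMeasure n R₀, p x) :
    ∀ᵐ x ∂volume.restrict (openExterior n R₀), p x := ae_mono restrict_openExterior_le h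

variable [CompleteSpace E]

lemma isCutoffMul_outer {χ : 𝔼 → ℂ} {f : Lp ℂ 2 (weightMeasure n R₀ (-1))}
    {g : Lp ℂ 2 (extMeasure n R₀)} (h : ∀ᵐ x ∂extMeasure n R₀, g x = χ x * f x) :
    IsCutoffMul χ (outerEmb (weightMeasure n R₀ (-1)) E f) (WithLp.toLp 2 (0, g)) := by
  have h1 : (WithLp.toLp 2 ((0 : E), g)).fst = 0 := rfl
  have h2 : (WithLp.toLp 2 ((0 : E), f)).fst = 0 := rfl
  have h3 : (WithLp.toLp 2 ((0 : E), g)).snd = g := rfl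
  have h4 : (WithLp.toLp 2 ((0 : E), f)).snd = f := rfl
  rw [outerEmb_apply]
  refine ⟨h1.trans h2.symm, ?_⟩
  rw [h3, h4]
  exact h

/-- The inclusion `𝒟(P) ⊆ 𝒟₁(P)`. -/
lemma IsBlackBoxHamiltonian.exists_domainToOne (hR₀ : 0 < R₀) (hP : IsBlackBoxHamiltonian P)
    {χ : 𝔼 → ℂ} (hχ : IsCutoff R₀ χ) :
    ∃ J : P.graph →L[ℂ] DomOne P χ, ∀ u, domOneFst P χ (J u) = oneL n R₀ E u.1.1 := by
  refine exists_domainOneMap (oneL n R₀ E ∘L domFst P) (fun χ' hχ' => ?_) hχ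
  obtain ⟨N, hN⟩ := hP.exists_mul_one_sub hR₀ hχ'
  refine ⟨ContinuousLinearMap.id ℂ _ - N, -(resOne n R₀ ∘L imgExt P ∘L N), fun u => ⟨⟨?_, ?_⟩, ?_⟩⟩
  · change u.1.1.fst - (N u).1.1.fst = (oneL n R₀ E u.1.1).fst
    rw [(hN u).1, sub_zero, oneL_fst]
  · change ∀ᵐ x ∂extMeasure n R₀, (u.1.1 - (N u).1.1).snd x = χ' x * (oneL n R₀ E u.1.1).snd x
    filter_upwards [coeFn_snd_sub u.1.1 (N u).1.1, (hN u).2, oneL_snd u.1.1] with x e1 e2 e3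
    rw [e1, e2, e3]
    ring
  · have hu := P.mem_domain_of_mem_graph (N u).2
    have h4 := hP.laplacian ⟨_, hu⟩
    rw [show P ⟨(N u).1.1, hu⟩ = (N u).1.2 from ((P.image_iff hu).2 (N u).2).symm] at h4
    refine h4.congr isOpen_openExterior ?_ ?_
    · change ∀ᵐ x ∂volume.restrict (openExterior n R₀),
        (N u).1.1.snd x = (1 - χ' x) * (oneL n R₀ E u.1.1).snd x
      filter_upwards [ae_open_of_ae_ext (hN u).2, ae_open_of_ae_ext (oneL_snd u.1.1)] with x e1 e2
      rw [e1, e2]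
    · change ∀ᵐ x ∂volume.restrict (openExterior n R₀),
        -(N u).1.2.snd x = (-resOne n R₀ (imgExt P (N u))) x
      filter_upwards [ae_open_of_ae_weight (Lp.coeFn_neg (resOne n R₀ (imgExt P (N u)))),
        ae_open_of_ae_weight (coeFn_resOne (imgExt P (N u)))] with x e1 e2
      rw [e1, Pi.neg_apply, e2, imgExt_apply]

lemma hasWeakLaplacianOn_jet {c : ℝ} {U : Set 𝔼} (hU : IsOpen U) (v : JetSpace n c) :
    HasWeakLaplacianOn U (fun x => wt c x * v.val.1 x) fun x => wt c x * jetLap v.val x := by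
  have h1 := (weakTwo_of_mem_jetSpace v.val_mem).mono hU (Set.subset_univ _)
  refine (h1.hasWeakLaplacianOn (locallyIntegrableOn_wt_mul c v.val.1 U)).congr hU (ae_of_all _ fun _ => rfl) (ae_restrict_of_ae ?_)
  filter_upwards [coeFn_sum_L2 Finset.univ fun i => v.val.2.2 i i] with x hx
  rw [jetLap, hx, Finset.mul_sum]

lemma mulBound_wt {ψ : 𝔼 → ℂ} {C : ℝ} (hψ : Measurable ψ) (hC : ∀ x, ‖ψ x‖ ≤ C) :
    MulBound (fun x => ψ x * wt 1 x) volume (weightMeasure n R₀ (-1)) C := by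
  have hC0 : 0 ≤ C := (norm_nonneg _).trans (hC 0)
  refine hasDens_volume.mulBound (hasDens_weightMeasure (-1)) (hψ.mul (continuous_wt 1).measurable)
    hC0 fun x => ?_
  by_cases hx : x ∈ exterior n R₀
  · have e : ‖wt 1 x‖ ^ 2 * Real.exp (2 * -1 * ‖x‖ ^ 2) = 1 := by
      rw [norm_wt, ← Real.exp_nat_mul, ← Real.exp_add, ← Real.exp_zero]
      congr 1; push_cast; ring
    rw [Set.indicator_of_mem hx, norm_mul, mul_pow, mul_assoc, e]
    gcongr
    exact hC x
  · rw [Set.indicator_of_notMem hx, mul_zero, mul_one]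
    positivity

variable (n R₀) in
/-- The operator `v ↦ ψ e^{|x|²} v`. -/
def weightMul (ψ : 𝔼 → ℂ) :
    L2 n →L[ℂ] Lp ℂ 2 (weightMeasure n R₀ (-1)) :=
  mulOp (fun x => ψ x * wt 1 x) volume (weightMeasure n R₀ (-1))

lemma ae_ext_weightMul {ψ : 𝔼 → ℂ} {C : ℝ} (hψ : Measurable ψ) (hC : ∀ x, ‖ψ x‖ ≤ C) (g : L2 n) :
    ∀ᵐ x ∂extMeasure n R₀, weightMul n R₀ ψ g x = ψ x * wt 1 x * g x :=
  (extMeasure_ac (-1)).ae_le (coeFn_mulOp (mulBound_wt hψ hC) g)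

lemma exists_outerMul (ψ : 𝔼 → ℂ) : ∃ A : JetSpace n 1 →L[ℂ] SpaceOne n R₀ E, ∀ v,
    A v = outerEmb (weightMeasure n R₀ (-1)) E (weightMul n R₀ ψ v.val.1) :=
  ⟨outerEmb (weightMeasure n R₀ (-1)) E ∘L weightMul n R₀ ψ ∘L jetFun n 1, fun _ => rfl⟩

/-- Multiplication by `ψ`, vanishing near the ball, as an operator from weighted Sobolev functions
on `ℝⁿ` to `𝒟₁(P)`. -/
lemma IsBlackBoxHamiltonian.exists_jetToOne (hR₀ : 0 < R₀) (hP : IsBlackBoxHamiltonian P)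
    {ψ : 𝔼 → ℂ} (hψ : IsOuter R₀ ψ)
    {χ : 𝔼 → ℂ} (hχ : IsCutoff R₀ χ) :
    ∃ J : JetSpace n 1 →L[ℂ] DomOne P χ, ∀ v, domOneFst P χ (J v) =
      outerEmb (weightMeasure n R₀ (-1)) E (weightMul n R₀ ψ v.val.1) := by
  obtain ⟨A, hA⟩ := exists_outerMul (n := n) (R₀ := R₀) (E := E) ψ
  simp only [← hA]
  refine exists_domainOneMap A (fun χ' hχ' => ?_) hχ
  obtain ⟨M, hM⟩ := hψ.bounded.1
  obtain ⟨ε, hε, h0⟩ := hψ.vanish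
  have hval := fun g => ae_ext_weightMul (R₀ := R₀) hψ.contDiff.continuous.measurable hM g
  have hs1 : ContDiff ℝ ∞ fun x => χ' x * ψ x := hχ'.1.mul hψ.contDiff
  have hc1 : HasCompactSupport fun x => χ' x * ψ x := hχ'.2.1.mul_right
  have hs2 : ContDiff ℝ ∞ fun x => (1 - χ' x) * ψ x := (contDiff_const.sub hχ'.1).mul hψ.contDiff
  have hc2 : HasCompactSupport fun x => 1 - (1 - χ' x) * ψ x := by
    have e : (fun x => 1 - (1 - χ' x) * ψ x) = fun x => (1 - ψ x) + χ' x * ψ x := by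
      ext x; ring
    rw [e]
    exact hψ.compact.add hc1
  obtain ⟨S, hS⟩ := exists_mulJet (c := 1) (c' := 0) hs1
    (((upToTwo_contDiff hs1).and (upToTwo_tsupport _)).imp fun φ h =>
      ((hc1.mono' (subset_tsupport _ |>.trans h.2)).mul_left
        (f := wt (1 - 0))).exists_bound_of_continuous ((continuous_wt _).mul h.1.continuous))
  obtain ⟨S', hS'⟩ := exists_mulJet (c := 1) (c' := 1) hs2
    ((upToTwo_bounded hs2 hc2).imp fun φ h => by simpa only [sub_self, wt_zero, one_mul] using h)
  obtain ⟨Q, hQ⟩ := hP.exists_graph_of_jet hR₀ S hε fun v => by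
    filter_upwards [(hS v).1] with x hx hlt
    rw [wt_zero, one_mul, h0 x hlt, mul_zero, zero_mul] at hx
    exact hx
  have hmul : ∀ v, IsCutoffMul χ' (outerEmb (weightMeasure n R₀ (-1)) E (weightMul n R₀ ψ v.val.1))
      (WithLp.toLp 2 (0, resExt n R₀ (S v).val.1)) := fun v => isCutoffMul_outer (by
    filter_upwards [coeFn_resExt (R₀ := R₀) (S v).val.1, ae_restrict_of_ae (hS v).1, hval v.val.1]
      with x e1 e2 e3
    rw [wt_zero, one_mul] at e2
    rw [e1, e2, e3]
    ring)
  have hlap : ∀ v, IsCutoffLaplacian χ'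
      (outerEmb (weightMeasure n R₀ (-1)) E (weightMul n R₀ ψ v.val.1))
      (weightMul n R₀ (fun _ => 1) (jetLapL n 1 (S' v))) := fun v => isCutoffLaplacian_outer (by
    refine (hasWeakLaplacianOn_jet isOpen_openExterior (S' v)).congr isOpen_openExterior ?_ ?_
    · filter_upwards [ae_open_of_ae_ext (hval v.val.1), ae_restrict_of_ae (hS' v).1] with x e1 e2
      rw [e1, e2]
      ring
    · rw [jetLapL_apply]
      filter_upwards [ae_open_of_ae_weight (coeFn_mulOp (mulBound_wt (n := n) (R₀ := R₀)
        measurable_const (fun _ => norm_one.le)) (jetLap (S' v).val))] with x e1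
      rw [weightMul, e1, one_mul])
  obtain ⟨B, hB⟩ : ∃ B : JetSpace n 1 →L[ℂ] Lp ℂ 2 (weightMeasure n R₀ (-1)), ∀ v,
      B v = weightMul n R₀ (fun _ => 1) (jetLapL n 1 (S' v)) :=
    ⟨weightMul n R₀ (fun _ => 1) ∘L jetLapL n 1 ∘L S', fun v => rfl⟩
  refine ⟨Q, B, fun v => ?_⟩
  rw [hQ, hA, hB]
  exact ⟨hmul v, hlap v⟩

end DomainOne

/-! ### The continuation of the resolvent -/

section Continuation

lemma IsResolventAt.apply_graph {H : Type*} [NormedAddCommGroup H] [InnerProductSpace ℂ H]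
    {P : H →ₗ.[ℂ] H} {z : ℂ} {T : H →L[ℂ] P.graph} (hT : IsResolventAt P z T) (u : P.graph) :
    T (u.1.2 - z • u.1.1) = u := by
  have hu := P.mem_domain_of_mem_graph u.2
  have h := hT.2 ⟨u.1.1, hu⟩
  rw [show P ⟨u.1.1, hu⟩ = u.1.2 from ((P.image_iff hu).2 u.2).symm] at h
  exact graph_ext h

lemma isCompactOperator_of_finiteDimensional {X V : Type*} [NormedAddCommGroup X] [NormedSpace ℂ X]
    [NormedAddCommGroup V] [NormedSpace ℂ V] [FiniteDimensional ℂ V] (T : X →L[ℂ] V) :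
    IsCompactOperator T := by
  have := FiniteDimensional.proper ℂ V
  refine ⟨Metric.closedBall 0 1, isCompact_closedBall 0 1, ?_⟩
  exact T.continuous.continuousAt.preimage_mem_nhds
    (by rw [map_zero]; exact Metric.closedBall_mem_nhds 0 one_pos)

lemma isCompactOperator_of_finiteRank {X Y : Type*} [NormedAddCommGroup X] [NormedSpace ℂ X]
    [NormedAddCommGroup Y] [NormedSpace ℂ Y] (T : X →L[ℂ] Y)
    (h : FiniteDimensional ℂ (LinearMap.range T.toLinearMap)) : IsCompactOperator T :=
  (isCompactOperator_of_finiteDimensional (T.codRestrict (LinearMap.range T.toLinearMap)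
    fun x => ⟨x, rfl⟩)).clm_comp (LinearMap.range T.toLinearMap).subtypeL

lemma finiteDimensional_range_comp {X Y Z W : Type*} [NormedAddCommGroup X] [NormedSpace ℂ X]
    [NormedAddCommGroup Y] [NormedSpace ℂ Y] [NormedAddCommGroup Z] [NormedSpace ℂ Z]
    [NormedAddCommGroup W] [NormedSpace ℂ W] (A : Z →L[ℂ] W) (B : Y →L[ℂ] Z) (C : X →L[ℂ] Y)
    (h : FiniteDimensional ℂ (LinearMap.range B.toLinearMap)) :
    FiniteDimensional ℂ (LinearMap.range (A ∘L B ∘L C).toLinearMap) := by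
  have h1 : FiniteDimensional ℂ ((LinearMap.range B.toLinearMap).map A.toLinearMap) := inferInstance
  refine Submodule.finiteDimensional_of_le (S₂ := (LinearMap.range B.toLinearMap).map A.toLinearMap)
    ?_
  rintro _ ⟨x, rfl⟩
  exact ⟨B (C x), ⟨C x, rfl⟩, rfl⟩

/-- A simple pole of finite rank. -/
lemma finiteRankMeromorphicAt_inv_smul {X : Type*} {Y : Type} [NormedAddCommGroup X]
    [NormedSpace ℂ X] [NormedAddCommGroup Y] [NormedSpace ℂ Y] (B : X →L[ℂ] Y)
    (hB : FiniteDimensional ℂ (LinearMap.range B.toLinearMap)) (z₀ : ℂ) :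
    FiniteRankMeromorphicAt (fun z => z⁻¹ • B) z₀ := by
  rcases eq_or_ne z₀ 0 with rfl | hz
  · let Q : X →L[ℂ] LinearMap.range B.toLinearMap :=
      B.codRestrict (LinearMap.range B.toLinearMap) fun x => LinearMap.mem_range_self _ x
    have h := FiniteRankMeromorphicAt.factor (z₀ := 0) 1
      (L := fun _ => (LinearMap.range B.toLinearMap).subtypeL) (Q := fun _ => Q)
      analyticAt_const analyticAt_const
    refine h.congr (Eventually.of_forall fun z => ?_)
    change ((z - 0) ^ 1)⁻¹ • B = z⁻¹ • B
    rw [sub_zero, pow_one]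
  · exact AnalyticAt.finiteRankMeromorphicAt ((analyticAt_inv hz).smul analyticAt_const)

section Ext

variable {E : Type*} [NormedAddCommGroup E] [InnerProductSpace ℂ E]
  {P : Space n R₀ E →ₗ.[ℂ] Space n R₀ E}

lemma domOneFst_injective (hR₀ : 0 < R₀) (χ : 𝔼 → ℂ) :
    Function.Injective (domOneFst P χ) := fun s t h => by
  rw [domOneFst_apply, domOneFst_apply] at h
  obtain ⟨-, hs1, hs2⟩ := s.val_mem
  obtain ⟨-, ht1, ht2⟩ := t.val_mem
  rw [h] at hs1 hs2
  refine DomOne.ext (Prod.ext h (Prod.ext ?_ ?_))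
  · refine graph_ext (space_ext (hs1.1.trans ht1.1.symm) ?_)
    filter_upwards [hs1.2, ht1.2] with x e1 e2
    exact e1.trans e2.symm
  · refine Lp.ext ((weight_ac (-1)).ae_le ?_)
    exact (extMeasure_eq hR₀).absolutelyContinuous.ae_le
      (HasWeakLaplacianOn.unique isOpen_openExterior hs2 ht2)

end Ext

variable {E : Type*} [NormedAddCommGroup E] [InnerProductSpace ℂ E] [CompleteSpace E]
  {P : Space n R₀ E →ₗ.[ℂ] Space n R₀ E} {k₀ : ℂ}

variable (n R₀ E) in
/-- The operator `v ↦ ψ e^{|x|²} v` into `ℋ₁`. -/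
def outerOne (ψ : 𝔼 → ℂ) : JetSpace n 1 →L[ℂ] SpaceOne n R₀ E :=
  outerEmb (weightMeasure n R₀ (-1)) E ∘L weightMul n R₀ ψ ∘L jetFun n 1

namespace GluingData

variable (d : GluingData P k₀)

section Solution

variable {Y Y' : Type*} [NormedAddCommGroup Y] [NormedSpace ℂ Y] [NormedAddCommGroup Y']
  [NormedSpace ℂ Y']

/-- The parametrix between weighted spaces: `J₁` and `J₂` map `𝒟(P)` and the weighted Sobolev
functions on `ℝⁿ` to the target, and `T` produces the outer part. -/
def sol (J₁ : P.graph →L[ℂ] Y) (J₂ : JetSpace n 1 →L[ℂ] Y)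
    (T : SpaceZero n R₀ E →L[ℂ] JetSpace n 1) : SpaceZero n R₀ E →L[ℂ] Y :=
  J₁ ∘L d.R ∘L zeroL n R₀ E + J₂ ∘L T

open Classical in
/-- The resolvent on the set `S`, where it exists, and its continuation elsewhere. -/
def contFam (J₁ : P.graph →L[ℂ] Y) (J₂ : JetSpace n 1 →L[ℂ] Y)
    (T : ℂ → SpaceZero n R₀ E →L[ℂ] JetSpace n 1) (ℓ : ℂ → ℂ) (S : Set ℂ) (z : ℂ) :
    SpaceZero n R₀ E →L[ℂ] Y :=
  if z ∈ S ∧ ℓ z ^ 2 ∈ resolventSet P then J₁ ∘L BlackBox.resolvent P (ℓ z ^ 2) ∘L zeroL n R₀ E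
  else d.sol J₁ J₂ (T z) ∘L Ring.inverse (1 + d.K (zeroL n R₀ E) (T z) (ℓ z))

lemma sol_comp (Φ : Y →L[ℂ] Y') (J₁ : P.graph →L[ℂ] Y) (J₂ : JetSpace n 1 →L[ℂ] Y)
    (T : SpaceZero n R₀ E →L[ℂ] JetSpace n 1) :
    Φ ∘L d.sol J₁ J₂ T = d.sol (Φ ∘L J₁) (Φ ∘L J₂) T := by
  rw [sol, sol, comp_add]
  rfl

lemma contFam_comp (Φ : Y →L[ℂ] Y') (J₁ : P.graph →L[ℂ] Y) (J₂ : JetSpace n 1 →L[ℂ] Y)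
    (T : ℂ → SpaceZero n R₀ E →L[ℂ] JetSpace n 1) (ℓ : ℂ → ℂ) (S : Set ℂ) (z : ℂ) :
    Φ ∘L d.contFam J₁ J₂ T ℓ S z = d.contFam (Φ ∘L J₁) (Φ ∘L J₂) T ℓ S z := by
  rw [contFam, contFam, ← sol_comp]
  split_ifs <;> rfl

end Solution

lemma oneL_F (k : ℂ) {f : SpaceZero n R₀ E} {v : JetSpace n 1}
    (h : v = weightJet n (freeDiff n k k₀ (d.G (zeroL n R₀ E f)))) :
    oneL n R₀ E (d.R (zeroL n R₀ E f)).1.1 + outerOne n R₀ E d.ψ v =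
      oneL n R₀ E (d.F k (zeroL n R₀ E f)).1.1 := by
  set u := freeDiff n k k₀ (d.G (zeroL n R₀ E f)) with hu
  have h1 : (d.F k (zeroL n R₀ E f)).1.1 = (d.R (zeroL n R₀ E f)).1.1 + (d.Q u).1.1 := rfl
  rw [h1, map_add]
  congr 1
  obtain ⟨M, hM⟩ := d.outer.bounded.1
  have h2 : outerOne n R₀ E d.ψ v =
      WithLp.toLp 2 (0, weightMul n R₀ d.ψ v.val.1) := rfl
  have h3 : (WithLp.toLp 2 ((0 : E), weightMul n R₀ d.ψ v.val.1)).fst = 0 := rfl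
  have h4 : (WithLp.toLp 2 ((0 : E), weightMul n R₀ d.ψ v.val.1)).snd =
    weightMul n R₀ d.ψ v.val.1 := rfl
  rw [h2]
  refine space_ext ?_ ?_
  · rw [h3, oneL_fst, (d.glue_fst u).1]
  · rw [h4]
    refine (weight_ac (-1)).ae_le ?_
    filter_upwards [ae_ext_weightMul (R₀ := R₀) d.outer.contDiff.continuous.measurable hM v.val.1,
      oneL_snd (d.Q u).1.1, d.glue_snd u, ae_restrict_of_ae (coeFn_wMul u.val.1)]
      with x e1 e2 e3 e4
    rw [e1, e2, e3, h, weightJet_fst, e4]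
    linear_combination (d.ψ x * u.val.1 x) * wt_neg_mul 1 x

/-- On the part of the plane that corresponds to the upper half-plane, the continuation is the
resolvent. -/
lemma resolvent_zeroL (hk₀ : 0 < k₀.im) {k : ℂ} (hk : 0 < k.im)
    (hz : k ^ 2 ∈ resolventSet P) {T : SpaceZero n R₀ E →L[ℂ] JetSpace n 1}
    (hT : ∀ f, T f = weightJet n (freeDiff n k k₀ (d.G (zeroL n R₀ E f))))
    (hu : IsUnit (1 + d.K (zeroL n R₀ E) T k)) (f : SpaceZero n R₀ E) :
    BlackBox.resolvent P (k ^ 2) (zeroL n R₀ E f) =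
      d.F k (zeroL n R₀ E (Ring.inverse (1 + d.K (zeroL n R₀ E) T k) f)) := by
  set g := Ring.inverse (1 + d.K (zeroL n R₀ E) T k) f with hg
  have h1 : g + d.K (zeroL n R₀ E) T k g = f :=
    DFunLike.congr_fun (Ring.mul_inverse_cancel _ hu) f
  have h2 : zeroL n R₀ E f = (d.F k (zeroL n R₀ E g)).1.2 -
      k ^ 2 • (d.F k (zeroL n R₀ E g)).1.1 := by
    rw [d.parametrix_identity hk₀ hk, ← h1, map_add]
    congr 1
    exact d.zeroL_K (T₀ := freeDiff n k k₀ ∘L d.G) hT k g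
  rw [h2]
  exact (isResolventAt_resolvent hz).apply_graph _

end GluingData

end Continuation

section Assembly

variable {E : Type*} [NormedAddCommGroup E] [InnerProductSpace ℂ E] [CompleteSpace E]
  {P : Space n R₀ E →ₗ.[ℂ] Space n R₀ E} {k₀ : ℂ}

namespace GluingData

variable (d : GluingData P k₀)

/-- The outer part of the continued parametrix. -/
def contT (D : ℂ → L2 n →L[ℂ] JetSpace n 1) (B : L2 n →L[ℂ] JetSpace n 1) (z : ℂ) :
    SpaceZero n R₀ E →L[ℂ] JetSpace n 1 :=
  (D z + z⁻¹ • B - wRes k₀) ∘L d.sourceZero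

variable {ℓ : ℂ → ℂ} {S : Set ℂ} {D : ℂ → L2 n →L[ℂ] JetSpace n 1} {B : L2 n →L[ℂ] JetSpace n 1}

lemma contT_apply (hD : IsFreeContinuation ℓ S D B) {z : ℂ} (hz : z ∈ S)
    (f : SpaceZero n R₀ E) : d.contT D B z f =
      weightJet n (freeDiff n (ℓ z) k₀ (d.G (zeroL n R₀ E f))) := by
  have h1 : d.contT D B z f =
      wRes (ℓ z) (d.sourceZero f) - wRes k₀ (d.sourceZero f) := by
    rw [← hD.eq z hz]; rfl
  rw [h1, ← wMul_sourceZero, freeDiff, sub_apply, map_sub]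
  rfl

lemma contT_eq (z : ℂ) : d.contT D B z = (D z - wRes k₀) ∘L d.sourceZero +
    z⁻¹ • (B ∘L d.sourceZero) := by
  rw [contT, add_sub_right_comm, add_comp, smul_comp]

lemma contT_finiteRank (hD : IsFreeContinuation ℓ S D B) (z₀ : ℂ) :
    FiniteRankMeromorphicAt (d.contT D B) z₀ := by
  have h1 : FiniteRankMeromorphicAt (fun z => D z - wRes k₀ + z⁻¹ • B) z₀ :=
    FiniteRankMeromorphicAt.add
      (AnalyticAt.finiteRankMeromorphicAt ((hD.analytic z₀).sub analyticAt_const))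
      (finiteRankMeromorphicAt_inv_smul B hD.finite z₀)
  refine (h1.comp_clm (S := fun _ => d.sourceZero) analyticAt_const).congr
    (Eventually.of_forall fun z => ?_)
  change (D z - wRes k₀ + z⁻¹ • B) ∘L d.sourceZero = (D z + z⁻¹ • B - wRes k₀) ∘L d.sourceZero
  rw [add_sub_right_comm]

lemma analyticAt_contT (hD : IsFreeContinuation ℓ S D B) {z₀ : ℂ} (hz : z₀ ≠ 0) :
    AnalyticAt ℂ (d.contT D B) z₀ :=
  analyticAt_clm_comp (((hD.analytic z₀).add ((analyticAt_inv hz).smul analyticAt_const)).sub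
    analyticAt_const) analyticAt_const

lemma K_add_smul {c : ℝ} {ν : Measure 𝔼} (ι : WithLp 2 (E × Lp ℂ 2 ν) →L[ℂ] Space n R₀ E)
    (T T' : WithLp 2 (E × Lp ℂ 2 ν) →L[ℂ] JetSpace n c) (a k : ℂ) :
    d.K ι (T + a • T') k = d.K ι T k + a • ((-d.commX c ν) ∘L T') := by
  ext1 f
  set u := (k₀ ^ 2 - k ^ 2) • d.cutX ν (d.R (ι f)).1.1
  change u - d.commX c ν (T f + a • T' f) = u - d.commX c ν (T f) + a • -d.commX c ν (T' f)
  rw [map_add, map_smul]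
  module

lemma isCompactOperator_jetLow_comp {c : ℝ} {X : Type*} [NormedAddCommGroup X] [NormedSpace ℂ X]
    {T : X →L[ℂ] JetSpace n c} (hT : FiniteDimensional ℂ (LinearMap.range T.toLinearMap))
    (φ : 𝔼 → ℂ) (α : Option (Fin n)) :
    IsCompactOperator (mulOp φ volume volume ∘L jetLow n c α ∘L T) :=
  ((isCompactOperator_of_finiteRank T hT).clm_comp (jetLow n c α)).clm_comp
    (mulOp φ volume volume)

lemma isCompactOperator_wRes (hD : IsFreeContinuation ℓ S D B) {z : ℂ} (hz : z ∈ S)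
    {φ : 𝔼 → ℂ} (hφ : Continuous φ) (hφc : HasCompactSupport φ) (α : Option (Fin n)) :
    IsCompactOperator (mulOp φ volume volume ∘L jetLow n 1 α ∘L wRes (ℓ z)) := by
  rw [← hD.eq z hz, comp_add, comp_add,
    comp_smul, comp_smul]
  exact (hD.compact z α φ hφ hφc).add
    ((isCompactOperator_jetLow_comp hD.finite φ α).smul z⁻¹)

/-- The parametrix has compact error, up to a pole of finite rank. -/
lemma exists_contK_eq (hR₀ : 0 < R₀) (hP : IsBlackBoxHamiltonian P)
    (hD : IsFreeContinuation ℓ S D B) (hℓ : ∀ z, AnalyticAt ℂ ℓ z) {zs : ℂ} (hzs : zs ∈ S)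
    (hzs' : ℓ zs = k₀) (z₀ : ℂ) :
    ∃ (Kr : ℂ → SpaceZero n R₀ E →L[ℂ] SpaceZero n R₀ E)
      (B' : SpaceZero n R₀ E →L[ℂ] SpaceZero n R₀ E), AnalyticAt ℂ Kr z₀ ∧
      IsCompactOperator (Kr z₀) ∧ FiniteDimensional ℂ (LinearMap.range B'.toLinearMap) ∧
      ∀ᶠ z in 𝓝[≠] z₀, d.K (zeroL n R₀ E) (d.contT D B z) (ℓ z) = Kr z + (z - z₀)⁻¹ • B' := by
  have hc : ∀ α, ∀ φ : 𝔼 → ℂ, Continuous φ → HasCompactSupport φ → IsCompactOperator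
      (mulOp φ volume volume ∘L jetLow n 1 α ∘L ((D z₀ - wRes k₀) ∘L d.sourceZero)) := by
    intro α φ hφ hφc
    have h1 : IsCompactOperator (mulOp φ volume volume ∘L jetLow n 1 α ∘L (D z₀ - wRes k₀)) := by
      rw [comp_sub, comp_sub]
      refine (hD.compact z₀ α φ hφ hφc).sub ?_
      rw [← hzs']
      exact isCompactOperator_wRes hD hzs hφ hφc α
    exact h1.comp_clm d.sourceZero
  have hfin : FiniteDimensional ℂ (LinearMap.range (B ∘L d.sourceZero).toLinearMap) :=
    finiteDimensional_range_comp (ContinuousLinearMap.id ℂ _) B d.sourceZero hD.finite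
  -- The only pole of the continued free resolvent is at the origin.
  rcases eq_or_ne z₀ 0 with rfl | hz
  · refine ⟨fun z => d.K (zeroL n R₀ E) ((D z - wRes k₀) ∘L d.sourceZero) (ℓ z),
      (-d.commX 1 (weightMeasure n R₀ 1)) ∘L B ∘L d.sourceZero,
      d.analyticAt_K (analyticAt_clm_comp ((hD.analytic 0).sub analyticAt_const) analyticAt_const)
        (hℓ 0), d.isCompactOperator_K hR₀ hP (hasDens_weightMeasure 1) hc _,
      finiteDimensional_range_comp _ B d.sourceZero hD.finite, Eventually.of_forall fun z => ?_⟩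
    rw [contT_eq, K_add_smul, sub_zero]
  · refine ⟨fun z => d.K (zeroL n R₀ E) (d.contT D B z) (ℓ z), 0,
      d.analyticAt_K (d.analyticAt_contT hD hz) (hℓ z₀),
      d.isCompactOperator_K hR₀ hP (hasDens_weightMeasure 1) (fun α φ hφ hφc => ?_) _, ?_,
      Eventually.of_forall fun z => ((congrArg _ (smul_zero _)).trans (add_zero _)).symm⟩
    · rw [contT_eq, comp_add, comp_add,
        comp_smul, comp_smul]
      exact (hc α φ hφ hφc).add ((isCompactOperator_jetLow_comp hfin φ α).smul z₀⁻¹)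
    · rw [toLinearMap_zero, LinearMap.range_zero]
      infer_instance

lemma contK_inverse (hR₀ : 0 < R₀) (hP : IsBlackBoxHamiltonian P)
    (hD : IsFreeContinuation ℓ S D B) (hS0 : ∀ z ∈ S, z ≠ 0) (hℓ : ∀ z, AnalyticAt ℂ ℓ z) {zs : ℂ}
    (hzs : zs ∈ S) (hzs' : ℓ zs = k₀) (z₀ : ℂ) :
    (∀ᶠ z in 𝓝[≠] z₀, IsUnit (1 + d.K (zeroL n R₀ E) (d.contT D B z) (ℓ z))) ∧
      FiniteRankMeromorphicAt
        (fun z => Ring.inverse (1 + d.K (zeroL n R₀ E) (d.contT D B z) (ℓ z))) z₀ := by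
  refine fredholm_meromorphic isOpen_univ isPreconnected_univ
    (fun z _ => d.exists_contK_eq hR₀ hP hD hℓ hzs hzs' z) (Set.mem_univ zs) ?_ z₀
    (Set.mem_univ z₀)
  refine eventually_isUnit_one_add
    (d.analyticAt_K (d.analyticAt_contT hD (hS0 zs hzs)) (hℓ zs)).continuousAt ?_
  rw [hzs']
  refine d.K_eq_zero _ (ContinuousLinearMap.ext fun f => ?_)
  rw [d.contT_apply hD hzs, hzs', freeDiff_self, zero_apply, map_zero, zero_apply]

lemma sol_finiteRank {Y : Type*} [NormedAddCommGroup Y] [NormedSpace ℂ Y] (J₁ : P.graph →L[ℂ] Y)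
    (J₂ : JetSpace n 1 →L[ℂ] Y) {T : ℂ → SpaceZero n R₀ E →L[ℂ] JetSpace n 1} {z₀ : ℂ}
    (hT : FiniteRankMeromorphicAt T z₀) :
    FiniteRankMeromorphicAt (fun z => d.sol J₁ J₂ (T z)) z₀ :=
  FiniteRankMeromorphicAt.add (AnalyticAt.finiteRankMeromorphicAt analyticAt_const)
    (FiniteRankMeromorphicAt.clm_comp (S := fun _ => J₂) analyticAt_const hT)

/-- The continuation is a meromorphic family of operators `ℋ₀ → 𝒟₁(P)`. -/
lemma contFam_finiteRank (hR₀ : 0 < R₀) (hP : IsBlackBoxHamiltonian P) (hk₀ : 0 < k₀.im)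
    (hD : IsFreeContinuation ℓ S D B) (hS0 : ∀ z ∈ S, z ≠ 0) (hℓ : ∀ z, AnalyticAt ℂ ℓ z)
    (hℓS : ∀ z ∈ S, 0 < (ℓ z).im) {zs : ℂ} (hzs : zs ∈ S) (hzs' : ℓ zs = k₀)
    {Y : Type*} [NormedAddCommGroup Y] [NormedSpace ℂ Y] {Φ : Y →L[ℂ] SpaceOne n R₀ E}
    (hΦ : Function.Injective Φ) {J₁ : P.graph →L[ℂ] Y} {J₂ : JetSpace n 1 →L[ℂ] Y}
    (hJ₁ : ∀ u, Φ (J₁ u) = oneL n R₀ E u.1.1) (hJ₂ : ∀ v, Φ (J₂ v) = outerOne n R₀ E d.ψ v)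
    (z₀ : ℂ) : FiniteRankMeromorphicAt (d.contFam J₁ J₂ (d.contT D B) ℓ S) z₀ := by
  obtain ⟨h1, h2⟩ := d.contK_inverse hR₀ hP hD hS0 hℓ hzs hzs' z₀
  have h3 := d.sol_finiteRank J₁ J₂ (d.contT_finiteRank hD z₀)
  refine (h3.comp h2).congr ?_
  filter_upwards [h1] with z hu
  rw [contFam]
  split_ifs with hz
  · obtain ⟨hzS, hzr⟩ := hz
    ext1 f
    refine hΦ ?_
    have hT := d.contT_apply hD hzS
    set g := Ring.inverse (1 + d.K (zeroL n R₀ E) (d.contT D B z) (ℓ z)) f with hg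
    have e1 : Φ (d.sol J₁ J₂ (d.contT D B z) g) =
        oneL n R₀ E (d.R (zeroL n R₀ E g)).1.1 + outerOne n R₀ E d.ψ (d.contT D B z g) := by
      rw [← hJ₁, ← hJ₂, ← map_add]; rfl
    refine (e1.trans ?_).trans (hJ₁ _).symm
    have e2 := congrArg (fun u : P.graph => oneL n R₀ E u.1.1)
      (d.resolvent_zeroL hk₀ (hℓS z hzS) hzr hT hu f)
    exact (d.oneL_F (ℓ z) (hT g)).trans e2.symm
  · rfl

lemma contFam_apply {Y : Type*} [NormedAddCommGroup Y] [NormedSpace ℂ Y]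
    {Φ : Y →L[ℂ] SpaceOne n R₀ E} {J₁ : P.graph →L[ℂ] Y} {J₂ : JetSpace n 1 →L[ℂ] Y}
    (hJ₁ : ∀ u, Φ (J₁ u) = oneL n R₀ E u.1.1) (hJ₂ : ∀ v, Φ (J₂ v) = outerOne n R₀ E d.ψ v)
    (T : ℂ → SpaceZero n R₀ E →L[ℂ] JetSpace n 1) (z : ℂ) (f : SpaceZero n R₀ E) :
    Φ (d.contFam J₁ J₂ T ℓ S z f) =
      d.contFam (oneL n R₀ E ∘L domFst P) (outerOne n R₀ E d.ψ) T ℓ S z f := by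
  rw [← show Φ ∘L J₁ = oneL n R₀ E ∘L domFst P from ContinuousLinearMap.ext hJ₁,
    ← show Φ ∘L J₂ = outerOne n R₀ E d.ψ from ContinuousLinearMap.ext hJ₂, ← contFam_comp]
  rfl

end GluingData

lemma outerOne_apply (ψ : 𝔼 → ℂ) (v : JetSpace n 1) : outerOne n R₀ E ψ v =
    outerEmb (weightMeasure n R₀ (-1)) E (weightMul n R₀ ψ v.val.1) := rfl

lemma IsBlackBoxHamiltonian.exists_maps (hR₀ : 0 < R₀) (hP : IsBlackBoxHamiltonian P)
    {ψ : 𝔼 → ℂ} (hψ : IsOuter R₀ ψ)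
    {χ : 𝔼 → ℂ} (hχ : IsCutoff R₀ χ) :
    ∃ (J₁ : P.graph →L[ℂ] DomOne P χ) (J₂ : JetSpace n 1 →L[ℂ] DomOne P χ),
      (∀ u, domOneFst P χ (J₁ u) = oneL n R₀ E u.1.1) ∧
      ∀ v, domOneFst P χ (J₂ v) = outerOne n R₀ E ψ v := by
  obtain ⟨J₁, h1⟩ := hP.exists_domainToOne hR₀ hχ
  obtain ⟨J₂, h2⟩ := hP.exists_jetToOne hR₀ hψ hχ
  exact ⟨J₁, J₂, h1, fun v => (h2 v).trans (outerOne_apply ψ v).symm⟩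

omit [CompleteSpace E] in
/-- Meromorphic families with values in `DomOne P χ` are meromorphic families with values in
`domainOneGraph P χ`. -/
lemma exists_meromorphic_graph {X : Type*} [NormedAddCommGroup X] [NormedSpace ℂ X]
    {χ : 𝔼 → ℂ} {U : Set ℂ} (A : ℂ → X →L[ℂ] DomOne P χ)
    (h : IsMeromorphicFamilyOn A U) : ∃ A' : ℂ → X →L[ℂ] domainOneGraph P χ,
      (∀ z f, (A' z f).1.1 = domOneFst P χ (A z f)) ∧
        IsMeromorphicFamilyOn (X := X) (Y := domainOneGraph P χ) A' U :=
  ⟨A, fun _ _ => rfl, h⟩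

/-- A family that factors through each of the norms of `𝒟₁(P)` as a meromorphic family is a
meromorphic family of operators with values in `𝒟₁(P)`. -/
lemma exists_meromorphicToDomainOne {C : ℂ → SpaceZero n R₀ E →L[ℂ] SpaceOne n R₀ E} {U : Set ℂ}
    {χ₀ : 𝔼 → ℂ} (hχ₀ : IsCutoff R₀ χ₀)
    (h : ∀ χ : 𝔼 → ℂ, IsCutoff R₀ χ →
      ∃ A : ℂ → SpaceZero n R₀ E →L[ℂ] DomOne P χ,
        (∀ z f, domOneFst P χ (A z f) = C z f) ∧ IsMeromorphicFamilyOn A U) :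
    ∃ R : ℂ → SpaceZero n R₀ E →ₗ[ℂ] domainOne P,
      IsMeromorphicToDomainOne P R U ∧ ∀ z f, (R z f : SpaceOne n R₀ E) = C z f := by
  have hmem : ∀ z f, C z f ∈ domainOne P := fun z f => by
    obtain ⟨I, hI, -⟩ := h _ hχ₀
    rw [← hI]
    exact (I z f).val_mem.1
  refine ⟨fun z => LinearMap.codRestrict (domainOne P) (C z).toLinearMap (hmem z), fun χ hχ => ?_,
    fun z f => rfl⟩
  obtain ⟨A, h1, h2⟩ := h χ hχ
  obtain ⟨A', h3, h4⟩ := exists_meromorphic_graph A h2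
  exact ⟨A', fun z _ f => (h3 z f).trans (h1 z f), h4⟩

/-- The continuation is meromorphic for each of the norms of `𝒟₁(P)`. -/
lemma IsBlackBoxHamiltonian.exists_contFam (hR₀ : 0 < R₀) (hP : IsBlackBoxHamiltonian P)
    (d : GluingData P k₀) (hk₀ : 0 < k₀.im) {ℓ : ℂ → ℂ} {S : Set ℂ}
    {D : ℂ → L2 n →L[ℂ] JetSpace n 1} {B : L2 n →L[ℂ] JetSpace n 1}
    (hD : IsFreeContinuation ℓ S D B) (hS0 : ∀ z ∈ S, z ≠ 0) (hℓ : ∀ z, AnalyticAt ℂ ℓ z)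
    (hℓS : ∀ z ∈ S, 0 < (ℓ z).im) {zs : ℂ} (hzs : zs ∈ S) (hzs' : ℓ zs = k₀)
    {χ : 𝔼 → ℂ} (hχ : IsCutoff R₀ χ) :
    ∃ A : ℂ → SpaceZero n R₀ E →L[ℂ] DomOne P χ, (∀ z f, domOneFst P χ (A z f) =
      d.contFam (oneL n R₀ E ∘L domFst P) (outerOne n R₀ E d.ψ) (d.contT D B) ℓ S z f) ∧
      IsMeromorphicFamilyOn A Set.univ := by
  obtain ⟨J₁, J₂, hJ₁, hJ₂⟩ := hP.exists_maps hR₀ d.outer hχ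
  have h : ∀ z ∈ Set.univ, FiniteRankMeromorphicAt (d.contFam J₁ J₂ (d.contT D B) ℓ S) z :=
    fun z _ => d.contFam_finiteRank hR₀ hP hk₀ hD hS0 hℓ hℓS hzs hzs'
      (domOneFst_injective hR₀ χ) hJ₁ hJ₂ z
  exact ⟨d.contFam J₁ J₂ (d.contT D B) ℓ S, fun z f => d.contFam_apply hJ₁ hJ₂ _ z f,
    isMeromorphicFamilyOn_of_finiteRank h⟩

/-- A continuation of the weighted free resolvent yields a continuation of the resolvent of `P`. -/
theorem IsBlackBoxHamiltonian.exists_continuation (hR₀ : 0 < R₀) (hP : IsBlackBoxHamiltonian P)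
    (d : GluingData P k₀) (hk₀ : 0 < k₀.im) {ℓ : ℂ → ℂ} {S : Set ℂ}
    {D : ℂ → L2 n →L[ℂ] JetSpace n 1} {B : L2 n →L[ℂ] JetSpace n 1}
    (hD : IsFreeContinuation ℓ S D B) (hS0 : ∀ z ∈ S, z ≠ 0) (hℓ : ∀ z, AnalyticAt ℂ ℓ z)
    (hℓS : ∀ z ∈ S, 0 < (ℓ z).im) {zs : ℂ} (hzs : zs ∈ S) (hzs' : ℓ zs = k₀) :
    ∃ R : ℂ → SpaceZero n R₀ E →ₗ[ℂ] domainOne P, IsMeromorphicToDomainOne P R Set.univ ∧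
      ∀ z ∈ S, ℓ z ^ 2 ∈ resolventSet P → ∀ f, (R z f : SpaceOne n R₀ E) =
        spaceToOne (resolvent P (ℓ z ^ 2) (zeroToSpace f)).1.1 := by
  have hχ₀ : IsCutoff R₀ fun x => 1 - d.ψ x :=
    ⟨contDiff_const.sub d.outer.contDiff, d.outer.compact, fun x hx => by
      change 1 - d.ψ x = 1
      rw [d.outer.eq_zero fun h => h (Metric.ball_subset_closedBall hx), sub_zero]⟩
  obtain ⟨R, h1, h2⟩ := exists_meromorphicToDomainOne hχ₀ fun χ hχ =>
    hP.exists_contFam hR₀ d hk₀ hD hS0 hℓ hℓS hzs hzs' hχ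
  refine ⟨R, h1, fun z hz hzr f => (h2 z f).trans ?_⟩
  rw [GluingData.contFam, if_pos ⟨hz, hzr⟩, ← oneL_apply, ← zeroL_apply]
  rfl

end Assembly

lemma exp_half_sq : Complex.exp ((3 * Real.pi / 4 : ℝ) * I) ^ 2 = -I := by
  rw [← Complex.exp_nat_mul, show ((2 : ℕ) : ℂ) * (((3 * Real.pi / 4 : ℝ) : ℂ) * I) =
    Real.pi * I + Real.pi / 2 * I by push_cast; ring, Complex.exp_add,
    Complex.exp_pi_mul_I, Complex.exp_pi_div_two_mul_I, neg_one_mul]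

lemma exp_im_pos {w : ℂ} (h0 : 0 < w.im) (h1 : w.im < Real.pi) : 0 < (Complex.exp w).im := by
  rw [Complex.exp_im]
  exact mul_pos (Real.exp_pos _) (Real.sin_pos_of_pos_of_lt_pi h0 h1)

lemma ne_zero_of_im_pos {z : ℂ} (h : 0 < z.im) : z ≠ 0 := by
  rintro rfl
  exact lt_irrefl _ h

end BlackBox

end

theorem proposition2p1 {n : ℕ} (hn : 1 ≤ n) {R₀ : ℝ} (hR₀ : 0 < R₀)
    {E : Type*} [NormedAddCommGroup E] [InnerProductSpace ℂ E] [CompleteSpace E]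
    [TopologicalSpace.SeparableSpace E]
    (P : BlackBox.Space n R₀ E →ₗ.[ℂ] BlackBox.Space n R₀ E)
    (hP : BlackBox.IsBlackBoxHamiltonian P) :
    ((∀ k₀ : ℂ, 0 < k₀.im → ∀ᶠ k in 𝓝[≠] k₀, k ^ 2 ∈ BlackBox.resolventSet P) ∧
      BlackBox.IsMeromorphicFamilyOn (fun k => BlackBox.resolvent P (k ^ 2)) {k | 0 < k.im}) ∧
    (Odd n → ∃ R : ℂ → BlackBox.SpaceZero n R₀ E →ₗ[ℂ] BlackBox.domainOne P,
      BlackBox.IsMeromorphicToDomainOne P R Set.univ ∧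
      ∀ k : ℂ, 0 < k.im → k ^ 2 ∈ BlackBox.resolventSet P → ∀ f,
        (R k f : BlackBox.SpaceOne n R₀ E) =
          BlackBox.spaceToOne (BlackBox.resolvent P (k ^ 2) (BlackBox.zeroToSpace f)).1.1) ∧
    (Even n → ∃ R : ℂ → BlackBox.SpaceZero n R₀ E →ₗ[ℂ] BlackBox.domainOne P,
      BlackBox.IsMeromorphicToDomainOne P R BlackBox.logPlane ∧
      ∀ w : ℂ, 0 < w.im → w.im < Real.pi → Complex.exp w ^ 2 ∈ BlackBox.resolventSet P → ∀ f,
        (R w f : BlackBox.SpaceOne n R₀ E) =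
          BlackBox.spaceToOne
            (BlackBox.resolvent P (Complex.exp w ^ 2) (BlackBox.zeroToSpace f)).1.1) := by
  -- The base point is `k₀ = e^{3πi/4}`, for which `k₀² = -i`.
  have him : ((3 * Real.pi / 4 : ℝ) * Complex.I : ℂ).im = 3 * Real.pi / 4 := by simp
  have hw : 0 < ((3 * Real.pi / 4 : ℝ) * Complex.I : ℂ).im := by
    rw [him]
    positivity
  have hw' : ((3 * Real.pi / 4 : ℝ) * Complex.I : ℂ).im < Real.pi := by
    rw [him]
    linarith [Real.pi_pos]
  have hk₀ := BlackBox.exp_im_pos hw hw'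
  obtain ⟨d⟩ := hP.nonempty_gluingData hR₀ hk₀ BlackBox.exp_half_sq
  refine ⟨hP.resolvent_meromorphic hR₀ d hk₀, fun ho => ?_, fun he => ?_⟩
  · obtain ⟨D, B, hD⟩ := BlackBox.exists_freeContinuation_odd ho
    exact hP.exists_continuation hR₀ d hk₀ hD (fun z hz => BlackBox.ne_zero_of_im_pos hz)
      (fun z => analyticAt_id) (fun z hz => hz) hk₀ rfl
  · obtain ⟨D, B, hD, -⟩ := BlackBox.exists_freeContinuation_even hn he
    obtain ⟨R, h1, h2⟩ := hP.exists_continuation hR₀ d hk₀ hD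
      (fun z hz => BlackBox.ne_zero_of_im_pos hz.1) (fun z => Complex.differentiable_exp.analyticAt z)
      (fun z hz => BlackBox.exp_im_pos hz.1 hz.2) ⟨hw, hw'⟩ rfl
    refine ⟨R, fun χ hχ => ?_, fun w h0 hπ => h2 w ⟨h0, hπ⟩⟩
    obtain ⟨A, h3, h4⟩ := h1 χ hχ
    exact ⟨A, fun z _ => h3 z trivial, fun z _ => h4 z trivial⟩
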